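/- **Setting.** Let $M\ge 0$ and let $\mathfrak h$ be a complex vector space of dimension $2M$ with a nondegenerate symmetric bilinear form $(\cdot,\cdot)$ and a decomposition $\mathfrak h=\mathfrak p\oplus\mathfrak q$ into isotropic subspaces, with bases $e_1,\dots,e_M$ of $\mathfrak p$ and $\bar e_1,\dots,\bar e_M$ of $\mathfrak q$ such that $(e_i,\bar e_j)=\delta_{ij}$. Write $\mathbb N=\{0,1,2,\dots\}$. *The space $V$.* $V=T\big(\bigoplus_{m\ge 0}\mathfrak h\otimes t^{-m-1/2}\big)$ is the tensor algebra, with vacuum $\mathbf 1=1$; for $h\in\mathfrak h$, $m\in\mathbb N$ the mode $h(-m-\frac12)$ is left multiplication by $h\otimes t^{-m-1/2}$, and the modes $h(m+\frac12)$ are determined by $h(m+\frac12)\mathbf 1=0$ and $a(m+\frac12)b(-k-\frac12)+b(-k-\frac12)a(m+\frac12)=(a,b)\delta_{mk}$. *The space $W$.* Let $N$ be the associative unital algebra generated by $\mathfrak h\otimes\mathbb C[t,t^{-1}]\oplus\mathbb C\mathbf k$ with the relations: $(a\otimes t^m)(b\otimes t^n)+(b\otimes t^n)(a\otimes t^m)=(a,b)\delta_{m+n,0}\mathbf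 k$ for $m>0>n$; $(a\otimes t^p)(b\otimes t^0)+(b\otimes t^0)(a\otimes t^p)=0$ for $p\ne0$; and $(a\otimes t^q)\mathbf k=\mathbf k(a\otimes t^q)$. Let $U$ be a $T(\mathfrak h)$-module. $W$ is the $N$-module induced from $U$, on which the elements $a\otimes t^m$ with $m>0$ act by $0$, $a\otimes t^0$ acts as $a$, and $\mathbf k$ acts as $1$. Write $a(n)$ for the action of $a\otimes t^n$ on $W$. *Normal ordering.* On $V$ and on $W$, ${:}h_1(d_1)\cdots h_r(d_r){:}$ is the product of the modes rearranged so that the modes with $d_i<0$ come first, then those with $d_i>0$, then the normal ordering of the modes with $d_i=0$, the order within each group being kept, multiplied by the sign of the rearranging permutation. Here the normal ordering of zero modes is defined recursively by ${:}\ {:}=1$ and $${:}a_1(0)\cdots a_r(0){:}=a_1(0)\,{:}a_2(0)\cdots a_r(0){:}+\sum_{i=2}^r\frac{(-1)^{i+1}}2(a_1,a_i)\,{:}a_2(0)\cdots\widehat{a_i(0)}\cdots a_r(0){:}.$$ Put $h^{(m)}(x)=\sum_d\binom{-d-1/2}{m}h(d)\,x^{-d-1/2-m}$ (sum over $d\in\mathbb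 Z+\frac12$ on $V$, over $d\in\mathbb Z$ on $W$) and define ${:}h_1^{(m_1)}(x_1)\cdots h_r^{(m_r)}(x_r){:}$ coefficientwise. *Vertex operators.* $Y_V(\cdot,x)$ on $V$ and $\bar Y_W(\cdot,x)$ on $W$ are the linear maps with $$h_1(-m_1-\tfrac12)\cdots h_r(-m_r-\tfrac12)\mathbf 1\mapsto{:}h_1^{(m_1)}(x)\cdots h_r^{(m_r)}(x){:},$$ and $Y_W(u,x)=\bar Y_W(\exp(\Delta(x))u,x)$, where $$\Delta(x)=\sum_{i=1}^M\sum_{m,n\ge0}C_{mn}\,e_i(m+\tfrac12)\,\bar e_i(n+\tfrac12)\,x^{-m-n-1},\qquad C_{mn}=\frac12\,\frac{m-n}{m+n+1}\binom{-1/2}{m}\binom{-1/2}{n}.$$ *Functions and contractions.* Let $g(x_1,y)=\frac12x_1^{-1/2}y^{-1/2}(x_1+y)(x_1-y)^{-1}$ and $g_{mn}=\frac1{m!\,n!}\partial_{x_1}^m\partial_y^n g$. For $a_1,\dots,a_r\in\mathfrak h$ and $m_1,\dots,m_r\in\mathbb N$ the total contraction numbers are defined by $T(\,)=1$ and $$T^{m_1,\dots,m_r}_{a_1,\dots,a_r}(p_1,\dots,p_{2t})=\sum_{k=2}^{2t}(-1)^k(a_{p_1},a_{p_k})\,C_{m_{p_1}m_{p_k}}\,T^{m_1,\dots,m_r}_{a_1,\dots,a_r}(\widehat{p_1},p_2,\dots,\widehat{p_k},\dots,p_{2t}).$$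 Complements of increasing sequences are denoted by a superscript $c$. Let $\iota_{yx}$ (respectively $\iota_{xy}$) denote the expansion of powers of $x+y$ in nonnegative powers of $x$ (respectively of $y$). **Statement.** Let $r,s\in\mathbb N$, $a_1,\dots,a_r,b_1,\dots,b_s\in\mathfrak h$, $m_1,\dots,m_r,n_1,\dots,n_s\in\mathbb N$, and put $A=a_1(-m_1-\frac12)\cdots a_r(-m_r-\frac12)\mathbf 1$, $B=b_1(-n_1-\frac12)\cdots b_s(-n_s-\frac12)\mathbf 1$. For $\iota\in\{\iota_{yx},\iota_{xy}\}$ let $$\begin{aligned}E_\iota=\ &\sum_{k\ge0}\ \sum_{1\le p_1<\cdots<p_{2k}\le r}\ \sum_{l\ge0}\ \sum_{1\le q_1<\cdots<q_{2l}\le s}\ \sum_{\rho=0}^{\min\{r-2k,s-2l\}}\ \sum_{\substack{1\le i_1<\cdots<i_\rho\le r-2k\\1\le j_1<\cdots<j_\rho\le s-2l}}\\ &(-1)^{p_1+\cdots+p_{2k}}\,T^{m_1,\dots,m_r}_{a_1,\dots,a_r}(p_1,\dots,p_{2k})\ (-1)^{q_1+\cdots+q_{2l}}\,T^{n_1,\dots,n_s}_{b_1,\dots,b_s}(q_1,\dots,q_{2l})\\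 &\cdot(-1)^{i_1+\cdots+i_\rho+j_1+\cdots+j_\rho+(r-2k)\rho+\rho(\rho+1)/2}\\ &\cdot\iota\Big[(x+y)^{-m_{p_1}-\cdots-m_{p_{2k}}-k}\,y^{-n_{q_1}-\cdots-n_{q_{2l}}-l}\,\det\Big(\big(a_{p^c_{i_\alpha}},b_{q^c_{j_\beta}}\big)\,g_{m_{p^c_{i_\alpha}}n_{q^c_{j_\beta}}}(x+y,y)\Big)_{\alpha,\beta=1}^{\rho}\Big]\\ &\cdot\iota\Big[{:}\prod_{\alpha=1}^{r-2k-\rho}a^{(m_{p^c_{i^c_\alpha}})}_{p^c_{i^c_\alpha}}(x+y)\ \prod_{\beta=1}^{s-2l-\rho}b^{(n_{q^c_{j^c_\beta}})}_{q^c_{j^c_\beta}}(y){:}\Big],\end{aligned}$$ where the products inside the last normal ordering are taken in increasing order of the indices. Then, on every $w\in W$: 1. (Iterate formula) $Y_W(Y_V(A,x)B,y)=E_{\iota_{yx}}$. 2. (Product formula) $Y_W(A,x+y)\,Y_W(B,y)=E_{\iota_{xy}}$, where on the left the powers of $x+y$ are expanded by $\iota_{xy}$. So the product and the iterate differ only by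 the choice of the expansion of one and the same expression. 3. (The difference is an expansion of zero that is removed by a power of $x+y$.) Let $|A|,|B|\in\{0,1\}$ be the parities of $r$ and $s$. For $w=h_1(-d_1)\cdots h_t(-d_t)u$ with $t\in\mathbb N$, $h_i\in\mathfrak h$, $d_i\in\mathbb N$, $u\in U$, and every integer $P\ge 0$ with $P>m_1+\cdots+m_r+\frac r2+d_1+\cdots+d_t$, $$\iota_{xy}\big[(x+y)^{P+|A|/2}\big]\,y^{|B|/2}\;Y_W(A,x+y)\,Y_W(B,y)w=\iota_{yx}\big[(x+y)^{P+|A|/2}\big]\,y^{|B|/2}\;Y_W(Y_V(A,x)B,y)w.$$ -/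

import Mathlib

open scoped TensorProduct DirectSum

noncomputable section

namespace TwistedFermion

universe u v w

/-! ### Mode systems, normal ordering, generating series -/

section TruncAt

variable {𝔥 : Type u} [AddCommGroup 𝔥] [Module ℂ 𝔥] {X : Type v} [AddCommGroup X] [Module ℂ X]

/-- All products of positive modes of total degree larger than `D` kill `x`. -/
def TruncAt (mode : ℤ → 𝔥 →ₗ[ℂ] Module.End ℂ X) (shift D : ℚ) (x : X) : Prop :=
  ∀ L : List (ℤ × 𝔥), (∀ c ∈ L, 0 < (c.1 : ℚ) + shift) →
    D < (L.map fun c => (c.1 : ℚ) + shift).sum → (L.map fun c => mode c.1 c.2).prod x = 0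

variable {mode : ℤ → 𝔥 →ₗ[ℂ] Module.End ℂ X} {shift D : ℚ} {x y : X}

theorem TruncAt.mono (hx : TruncAt mode shift D x) {D' : ℚ} (h : D ≤ D') :
    TruncAt mode shift D' x := fun L h1 h2 => hx L h1 (lt_of_le_of_lt h h2)

theorem TruncAt.add (hx : TruncAt mode shift D x) (hy : TruncAt mode shift D y) :
    TruncAt mode shift D (x + y) := fun L h1 h2 => by
  rw [map_add, hx L h1 h2, hy L h1 h2, add_zero]

theorem TruncAt.smul (hx : TruncAt mode shift D x) (c : ℂ) : TruncAt mode shift D (c • x) :=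
  fun L h1 h2 => by rw [map_smul, hx L h1 h2, smul_zero]

theorem TruncAt.vacuum (hx : ∀ (p : ℤ) (a : 𝔥), 0 < (p : ℚ) + shift → mode p a x = 0) :
    TruncAt mode shift 0 x := by
  intro L h1 h2
  induction L using List.reverseRecOn with
  | nil => simp at h2
  | append_singleton L c _ => simp [hx c.1 c.2 (h1 c (by simp))]

theorem TruncAt.pos (hx : TruncAt mode shift D x) (p : ℤ) (a : 𝔥) (hp : 0 < (p : ℚ) + shift) :
    TruncAt mode shift (D - (p + shift)) (mode p a x) := by
  intro L h1 h2
  have := hx (L ++ [(p, a)]) (by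
    intro c hc
    rcases List.mem_append.1 hc with hc | hc
    · exact h1 c hc
    · obtain rfl : c = (p, a) := by simpa using hc
      exact hp) (by
    rw [List.map_append, List.sum_append]
    simp only [List.map_cons, List.map_nil, List.sum_cons, List.sum_nil]
    linarith)
  simpa using this

theorem TruncAt.move (T : Module.End ℂ X) {k : ℚ} (hk : 0 ≤ k)
    (hT : ∀ (p : ℤ) (a : 𝔥), 0 < (p : ℚ) + shift → ∃ c : ℂ, (c ≠ 0 → (p : ℚ) + shift = k) ∧
      mode p a * T + T * mode p a = c • 1) (hx : TruncAt mode shift D x) :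
    TruncAt mode shift (D + k) (T x) := by
  intro L h1 h2
  induction L using List.reverseRecOn generalizing D x with
  | nil =>
    have h0 : x = 0 := hx [] (by simp) (by simp at h2 ⊢; linarith)
    simp [h0]
  | append_singleton L c ih =>
    obtain ⟨γ, hγ, hrel⟩ := hT c.1 c.2 (h1 c (by simp))
    have hL : ∀ d ∈ L, 0 < (d.1 : ℚ) + shift := fun d hd => h1 d (by simp [hd])
    have h2' : D + k < (L.map fun c => (c.1 : ℚ) + shift).sum + ((c.1 : ℚ) + shift) := by
      simpa using h2
    have e : mode c.1 c.2 (T x) = γ • x - T (mode c.1 c.2 x) := by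
      have := congrArg (fun f : Module.End ℂ X => f x) hrel
      simp only [LinearMap.add_apply, Module.End.mul_apply, LinearMap.smul_apply,
        Module.End.one_apply] at this
      rw [← this]
      abel
    have e2 := ih (hx.pos c.1 c.2 (h1 c (by simp))) hL (by linarith)
    simp only [List.map_append, List.map_cons, List.map_nil, List.prod_append, List.prod_cons,
      List.prod_nil, mul_one, Module.End.mul_apply]
    rw [e, map_sub, e2, map_smul, sub_zero]
    by_cases h0 : γ = 0
    · simp [h0]
    · rw [hx L hL (by linarith [hγ h0]), smul_zero]

end TruncAt

/-- A space `X` with modes `h(d)`, `h ∈ 𝔥`, `d ∈ ℤ + shift`; `mode n h` is `h(n + shift)`.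
The two fields of proofs say that positive modes anticommute with zero modes and that every vector
is killed by all products of positive modes of sufficiently large total degree.
Only two instances are used below: `modesV` on `V` (`shift = 1/2`) and `modesW` on `W`
(`shift = 0`). -/
structure ModeSystem (𝔥 : Type u) [AddCommGroup 𝔥] [Module ℂ 𝔥]
    (X : Type v) [AddCommGroup X] [Module ℂ X] where
  shift : ℚ
  mode : ℤ → 𝔥 →ₗ[ℂ] Module.End ℂ X
  pos_zero : ∀ (p z : ℤ) (a b : 𝔥), 0 < (p : ℚ) + shift → (z : ℚ) + shift = 0 →
    mode p a * mode z b = -(mode z b * mode p a)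
  truncated : ∀ x : X, ∃ D : ℚ, TruncAt mode shift D x

section Generic

variable {𝔥 : Type u} [AddCommGroup 𝔥] [Module ℂ 𝔥] {X : Type v} [AddCommGroup X] [Module ℂ X]

/-- The degree `d = n + shift` of the mode with index `n`. -/
def ModeSystem.deg (S : ModeSystem 𝔥 X) (n : ℤ) : ℚ := n + S.shift

/-- The normal ordering of a product of zero modes `φ i`, with contractions `β i j`:
`:φ₁ φ₂ ⋯ φᵣ: = φ₁ :φ₂ ⋯ φᵣ: + ∑_{i=2}^r ((-1)^(i+1)/2) β₁ᵢ :φ₂ ⋯ φ̂ᵢ ⋯ φᵣ:`. -/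
def nordZero {ι : Type} (φ : ι → Module.End ℂ X) (β : ι → ι → ℂ) : List ι → Module.End ℂ X
  | [] => 1
  | a :: L => φ a * nordZero φ β L +
      ∑ i : Fin L.length, ((-1 : ℂ) ^ ((i : ℕ) + 1) / 2 * β a L[i]) •
        nordZero φ β (L.eraseIdx i)
termination_by L => L.length
decreasing_by
  · simp
  · simp only [List.length_cons, List.length_eraseIdx]
    split <;> omega

/-- `0`, `1`, `2` for negative, positive and zero degree. -/
def kind (d : ℚ) : ℕ := if d < 0 then 0 else if 0 < d then 1 else 2

/-- The normal ordering `:h₁(n₁)⋯hᵣ(nᵣ):` of a product of modes: all negative modes, then all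
positive modes, then the normal ordering of the zero modes, the order being kept within each of the
three groups, multiplied by the sign of the 3-shuffle (`Tuple.sort` is the stable sort). -/
def nord (S : ModeSystem 𝔥 X) (B : LinearMap.BilinForm ℂ 𝔥) {r : ℕ}
    (n : Fin r → ℤ) (h : Fin r → 𝔥) : Module.End ℂ X :=
  (((Equiv.Perm.sign (Tuple.sort fun i => kind (S.deg (n i))) : ℤˣ) : ℤ) : ℂ) •
    ((((List.finRange r).filter fun i => S.deg (n i) < 0).map fun i => S.mode (n i) (h i)).prod *
      (((List.finRange r).filter fun i => 0 < S.deg (n i)).map fun i => S.mode (n i) (h i)).prod *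
      nordZero (fun i => S.mode (n i) (h i)) (fun i j => B (h i) (h j))
        ((List.finRange r).filter fun i => S.deg (n i) = 0))

/-- The binomial coefficient `α (α - 1) ⋯ (α - k + 1) / k!`. -/
def binom (α : ℚ) (k : ℕ) : ℂ := ((Ring.choose α k : ℚ) : ℂ)

/-- The exponent of `(x^(-d-1/2))^(m) = (1/m!) ∂ₓ^m x^(-d-1/2) = binom (-d-1/2) m x^(-d-1/2-m)`,
the factor that accompanies `h(d)` in `h^(m)(x)`; here `d = n + shift`. -/
def fexp (S : ModeSystem 𝔥 X) (m : ℕ) (n : ℤ) : ℚ := -S.deg n - 1 / 2 - m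

/-- The numerical factor of `(x^(-d-1/2))^(m)`. -/
def fcoef (S : ModeSystem 𝔥 X) (m : ℕ) (n : ℤ) : ℂ := binom (-S.deg n - 1 / 2) m

/-! #### Multilinearity and finiteness -/

section Multilinear

variable {r : ℕ} {E F G : Type*} [AddCommGroup E] [Module ℂ E] [AddCommGroup F] [Module ℂ F]
  [AddCommGroup G] [Module ℂ G]

/-- `F` is linear in each of the variables in `s` and does not depend on the others. -/
def MLOn (s : Finset (Fin r)) (f : (Fin r → 𝔥) → E) : Prop :=
  (∀ h i x, i ∉ s → f (Function.update h i x) = f h) ∧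
  (∀ h i x y, i ∈ s → f (Function.update h i (x + y)) =
    f (Function.update h i x) + f (Function.update h i y)) ∧
  (∀ h i (c : ℂ) x, i ∈ s → f (Function.update h i (c • x)) = c • f (Function.update h i x))

theorem MLOn.const (e : E) : MLOn (𝔥 := 𝔥) (∅ : Finset (Fin r)) fun _ => e := by
  refine ⟨?_, ?_, ?_⟩ <;> simp

theorem MLOn.single (f : 𝔥 →ₗ[ℂ] E) (i : Fin r) : MLOn {i} fun h : Fin r → 𝔥 => f (h i) := by
  refine ⟨?_, ?_, ?_⟩
  · intro h j x hj
    have : i ≠ j := by simpa [eq_comm] using hj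
    simp [Function.update_of_ne this]
  · intro h j x y hj
    obtain rfl : j = i := by simpa using hj
    simp
  · intro h j c x hj
    obtain rfl : j = i := by simpa using hj
    simp

theorem MLOn.bilin {s t : Finset (Fin r)} {f : (Fin r → 𝔥) → E} {g : (Fin r → 𝔥) → F}
    (hf : MLOn s f) (hg : MLOn t g) (hst : Disjoint s t) (b : E →ₗ[ℂ] F →ₗ[ℂ] G) :
    MLOn (s ∪ t) fun h => b (f h) (g h) := by
  have hd : ∀ i, i ∈ s → i ∉ t := fun i hi hi' => Finset.disjoint_left.1 hst hi hi'
  refine ⟨?_, ?_, ?_⟩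
  · intro h i x hi
    simp only [Finset.mem_union, not_or] at hi
    simp only [hf.1 h i x hi.1, hg.1 h i x hi.2]
  · intro h i x y hi
    rcases Finset.mem_union.1 hi with hi | hi
    · simp [hf.2.1 h i x y hi, hg.1 h i _ (hd i hi)]
    · have : i ∉ s := fun h' => hd i h' hi
      simp [hg.2.1 h i x y hi, hf.1 h i _ this]
  · intro h i c x hi
    rcases Finset.mem_union.1 hi with hi | hi
    · simp [hf.2.2 h i c x hi, hg.1 h i _ (hd i hi)]
    · have : i ∉ s := fun h' => hd i h' hi
      simp [hg.2.2 h i c x hi, hf.1 h i _ this]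

theorem MLOn.add {s : Finset (Fin r)} {f g : (Fin r → 𝔥) → E} (hf : MLOn s f) (hg : MLOn s g) :
    MLOn s fun h => f h + g h := by
  refine ⟨?_, ?_, ?_⟩
  · intro h i x hi
    simp only [hf.1 h i x hi, hg.1 h i x hi]
  · intro h i x y hi
    simp only [hf.2.1 h i x y hi, hg.2.1 h i x y hi]
    abel
  · intro h i c x hi
    simp only [hf.2.2 h i c x hi, hg.2.2 h i c x hi, smul_add]

theorem MLOn.sum {κ : Type*} {s : Finset (Fin r)} (T : Finset κ) {f : κ → (Fin r → 𝔥) → E}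
    (hf : ∀ k ∈ T, MLOn s (f k)) : MLOn s fun h => ∑ k ∈ T, f k h := by
  refine ⟨?_, ?_, ?_⟩
  · intro h i x hi
    exact Finset.sum_congr rfl fun k hk => (hf k hk).1 h i x hi
  · intro h i x y hi
    rw [← Finset.sum_add_distrib]
    exact Finset.sum_congr rfl fun k hk => (hf k hk).2.1 h i x y hi
  · intro h i c x hi
    rw [Finset.smul_sum]
    exact Finset.sum_congr rfl fun k hk => (hf k hk).2.2 h i c x hi

theorem MLOn.map {s : Finset (Fin r)} {f : (Fin r → 𝔥) → E} (hf : MLOn s f) (g : E →ₗ[ℂ] F) :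
    MLOn s fun h => g (f h) := by
  refine ⟨?_, ?_, ?_⟩
  · intro h i x hi
    simp only [hf.1 h i x hi]
  · intro h i x y hi
    simp only [hf.2.1 h i x y hi, map_add]
  · intro h i c x hi
    simp only [hf.2.2 h i c x hi, map_smul]

theorem MLOn.prod (φ : Fin r → 𝔥 →ₗ[ℂ] Module.End ℂ X) (L : List (Fin r)) (hL : L.Nodup) :
    MLOn L.toFinset fun h => (L.map fun i => φ i (h i)).prod := by
  induction L with
  | nil => simpa using MLOn.const (1 : Module.End ℂ X)
  | cons a L ih =>
    rw [List.nodup_cons] at hL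
    have := (MLOn.single (φ a) a).bilin (ih hL.2) (by simpa using hL.1)
      (LinearMap.mul ℂ (Module.End ℂ X))
    rw [List.toFinset_cons, Finset.insert_eq]
    simpa using this

theorem MLOn.nordZero (φ : Fin r → 𝔥 →ₗ[ℂ] Module.End ℂ X) (B : LinearMap.BilinForm ℂ 𝔥)
    (L : List (Fin r)) (hL : L.Nodup) : MLOn L.toFinset fun h =>
      nordZero (fun i => φ i (h i)) (fun i j => B (h i) (h j)) L := by
  induction hk : L.length using Nat.strong_induction_on generalizing L with
  | _ k ih =>
    cases L with
    | nil => simpa [TwistedFermion.nordZero] using MLOn.const (1 : Module.End ℂ X)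
    | cons a L =>
      rw [List.nodup_cons] at hL
      subst hk
      have h1 := (MLOn.single (φ a) a).bilin (ih _ (by simp) L hL.2 rfl) (by simpa using hL.1)
        (LinearMap.mul ℂ (Module.End ℂ X))
      simp only [TwistedFermion.nordZero]
      rw [List.toFinset_cons, Finset.insert_eq]
      refine MLOn.add (by simpa using h1) (MLOn.sum _ fun i _ => ?_)
      have hne : a ≠ L[i] := fun h => hL.1 (h ▸ List.getElem_mem _)
      have hmem : ∀ j, j ∈ L.eraseIdx i ↔ j ∈ L ∧ j ≠ L[i] := by
        intro j
        rw [List.mem_eraseIdx_iff_getElem]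
        constructor
        · rintro ⟨k, hk, hki, rfl⟩
          refine ⟨List.getElem_mem _, fun h => hki ?_⟩
          exact (hL.2.getElem_inj_iff.1 h)
        · rintro ⟨hj, hne'⟩
          obtain ⟨k, hk, rfl⟩ := List.getElem_of_mem hj
          exact ⟨k, hk, fun h => hne' (by subst h; rfl), rfl⟩
      have h2 : MLOn ({a} ∪ {L[i]}) fun h : Fin r → 𝔥 => B (h a) (h L[i]) :=
        (MLOn.single LinearMap.id a).bilin (MLOn.single LinearMap.id L[i]) (by simpa using hne) B
      have h3 := ih (L.eraseIdx i).length
        (by rw [List.length_cons, List.length_eraseIdx]; split <;> omega) (L.eraseIdx i)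
        (hL.2.sublist (List.eraseIdx_sublist _ _)) rfl
      have h4 := (h2.map (LinearMap.mulLeft ℂ ((-1 : ℂ) ^ ((i : ℕ) + 1) / 2))).bilin h3
        (by
          rw [Finset.disjoint_left]
          intro j hj hj'
          simp only [List.mem_toFinset, hmem] at hj'
          simp only [Finset.mem_union, Finset.mem_singleton] at hj
          rcases hj with rfl | rfl
          · exact hL.1 hj'.1
          · exact hj'.2 rfl) (LinearMap.lsmul ℂ (Module.End ℂ X))
      have h5 : ({a} ∪ {L[i]}) ∪ (L.eraseIdx i).toFinset = {a} ∪ L.toFinset := by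
        ext j
        simp only [Finset.mem_union, Finset.mem_singleton, List.mem_toFinset, hmem]
        constructor
        · rintro ((h | rfl) | h)
          · exact Or.inl h
          · exact Or.inr (List.getElem_mem _)
          · exact Or.inr h.1
        · rintro (h | h)
          · exact Or.inl (Or.inl h)
          · by_cases h' : j = L[i]
            · exact Or.inl (Or.inr h')
            · exact Or.inr ⟨h, h'⟩
      rw [h5] at h4
      simpa using h4

theorem MLOn.nord (S : ModeSystem 𝔥 X) (B : LinearMap.BilinForm ℂ 𝔥) (n : Fin r → ℤ) :
    MLOn Finset.univ (nord S B n) := by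
  have hnd := List.nodup_finRange r
  have h1 := (((MLOn.prod (fun i => S.mode (n i)) _
    (hnd.filter fun i => S.deg (n i) < 0)).bilin (MLOn.prod (fun i => S.mode (n i)) _
    (hnd.filter fun i => 0 < S.deg (n i))) (by
      rw [Finset.disjoint_left]
      intro j hj hj'
      simp at hj hj'
      exact absurd hj (not_lt.2 hj'.le)) (LinearMap.mul ℂ (Module.End ℂ X))).bilin
    (MLOn.nordZero (fun i => S.mode (n i)) B _ (hnd.filter fun i => S.deg (n i) = 0)) (by
      rw [Finset.disjoint_left]
      intro j hj hj'
      simp at hj hj'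
      exact hj hj') (LinearMap.mul ℂ (Module.End ℂ X))).map
    (LinearMap.lsmul ℂ (Module.End ℂ X)
      (((Equiv.Perm.sign (Tuple.sort fun i => kind (S.deg (n i))) : ℤˣ) : ℤ) : ℂ))
  convert h1 using 1
  swap
  · rfl
  ext j
  rcases lt_trichotomy (S.deg (n j)) 0 with h | h | h <;> simp [h]

end Multilinear

/-- `TruncAt` for the modes of `S`. -/
def Trunc (S : ModeSystem 𝔥 X) (D : ℚ) (x : X) : Prop :=
  ∀ L : List (ℤ × 𝔥), (∀ c ∈ L, 0 < S.deg c.1) → D < (L.map fun c => S.deg c.1).sum →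
    (L.map fun c => S.mode c.1 c.2).prod x = 0

theorem Trunc.add {S : ModeSystem 𝔥 X} {D : ℚ} {x y : X} (hx : Trunc S D x) (hy : Trunc S D y) :
    Trunc S D (x + y) := fun L h1 h2 => by rw [map_add, hx L h1 h2, hy L h1 h2, add_zero]

theorem Trunc.smul {S : ModeSystem 𝔥 X} {D : ℚ} {x : X} (hx : Trunc S D x) (c : ℂ) :
    Trunc S D (c • x) := fun L h1 h2 => by rw [map_smul, hx L h1 h2, smul_zero]

theorem Trunc.zero_mode {S : ModeSystem 𝔥 X} {D : ℚ} {x : X} (hx : Trunc S D x) (z : ℤ)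
    (hz : S.deg z = 0) (b : 𝔥) : Trunc S D (S.mode z b x) := by
  intro L h1 h2
  have key : ∀ L : List (ℤ × 𝔥), (∀ c ∈ L, 0 < S.deg c.1) →
      (L.map fun c => S.mode c.1 c.2).prod * S.mode z b =
        (-1 : ℂ) ^ L.length • (S.mode z b * (L.map fun c => S.mode c.1 c.2).prod) := by
    intro L hL
    induction L with
    | nil => simp
    | cons c L ih =>
      have e1 := ih fun d hd => hL d (by simp [hd])
      have e2 := S.pos_zero c.1 z c.2 b (hL c (by simp)) hz
      simp only [List.map_cons, List.prod_cons, List.length_cons, pow_succ]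
      rw [mul_assoc, e1, mul_smul_comm, ← mul_assoc, e2]
      simp [mul_assoc]
  have := congrArg (fun f : Module.End ℂ X => f x) (key L h1)
  simp only [Module.End.mul_apply, LinearMap.smul_apply] at this
  rw [this, hx L h1 h2]
  simp

theorem Trunc.nordZero {S : ModeSystem 𝔥 X} {D : ℚ} {x : X} (hx : Trunc S D x) {ι : Type}
    (n : ι → ℤ) (h : ι → 𝔥) (β : ι → ι → ℂ) (L : List ι) (hL : ∀ i ∈ L, S.deg (n i) = 0) :
    Trunc S D (nordZero (fun i => S.mode (n i) (h i)) β L x) := by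
  induction hk : L.length using Nat.strong_induction_on generalizing L with
  | _ k ih =>
    cases L with
    | nil => simpa [TwistedFermion.nordZero] using hx
    | cons a L =>
      subst hk
      simp only [TwistedFermion.nordZero, LinearMap.add_apply, Module.End.mul_apply,
        LinearMap.sum_apply, LinearMap.smul_apply]
      refine Trunc.add ((ih _ (by simp) L (fun i hi => hL i (by simp [hi])) rfl).zero_mode _
        (hL a (by simp)) _) ?_
      refine Finset.sum_induction _ (Trunc S D) (fun _ _ => Trunc.add)
        (fun L _ _ => map_zero _) fun i _ => Trunc.smul ?_ _
      exact ih (L.eraseIdx i).length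
        (by rw [List.length_cons, List.length_eraseIdx]; split <;> omega) (L.eraseIdx i)
        (fun j hj => hL j (by simp [List.mem_of_mem_eraseIdx hj])) rfl

/-- For fixed `x` and fixed total degree only finitely many normal-ordered products of modes are
nonzero on `x`, so the sums over modes below are finite. -/
theorem nord_finite (S : ModeSystem 𝔥 X) (B : LinearMap.BilinForm ℂ 𝔥) {r : ℕ} (h : Fin r → 𝔥)
    (x : X) (t : ℚ) : {n : Fin r → ℤ | ∑ i, S.deg (n i) = t ∧ nord S B n h x ≠ 0}.Finite := by
  obtain ⟨D', hD'⟩ := S.truncated x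
  set D := max D' 0 with hD
  have hx : Trunc S D x := fun L h1 h2 => hD' L h1 (lt_of_le_of_lt (le_max_left _ _) h2)
  have hD0 : 0 ≤ D := le_max_right _ _
  refine (Set.finite_Icc (fun _ : Fin r => ⌊t - r * D - S.shift⌋)
    (fun _ : Fin r => ⌈D - S.shift⌉)).subset ?_
  rintro n ⟨hs, hn⟩
  have hpos : (((List.finRange r).filter fun i => 0 < S.deg (n i)).map fun i =>
      S.deg (n i)).sum ≤ D := by
    by_contra hlt
    push Not at hlt
    apply hn
    have h0 := (hx.nordZero n h (fun i j => B (h i) (h j))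
      ((List.finRange r).filter fun i => S.deg (n i) = 0) (by simp))
      (((List.finRange r).filter fun i => 0 < S.deg (n i)).map fun i => (n i, h i)) (by simp)
      (by simpa [List.map_map, Function.comp_def] using hlt)
    simp only [List.map_map, Function.comp_def] at h0
    simp only [nord, LinearMap.smul_apply, Module.End.mul_apply]
    rw [h0]
    simp
  have hpos' : ∑ i, max (S.deg (n i)) 0 ≤ D := by
    refine le_of_eq_of_le ?_ hpos
    have : ∀ L : List (Fin r), (L.map fun i => max (S.deg (n i)) 0).sum =
        ((L.filter fun i => 0 < S.deg (n i)).map fun i => S.deg (n i)).sum := by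
      intro L
      induction L with
      | nil => simp
      | cons a L ih =>
        by_cases ha : 0 < S.deg (n a)
        · simp [ha, ih, ha.le]
        · simp [ha, ih, not_lt.1 ha]
    rw [← this, ← List.ofFn_eq_map, List.sum_ofFn]
  have hle : ∀ i, S.deg (n i) ≤ D := fun i => (le_max_left _ _).trans
    ((Finset.single_le_sum (f := fun i => max (S.deg (n i)) 0) (fun j _ => le_max_right _ _)
      (Finset.mem_univ i)).trans hpos')
  have hge : ∀ i, t - r * D ≤ S.deg (n i) := by
    intro i
    have h1 : ∑ j ∈ Finset.univ.erase i, S.deg (n j) ≤ r * D := by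
      refine (Finset.sum_le_card_nsmul _ _ D fun j _ => hle j).trans ?_
      rw [nsmul_eq_mul]
      refine mul_le_mul_of_nonneg_right ?_ hD0
      exact_mod_cast (Finset.card_le_univ _).trans (by simp)
    have h2 := Finset.add_sum_erase Finset.univ (fun j => S.deg (n j)) (Finset.mem_univ i)
    rw [hs] at h2
    linarith
  constructor
  · intro i
    have := hge i
    have h3 := Int.floor_le (t - r * D - S.shift)
    simp only [ModeSystem.deg] at this
    have h4 : ((⌊t - r * D - S.shift⌋ : ℤ) : ℚ) ≤ n i := by linarith
    exact_mod_cast h4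
  · intro i
    have := hle i
    have h3 := Int.le_ceil (D - S.shift)
    simp only [ModeSystem.deg] at this
    have h4 : (n i : ℚ) ≤ ((⌈D - S.shift⌉ : ℤ) : ℚ) := by linarith
    exact_mod_cast h4

/-- The multilinear map `(h₁, …, hᵣ) ↦ :h₁^(m₁)(x) ⋯ hᵣ^(mᵣ)(x):`. An operator-valued series in
(rational powers of) `x` is represented by the map that sends a vector and an exponent `q` to the
coefficient of `x^q` applied to the vector. -/
def fieldProd (S : ModeSystem 𝔥 X) (B : LinearMap.BilinForm ℂ 𝔥) {r : ℕ} (m : Fin r → ℕ) :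
    MultilinearMap ℂ (fun _ : Fin r => 𝔥) (X →ₗ[ℂ] (ℚ → X)) :=
  have fin : ∀ (h : Fin r → 𝔥) (x : X) (q : ℚ), (Function.support fun n : Fin r → ℤ =>
      if ∑ i, fexp S (m i) (n i) = q then
        (∏ i, fcoef S (m i) (n i)) • nord S B n h x else 0).Finite := by
    intro h x q
    refine (nord_finite S B h x (-q - r / 2 - ∑ i, (m i : ℚ))).subset ?_
    intro n hn
    simp only [Function.mem_support, ne_eq, ite_eq_right_iff, Classical.not_imp, smul_eq_zero,
      not_or] at hn
    refine ⟨?_, hn.2.2⟩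
    have := hn.1
    simp only [fexp, Finset.sum_sub_distrib, Finset.sum_neg_distrib, Finset.sum_const,
      Finset.card_univ, Fintype.card_fin, nsmul_eq_mul] at this
    linarith
  { toFun := fun h =>
      { toFun := fun x q => ∑ᶠ n : Fin r → ℤ,
          if ∑ i, fexp S (m i) (n i) = q then
            (∏ i, fcoef S (m i) (n i)) • nord S B n h x else 0
        map_add' := fun x y => by
          funext q
          rw [Pi.add_apply, ← finsum_add_distrib (fin h x q) (fin h y q)]
          refine finsum_congr fun n => ?_
          split_ifs <;> simp
        map_smul' := fun c x => by
          funext q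
          simp only [RingHom.id_apply, Pi.smul_apply]
          rw [smul_finsum' c (fin h x q)]
          refine finsum_congr fun n => ?_
          split_ifs
          · rw [map_smul, smul_comm]
          · simp }
    map_update_add' := fun {dec} h i a b => by
      obtain rfl : dec = instDecidableEqFin r := Subsingleton.elim _ _
      ext x q
      change _ = (_ : X) + _
      refine Eq.trans ?_ (finsum_add_distrib (fin _ x q) (fin _ x q))
      refine finsum_congr fun n => ?_
      split_ifs
      · rw [(MLOn.nord S B n).2.1 h i a b (Finset.mem_univ i)]
        simp
      · simp
    map_update_smul' := fun {dec} h i c a => by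
      obtain rfl : dec = instDecidableEqFin r := Subsingleton.elim _ _
      ext x q
      change _ = c • (_ : X)
      refine Eq.trans ?_ (smul_finsum' c (fin _ x q)).symm
      refine finsum_congr fun n => ?_
      split_ifs
      · rw [(MLOn.nord S B n).2.2 h i c a (Finset.mem_univ i), LinearMap.smul_apply, smul_comm]
      · simp }

end Generic

/-! ### The algebra `V` -/

section AlgebraV

variable {𝔥 : Type u} [AddCommGroup 𝔥] [Module ℂ 𝔥]

/-- The underlying space of `V`: the tensor algebra of `⨁_{m ≥ 0} 𝔥 ⊗ t^(-m-1/2)`; the element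
`DirectSum.lof ℂ ℕ _ m h` stands for `h ⊗ t^(-m-1/2)`. The vacuum is `1`. -/
abbrev FockV (𝔥 : Type u) [AddCommGroup 𝔥] [Module ℂ 𝔥] : Type u :=
  TensorAlgebra ℂ (⨁ _ : ℕ, 𝔥)

theorem tensor_left_induction {M : Type*} [AddCommGroup M] [Module ℂ M]
    {P : TensorAlgebra ℂ M → Prop} (h1 : P 1) (hadd : ∀ x y, P x → P y → P (x + y))
    (hsmul : ∀ (c : ℂ) x, P x → P (c • x))
    (hmul : ∀ a x, P x → P (TensorAlgebra.ι ℂ a * x)) (x : TensorAlgebra ℂ M) : P x := by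
  have : ∀ y, P y → P (x * y) := by
    induction x using TensorAlgebra.induction with
    | algebraMap c =>
      intro y hy
      rw [← Algebra.smul_def]
      exact hsmul c y hy
    | ι a => exact fun y hy => hmul a y hy
    | mul a b ha hb =>
      intro y hy
      rw [mul_assoc]
      exact ha _ (hb y hy)
    | add a b ha hb =>
      intro y hy
      rw [add_mul]
      exact hadd _ _ (ha y hy) (hb y hy)
  simpa using this 1 h1

/-- Left multiplication by `v` on the first component, `(w, z) ↦ f v • w - v * z` on the second. -/
def contrAux {M : Type*} [AddCommGroup M] [Module ℂ M] (f : Module.Dual ℂ M) :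
    TensorAlgebra ℂ M →ₐ[ℂ] Module.End ℂ (TensorAlgebra ℂ M × TensorAlgebra ℂ M) :=
  TensorAlgebra.lift ℂ
    { toFun := fun v =>
        { toFun := fun p => (TensorAlgebra.ι ℂ v * p.1, f v • p.1 - TensorAlgebra.ι ℂ v * p.2)
          map_add' := fun p q => by
            ext
            · simp [mul_add]
            · simp [mul_add]
              abel
          map_smul' := fun c p => by
            ext
            · simp
            · simp [smul_sub, smul_comm c] }
      map_add' := fun v w => by
        refine LinearMap.ext fun p => ?_
        ext
        · simp [add_mul]
        · simp [add_mul, add_smul]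
          abel
      map_smul' := fun c v => by
        refine LinearMap.ext fun p => ?_
        ext
        · simp
        · simp [smul_sub, mul_smul] }

theorem contrAux_fst {M : Type*} [AddCommGroup M] [Module ℂ M] (f : Module.Dual ℂ M)
    (x : TensorAlgebra ℂ M) : (contrAux f x (1, 0)).1 = x := by
  induction x using tensor_left_induction with
  | h1 => simp
  | hadd x y hx hy => simp [hx, hy]
  | hsmul c x hx => simp [hx]
  | hmul a x hx =>
    rw [map_mul, Module.End.mul_apply]
    conv_rhs => rw [← hx]
    simp [contrAux]

/-- The antiderivation of the tensor algebra that extends the functional `f`: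
`v₁ ⋯ vₖ ↦ ∑ᵢ (-1)^(i-1) f(vᵢ) v₁ ⋯ v̂ᵢ ⋯ vₖ`. -/
def contr {M : Type*} [AddCommGroup M] [Module ℂ M] (f : Module.Dual ℂ M) :
    Module.End ℂ (TensorAlgebra ℂ M) :=
  { toFun := fun x => (contrAux f x (1, 0)).2
    map_add' := by simp
    map_smul' := by simp }

theorem contr_one {M : Type*} [AddCommGroup M] [Module ℂ M] (f : Module.Dual ℂ M) :
    contr f 1 = 0 := by simp [contr]

theorem contr_mul {M : Type*} [AddCommGroup M] [Module ℂ M] (f : Module.Dual ℂ M) (v : M)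
    (x : TensorAlgebra ℂ M) :
    contr f (TensorAlgebra.ι ℂ v * x) = f v • x - TensorAlgebra.ι ℂ v * contr f x := by
  have e : contrAux f (TensorAlgebra.ι ℂ v) (contrAux f x (1, 0)) =
      (TensorAlgebra.ι ℂ v * (contrAux f x (1, 0)).1,
        f v • (contrAux f x (1, 0)).1 - TensorAlgebra.ι ℂ v * (contrAux f x (1, 0)).2) := by
    rw [contrAux, TensorAlgebra.lift_ι_apply]
    rfl
  change (contrAux f _ (1, 0)).2 = f v • x - TensorAlgebra.ι ℂ v * (contrAux f x (1, 0)).2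
  rw [map_mul, Module.End.mul_apply, e, contrAux_fst]

theorem contr_add {M : Type*} [AddCommGroup M] [Module ℂ M] (f g : Module.Dual ℂ M) :
    contr (f + g) = contr f + contr g := by
  ext x
  induction x using tensor_left_induction with
  | h1 => simp [contr_one]
  | hadd x y hx hy => rw [map_add, hx, hy, map_add]
  | hsmul c x hx => rw [map_smul, hx, map_smul]
  | hmul a x hx =>
    rw [contr_mul, hx]
    simp only [LinearMap.add_apply, contr_mul, add_smul, mul_add]
    abel

theorem contr_smul {M : Type*} [AddCommGroup M] [Module ℂ M] (c : ℂ) (f : Module.Dual ℂ M) :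
    contr (c • f) = c • contr f := by
  ext x
  induction x using tensor_left_induction with
  | h1 => simp [contr_one]
  | hadd x y hx hy => rw [map_add, hx, hy, map_add]
  | hsmul d x hx => rw [map_smul, hx, map_smul]
  | hmul a x hx =>
    rw [contr_mul, hx]
    simp [contr_mul, smul_sub, mul_smul]

/-- The mode `h(-m-1/2)` on `V`: left multiplication. -/
def create (m : ℕ) : 𝔥 →ₗ[ℂ] Module.End ℂ (FockV 𝔥) :=
  LinearMap.mul ℂ (FockV 𝔥) ∘ₗ TensorAlgebra.ι ℂ ∘ₗ DirectSum.lof ℂ ℕ (fun _ => 𝔥) m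

/-- The mode `h(m+1/2)` on `V`: the antiderivation with
`b ⊗ t^(-k-1/2) ↦ (h, b) δ_{m,k}`. -/
def annih (B : LinearMap.BilinForm ℂ 𝔥) (m : ℕ) : 𝔥 →ₗ[ℂ] Module.End ℂ (FockV 𝔥) where
  toFun h := contr (B h ∘ₗ DirectSum.component ℂ ℕ (fun _ => 𝔥) m)
  map_add' a b := by rw [map_add, LinearMap.add_comp, contr_add]
  map_smul' c a := by rw [map_smul, LinearMap.smul_comp, contr_smul]; rfl

/-- The defining relation `{a(m+1/2), b(-k-1/2)} = (a, b) δ_{m,k}` of the modes on `V`. -/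
theorem annih_create (B : LinearMap.BilinForm ℂ 𝔥) (m k : ℕ) (a b : 𝔥) :
    annih B m a * create k b + create k b * annih B m a =
      (if m = k then B a b else 0) • (1 : Module.End ℂ (FockV 𝔥)) := by
  ext x
  simp only [annih, create, LinearMap.add_apply, Module.End.mul_apply, LinearMap.coe_mk,
    AddHom.coe_mk, LinearMap.comp_apply, LinearMap.mul_apply', contr_mul, LinearMap.smul_apply,
    Module.End.one_apply, sub_add_cancel]
  congr 1
  split_ifs with h
  · subst h
    rw [DirectSum.component.lof_self]
  · rw [DirectSum.component.of, dif_neg (fun h' => h h'.symm), map_zero]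

theorem annih_one (B : LinearMap.BilinForm ℂ 𝔥) (m : ℕ) (a : 𝔥) : annih B m a 1 = 0 :=
  contr_one _

/-- The mode `h(n+1/2)` on `V`, `n ∈ ℤ`. -/
def modeV (B : LinearMap.BilinForm ℂ 𝔥) : ℤ → 𝔥 →ₗ[ℂ] Module.End ℂ (FockV 𝔥)
  | Int.ofNat m => annih B m
  | Int.negSucc m => create m

theorem modeV_truncated (B : LinearMap.BilinForm ℂ 𝔥) (x : FockV 𝔥) :
    ∃ D : ℚ, TruncAt (modeV B) (1 / 2) D x := by
  have hp : ∀ p : ℤ, 0 < (p : ℚ) + 1 / 2 → ∃ m : ℕ, p = Int.ofNat m := by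
    intro p hp
    have h : (0 : ℚ) < ((2 * p + 1 : ℤ) : ℚ) := by
      push_cast
      linarith
    have h' : 0 < 2 * p + 1 := by exact_mod_cast h
    exact ⟨p.toNat, by simp only [Int.ofNat_eq_natCast]; omega⟩
  induction x using tensor_left_induction with
  | h1 =>
    refine ⟨0, TruncAt.vacuum fun p a h => ?_⟩
    obtain ⟨m, rfl⟩ := hp p h
    exact annih_one B m a
  | hadd x y hx hy =>
    obtain ⟨D, hD⟩ := hx
    obtain ⟨E, hE⟩ := hy
    exact ⟨max D E, (hD.mono (le_max_left _ _)).add (hE.mono (le_max_right _ _))⟩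
  | hsmul c x hx =>
    obtain ⟨D, hD⟩ := hx
    exact ⟨D, hD.smul c⟩
  | hmul v x hx =>
    induction v using DirectSum.induction_on with
    | zero => exact ⟨0, fun L _ _ => by simp⟩
    | add v w hv hw =>
      obtain ⟨D, hD⟩ := hv
      obtain ⟨E, hE⟩ := hw
      rw [map_add, add_mul]
      exact ⟨max D E, (hD.mono (le_max_left _ _)).add (hE.mono (le_max_right _ _))⟩
    | of k b =>
      obtain ⟨D, hD⟩ := hx
      refine ⟨D + ((k : ℚ) + 1 / 2), TruncAt.move (create k b) (by positivity) ?_ hD⟩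
      intro p a h
      obtain ⟨m, rfl⟩ := hp p h
      refine ⟨if m = k then B a b else 0, ?_, annih_create B m k a b⟩
      intro h'
      have : m = k := by
        by_contra hne
        simp [hne] at h'
      simp [this]

/-- The modes of `V`. -/
def modesV (B : LinearMap.BilinForm ℂ 𝔥) : ModeSystem 𝔥 (FockV 𝔥) where
  shift := 1 / 2
  mode := modeV B
  pos_zero p z a b _ hz := by
    exfalso
    have h : ((2 * z + 1 : ℤ) : ℚ) = 0 := by
      push_cast
      linarith
    have h' : 2 * z + 1 = 0 := by exact_mod_cast h
    omega
  truncated := modeV_truncated B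

/-- The element `a₁(-m₁-1/2) ⋯ aᵣ(-mᵣ-1/2) 𝟏` of `V`. -/
def word (B : LinearMap.BilinForm ℂ 𝔥) {r : ℕ} (a : Fin r → 𝔥) (m : Fin r → ℕ) : FockV 𝔥 :=
  (List.ofFn fun i => modeV B (-(m i : ℤ) - 1) (a i)).prod 1

theorem word_eq (B : LinearMap.BilinForm ℂ 𝔥) {r : ℕ} (a : Fin r → 𝔥) (m : Fin r → ℕ) :
    word B a m = TensorAlgebra.tprod ℂ _ r fun i => DirectSum.lof ℂ ℕ (fun _ => 𝔥) (m i) (a i) := by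
  have : ∀ L : List (ℕ × 𝔥), (L.map fun c => modeV B (-(c.1 : ℤ) - 1) c.2).prod 1 =
      (L.map fun c => TensorAlgebra.ι ℂ (DirectSum.lof ℂ ℕ (fun _ => 𝔥) c.1 c.2)).prod := by
    intro L
    induction L with
    | nil => simp
    | cons c L ih =>
      have hc : -(c.1 : ℤ) - 1 = Int.negSucc c.1 := by
        rw [Int.negSucc_eq]
        ring
      simp only [List.map_cons, List.prod_cons, Module.End.mul_apply, ih]
      rw [hc]
      rfl
  rw [TensorAlgebra.tprod_apply]
  simpa [word, List.map_ofFn, Function.comp_def] using this (List.ofFn fun i => (m i, a i))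

variable {X : Type v} [AddCommGroup X] [Module ℂ X]

/-- The linear extension to `V` of
`h₁(-m₁-1/2) ⋯ hᵣ(-mᵣ-1/2) 𝟏 ↦ :h₁^(m₁)(x) ⋯ hᵣ^(mᵣ)(x):` (see `vop_word`). -/
def vop (S : ModeSystem 𝔥 X) (B : LinearMap.BilinForm ℂ 𝔥) :
    FockV 𝔥 →ₗ[ℂ] X →ₗ[ℂ] (ℚ → X) :=
  (DirectSum.toModule ℂ ℕ _ fun r => PiTensorProduct.lift
    ((DFinsupp.lsum ℂ fun _ : Fin r → ℕ => LinearMap.id).compMultilinearMap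
      (MultilinearMap.dfinsuppFamily fun m : Fin r → ℕ => fieldProd S B m))) ∘ₗ
    (TensorAlgebra.toDirectSum (R := ℂ) (M := ⨁ _ : ℕ, 𝔥)).toLinearMap

theorem vop_word (S : ModeSystem 𝔥 X) (B : LinearMap.BilinForm ℂ 𝔥) {r : ℕ} (a : Fin r → 𝔥)
    (m : Fin r → ℕ) (x : X) (q : ℚ) : vop S B (word B a m) x q =
      ∑ᶠ n : Fin r → ℤ, if ∑ i, fexp S (m i) (n i) = q then
        (∏ i, fcoef S (m i) (n i)) • nord S B n a x else 0 := by
  have h1 : vop S B (word B a m) = fieldProd S B m a := by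
    rw [word_eq, vop, LinearMap.comp_apply, AlgHom.toLinearMap_apply,
      TensorAlgebra.toDirectSum_tensorPower_tprod]
    erw [DirectSum.toModule_lof]
    rw [PiTensorProduct.lift.tprod]
    have := MultilinearMap.dfinsuppFamily_single (R := ℂ)
      (N := fun _ => X →ₗ[ℂ] (ℚ → X)) (κ := fun _ : Fin r => ℕ)
      (M := fun _ _ => 𝔥) (fun m : Fin r → ℕ => fieldProd S B m) m a
    rw [LinearMap.compMultilinearMap_apply]
    erw [this]
    rw [DFinsupp.lsum_single]
    rfl
  rw [h1]
  rfl

/-- The vertex operator of `V`: `opYV B u v p` is the coefficient of `x^p` in `Y_V(u, x) v`, where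
`Y_V(h₁(-m₁-1/2) ⋯ hᵣ(-mᵣ-1/2) 𝟏, x) = :h₁^(m₁)(x) ⋯ hᵣ^(mᵣ)(x):`. -/
def opYV (B : LinearMap.BilinForm ℂ 𝔥) (u v : FockV 𝔥) (p : ℚ) : FockV 𝔥 :=
  vop (modesV B) B u v p

/-! ### The operator `exp(Δ(x))` -/

/-- `C_{mn} = (1/2) (m - n)/(m + n + 1) binom(-1/2, m) binom(-1/2, n)`. -/
def cNum (m n : ℕ) : ℂ :=
  1 / 2 * (((m : ℂ) - n) / ((m : ℂ) + n + 1)) * binom (-1 / 2) m * binom (-1 / 2) n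

/-- `Δ(x) = ∑_{i} ∑_{m, n ≥ 0} C_{mn} e_i(m+1/2) ē_i(n+1/2) x^(-m-n-1)`, as a power series in the
variable `x⁻¹`. -/
def deltaSeries (B : LinearMap.BilinForm ℂ 𝔥) {M : ℕ} (e e' : Fin M → 𝔥) :
    PowerSeries (Module.End ℂ (FockV 𝔥)) :=
  PowerSeries.mk fun
    | 0 => 0
    | d + 1 => ∑ mn ∈ Finset.HasAntidiagonal.antidiagonal d, ∑ i : Fin M,
        cNum mn.1 mn.2 • (modeV B mn.1 (e i) * modeV B mn.2 (e' i))

/-- The coefficient of `x^(-d)` in `exp(Δ(x)) = ∑_j Δ(x)^j / j!`; the terms with `j > d` do not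
contribute since `Δ(x)` has no constant term. -/
def expDelta (B : LinearMap.BilinForm ℂ 𝔥) {M : ℕ} (e e' : Fin M → 𝔥) (d : ℕ) :
    Module.End ℂ (FockV 𝔥) :=
  ∑ j ∈ Finset.range (d + 1),
    ((j.factorial : ℂ))⁻¹ • PowerSeries.coeff d (deltaSeries B e e' ^ j)

end AlgebraV

/-! ### The space `W` -/

section SpaceW

variable {𝔥 : Type u} [AddCommGroup 𝔥] [Module ℂ 𝔥]

/-- The tensor algebra of `𝔥 ⊗ ℂ[t, t⁻¹] ⊕ ℂ 𝐤`, where `𝔥 ⊗ ℂ[t, t⁻¹]` is written as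
`ℤ →₀ 𝔥`. -/
abbrev TensorAff (𝔥 : Type u) [AddCommGroup 𝔥] [Module ℂ 𝔥] : Type u :=
  TensorAlgebra ℂ ((ℤ →₀ 𝔥) × ℂ)

/-- The generator `a ⊗ t^m`. -/
def gen (m : ℤ) : 𝔥 →ₗ[ℂ] TensorAff 𝔥 :=
  TensorAlgebra.ι ℂ ∘ₗ LinearMap.inl ℂ (ℤ →₀ 𝔥) ℂ ∘ₗ Finsupp.lsingle m

/-- The generator `𝐤`. -/
def genK (𝔥 : Type u) [AddCommGroup 𝔥] [Module ℂ 𝔥] : TensorAff 𝔥 :=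
  TensorAlgebra.ι ℂ ((0, 1) : (ℤ →₀ 𝔥) × ℂ)

/-- The defining relations of the algebra `N`. There are no relations between two positive, two
negative or two zero modes. -/
inductive NRel (B : LinearMap.BilinForm ℂ 𝔥) : TensorAff 𝔥 → TensorAff 𝔥 → Prop
  | pos_neg (m n : ℤ) (a b : 𝔥) (hm : 0 < m) (hn : n < 0) :
      NRel B (gen m a * gen n b + gen n b * gen m a) ((if m + n = 0 then B a b else 0) • genK 𝔥)
  | nonzero_zero (p : ℤ) (a b : 𝔥) (hp : p ≠ 0) : NRel B (gen p a * gen 0 b + gen 0 b * gen p a) 0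
  | central (q : ℤ) (a : 𝔥) : NRel B (gen q a * genK 𝔥) (genK 𝔥 * gen q a)

/-- The algebra `N`. -/
def AlgN (B : LinearMap.BilinForm ℂ 𝔥) : Type u := RingQuot (NRel B)

instance (B : LinearMap.BilinForm ℂ 𝔥) : Ring (AlgN B) := inferInstanceAs (Ring (RingQuot (NRel B)))

instance (B : LinearMap.BilinForm ℂ 𝔥) : Algebra ℂ (AlgN B) :=
  inferInstanceAs (Algebra ℂ (RingQuot (NRel B)))

/-- The quotient map onto `N`. -/
def mkN (B : LinearMap.BilinForm ℂ 𝔥) : TensorAff 𝔥 →ₐ[ℂ] AlgN B := RingQuot.mkAlgHom ℂ (NRel B)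

theorem mkN_surjective (B : LinearMap.BilinForm ℂ 𝔥) : Function.Surjective (mkN B) :=
  RingQuot.mkAlgHom_surjective ℂ (NRel B)

theorem mkN_rel {B : LinearMap.BilinForm ℂ 𝔥} {x y : TensorAff 𝔥} (h : NRel B x y) :
    mkN B x = mkN B y := RingQuot.mkAlgHom_rel ℂ h

/-- The class of `a ⊗ t^m` in `N`. -/
def nGen (B : LinearMap.BilinForm ℂ 𝔥) (m : ℤ) : 𝔥 →ₗ[ℂ] AlgN B :=
  (mkN B).toLinearMap ∘ₗ gen m

/-- The class of `𝐤` in `N`. -/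
def nK (B : LinearMap.BilinForm ℂ 𝔥) : AlgN B := mkN B (genK 𝔥)

variable (B : LinearMap.BilinForm ℂ 𝔥) (U : Type v) [AddCommGroup U] [Module ℂ U]
  [Module (TensorAlgebra ℂ 𝔥) U]

/-- The relations `n a(m) ⊗ u = 0` (`m > 0`), `n a(0) ⊗ u = n ⊗ a u`, `n 𝐤 ⊗ u = n ⊗ u` that define
the tensor product of `N` and `U` over the subalgebra of `N` generated by the positive modes, the
zero modes and `𝐤`. -/
def inducedRel : Submodule (AlgN B) (AlgN B ⊗[ℂ] U) :=
  Submodule.span (AlgN B)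
    ({z | ∃ (m : ℤ) (a : 𝔥) (u : U), 0 < m ∧ z = nGen B m a ⊗ₜ[ℂ] u} ∪
      {z | ∃ (a : 𝔥) (u : U), z = nGen B 0 a ⊗ₜ[ℂ] u - 1 ⊗ₜ[ℂ] (TensorAlgebra.ι ℂ a • u)} ∪
      {z | ∃ u : U, z = nK B ⊗ₜ[ℂ] u - 1 ⊗ₜ[ℂ] u})

/-- The induced module `W`. -/
abbrev SpaceW : Type (max u v) := (AlgN B ⊗[ℂ] U) ⧸ inducedRel B U

variable {U} in
/-- The vector `u ∈ U ⊆ W`. -/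
def ofU (u : U) : SpaceW B U := (inducedRel B U).mkQ (1 ⊗ₜ[ℂ] u)

/-- The mode `a(n)` on `W`. -/
def modeW (n : ℤ) : 𝔥 →ₗ[ℂ] Module.End ℂ (SpaceW B U) :=
  (Algebra.lsmul ℂ ℂ (SpaceW B U)).toLinearMap ∘ₗ nGen B n

theorem modeW_apply (n : ℤ) (a : 𝔥) (w : SpaceW B U) : modeW B U n a w = nGen B n a • w := rfl

theorem nK_central (x : AlgN B) : x * nK B = nK B * x := by
  obtain ⟨t, rfl⟩ := mkN_surjective B x
  induction t using TensorAlgebra.induction with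
  | algebraMap c =>
    rw [AlgHom.commutes]
    exact Algebra.commutes c _
  | ι v =>
    obtain ⟨f, c⟩ := v
    induction f using Finsupp.induction_linear with
    | zero =>
      have : ((0 : ℤ →₀ 𝔥), c) = c • (0, 1) := by ext <;> simp
      rw [this, map_smul, map_smul]
      simp [nK, genK]
    | add f g hf hg =>
      have : (f + g, c) = (f, c) + (g, c) - (0, c) := by ext <;> simp
      have h0 : ((0 : ℤ →₀ 𝔥), c) = c • (0, 1) := by ext <;> simp
      rw [this, map_sub, map_sub, map_add, map_add, sub_mul, mul_sub, add_mul, mul_add, hf, hg, h0,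
        map_smul, map_smul]
      simp [nK, genK]
    | single q a =>
      have : (Finsupp.single q a, c) = (Finsupp.single q a, (0 : ℂ)) + c • ((0 : ℤ →₀ 𝔥), 1) := by
        ext <;> simp
      rw [this, map_add, map_add, add_mul, mul_add, map_smul, map_smul]
      congr 1
      · have := mkN_rel (NRel.central (B := B) q a)
        rw [map_mul, map_mul] at this
        exact this
      · simp [nK, genK]
  | mul a b ha hb => rw [map_mul, mul_assoc, hb, ← mul_assoc, ha, mul_assoc]
  | add a b ha hb => rw [map_add, add_mul, mul_add, ha, hb]

theorem nK_smul (w : SpaceW B U) : nK B • w = w := by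
  obtain ⟨t, rfl⟩ := Submodule.mkQ_surjective _ w
  rw [← map_smul]
  induction t using TensorProduct.induction_on with
  | zero => simp
  | add x y hx hy => rw [smul_add, map_add, map_add, hx, hy]
  | tmul x u =>
    have h : nK B • (x ⊗ₜ[ℂ] u) - x ⊗ₜ[ℂ] u = x • (nK B ⊗ₜ[ℂ] u - 1 ⊗ₜ[ℂ] u) := by
      rw [smul_sub, TensorProduct.smul_tmul', TensorProduct.smul_tmul', TensorProduct.smul_tmul',
        smul_eq_mul, smul_eq_mul, smul_eq_mul, mul_one, nK_central]
    rw [← sub_eq_zero, ← map_sub, h, Submodule.mkQ_apply, Submodule.Quotient.mk_eq_zero]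
    exact Submodule.smul_mem _ _ (Submodule.subset_span (Or.inr ⟨u, rfl⟩))

/-- `{a(m), b(n)} = (a, b) δ_{m+n,0}` on `W` for `m > 0 > n`. -/
theorem modeW_pos_neg (m n : ℤ) (a b : 𝔥) (hm : 0 < m) (hn : n < 0) :
    modeW B U m a * modeW B U n b + modeW B U n b * modeW B U m a =
      (if m + n = 0 then B a b else 0) • (1 : Module.End ℂ (SpaceW B U)) := by
  have h := mkN_rel (NRel.pos_neg (B := B) m n a b hm hn)
  rw [map_add, map_mul, map_mul, map_smul] at h
  have h' := congrArg (Algebra.lsmul ℂ ℂ (SpaceW B U)) h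
  rw [map_add, map_mul, map_mul, map_smul] at h'
  refine h'.trans ?_
  congr 1
  exact LinearMap.ext fun w => nK_smul B U w

/-- `{a(p), b(0)} = 0` on `W` for `p ≠ 0`. -/
theorem modeW_nonzero_zero (p : ℤ) (a b : 𝔥) (hp : p ≠ 0) :
    modeW B U p a * modeW B U 0 b + modeW B U 0 b * modeW B U p a = 0 := by
  have h := mkN_rel (NRel.nonzero_zero (B := B) p a b hp)
  rw [map_add, map_mul, map_mul, map_zero] at h
  have h' := congrArg (Algebra.lsmul ℂ ℂ (SpaceW B U)) h
  rw [map_add, map_mul, map_mul, map_zero] at h'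
  exact h'

theorem modeW_ofU (m : ℤ) (a : 𝔥) (u : U) (hm : 0 < m) : modeW B U m a (ofU B u) = 0 := by
  rw [modeW_apply, ofU, ← map_smul, Submodule.mkQ_apply, Submodule.Quotient.mk_eq_zero]
  refine Submodule.subset_span (Or.inl (Or.inl ⟨m, a, u, hm, ?_⟩))
  rw [TensorProduct.smul_tmul', smul_eq_mul, mul_one]

theorem modeW_truncated (w : SpaceW B U) : ∃ D : ℚ, TruncAt (modeW B U) 0 D w := by
  have hadd : ∀ x y : SpaceW B U, (∃ D : ℚ, TruncAt (modeW B U) 0 D x) →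
      (∃ D : ℚ, TruncAt (modeW B U) 0 D y) → ∃ D : ℚ, TruncAt (modeW B U) 0 D (x + y) := by
    rintro x y ⟨D, hD⟩ ⟨E, hE⟩
    exact ⟨max D E, (hD.mono (le_max_left _ _)).add (hE.mono (le_max_right _ _))⟩
  have hN : ∀ (t : TensorAff 𝔥) (w : SpaceW B U), (∃ D : ℚ, TruncAt (modeW B U) 0 D w) →
      ∃ D : ℚ, TruncAt (modeW B U) 0 D (mkN B t • w) := by
    intro t
    induction t using TensorAlgebra.induction with
    | algebraMap c =>
      rintro w ⟨D, hD⟩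
      rw [AlgHom.commutes, algebraMap_smul]
      exact ⟨D, hD.smul c⟩
    | mul a b ha hb =>
      intro w hw
      rw [map_mul, mul_smul]
      exact ha _ (hb w hw)
    | add a b ha hb =>
      intro w hw
      rw [map_add, add_smul]
      exact hadd _ _ (ha w hw) (hb w hw)
    | ι v =>
      rintro w ⟨D, hD⟩
      obtain ⟨f, c⟩ := v
      have h0 : (f, c) = (f, (0 : ℂ)) + c • ((0 : ℤ →₀ 𝔥), 1) := by ext <;> simp
      rw [h0, map_add, map_add, add_smul]
      refine hadd _ _ ?_ ⟨D, ?_⟩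
      · induction f using Finsupp.induction_linear with
        | zero =>
          refine ⟨0, fun L _ _ => ?_⟩
          have : ((0 : ℤ →₀ 𝔥), (0 : ℂ)) = 0 := rfl
          simp [this]
        | add f g hf hg =>
          have : (f + g, (0 : ℂ)) = (f, 0) + (g, 0) := by ext <;> simp
          rw [this, map_add, map_add, add_smul]
          exact hadd _ _ (hf (by ext <;> simp)) (hg (by ext <;> simp))
        | single n b =>
          change ∃ D : ℚ, TruncAt (modeW B U) 0 D (modeW B U n b w)
          rcases lt_trichotomy n 0 with hn | rfl | hn
          · refine ⟨D + -(n : ℚ), TruncAt.move _ (by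
              have : (n : ℚ) < 0 := by exact_mod_cast hn
              linarith) (fun p a hp => ?_) hD⟩
            have hp' : 0 < p := by simpa using hp
            refine ⟨if p + n = 0 then B a b else 0, fun h => ?_, modeW_pos_neg B U p n a b hp' hn⟩
            have : p + n = 0 := by
              by_contra hne
              simp [hne] at h
            have : (p : ℚ) + n = 0 := by exact_mod_cast this
            linarith
          · refine ⟨D + 0, TruncAt.move _ le_rfl (fun p a hp => ⟨0, fun h => absurd rfl h, ?_⟩) hD⟩
            have hp' : 0 < p := by simpa using hp
            rw [zero_smul]
            exact modeW_nonzero_zero B U p a b hp'.ne'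
          · exact ⟨_, hD.pos n b (by simpa using hn)⟩
      · rw [map_smul, map_smul, smul_assoc]
        refine TruncAt.smul ?_ c
        have := nK_smul B U w
        rw [nK, genK] at this
        rwa [this]
  obtain ⟨t, rfl⟩ := Submodule.mkQ_surjective _ w
  induction t using TensorProduct.induction_on with
  | zero => exact ⟨0, fun L _ _ => by simp⟩
  | add x y hx hy =>
    rw [map_add]
    exact hadd _ _ hx hy
  | tmul x u =>
    obtain ⟨t, rfl⟩ := mkN_surjective B x
    have := hN t (ofU B u) ⟨0, TruncAt.vacuum fun p a hp => modeW_ofU B U p a u (by simpa using hp)⟩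
    rwa [ofU, ← map_smul, TensorProduct.smul_tmul', smul_eq_mul, mul_one] at this

/-- The modes of `W`. -/
def modesW : ModeSystem 𝔥 (SpaceW B U) where
  shift := 0
  mode := modeW B U
  pos_zero p z a b hp hz := by
    have hp' : 0 < p := by simpa using hp
    obtain rfl : z = 0 := by simpa using hz
    exact eq_neg_of_add_eq_zero_left (modeW_nonzero_zero B U p a b hp'.ne')
  truncated := modeW_truncated B U

variable {U}

/-- The actual vertex operator `Y_W(u, x) = Ȳ_W(exp(Δ(x)) u, x)`: `opYW B e e' u w q` is the
coefficient of `x^q` in `Y_W(u, x) w`. Here `vop (modesW B U) B` is the naive vertex operator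
`Ȳ_W`. The sum is finite because `exp(Δ(x)) u` is a polynomial in `x⁻¹`. -/
def opYW {M : ℕ} (e e' : Fin M → 𝔥) (x : FockV 𝔥) (w : SpaceW B U) (q : ℚ) : SpaceW B U :=
  ∑ᶠ d : ℕ, vop (modesW B U) B (expDelta B e e' d x) w (q + d)

end SpaceW

/-! ### Algebraic functions and their expansions -/

/-- Finite linear combinations of `x₁^α y^β (x₁ - y)^γ`, `α β ∈ ℚ`, `γ ∈ ℤ`. -/
abbrev AlgFun : Type := AddMonoidAlgebra ℂ (ℚ × ℚ × ℤ)

/-- `c x₁^α y^β (x₁ - y)^γ`. -/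
def AlgFun.mono (α β : ℚ) (γ : ℤ) (c : ℂ) : AlgFun := AddMonoidAlgebra.single (α, β, γ) c

/-- `∂/∂x₁`. -/
def AlgFun.d1 (A : AlgFun) : AlgFun :=
  A.coeff.sum fun t c => .mono (t.1 - 1) t.2.1 t.2.2 (c * t.1) +
    .mono t.1 t.2.1 (t.2.2 - 1) (c * t.2.2)

/-- `∂/∂y`. -/
def AlgFun.d2 (A : AlgFun) : AlgFun :=
  A.coeff.sum fun t c => .mono t.1 (t.2.1 - 1) t.2.2 (c * t.2.1) -
    .mono t.1 t.2.1 (t.2.2 - 1) (c * t.2.2)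

/-- `g(x₁, y) = (1/2) x₁^(-1/2) y^(-1/2) (x₁ + y) (x₁ - y)⁻¹`. -/
def gFun : AlgFun :=
  .mono (-1 / 2) (-1 / 2) 0 (1 / 2) * (.mono 1 0 0 1 + .mono 0 1 0 1) * .mono 0 0 (-1) 1

/-- `g_{mn} = (1/(m! n!)) ∂^(m+n) g / ∂x₁^m ∂y^n`. -/
def gDer (m n : ℕ) : AlgFun :=
  ((m.factorial : ℂ) * n.factorial)⁻¹ • AlgFun.d1^[m] (AlgFun.d2^[n] gFun)

/-- The two expansions: `xy` is `ι_{xy}` (nonnegative powers of `y` in the expansion of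
`(x + y)^α`), `yx` is `ι_{yx}` (nonnegative powers of `x`). -/
inductive Expansion
  | xy
  | yx

/-- The coefficient of `x^p y^q` in the expansion of `(x + y)^α y^β x^γ`. -/
def iotaMono (R : Expansion) (α β : ℚ) (γ : ℤ) (p q : ℚ) : ℂ :=
  match R with
  | .xy => ∑ᶠ i : ℕ, if p = γ + α - i ∧ q = β + i then binom α i else 0
  | .yx => ∑ᶠ i : ℕ, if p = γ + i ∧ q = β + α - i then binom α i else 0

/-- The coefficient of `x^p y^q` in the expansion of `A(x + y, y)`; note `x₁ - y = x`. -/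
def iota (R : Expansion) (A : AlgFun) (p q : ℚ) : ℂ :=
  A.coeff.sum fun t c => c * iotaMono R t.1 t.2.1 t.2.2 p q

section Series

variable {X : Type v} [AddCommGroup X] [Module ℂ X]

/-- The product of a scalar and a vector-valued series in `x`, `y`, given by their coefficients. -/
def mulSer (s : ℚ → ℚ → ℂ) (F : ℚ → ℚ → X) (p q : ℚ) : X :=
  ∑ᶠ c : ℚ × ℚ, s c.1 c.2 • F (p - c.1) (q - c.2)

/-- The series `F(x + y, y)` for a series `F(x₁, y)`: every `x₁^α y^β` is replaced by the expansion
of `(x + y)^α y^β`. -/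
def substSer (R : Expansion) (F : ℚ → ℚ → X) (p q : ℚ) : X :=
  ∑ᶠ c : ℚ × ℚ, iotaMono R c.1 c.2 0 p q • F c.1 c.2

variable {𝔥 : Type u} [AddCommGroup 𝔥] [Module ℂ 𝔥]

/-- The coefficient of `x₁^α y^β` in
`:a₁^(m₁)(x₁) ⋯ aᵣ^(mᵣ)(x₁) b₁^(n₁)(y) ⋯ bₛ^(nₛ)(y): w`. -/
def nordTwo (S : ModeSystem 𝔥 X) (B : LinearMap.BilinForm ℂ 𝔥) {r s : ℕ} (a : Fin r → 𝔥)
    (m : Fin r → ℕ) (b : Fin s → 𝔥) (n : Fin s → ℕ) (w : X) (α β : ℚ) : X :=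
  ∑ᶠ k : (Fin r → ℤ) × (Fin s → ℤ),
    if ∑ i, fexp S (m i) (k.1 i) = α ∧ ∑ j, fexp S (n j) (k.2 j) = β then
      ((∏ i, fcoef S (m i) (k.1 i)) * ∏ j, fcoef S (n j) (k.2 j)) •
        nord S B (Fin.append k.1 k.2) (Fin.append a b) w
    else 0

end Series

/-! ### The two sides of the formula -/

/-- The total contraction number with contractions `β i j`:
`T(i₁, …, i_{2t}) = ∑_{k=2}^{2t} (-1)^k β i₁ iₖ T(î₁, i₂, …, îₖ, …, i_{2t})`, `T() = 1`. -/
def contrNum {ι : Type} (β : ι → ι → ℂ) : List ι → ℂ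
  | [] => 1
  | a :: L => ∑ k : Fin L.length, (-1 : ℂ) ^ (k : ℕ) * β a L[k] * contrNum β (L.eraseIdx k)
termination_by L => L.length
decreasing_by
  simp only [List.length_cons, List.length_eraseIdx]
  split <;> omega

/-- The complementary increasing sequence. -/
def complSeq {k r : ℕ} (p : Fin k ↪o Fin r) : Fin (r - k) ↪o Fin r :=
  (Finset.univ.map p.toEmbedding)ᶜ.orderEmbOfFin (by simp [Finset.card_compl])

/-- `p₁ + ⋯ + pₖ`, the entries being counted from `1`. -/
def seqSum {k r : ℕ} (p : Fin k ↪o Fin r) : ℕ := ∑ α, ((p α : ℕ) + 1)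

section Sides

variable {𝔥 : Type u} [AddCommGroup 𝔥] [Module ℂ 𝔥] (B : LinearMap.BilinForm ℂ 𝔥)
  {U : Type v} [AddCommGroup U] [Module ℂ U]
  [Module (TensorAlgebra ℂ 𝔥) U]

/-- The number `T_{a₁,…,aᵣ}^{m₁,…,mᵣ}(p₁, …, pₖ)`. -/
def tNum {r k : ℕ} (a : Fin r → 𝔥) (m : Fin r → ℕ) (p : Fin k ↪o Fin r) : ℂ :=
  contrNum (fun i j => B (a i) (a j) * cNum (m i) (m j)) (List.ofFn p)

/-- The scalar algebraic function of the summand with indices `p`, `q`, `i`, `j`, in the variables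
`x₁` and `y`; `i`, `j` select from the complementary sequences `p^c`, `q^c`. -/
def scalarFun {r s k l ρ : ℕ} (a : Fin r → 𝔥) (m : Fin r → ℕ) (b : Fin s → 𝔥) (n : Fin s → ℕ)
    (p : Fin (2 * k) ↪o Fin r) (q : Fin (2 * l) ↪o Fin s)
    (i : Fin ρ ↪o Fin (r - 2 * k)) (j : Fin ρ ↪o Fin (s - 2 * l)) : AlgFun :=
  .mono (-(∑ α, (m (p α) : ℚ)) - k) 0 0 ((-1) ^ seqSum p * tNum B a m p) *
  .mono 0 (-(∑ α, (n (q α) : ℚ)) - l) 0 ((-1) ^ seqSum q * tNum B b n q) *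
  ((-1 : ℂ) ^ (seqSum i + seqSum j + (r - 2 * k) * ρ + ρ * (ρ + 1) / 2) •
    (Matrix.of fun α β : Fin ρ =>
      B (a (complSeq p (i α))) (b (complSeq q (j β))) •
        gDer (m (complSeq p (i α))) (n (complSeq q (j β)))).det)

/-- The right-hand side of the formula, applied to `w`, with the expansion `R` of the functions and
fields of `x + y`. -/
def wickSide (R : Expansion) {r s : ℕ} (a : Fin r → 𝔥) (m : Fin r → ℕ) (b : Fin s → 𝔥)
    (n : Fin s → ℕ) (w : SpaceW B U) : ℚ → ℚ → SpaceW B U :=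
  ∑ k ∈ Finset.range (r + 1), ∑ p : Fin (2 * k) ↪o Fin r,
  ∑ l ∈ Finset.range (s + 1), ∑ q : Fin (2 * l) ↪o Fin s,
  ∑ ρ ∈ Finset.range (min (r - 2 * k) (s - 2 * l) + 1),
  ∑ i : Fin ρ ↪o Fin (r - 2 * k), ∑ j : Fin ρ ↪o Fin (s - 2 * l),
    mulSer (iota R (scalarFun B a m b n p q i j))
      (substSer R (nordTwo (modesW B U) B
        (fun α => a (complSeq p (complSeq i α))) (fun α => m (complSeq p (complSeq i α)))
        (fun β => b (complSeq q (complSeq j β))) (fun β => n (complSeq q (complSeq j β))) w))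

/-- The coefficients of `x^p y^q` in `Y_W(Y_V(u, x) v, y) w`. -/
def iterateSide {M : ℕ} (e e' : Fin M → 𝔥) (x y : FockV 𝔥) (w : SpaceW B U) (p q : ℚ) :
    SpaceW B U :=
  opYW B e e' (opYV B x y p) w q

/-- The coefficients of `x^p y^q` in `Y_W(u, x + y) Y_W(v, y) w`, where the powers of `x + y` are
expanded in nonnegative powers of `y`. -/
def productSide {M : ℕ} (e e' : Fin M → 𝔥) (x y : FockV 𝔥) (w : SpaceW B U) :
    ℚ → ℚ → SpaceW B U :=
  substSer .xy fun α β => opYW B e e' x (opYW B e e' y w β) α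

end Sides

end TwistedFermion

/-! The whole statement is Wick's theorem, organised as an algebra of contractions on words. For a
functional `F` of words, `wick β F` sums `F` over all partial contractions of a word, a contracted
pair having the value `β`. Up to transposition this is the exponential of a quadratic expression in
anticommuting antiderivations. Hence `wick β (wick γ F) = wick (β + γ) F` (`wick_wick`), and `wick
β` commutes with every further contraction (`wick_contract`). Four operations become such sums: the
normal ordering of modes (`nord_eq_nordList`), the product of two normally ordered products
(`nordList_mul`), the action of `exp(Δ(x))` on a word (`expDelta_wordL`), and the passage from modes
to fields, which merely replaces contractions of modes by their generating series (`modeSum_wick`).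

Each side of the formula, paired with a linear functional on `W`, is therefore `wick` of the
normally ordered fields, and only the value of a single contraction has to be computed. The common
target is `twistContr`: `-C_{mm'} (a,a') (x+y)^(-m-m'-1)` for two fields at `x+y`, the same with `y`
for two fields at `y`, and `(a,b) g_{mn}(x+y,y)` for a mixed pair.

In the product, the contractions inside `A` and inside `B` come from the two factors `exp Δ`. The
mixed ones come from moving positive modes past negative ones, together with one half of the zero
mode term. Their sum telescopes to the expansion of `g_{mn}` in nonnegative powers of `y`
(`tends_gDer_xy`).

In the iterate, `exp Δ` acts after `Y_V(A,x)B` has been formed, so it also contracts `A` with `B`.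
The polar contraction in `V` plus these contributions is the other expansion of the same `g_{mn}`
(`tends_gDer_yx`); here the precise value of `C_{mn}` enters. Two letters of `A` give a Taylor
series that sums to a power of `x+y` (`tends_cNum_yx`), and an uncontracted field at `x` becomes the
Taylor expansion of the field at `x+y` (`tends_field_yx`).

The explicit expression of the statement is the same Wick sum written out. Contractions inside `A`
or `B` give the numbers `T`, mixed contractions give determinants, and the signs are those of
shuffles (`wick_ofFn`, `wick_cross_ofFn`, `wickSide_coeff`).

Convergence is handled with Hahn series. An exponent records the power of the small variable and the
total power. A limit (`Tends`) means that every coefficient is eventually constant and that all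
supports lie in one partially well-ordered set; this makes limits compatible with products and with
Wick sums. Identities between vectors are tested on all linear functionals.

For the last assertion, the two expansions agree on `(x+y)^n y^β x^γ` with `n` a natural number, so
it suffices to count denominators (`SameAfter`). A letter `a(-m-1/2)` of `A` costs `m + 1/2`,
whether it is contracted or not, and the modes that survive on `w` cost at most the degree of `w`.
-/

namespace TwistedFermion

universe u v w

/-! ### Contractions of functionals on words -/

section Words

variable {ι κ K M M' : Type*} [CommRing K] [AddCommGroup M] [Module K M] [AddCommGroup M']
  [Module K M']

/-- The transpose of the antiderivation of the tensor algebra that extends the functional `f`: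
`a₁ ⋯ aₖ ↦ ∑ᵢ (-1)^(i-1) f(aᵢ) F(a₁ ⋯ âᵢ ⋯ aₖ)`. -/
def contract (f : ι → K) : (List ι → M) → List ι → M
  | _, [] => 0
  | F, b :: L => f b • F L - contract f (fun l => F (b :: l)) L

@[simp] theorem contract_nil (f : ι → K) (F : List ι → M) : contract f F [] = 0 := rfl

theorem contract_cons (f : ι → K) (F : List ι → M) (b : ι) (L : List ι) :
    contract f F (b :: L) = f b • F L - contract f (fun l => F (b :: l)) L := rfl

theorem contract_congr {f g : ι → K} {F G : List ι → M} {L : List ι} (hfg : ∀ a ∈ L, f a = g a)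
    (h : ∀ l, l.Sublist L → l.length + 1 = L.length → F l = G l) :
    contract f F L = contract g G L := by
  induction L generalizing F G with
  | nil => rfl
  | cons b L ih =>
    rw [contract_cons, contract_cons, hfg b (by simp), h L (List.sublist_cons_self b L) (by simp),
      ih (fun a ha => hfg a (by simp [ha]))
        fun l hl hl' => h _ (hl.cons_cons b) (by simp [hl'])]

theorem contract_add (f : ι → K) (F G : List ι → M) (L : List ι) :
    contract f (fun l => F l + G l) L = contract f F L + contract f G L := by
  induction L generalizing F G with
  | nil => simp
  | cons b L ih => simp only [contract_cons, ih, smul_add]; abel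

theorem contract_zero (f : ι → K) (L : List ι) : contract f (fun _ => (0 : M)) L = 0 := by
  induction L with
  | nil => rfl
  | cons b L ih => rw [contract_cons, ih]; simp

theorem contract_sum {σ : Type*} (T : Finset σ) (f : ι → K) (F : σ → List ι → M) (L : List ι) :
    contract f (fun l => ∑ t ∈ T, F t l) L = ∑ t ∈ T, contract f (F t) L := by
  classical
  induction T using Finset.induction_on with
  | empty => simpa using contract_zero f L
  | insert a T ha ih => simp only [Finset.sum_insert ha, contract_add, ih]

theorem contract_map {K' : Type*} [CommRing K'] {N : Type*} [AddCommGroup N] [Module K' N]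
    (T : M →+ N) (f : ι → K) (g : ι → K') (h : ∀ a x, T (f a • x) = g a • T x)
    (F : List ι → M) (L : List ι) : contract g (fun l => T (F l)) L = T (contract f F L) := by
  induction L generalizing F with
  | nil => simp
  | cons b L ih => simp only [contract_cons, ih, map_sub, h]

theorem contract_linear (T : M →ₗ[K] M') (f : ι → K) (F : List ι → M) (L : List ι) :
    contract f (fun l => T (F l)) L = T (contract f F L) :=
  contract_map T.toAddMonoidHom f f (fun _ _ => map_smul T _ _) F L

theorem contract_smul (f : ι → K) (c : K) (F : List ι → M) (L : List ι) :
    contract f (fun l => c • F l) L = c • contract f F L :=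
  contract_linear (LinearMap.lsmul K M c) f F L

theorem contract_neg (f : ι → K) (F : List ι → M) (L : List ι) :
    contract f (fun l => -F l) L = -contract f F L :=
  contract_linear (-LinearMap.id) f F L

theorem contract_sub (f : ι → K) (F G : List ι → M) (L : List ι) :
    contract f (fun l => F l - G l) L = contract f F L - contract f G L := by
  simp only [sub_eq_add_neg, contract_add, contract_neg]

theorem contract_add_left (f g : ι → K) (F : List ι → M) (L : List ι) :
    contract (fun a => f a + g a) F L = contract f F L + contract g F L := by
  induction L generalizing F with
  | nil => simp
  | cons b L ih => simp only [contract_cons, ih, add_smul]; abel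

theorem contract_smul_left (c : K) (f : ι → K) (F : List ι → M) (L : List ι) :
    contract (fun a => c * f a) F L = c • contract f F L := by
  induction L generalizing F with
  | nil => simp
  | cons b L ih => simp only [contract_cons, ih, mul_smul, smul_sub]

theorem contract_sum_left {σ : Type*} (T : Finset σ) (f : σ → ι → K) (F : List ι → M)
    (L : List ι) : contract (fun a => ∑ t ∈ T, f t a) F L = ∑ t ∈ T, contract (f t) F L := by
  induction L generalizing F with
  | nil => simp
  | cons b L ih => simp only [contract_cons, ih, Finset.sum_smul, Finset.sum_sub_distrib]

theorem contract_eq_zero {f : ι → K} {L : List ι} (h : ∀ a ∈ L, f a = 0) (F : List ι → M) :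
    contract f F L = 0 := by
  induction L generalizing F with
  | nil => rfl
  | cons b L ih =>
    rw [contract_cons, h b (by simp), ih fun a ha => h a (by simp [ha])]; simp

/-- When two letters are deleted in the other order, the position of the later one changes by one,
so the sign changes. -/
theorem contract_contract (f g : ι → K) (F : List ι → M) (L : List ι) :
    contract f (contract g F) L = -contract g (contract f F) L := by
  induction L generalizing F with
  | nil => simp
  | cons b L ih =>
    simp only [contract_cons, contract_sub, contract_smul]
    rw [ih]
    abel

theorem contract_append (f : ι → K) (F : List ι → M) (L L' : List ι) :
    contract f F (L ++ L') = contract f (fun l => F (l ++ L')) L +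
      (-1 : K) ^ L.length • contract f (fun l => F (L ++ l)) L' := by
  induction L generalizing F with
  | nil => simp
  | cons b L ih =>
    simp only [List.cons_append, contract_cons, ih, List.length_cons, pow_succ, mul_smul]
    simp only [neg_smul, one_smul, smul_neg]
    abel

theorem contract_comap (e : κ → ι) (f : ι → K) (F : List ι → M) (L : List κ) :
    contract f F (L.map e) = contract (fun a => f (e a)) (fun l => F (l.map e)) L := by
  induction L generalizing F with
  | nil => rfl
  | cons b L ih => simp only [List.map_cons, contract_cons, ih]

theorem contract_eq_sum (f : ι → K) (F : List ι → M) (L : List ι) :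
    contract f F L =
      ∑ i : Fin L.length, (-1 : K) ^ (i : ℕ) • f L[i] • F (L.eraseIdx i) := by
  induction L generalizing F with
  | nil => simp
  | cons b L ih =>
    rw [contract_cons, ih]
    simp only [List.length_cons]
    rw [Fin.sum_univ_succ, sub_eq_add_neg, ← Finset.sum_neg_distrib]
    simp [pow_succ]

/-- The sum of `F` over all partial contractions of a word, with contractions `β`. -/
def wick (β : ι → ι → K) : (List ι → M) → List ι → M
  | F, [] => F []
  | F, a :: L => wick β (fun l => F (a :: l) + contract (β a) F l) L

@[simp] theorem wick_nil (β : ι → ι → K) (F : List ι → M) : wick β F [] = F [] := rfl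

theorem wick_cons (β : ι → ι → K) (F : List ι → M) (a : ι) (L : List ι) :
    wick β F (a :: L) = wick β (fun l => F (a :: l) + contract (β a) F l) L := rfl

theorem wick_congr {β γ : ι → ι → K} {F G : List ι → M} {L : List ι}
    (hβ : L.Pairwise fun a b => β a b = γ a b) (h : ∀ l, l.Sublist L → F l = G l) :
    wick β F L = wick γ G L := by
  induction L generalizing F G with
  | nil => exact h [] (List.Sublist.refl _)
  | cons a L ih =>
    rw [List.pairwise_cons] at hβ
    rw [wick_cons, wick_cons]
    refine ih hβ.2 fun l hl => ?_
    rw [h _ (hl.cons_cons a)]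
    congr 1
    exact contract_congr (fun b hb => hβ.1 b (hl.subset hb))
      fun l' hl' _ => h _ ((hl'.trans hl).trans (List.sublist_cons_self a L))

theorem wick_add (β : ι → ι → K) (F G : List ι → M) (L : List ι) :
    wick β (fun l => F l + G l) L = wick β F L + wick β G L := by
  induction L generalizing F G with
  | nil => rfl
  | cons a L ih =>
    simp only [wick_cons, ← ih, contract_add]
    congr 1
    funext l
    abel

/-- The additive map `T` may change the ring of scalars. This transports Wick sums of operators over
`ℂ` to Wick sums of scalar series. -/
theorem wick_map {K' : Type*} [CommRing K'] {N : Type*} [AddCommGroup N] [Module K' N]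
    (T : M →+ N) (β : ι → ι → K) (γ : ι → ι → K') (h : ∀ a b x, T (β a b • x) = γ a b • T x)
    (F : List ι → M) (L : List ι) : wick γ (fun l => T (F l)) L = T (wick β F L) := by
  induction L generalizing F with
  | nil => rfl
  | cons a L ih =>
    simp only [wick_cons, ← ih, map_add]
    congr 1
    funext l
    rw [contract_map T (β a) (γ a) (h a)]

theorem wick_linear (T : M →ₗ[K] M') (β : ι → ι → K) (F : List ι → M) (L : List ι) :
    wick β (fun l => T (F l)) L = T (wick β F L) :=
  wick_map T.toAddMonoidHom β β (fun _ _ _ => map_smul T _ _) F L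

theorem wick_smul (β : ι → ι → K) (c : K) (F : List ι → M) (L : List ι) :
    wick β (fun l => c • F l) L = c • wick β F L :=
  wick_linear (LinearMap.lsmul K M c) β F L

theorem wick_neg (β : ι → ι → K) (F : List ι → M) (L : List ι) :
    wick β (fun l => -F l) L = -wick β F L :=
  wick_linear (-LinearMap.id) β F L

theorem wick_sub (β : ι → ι → K) (F G : List ι → M) (L : List ι) :
    wick β (fun l => F l - G l) L = wick β F L - wick β G L := by
  simp only [sub_eq_add_neg, wick_add, wick_neg]

theorem wick_zero (β : ι → ι → K) (L : List ι) : wick β (fun _ => (0 : M)) L = 0 := by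
  simpa using wick_smul β (0 : K) (fun _ => (0 : M)) L

theorem wick_sum {σ : Type*} (T : Finset σ) (β : ι → ι → K) (F : σ → List ι → M) (L : List ι) :
    wick β (fun l => ∑ t ∈ T, F t l) L = ∑ t ∈ T, wick β (F t) L := by
  classical
  induction T using Finset.induction_on with
  | empty => simpa using wick_zero β L
  | insert a T ha ih => simp only [Finset.sum_insert ha, wick_add, ih]

theorem wick_comap (e : κ → ι) (β : ι → ι → K) (F : List ι → M) (L : List κ) :
    wick β F (L.map e) = wick (fun a b => β (e a) (e b)) (fun l => F (l.map e)) L := by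
  induction L generalizing F with
  | nil => rfl
  | cons a L ih => simp only [List.map_cons, wick_cons, ih, contract_comap]

/-- Each pair contraction is a product of two antiderivations and is therefore even, so it commutes
with a single contraction. No symmetry of `β` is needed: only `β a b` with `a` to the left of `b`
ever occurs. -/
theorem wick_contract (β : ι → ι → K) (f : ι → K) (F : List ι → M) (L : List ι) :
    wick β (contract f F) L = contract f (wick β F) L := by
  induction L generalizing F with
  | nil => rfl
  | cons a L ih =>
    simp only [contract_cons, wick_cons]
    have e : (fun l => f a • F l - contract f (fun l => F (a :: l)) l +
        contract (β a) (contract f F) l) =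
        fun l => f a • F l - contract f (fun l => F (a :: l) + contract (β a) F l) l := by
      funext l
      rw [contract_contract, contract_add]
      abel
    rw [e, wick_sub, wick_smul, ih]

/-- This second recursion decides the fate of the first letter last: either it stays, or it is
contracted with a letter of `L` and the rest is summed by `wick β`. -/
theorem wick_cons' (β : ι → ι → K) (F : List ι → M) (a : ι) (L : List ι) :
    wick β F (a :: L) = wick β (fun l => F (a :: l)) L + contract (β a) (wick β F) L := by
  rw [wick_cons, wick_add]
  congr 1
  exact wick_contract β (β a) F L

/-- The law `exp X exp Y = exp (X + Y)` for commuting quadratic expressions. Combinatorially, each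
contracted pair is assigned to one of the two sources of contractions. -/
theorem wick_wick (β γ : ι → ι → K) (F : List ι → M) (L : List ι) :
    wick β (wick γ F) L = wick (fun a b => β a b + γ a b) F L := by
  induction L generalizing F with
  | nil => rfl
  | cons a L ih =>
    rw [wick_cons, wick_cons, ← ih]
    congr 1
    funext l
    rw [wick_cons, wick_add, wick_add, add_assoc, ← wick_contract, ← wick_add]
    congr 2
    funext l'
    rw [contract_add_left, add_comm]

theorem wick_zero_left {β : ι → ι → K} {L : List ι} (h : L.Pairwise fun a b => β a b = 0)
    (F : List ι → M) : wick β F L = F L := by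
  induction L generalizing F with
  | nil => rfl
  | cons a L ih =>
    rw [List.pairwise_cons] at h
    rw [wick_cons, ih h.2, contract_eq_zero h.1, add_zero]

theorem wick_append_left {β : ι → ι → K} {L L' : List ι} (h : ∀ a ∈ L, ∀ b ∈ L', β a b = 0)
    (h' : L'.Pairwise fun a b => β a b = 0) (F : List ι → M) :
    wick β F (L ++ L') = wick β (fun l => F (l ++ L')) L := by
  induction L generalizing F with
  | nil => exact wick_zero_left h' F
  | cons a L ih =>
    rw [List.cons_append, wick_cons, wick_cons, ih fun b hb => h b (by simp [hb])]
    congr 1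
    funext l
    rw [contract_append, contract_eq_zero (h a (by simp)), smul_zero, add_zero]
    rfl

theorem wick_append_right {β : ι → ι → K} {L L' : List ι}
    (h : ∀ a ∈ L, ∀ b, β a b = 0) (F : List ι → M) :
    wick β F (L ++ L') = wick β (fun l => F (L ++ l)) L' := by
  induction L generalizing F with
  | nil => rfl
  | cons a L ih =>
    rw [List.cons_append, wick_cons, ih fun b hb => h b (by simp [hb])]
    congr 1
    funext l
    rw [contract_eq_zero fun b _ => h a (by simp) b, add_zero]
    rfl

/-- The sum over all decompositions of a word into two complementary subwords, with the sign of the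
shuffle. -/
def unshuffle (K : Type*) [CommRing K] [Module K M] : (List ι → List ι → M) → List ι → M
  | H, [] => H [] []
  | H, a :: L => unshuffle K (fun s c => H (a :: s) c) L +
      unshuffle K (fun s c => (-1 : K) ^ s.length • H s (a :: c)) L

@[simp] theorem unshuffle_nil (H : List ι → List ι → M) : unshuffle K H [] = H [] [] := rfl

theorem unshuffle_cons (H : List ι → List ι → M) (a : ι) (L : List ι) :
    unshuffle K H (a :: L) = unshuffle K (fun s c => H (a :: s) c) L +
      unshuffle K (fun s c => (-1 : K) ^ s.length • H s (a :: c)) L := rfl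

theorem unshuffle_linear (T : M →ₗ[K] M') (H : List ι → List ι → M) (L : List ι) :
    unshuffle K (fun s c => T (H s c)) L = T (unshuffle K H L) := by
  induction L generalizing H with
  | nil => rfl
  | cons a L ih => simp only [unshuffle_cons, map_add, ← ih, map_smul]

theorem unshuffle_smul (k : K) (H : List ι → List ι → M) (L : List ι) :
    unshuffle K (fun s c => k • H s c) L = k • unshuffle K H L :=
  unshuffle_linear (LinearMap.lsmul K M k) H L

theorem unshuffle_neg (H : List ι → List ι → M) (L : List ι) :
    unshuffle K (fun s c => -H s c) L = -unshuffle K H L :=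
  unshuffle_linear (-LinearMap.id) H L

theorem unshuffle_zero (L : List ι) : unshuffle K (fun _ _ => (0 : M)) L = 0 := by
  simpa using unshuffle_smul (0 : K) (fun _ _ => (0 : M)) L

theorem unshuffle_add (H H' : List ι → List ι → M) (L : List ι) :
    unshuffle K (fun s c => H s c + H' s c) L = unshuffle K H L + unshuffle K H' L := by
  induction L generalizing H H' with
  | nil => rfl
  | cons a L ih => simp only [unshuffle_cons, smul_add, ih]; abel

theorem unshuffle_sub (H H' : List ι → List ι → M) (L : List ι) :
    unshuffle K (fun s c => H s c - H' s c) L = unshuffle K H L - unshuffle K H' L := by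
  simp only [sub_eq_add_neg, unshuffle_add, unshuffle_neg]

theorem unshuffle_comap (e : κ → ι) (H : List ι → List ι → M) (L : List κ) :
    unshuffle K H (L.map e) = unshuffle K (fun s c => H (s.map e) (c.map e)) L := by
  induction L generalizing H with
  | nil => rfl
  | cons a L ih => simp only [List.map_cons, unshuffle_cons, ih, List.length_map]

/-- A deleted letter together with a splitting of the remaining ones is the same as a splitting of
the whole word in which the deleted letter is counted in one of the halves. Counting it in the first
half produces no extra sign; counting it in the second half, in the companion lemma, produces the
sign of passing the first half. -/
theorem contract_unshuffle_left (f : ι → K) (H : List ι → List ι → M) (L : List ι) :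
    contract f (unshuffle K H) L =
      unshuffle K (fun s c => contract f (fun s' => H s' c) s) L := by
  induction L generalizing H with
  | nil => rfl
  | cons a L ih =>
    simp only [contract_cons, unshuffle_cons, contract_add, ih, unshuffle_sub, unshuffle_smul]
    have : (fun s c => contract f (fun s' => (-1 : K) ^ s'.length • H s' (a :: c)) s) =
        fun s c => -((-1 : K) ^ s.length • contract f (fun s' => H s' (a :: c)) s) := by
      funext s c
      rw [← contract_smul, ← contract_neg]
      refine contract_congr (fun _ _ => rfl) fun l _ hl => ?_
      rw [← hl, pow_succ, mul_smul]
      simp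
    rw [this, unshuffle_neg]
    abel

theorem contract_unshuffle_right (f : ι → K) (H : List ι → List ι → M) (L : List ι) :
    contract f (unshuffle K H) L =
      unshuffle K (fun s c => (-1 : K) ^ s.length • contract f (H s) c) L := by
  induction L generalizing H with
  | nil => simp
  | cons a L ih =>
    have h1 : ∀ s : List ι, (-1 : K) ^ s.length * (-1 : K) ^ s.length = 1 := fun s => by
      rw [← mul_pow]; simp
    simp only [contract_cons, unshuffle_cons, contract_add, ih, smul_sub, unshuffle_sub,
      contract_smul, smul_smul, h1, one_smul, List.length_cons, pow_succ, mul_neg,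
      mul_one, neg_smul, unshuffle_neg, ← mul_assoc, one_mul]
    rw [unshuffle_smul]
    abel

theorem unshuffle_append (H : List ι → List ι → M) (L L' : List ι) :
    unshuffle K H (L ++ L') = unshuffle K (fun s c => unshuffle K (fun s' c' =>
      (-1 : K) ^ (c.length * s'.length) • H (s ++ s') (c ++ c')) L') L := by
  induction L generalizing H with
  | nil => simp
  | cons a L ih =>
    simp only [List.cons_append, unshuffle_cons, ih, List.length_cons, List.length_append]
    congr 2
    funext s c
    rw [← unshuffle_smul]
    congr 1
    funext s' c'
    rw [smul_smul, smul_smul]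
    congr 1
    ring

/-- The sign of the shuffle that moves the letters with `p` to the front. -/
def splitSign (p : ι → Prop) [DecidablePred p] : List ι → ℤ
  | [] => 1
  | a :: L => (if p a then 1 else (-1) ^ (L.filter p).length) * splitSign p L

/-- Exactly one splitting survives, the one prescribed by `p`. -/
theorem unshuffle_ite (p : ι → Prop) [DecidablePred p] (H : List ι → List ι → M) (L : List ι) :
    unshuffle K (fun s c => if (∀ a ∈ s, p a) ∧ (∀ a ∈ c, ¬ p a) then H s c else 0) L =
      ((splitSign p L : ℤ) : K) • H (L.filter p) (L.filter fun a => ¬ p a) := by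
  induction L generalizing H with
  | nil => simp [splitSign]
  | cons a L ih =>
    rw [unshuffle_cons]
    by_cases ha : p a
    · have h1 := ih fun s c => H (a :: s) c
      simp only [List.forall_mem_cons, ha, true_and, not_true_eq_false, false_and, and_false,
        if_false, smul_zero, unshuffle_zero, add_zero] at h1 ⊢
      rw [h1]
      simp [ha, splitSign]
    · have h1 := ih fun s c => (-1 : K) ^ s.length • H s (a :: c)
      simp only [List.forall_mem_cons, ha, false_and, if_false, unshuffle_zero, zero_add,
        not_false_eq_true, true_and] at h1 ⊢
      simp only [smul_ite, smul_zero]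
      rw [h1]
      simp [ha, splitSign, mul_smul]
      rw [smul_comm]

/-- The sum of all total contractions of a word, with contractions `β`. -/
def totalContr (β : ι → ι → K) : List ι → K := wick β fun l => if l.isEmpty then 1 else 0

@[simp] theorem totalContr_nil (β : ι → ι → K) : totalContr β [] = 1 := by simp [totalContr]

theorem totalContr_cons (β : ι → ι → K) (a : ι) (L : List ι) :
    totalContr β (a :: L) = contract (β a) (totalContr β) L := by
  rw [totalContr, wick_cons']
  simp [wick_zero]

theorem totalContr_odd (β : ι → ι → K) {L : List ι} (hL : Odd L.length) : totalContr β L = 0 := by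
  induction hk : L.length using Nat.strong_induction_on generalizing L with
  | _ k ih =>
    cases L with
    | nil => simp at hL
    | cons a L =>
      rw [totalContr_cons, ← contract_zero (β a) L]
      refine contract_congr (fun _ _ => rfl) fun l _ hl => ih _ ?_ ?_ rfl
      · rw [← hk, List.length_cons]; omega
      · rw [List.length_cons, ← hl] at hL
        simpa [Nat.odd_add_one] using hL

/-- The first subword consists of the contracted letters. It contributes its Pfaffian-like total
contraction, and `F` sees the second subword. -/
theorem wick_eq_unshuffle (β : ι → ι → K) (F : List ι → M) (L : List ι) :
    wick β F L = unshuffle K (fun s c => totalContr β s • F c) L := by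
  induction L generalizing F with
  | nil => simp
  | cons a L ih =>
    rw [wick_cons, ih, unshuffle_cons, add_comm (unshuffle K _ L)]
    simp only [smul_add]
    rw [unshuffle_add]
    congr 1
    swap
    -- The partner of `a`, first counted among the surviving letters, is counted among the
    -- contracted ones: the two formulas for a contraction of an unshuffle have the same left-hand
    -- side. The sign that arises is invisible, since total contractions of words of odd length
    -- vanish.
    · have h1 := contract_unshuffle_left (β a) (fun s c => totalContr β s • F c) L
      rw [contract_unshuffle_right] at h1
      simp only [totalContr_cons]
      have h2 : ∀ (f : ι → K) (x : M) (s : List ι), contract f (fun s' => totalContr β s' • x) s =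
          contract f (totalContr β) s • x := fun f x s =>
        contract_linear (LinearMap.toSpanSingleton K M x) f (totalContr β) s
      simp only [h2] at h1
      rw [← h1]
      congr 1
      funext s c
      rw [contract_smul, smul_smul]
      rcases Nat.even_or_odd s.length with hs | hs
      · rw [hs.neg_one_pow, one_mul]
      · simp [totalContr_odd β hs]
    · congr 1
      funext s c
      rw [smul_smul]
      rcases Nat.even_or_odd s.length with hs | hs
      · rw [hs.neg_one_pow, one_mul]
      · simp [totalContr_odd β hs]

theorem totalContr_map {K' : Type*} [CommRing K'] (f : K →+* K') (β : ι → ι → K) (L : List ι) :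
    totalContr (fun a b => f (β a b)) L = f (totalContr β L) := by
  unfold totalContr
  refine Eq.trans ?_ (wick_map f.toAddMonoidHom β (fun a b => f (β a b)) (by intros; simp) _ L)
  congr 1
  funext l
  split_ifs <;> simp_all

/-- A word of length `2k` has `k` pairs in each total contraction, and every letter occurs in
exactly one pair. So factors attached to letters and a common factor of the pairs can be taken out.
-/
theorem totalContr_scale (β : ι → ι → K) (c : K) (u : ι → K) {L : List ι} {k : ℕ}
    (hL : L.length = 2 * k) :
    totalContr (fun a b => c * (u a * u b) * β a b) L =
      c ^ k * (L.map u).prod * totalContr β L := by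
  induction k generalizing L with
  | zero =>
    obtain rfl : L = [] := List.length_eq_zero_iff.1 (by simpa using hL)
    simp
  | succ k ih =>
    have key : ∀ (f : ι → K) (L : List ι), L.length = 2 * k + 1 →
        contract (fun b => u b * f b) (totalContr fun a b => c * (u a * u b) * β a b) L =
        (c ^ k * (L.map u).prod) • contract f (totalContr β) L := by
      intro f L hL
      rw [contract_eq_sum, contract_eq_sum, Finset.smul_sum]
      refine Finset.sum_congr rfl fun i _ => ?_
      rw [ih (by rw [List.length_eraseIdx, if_pos i.2, hL]; simp)]
      have h3 : (L.map u).prod = u L[i] * ((L.eraseIdx i).map u).prod := by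
        rw [← List.prod_cons, ← List.map_cons]
        exact ((List.getElem_cons_eraseIdx_perm i.2).map u).prod_eq.symm
      rw [h3]
      simp only [smul_eq_mul]
      ring
    cases L with
    | nil => simp at hL
    | cons a L =>
      have hL' : L.length = 2 * k + 1 := by simpa [mul_add] using hL
      rw [totalContr_cons, totalContr_cons, ← smul_eq_mul (c ^ (k + 1) * _)]
      have := key (β a) L hL'
      have e : (fun b => c * (u a * u b) * β a b) = fun b => (c * u a) * (u b * β a b) := by
        funext b; ring
      rw [e, contract_smul_left, this, smul_smul]
      congr 1
      rw [List.map_cons, List.prod_cons]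
      ring

theorem contrNum_eq_totalContr {ι : Type} (β : ι → ι → ℂ) (L : List ι) :
    contrNum β L = totalContr β L := by
  induction hk : L.length using Nat.strong_induction_on generalizing L with
  | _ k ih =>
    cases L with
    | nil => simp [contrNum]
    | cons a L =>
      rw [totalContr_cons, contract_eq_sum, contrNum]
      refine Finset.sum_congr rfl fun i _ => ?_
      rw [ih _ ?_ (L.eraseIdx i) rfl]
      · simp [mul_assoc]
      · rw [← hk, List.length_cons, List.length_eraseIdx]; split <;> omega

/-- The contraction between letters of two alphabets. -/
def crossContr (g : ι → κ → K) : ι ⊕ κ → ι ⊕ κ → K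
  | .inl a, .inr b => g a b
  | _, _ => 0

theorem eraseIdx_ofFn {ρ : ℕ} (b : Fin (ρ + 1) → ι) (i : Fin (ρ + 1)) :
    (List.ofFn b).eraseIdx i = List.ofFn fun j => b (i.succAbove j) := by
  refine List.ext_getElem (by
    rw [List.length_eraseIdx]; simp [Nat.lt_succ_iff.1 i.2]) fun j h1 h2 => ?_
  rw [List.getElem_eraseIdx]
  simp only [List.getElem_ofFn, Fin.succAbove, Fin.lt_def, Fin.val_castSucc]
  split_ifs <;> rfl

/-- The Pfaffian of a matrix with vanishing diagonal blocks is a determinant up to sign. The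
recursion for the first letter is the expansion of the determinant along its first row. -/
theorem totalContr_cross (g : ι → κ → K) {ρ : ℕ} (a : Fin ρ → ι) (b : Fin ρ → κ) :
    totalContr (crossContr g) ((List.ofFn a).map .inl ++ (List.ofFn b).map .inr) =
      (-1) ^ (ρ * (ρ - 1) / 2) * (Matrix.of fun i j => g (a i) (b j)).det := by
  induction ρ with
  | zero => simp
  | succ ρ ih =>
    rw [List.ofFn_succ, List.map_cons, List.cons_append, totalContr_cons, contract_append,
      contract_eq_zero (by intro x hx; obtain ⟨y, -, rfl⟩ := List.mem_map.1 hx; rfl), zero_add,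
      contract_comap, contract_eq_sum, Matrix.det_succ_row_zero, Finset.smul_sum, Finset.mul_sum]
    refine Fintype.sum_equiv (finCongr (by simp)) _ _ fun i => ?_
    obtain ⟨i', hi'⟩ : ∃ i' : Fin (ρ + 1), i' = finCongr (by simp) i := ⟨_, rfl⟩
    have hv : (i : ℕ) = i' := by rw [hi']; rfl
    have h1 : (List.ofFn b).eraseIdx (i : ℕ) = List.ofFn fun j => b (i'.succAbove j) := by
      rw [← eraseIdx_ofFn b i', hv]
    -- The first letter is contracted across the remaining `ρ` letters of the first alphabet, which
    -- accounts for the extra sign `(-1)^ρ`.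
    have h2 : (ρ + 1) * ρ / 2 = ρ + ρ * (ρ - 1) / 2 := by
      cases ρ with
      | zero => rfl
      | succ n =>
        have : (n + 1 + 1) * (n + 1) = (n + 1) * 2 + (n + 1) * n := by ring
        rw [this, Nat.add_sub_cancel, Nat.add_comm, Nat.add_mul_div_right _ _ (by norm_num)]
        ring
    have h4 : (List.ofFn b)[i] = b i' := by
      simp only [Fin.getElem_fin, List.getElem_ofFn, hv]
    have h3 : (Matrix.of fun i j => g (a i) (b j)).submatrix Fin.succ i'.succAbove =
      Matrix.of fun k j => g (a k.succ) (b (i'.succAbove j)) := rfl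
    rw [← hi', h3, h4, h1, ih, hv, Matrix.of_apply, Nat.add_sub_cancel, h2, pow_add, List.length_map,
      List.length_ofFn]
    simp only [crossContr, smul_eq_mul]
    ring

theorem totalContr_cross_eq_zero (g : ι → κ → K) {l : List ι} {l' : List κ}
    (h : l.length ≠ l'.length) :
    totalContr (crossContr g) (l.map .inl ++ l'.map .inr) = 0 := by
  induction l generalizing l' with
  | nil =>
    cases l' with
    | nil => simp at h
    | cons b l' =>
      rw [List.map_nil, List.nil_append, List.map_cons, totalContr_cons]
      exact contract_eq_zero (fun _ _ => rfl) _
  | cons a l ih =>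
    rw [List.map_cons, List.cons_append, totalContr_cons, contract_append,
      contract_eq_zero (by intro x hx; obtain ⟨y, -, rfl⟩ := List.mem_map.1 hx; rfl), zero_add,
      contract_comap]
    refine (congrArg _ ((contract_congr (fun _ _ => rfl) fun s _ hs => ih (by
      simp only [List.length_cons] at h; omega)).trans (contract_zero _ l'))).trans (smul_zero _)

/-- The sum of `G` over all words in `ι × μ` with given projection to `ι` and with second components
in `Λ`, with weights. -/
def modeSum {μ : Type*} (wt : ι → μ → K) (Λ : Finset μ) : (List (ι × μ) → M) → List ι → M
  | G, [] => G []
  | G, a :: L => ∑ n ∈ Λ, wt a n • modeSum wt Λ (fun l => G ((a, n) :: l)) L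

/-! ### Weighted sums over the modes of the letters of a word. -/

section ModeSum

variable {μ : Type*} (wt : ι → μ → K) (Λ : Finset μ)

@[simp] theorem modeSum_nil (G : List (ι × μ) → M) : modeSum wt Λ G [] = G [] := rfl

theorem modeSum_cons (G : List (ι × μ) → M) (a : ι) (L : List ι) :
    modeSum wt Λ G (a :: L) = ∑ n ∈ Λ, wt a n • modeSum wt Λ (fun l => G ((a, n) :: l)) L := rfl

theorem modeSum_congr {G G' : List (ι × μ) → M} {L : List ι}
    (h : ∀ l : List (ι × μ), l.map Prod.fst = L → G l = G' l) :
    modeSum wt Λ G L = modeSum wt Λ G' L := by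
  induction L generalizing G G' with
  | nil => exact h [] rfl
  | cons a L ih =>
    refine Finset.sum_congr rfl fun n _ => ?_
    rw [ih fun l hl => h _ (by simp [hl])]

theorem modeSum_linear (T : M →ₗ[K] M') (G : List (ι × μ) → M) (L : List ι) :
    modeSum wt Λ (fun l => T (G l)) L = T (modeSum wt Λ G L) := by
  induction L generalizing G with
  | nil => rfl
  | cons a L ih => simp only [modeSum_cons, ih, map_sum, map_smul]

theorem modeSum_smul (c : K) (G : List (ι × μ) → M) (L : List ι) :
    modeSum wt Λ (fun l => c • G l) L = c • modeSum wt Λ G L :=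
  modeSum_linear wt Λ (LinearMap.lsmul K M c) G L

theorem modeSum_add (G G' : List (ι × μ) → M) (L : List ι) :
    modeSum wt Λ (fun l => G l + G' l) L = modeSum wt Λ G L + modeSum wt Λ G' L := by
  induction L generalizing G G' with
  | nil => rfl
  | cons a L ih => simp only [modeSum_cons, ih, smul_add, Finset.sum_add_distrib]

theorem modeSum_neg (G : List (ι × μ) → M) (L : List ι) :
    modeSum wt Λ (fun l => -G l) L = -modeSum wt Λ G L :=
  modeSum_linear wt Λ (-LinearMap.id) G L

theorem modeSum_contract (f : ι × μ → K) (G : List (ι × μ) → M) (L : List ι) :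
    modeSum wt Λ (contract f G) L =
      contract (fun b => ∑ n ∈ Λ, wt b n * f (b, n)) (modeSum wt Λ G) L := by
  induction L generalizing G with
  | nil => rfl
  | cons a L ih =>
    simp only [contract_cons, modeSum_cons, sub_eq_add_neg, modeSum_add, modeSum_smul, modeSum_neg,
      ih, contract_sum, contract_smul, smul_add, Finset.sum_add_distrib, Finset.sum_smul, smul_smul,
      smul_neg, Finset.sum_neg_distrib]

/-- A contraction removes two letters together with their modes, so the sum over these two modes
factors out. Contractions of modes thereby turn into contractions of generating series, and the
functional of the surviving letters is summed separately. -/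
theorem modeSum_wick (β : ι × μ → ι × μ → K) (G : List (ι × μ) → M) (L : List ι) :
    modeSum wt Λ (wick β G) L =
      wick (fun a b => ∑ n ∈ Λ, ∑ n' ∈ Λ, wt a n * (wt b n' * β (a, n) (b, n')))
        (modeSum wt Λ G) L := by
  induction L generalizing G with
  | nil => rfl
  | cons a L ih =>
    simp only [modeSum_cons, wick_cons, ih]
    rw [← Finset.sum_congr rfl fun n _ => wick_smul _ (wt a n) _ L, ← wick_sum]
    congr 1
    funext l
    have e : ∀ n, modeSum wt Λ (fun l => G ((a, n) :: l) + contract (β (a, n)) G l) l =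
        modeSum wt Λ (fun l => G ((a, n) :: l)) l + contract
          (fun b => ∑ n' ∈ Λ, wt b n' * β (a, n) (b, n')) (modeSum wt Λ G) l := fun n => by
      rw [modeSum_add, ← modeSum_contract]
    simp only [e, smul_add, Finset.sum_add_distrib, contract_sum_left, ← Finset.mul_sum,
      contract_smul_left]

theorem modeSum_append (G : List (ι × μ) → M) (L L' : List ι) :
    modeSum wt Λ G (L ++ L') =
      modeSum wt Λ (fun l => modeSum wt Λ (fun l' => G (l ++ l')) L') L := by
  induction L generalizing G with
  | nil => rfl
  | cons a L ih => simp only [List.cons_append, modeSum_cons, ih]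

theorem modeSum_comap (e : κ → ι) (G : List (ι × μ) → M) (L : List κ) :
    modeSum wt Λ G (L.map e) =
      modeSum (fun a => wt (e a)) Λ (fun l => G (l.map fun c => (e c.1, c.2))) L := by
  induction L generalizing G with
  | nil => rfl
  | cons a L ih => simp only [List.map_cons, modeSum_cons, ih]

theorem modeSum_ofFn (G : List (ι × μ) → M) {r : ℕ} (a : Fin r → ι) :
    modeSum wt Λ G (List.ofFn a) = ∑ n ∈ Fintype.piFinset fun _ : Fin r => Λ,
      (∏ i, wt (a i) (n i)) • G (List.ofFn fun i => (a i, n i)) := by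
  induction r generalizing G with
  | zero => simp
  | succ r ih =>
    rw [List.ofFn_succ, modeSum_cons]
    simp only [ih]
    simp only [Finset.smul_sum]
    rw [← Finset.sum_product']
    refine Finset.sum_nbij' (fun x => Fin.cons x.1 x.2) (fun n => (n 0, fun i => n i.succ))
      ?_ ?_ ?_ ?_ ?_
    · intro x hx
      simp only [Finset.mem_product, Fintype.mem_piFinset] at hx ⊢
      exact Fin.cases hx.1 hx.2
    · intro x hx
      simp only [Finset.mem_product, Fintype.mem_piFinset] at hx ⊢
      exact ⟨hx 0, fun i => hx _⟩
    · intro x _; simp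
    · intro x _; exact Fin.cons_self_tail x
    · intro x _
      simp [Fin.prod_univ_succ, List.ofFn_succ, smul_smul]

end ModeSum

end Words

/-! ### Normal ordering as a sum over contractions -/

section NormalOrdering

/-- The sign `(-1)^N`, where `N` is the number of inversions of the values of `k`. -/
def invSign {ι : Type*} (k : ι → ℕ) : List ι → ℤ
  | [] => 1
  | a :: L => (L.map fun b => if k b < k a then -1 else 1).prod * invSign k L

theorem neg_one_pow_length_filter {ι : Type*} (p : ι → Prop) [DecidablePred p] (L : List ι) :
    (-1 : ℤ) ^ (L.filter p).length = (L.map fun b => if p b then -1 else 1).prod := by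
  induction L with
  | nil => rfl
  | cons a L ih => by_cases ha : p a <;> simp [ha, pow_succ, ih]

theorem invSign_comap {ι κ : Type*} (k : ι → ℕ) (e : κ → ι) (L : List κ) :
    invSign k (L.map e) = invSign (fun a => k (e a)) L := by
  induction L with
  | nil => rfl
  | cons a L ih => simp [invSign, ih, Function.comp_def]

/-- The stable sort inverts a pair `i < j` exactly if `f j < f i`, and the sign of a permutation is
the product of its signs on pairs. -/
theorem sign_sort {r : ℕ} (f : Fin r → ℕ) :
    ((Equiv.Perm.sign (Tuple.sort f) : ℤˣ) : ℤ) = invSign f (List.finRange r) := by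
  have h1 : ∀ i j : Fin r, i < j → ((Tuple.sort f)⁻¹ i < (Tuple.sort f)⁻¹ j ↔ f i ≤ f j) := by
    obtain ⟨hm, hs⟩ := Tuple.eq_sort_iff.1 (rfl : Tuple.sort f = Tuple.sort f)
    have key : ∀ i j : Fin r, (Tuple.sort f)⁻¹ i < (Tuple.sort f)⁻¹ j → f i ≤ f j := fun i j h => by
      simpa using hm h.le
    intro i j hij
    refine ⟨key i j, fun h => ?_⟩
    by_contra hlt
    rcases (not_lt.1 hlt).eq_or_lt with he | hlt
    · exact hij.ne' ((Tuple.sort f)⁻¹.injective he)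
    · have := hs _ _ hlt
      simp only [← Equiv.Perm.mul_apply, mul_inv_cancel, Equiv.Perm.one_apply] at this
      exact absurd (this (le_antisymm (key _ _ hlt) h)) (not_lt.2 hij.le)
  rw [← Equiv.Perm.sign_inv, Equiv.Perm.sign_eq_prod_prod_Ioi]
  have h2 : ∀ (r : ℕ) (f : Fin r → ℕ), invSign f (List.finRange r) =
      ∏ i, ∏ j ∈ Finset.Ioi i, if f i ≤ f j then 1 else -1 := by
    intro r
    induction r with
    | zero => intro f; rfl
    | succ r ih =>
      intro f
      rw [List.finRange_succ, invSign, invSign_comap, ih, Fin.prod_univ_succ, Fin.prod_Ioi_zero,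
        List.map_map, ← List.ofFn_eq_map, List.prod_ofFn]
      congr 1
      · refine Finset.prod_congr rfl fun i _ => ?_
        simp only [Function.comp_apply, ← not_le, ite_not]
      · refine Finset.prod_congr rfl fun i _ => ?_
        rw [Fin.prod_Ioi_succ]
  rw [h2]
  push_cast
  refine Finset.prod_congr rfl fun i _ => Finset.prod_congr rfl fun j hj => ?_
  have := h1 i j (Finset.mem_Ioi.1 hj)
  by_cases h : f i ≤ f j
  · rw [if_pos h, if_pos (this.2 h)]; rfl
  · rw [if_neg h, if_neg (mt this.1 h)]; rfl

/-- Sorting into three kinds is done in two steps: kind `0` is moved to the front, then kind `1` to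
the front of the rest. The inversions of the two steps add up to all inversions. -/
theorem splitSign_mul {ι : Type*} (k : ι → ℕ) (hk : ∀ a, k a ≤ 2) (L : List ι) :
    splitSign (fun a => k a = 0) L *
      splitSign (fun a => k a = 1) (L.filter fun a => ¬ k a = 0) = invSign k L := by
  induction L with
  | nil => rfl
  | cons a L ih =>
    rw [invSign, ← ih, ← neg_one_pow_length_filter]
    have h3 : k a = 0 ∨ k a = 1 ∨ k a = 2 := by have := hk a; omega
    rcases h3 with h | h | h
    · simp [splitSign, h]
    · simp [splitSign, h, mul_assoc]
    -- A letter of kind `2` is passed by the letters of kind `0` in the first step and by those of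
    -- kind `1` in the second.
    · have e : (L.filter fun b => decide (k b < k a)).length =
          (L.filter fun b => decide (k b = 0)).length +
          ((L.filter fun b => decide (¬ k b = 0)).filter fun b => decide (k b = 1)).length := by
        rw [h]
        clear ih
        induction L with
        | nil => rfl
        | cons b L ih =>
          have h3 : k b = 0 ∨ k b = 1 ∨ k b = 2 := by have := hk b; omega
          rcases h3 with h | h | h <;> simp [h] at ih ⊢ <;> omega
      rw [e, pow_add]
      simp only [splitSign, h, OfNat.ofNat_ne_zero, if_false, not_false_eq_true, decide_true,
        List.filter_cons_of_pos, OfNat.ofNat_ne_one]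
      ring

variable {𝔥 : Type u} [AddCommGroup 𝔥] [Module ℂ 𝔥] {X : Type v} [AddCommGroup X] [Module ℂ X]

/-- In the recursion the positions are counted from `0` and the sign is `(-1)^(i+1)`. Hence the
contraction is minus one half of the form. -/
theorem nordZero_eq_wick {ι : Type} (φ : ι → Module.End ℂ X) (β : ι → ι → ℂ) (L : List ι) :
    nordZero φ β L = wick (fun a b => -(β a b / 2)) (fun l => (l.map φ).prod) L := by
  induction hk : L.length using Nat.strong_induction_on generalizing L with
  | _ k ih =>
    cases L with
    | nil => simp [nordZero]
    | cons a L =>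
      rw [nordZero, wick_cons', contract_eq_sum]
      congr 1
      · rw [ih _ (by rw [← hk, List.length_cons]; omega) L rfl]
        exact (wick_linear (LinearMap.mulLeft ℂ (φ a)) _ (fun l => (l.map φ).prod) L).symm
      · refine Finset.sum_congr rfl fun i _ => ?_
        rw [ih _ ?_ (L.eraseIdx i) rfl]
        · rw [smul_smul]
          congr 1
          rw [pow_succ]
          ring
        · rw [← hk, List.length_cons, List.length_eraseIdx]; split <;> omega

/-- The (anti)commutation relations that hold for the modes of `V` and of `W`. -/
structure ModeSystem.Fermionic (S : ModeSystem 𝔥 X) (B : LinearMap.BilinForm ℂ 𝔥) : Prop where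
  pos_neg : ∀ (m n : ℤ) (a b : 𝔥), 0 < S.deg m → S.deg n < 0 →
    S.mode m a * S.mode n b + S.mode n b * S.mode m a =
      (if S.deg m + S.deg n = 0 then B a b else 0) • (1 : Module.End ℂ X)
  neg_zero : ∀ (n z : ℤ) (a b : 𝔥), S.deg n < 0 → S.deg z = 0 →
    S.mode n a * S.mode z b = -(S.mode z b * S.mode n a)

/-- The difference between the product and the normal ordered product of two modes. -/
def modeContr (S : ModeSystem 𝔥 X) (B : LinearMap.BilinForm ℂ 𝔥) (c d : ℤ × 𝔥) : ℂ :=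
  if S.deg c.1 + S.deg d.1 = 0 then
    if 0 < S.deg c.1 then B c.2 d.2 else if S.deg c.1 = 0 then B c.2 d.2 / 2 else 0
  else 0

/-- The product of modes. -/
def modeProd (S : ModeSystem 𝔥 X) (L : List (ℤ × 𝔥)) : Module.End ℂ X :=
  (L.map fun c => S.mode c.1 c.2).prod

/-- The normal ordered product of modes, as a sum over contractions. -/
def nordList (S : ModeSystem 𝔥 X) (B : LinearMap.BilinForm ℂ 𝔥) :
    List (ℤ × 𝔥) → Module.End ℂ X :=
  wick (fun c d => -modeContr S B c d) (modeProd S)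

variable (S : ModeSystem 𝔥 X) (B : LinearMap.BilinForm ℂ 𝔥)

theorem modeProd_cons (c : ℤ × 𝔥) (L : List (ℤ × 𝔥)) :
    modeProd S (c :: L) = S.mode c.1 c.2 * modeProd S L := by simp [modeProd]

@[simp] theorem nordList_nil : nordList S B [] = 1 := by simp [nordList, modeProd]

theorem nordList_cons (c : ℤ × 𝔥) (L : List (ℤ × 𝔥)) : nordList S B (c :: L) =
    S.mode c.1 c.2 * nordList S B L - contract (modeContr S B c) (nordList S B) L := by
  rw [nordList, wick_cons', sub_eq_add_neg]
  congr 1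
  · simp only [modeProd_cons]
    exact wick_linear (LinearMap.mulLeft ℂ (S.mode c.1 c.2)) _ (modeProd S) L
  · rw [← neg_one_smul ℂ, ← contract_smul_left]
    simp only [neg_one_mul]

theorem contract_ite {ι K M : Type*} [CommRing K] [AddCommGroup M] [Module K M] (p : ι → Prop)
    [DecidablePred p] {f : ι → K} (hf : ∀ a, ¬ p a → f a = 0) (F : List ι → M) (L : List ι) :
    contract f (fun l => if ∀ a ∈ l, p a then F l else 0) L =
      if ∀ a ∈ L, p a then contract f F L else 0 := by
  induction L generalizing F with
  | nil => simp
  | cons b L ih =>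
    rw [contract_cons]
    by_cases hb : p b
    · simp only [List.forall_mem_cons, hb, true_and, ih, contract_cons]
      split_ifs <;> simp
    · simp only [List.forall_mem_cons, hb, false_and, if_false, hf b hb, contract_zero]
      simp

/-- The product of modes if all of them satisfy `p`, zero otherwise. -/
def prodIf (p : ℚ → Prop) [DecidablePred p] (F : List (ℤ × 𝔥) → Module.End ℂ X)
    (L : List (ℤ × 𝔥)) : Module.End ℂ X :=
  if ∀ c ∈ L, p (S.deg c.1) then F L else 0

theorem prodIf_cons_neg {p : ℚ → Prop} [DecidablePred p] (F : List (ℤ × 𝔥) → Module.End ℂ X)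
    {c : ℤ × 𝔥} (hc : ¬ p (S.deg c.1)) (L : List (ℤ × 𝔥)) : prodIf S p F (c :: L) = 0 := by
  simp [prodIf, hc]

theorem prodIf_cons_pos {p : ℚ → Prop} [DecidablePred p]
    {c : ℤ × 𝔥} (hc : p (S.deg c.1)) (L : List (ℤ × 𝔥)) :
    prodIf S p (modeProd S) (c :: L) = S.mode c.1 c.2 * prodIf S p (modeProd S) L := by
  simp only [prodIf, List.forall_mem_cons, hc, true_and, modeProd_cons, mul_ite, mul_zero]

/-- A mode is moved from the left to the right through a product of modes. It picks up one sign per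
factor, and each anticommutator contributes a contraction. -/
theorem mul_prodIf {p : ℚ → Prop} [DecidablePred p] {c : ℤ × 𝔥} (f : ℤ × 𝔥 → ℂ)
    (hf : ∀ d, ¬ p (S.deg d.1) → f d = 0)
    (h : ∀ d : ℤ × 𝔥, p (S.deg d.1) → S.mode c.1 c.2 * S.mode d.1 d.2 =
      f d • 1 - S.mode d.1 d.2 * S.mode c.1 c.2) (L : List (ℤ × 𝔥)) :
    S.mode c.1 c.2 * prodIf S p (modeProd S) L =
      (-1 : ℂ) ^ L.length • (prodIf S p (modeProd S) L * S.mode c.1 c.2) +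
      contract f (prodIf S p (modeProd S)) L := by
  induction L with
  | nil => simp [prodIf, modeProd]
  | cons d L ih =>
    by_cases hd : p (S.deg d.1)
    · rw [contract_cons, prodIf_cons_pos S hd, ← mul_assoc, h d hd, sub_mul, mul_assoc, ih]
      simp only [prodIf_cons_pos S hd]
      have := contract_linear (LinearMap.mulLeft ℂ (S.mode d.1 d.2)) f
        (prodIf S p (modeProd S)) L
      simp only [LinearMap.mulLeft_apply] at this
      rw [this]
      simp only [List.length_cons, pow_succ, mul_add, mul_smul_comm, smul_mul_assoc, one_mul,
        mul_neg, mul_one, neg_smul, mul_assoc]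
      abel
    · rw [contract_cons, prodIf_cons_neg S _ hd, hf d hd]
      simp [prodIf_cons_neg S _ hd, contract_zero]

/-- The normal ordering of zero modes, as a sum over contractions. -/
def nordZeroList : List (ℤ × 𝔥) → Module.End ℂ X :=
  wick (fun c d => -(B c.2 d.2 / 2)) (modeProd S)

/-- The normal ordered product of nonnegative modes. -/
def nordNonneg : List (ℤ × 𝔥) → Module.End ℂ X :=
  unshuffle ℂ fun s c => prodIf S (0 < ·) (modeProd S) s * prodIf S (· = 0) (nordZeroList S B) c

/-- The normal ordered product, as a sum over decompositions into negative and nonnegative modes. -/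
def nordSplit : List (ℤ × 𝔥) → Module.End ℂ X :=
  unshuffle ℂ fun s c => prodIf S (· < 0) (modeProd S) s * nordNonneg S B c

variable {S B}

theorem nordNonneg_cons_neg {c : ℤ × 𝔥} (hc : S.deg c.1 < 0) (L : List (ℤ × 𝔥)) :
    nordNonneg S B (c :: L) = 0 := by
  rw [nordNonneg, unshuffle_cons]
  simp only [prodIf_cons_neg S (p := (0 < ·)) _ hc.le.not_gt,
    prodIf_cons_neg S (p := (· = 0)) _ hc.ne, zero_mul, mul_zero,
    smul_zero, unshuffle_zero, add_zero]

theorem nordNonneg_cons_pos {c : ℤ × 𝔥} (hc : 0 < S.deg c.1) (L : List (ℤ × 𝔥)) :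
    nordNonneg S B (c :: L) = S.mode c.1 c.2 * nordNonneg S B L := by
  rw [nordNonneg, unshuffle_cons]
  simp only [prodIf_cons_pos S (p := (0 < ·)) hc,
    prodIf_cons_neg S (p := (· = 0)) _ hc.ne', mul_zero, smul_zero, unshuffle_zero,
    add_zero, mul_assoc]
  exact unshuffle_linear (LinearMap.mulLeft ℂ (S.mode c.1 c.2)) _ L

/-- The zero mode anticommutes with the positive modes and so reaches the block of zero modes with
the sign of the shuffle. There the recursion for zero modes applies; its factor `1/2` is the one in
`modeContr`. -/
theorem nordNonneg_cons_zero {c : ℤ × 𝔥} (hc : S.deg c.1 = 0) (L : List (ℤ × 𝔥)) :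
    nordNonneg S B (c :: L) = S.mode c.1 c.2 * nordNonneg S B L -
      contract (modeContr S B c) (nordNonneg S B) L := by
  have hz : ∀ d : ℤ × 𝔥, ¬ S.deg d.1 = 0 → modeContr S B c d = 0 := fun d hd => by
    simp [modeContr, hc, hd]
  have h1 : ∀ l : List (ℤ × 𝔥), prodIf S (· = 0) (nordZeroList S B) (c :: l) =
      S.mode c.1 c.2 * prodIf S (· = 0) (nordZeroList S B) l -
        contract (modeContr S B c) (prodIf S (· = 0) (nordZeroList S B)) l := by
    intro l
    have h2 := contract_ite (fun d : ℤ × 𝔥 => S.deg d.1 = 0) hz (nordZeroList S B) l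
    rw [show prodIf S (· = 0) (nordZeroList S B) = fun l : List (ℤ × 𝔥) =>
      if ∀ d ∈ l, S.deg d.1 = 0 then nordZeroList S B l else 0 from rfl, h2]
    simp only [List.forall_mem_cons, hc, true_and]
    split_ifs with hl
    · rw [nordZeroList, wick_cons', sub_eq_add_neg]
      congr 1
      · simp only [modeProd_cons]
        exact wick_linear (LinearMap.mulLeft ℂ (S.mode c.1 c.2)) _ (modeProd S) l
      · rw [← neg_one_smul ℂ, ← contract_smul_left]
        refine contract_congr (fun d hd => ?_) fun _ _ _ => rfl
        simp [modeContr, hc, hl d hd]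
    · simp
  have h3 : ∀ s : List (ℤ × 𝔥), S.mode c.1 c.2 * prodIf S (0 < ·) (modeProd S) s =
      (-1 : ℂ) ^ s.length • (prodIf S (0 < ·) (modeProd S) s * S.mode c.1 c.2) := fun s => by
    rw [mul_prodIf S (fun _ => 0) (fun _ _ => rfl)]
    · rw [contract_eq_zero fun _ _ => rfl, add_zero]
    · intro d hd
      rw [S.pos_zero d.1 c.1 d.2 c.2 hd hc, zero_smul, zero_sub, neg_neg]
  have h4 := contract_unshuffle_right (modeContr S B c) (fun s c =>
    prodIf S (0 < ·) (modeProd S) s * prodIf S (· = 0) (nordZeroList S B) c) L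
  rw [nordNonneg, unshuffle_cons, h4, ← LinearMap.mulLeft_apply (R := ℂ), ← unshuffle_linear,
    ← unshuffle_sub]
  simp only [prodIf_cons_neg S (p := (0 < ·)) _ hc.not_gt, zero_mul, unshuffle_zero, zero_add]
  congr 1
  funext s d
  rw [h1, LinearMap.mulLeft_apply, ← mul_assoc, h3, smul_mul_assoc, mul_assoc, ← smul_sub]
  congr 1
  rw [mul_sub]
  congr 1
  exact (contract_linear (LinearMap.mulLeft ℂ (prodIf S (0 < ·) (modeProd S) s)) _ _ d).symm

/-- The actual normal ordering satisfies the recursion that `wick` satisfies for `nordList`. A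
negative mode is already in its place. A positive mode has to pass the negative modes, and each
anticommutator is a contraction. A zero mode passes the negative ones with signs only and is then
treated as in `nordNonneg_cons_zero`. -/
theorem nordSplit_cons (hS : S.Fermionic B) (c : ℤ × 𝔥) (L : List (ℤ × 𝔥)) :
    nordSplit S B (c :: L) = S.mode c.1 c.2 * nordSplit S B L -
      contract (modeContr S B c) (nordSplit S B) L := by
  rw [nordSplit, unshuffle_cons]
  rcases lt_trichotomy (S.deg c.1) 0 with hc | hc | hc
  · rw [contract_eq_zero (fun d _ => by simp [modeContr, hc.not_gt, hc.ne]), sub_zero]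
    simp only [prodIf_cons_pos S (p := (· < 0)) hc, nordNonneg_cons_neg hc, mul_zero, smul_zero, unshuffle_zero,
      add_zero, mul_assoc]
    exact unshuffle_linear (LinearMap.mulLeft ℂ (S.mode c.1 c.2)) _ L
  · have h3 : ∀ s : List (ℤ × 𝔥), S.mode c.1 c.2 * prodIf S (· < 0) (modeProd S) s =
        (-1 : ℂ) ^ s.length • (prodIf S (· < 0) (modeProd S) s * S.mode c.1 c.2) := fun s => by
      rw [mul_prodIf S (fun _ => 0) (fun _ _ => rfl)]
      · rw [contract_eq_zero fun _ _ => rfl, add_zero]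
      · intro d hd
        rw [hS.neg_zero d.1 c.1 d.2 c.2 hd hc, zero_smul, zero_sub, neg_neg]
    rw [contract_unshuffle_right, ← LinearMap.mulLeft_apply (R := ℂ), ← unshuffle_linear,
      ← unshuffle_sub]
    simp only [prodIf_cons_neg S (p := (· < 0)) _ hc.not_lt, zero_mul, unshuffle_zero, zero_add]
    congr 1
    funext s d
    rw [nordNonneg_cons_zero hc, LinearMap.mulLeft_apply, ← mul_assoc, h3, smul_mul_assoc,
      mul_assoc, ← smul_sub, mul_sub]
    congr 2
    exact (contract_linear (LinearMap.mulLeft ℂ (prodIf S (· < 0) (modeProd S) s)) _ _ d).symm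
  · have h3 : ∀ s : List (ℤ × 𝔥), S.mode c.1 c.2 * prodIf S (· < 0) (modeProd S) s =
        (-1 : ℂ) ^ s.length • (prodIf S (· < 0) (modeProd S) s * S.mode c.1 c.2) +
        contract (modeContr S B c) (prodIf S (· < 0) (modeProd S)) s := fun s => by
      refine mul_prodIf S _ (fun d hd => ?_) (fun d hd => ?_) s
      · rw [modeContr, if_neg]
        have := not_lt.1 hd
        linarith
      · rw [eq_sub_iff_add_eq, hS.pos_neg c.1 d.1 c.2 d.2 hc hd, modeContr, if_pos hc]
    rw [contract_unshuffle_left, ← LinearMap.mulLeft_apply (R := ℂ), ← unshuffle_linear,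
      ← unshuffle_sub]
    simp only [prodIf_cons_neg S (p := (· < 0)) _ hc.not_gt, zero_mul, unshuffle_zero, zero_add]
    congr 1
    funext s d
    have h5 := contract_linear (LinearMap.mulRight ℂ (nordNonneg S B d)) (modeContr S B c)
      (prodIf S (· < 0) (modeProd S)) s
    simp only [LinearMap.mulRight_apply] at h5
    have h6 := mul_assoc (S.mode c.1 c.2) (prodIf S (· < 0) (modeProd S) s) (nordNonneg S B d)
    rw [nordNonneg_cons_pos hc, LinearMap.mulLeft_apply, ← h6, h3, add_mul, h5,
      smul_mul_assoc, mul_assoc]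
    abel

theorem nordSplit_eq_nordList (hS : S.Fermionic B) (L : List (ℤ × 𝔥)) :
    nordSplit S B L = nordList S B L := by
  induction hk : L.length using Nat.strong_induction_on generalizing L with
  | _ k ih =>
    cases L with
    | nil => simp [nordSplit, nordNonneg, prodIf, modeProd, nordZeroList]
    | cons c L =>
      rw [nordSplit_cons hS, nordList_cons, ih _ (by rw [← hk]; simp) L rfl]
      congr 1
      exact contract_congr (fun _ _ => rfl) fun l _ hl =>
        ih _ (by rw [← hk, List.length_cons]; omega) l rfl

theorem nordNonneg_eq (L : List (ℤ × 𝔥)) : nordNonneg S B L =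
    ((splitSign (fun c : ℤ × 𝔥 => 0 < S.deg c.1) L : ℤ) : ℂ) •
      (modeProd S (L.filter fun c => 0 < S.deg c.1) *
        prodIf S (· = 0) (nordZeroList S B) (L.filter fun c => ¬ 0 < S.deg c.1)) := by
  rw [← unshuffle_ite (K := ℂ) (fun c : ℤ × 𝔥 => 0 < S.deg c.1)
    (fun s c => modeProd S s * prodIf S (· = 0) (nordZeroList S B) c) L, nordNonneg]
  congr 1
  funext s c
  by_cases hs : ∀ a ∈ s, 0 < S.deg a.1
  · by_cases hc : ∀ a ∈ c, S.deg a.1 = 0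
    · rw [if_pos ⟨hs, fun a ha => by rw [hc a ha]; exact lt_irrefl _⟩, prodIf, if_pos hs]
    · rw [show prodIf S (· = 0) (nordZeroList S B) c = 0 from if_neg hc]
      simp
  · rw [if_neg fun h => hs h.1, prodIf, if_neg hs, zero_mul]

theorem nord_eq_nordList (hS : S.Fermionic B) {r : ℕ} (n : Fin r → ℤ) (h : Fin r → 𝔥) :
    nord S B n h = nordList S B (List.ofFn fun i => (n i, h i)) := by
  rw [← nordSplit_eq_nordList hS]
  have h0 : nordSplit S B = unshuffle ℂ fun s c =>
      if (∀ a ∈ s, S.deg a.1 < 0) ∧ (∀ a ∈ c, ¬ S.deg a.1 < 0) then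
        modeProd S s * nordNonneg S B c else 0 := by
    unfold nordSplit
    congr 1
    funext s c
    by_cases hs : ∀ a ∈ s, S.deg a.1 < 0
    · by_cases hc : ∀ a ∈ c, ¬ S.deg a.1 < 0
      · rw [if_pos ⟨hs, hc⟩, prodIf, if_pos hs]
      · rw [if_neg fun h => hc h.2, nordNonneg_eq, prodIf.eq_def S (· = 0), if_neg, mul_zero,
          smul_zero, mul_zero]
        intro h'
        push Not at hc
        obtain ⟨a, ha, ha'⟩ := hc
        exact ha'.ne (h' a (List.mem_filter.2 ⟨ha, by simpa using ha'.le⟩))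
    · rw [if_neg fun h => hs h.1, prodIf, if_neg hs, zero_mul]
  rw [h0, unshuffle_ite (K := ℂ) (fun c : ℤ × 𝔥 => S.deg c.1 < 0), nordNonneg_eq]
  -- What remains is a comparison of signs: the two nested splittings by degree have together the
  -- sign of the stable sort by `kind`.
  have hkind : ∀ d : ℚ, kind d ≤ 2 := fun d => by unfold kind; split_ifs <;> simp
  have hk0 : ∀ d : ℚ, d < 0 ↔ kind d = 0 := fun d => by unfold kind; split_ifs <;> simp [*]
  have hk1 : ∀ d : ℚ, 0 < d ↔ kind d = 1 := fun d => by
    unfold kind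
    split_ifs with h1 h2
    · simp [h1.le]
    · simp [h2]
    · simp [h2]
  have e := splitSign_mul (fun c : ℤ × 𝔥 => kind (S.deg c.1)) (fun _ => hkind _)
    (List.ofFn fun i => (n i, h i))
  have h2 : ∀ d : ℚ, (¬ d < 0 ∧ ¬ 0 < d) ↔ d = 0 := fun d =>
    ⟨fun h => le_antisymm (not_lt.1 h.2) (not_lt.1 h.1), fun h => by simp [h]⟩
  have h3 : ∀ d : ℚ, (¬ d < 0 ∧ 0 < d) ↔ 0 < d := fun d =>
    ⟨fun h => h.2, fun h => ⟨h.le.not_gt, h⟩⟩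
  have e' : splitSign (fun c : ℤ × 𝔥 => S.deg c.1 < 0) (List.ofFn fun i => (n i, h i)) *
      splitSign (fun c : ℤ × 𝔥 => 0 < S.deg c.1)
        ((List.ofFn fun i => (n i, h i)).filter fun c => ¬ S.deg c.1 < 0) =
      ((Equiv.Perm.sign (Tuple.sort fun i => kind (S.deg (n i))) : ℤˣ) : ℤ) := by
    rw [sign_sort]
    rw [List.ofFn_eq_map, invSign_comap] at e
    rw [← e, List.ofFn_eq_map]
    simp only [hk0, hk1]
  rw [mul_smul_comm, smul_smul, ← Int.cast_mul, e', nord, List.filter_filter, List.filter_filter,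
    prodIf, if_pos]
  · have hb3 : ∀ d : ℚ, (decide (0 < d) && decide (¬ d < 0)) = decide (0 < d) := fun d => by
      rw [← Bool.decide_and, decide_eq_decide, and_comm]; exact h3 d
    have hb2 : ∀ d : ℚ, (decide (¬ 0 < d) && decide (¬ d < 0)) = decide (d = 0) := fun d => by
      rw [← Bool.decide_and, decide_eq_decide, and_comm]; exact h2 d
    simp only [hb2, hb3]
    rw [List.ofFn_eq_map]
    simp only [List.filter_map, nordZero_eq_wick, nordZeroList, wick_comap, modeProd, List.map_map,
      Function.comp_def, mul_assoc]
  · intro c hc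
    have := List.of_mem_filter hc
    simp at this
    exact le_antisymm this.1 this.2

/-- Wick's theorem for two normally ordered factors: only pairs with one letter in each factor are
contracted. The labels `τ` remember the factor from which a mode comes, which the mode itself does
not. -/
theorem nordList_mul {τ : Type*} (e : τ → ℤ × 𝔥) (γ : τ → τ → ℂ) {L L' : List τ}
    (h1 : ∀ a ∈ L, ∀ b ∈ L, γ a b = 0)
    (h12 : ∀ a ∈ L, ∀ b ∈ L', γ a b = modeContr S B (e a) (e b))
    (h2 : ∀ a ∈ L', ∀ b ∈ L', γ a b = 0) :
    nordList S B (L.map e) * nordList S B (L'.map e) =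
      wick γ (fun l => nordList S B (l.map e)) (L ++ L') := by
  induction hk : L.length using Nat.strong_induction_on generalizing L with
  | _ k ih =>
    cases L with
    | nil =>
      rw [List.nil_append, wick_zero_left (List.pairwise_of_forall_mem_list h2)]
      simp
    | cons a L =>
      have hlen : L.length < k := by rw [← hk]; simp
      have ihL := ih _ hlen (fun b hb c hc => h1 b (by simp [hb]) c (by simp [hc]))
        (fun b hb => h12 b (by simp [hb])) rfl
      rw [List.cons_append, wick_cons']
      have e1 : (fun l : List τ => nordList S B ((a :: l).map e)) = fun l =>
          LinearMap.mulLeft ℂ (S.mode (e a).1 (e a).2) (nordList S B (l.map e)) -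
          contract (fun b => modeContr S B (e a) (e b)) (fun l => nordList S B (l.map e)) l := by
        funext l
        rw [List.map_cons, nordList_cons, contract_comap]
        rfl
      -- The first letter `a` occurs contracted with letters of `L'` twice: with a minus sign from
      -- the recursion of the normal ordering of `a :: l`, and with a plus sign from `γ`. These
      -- terms cancel. The contractions with `L` remain and complete the normal ordering of `a ::
      -- L`.
      rw [e1, wick_sub, wick_linear, ← ihL]
      have e2 := wick_contract γ (fun b => modeContr S B (e a) (e b))
        (fun l => nordList S B (l.map e)) (L ++ L')
      rw [e2, contract_append, contract_append, contract_eq_zero (L := L) (f := γ a)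
        fun b hb => h1 a (by simp) b (by simp [hb]), contract_congr (L := L') (f := γ a)
        (h12 a (by simp)) fun _ _ _ => rfl, List.map_cons, nordList_cons, sub_mul, mul_assoc,
        contract_comap]
      have e3 : contract (fun b => modeContr S B (e a) (e b))
          (fun l => wick γ (fun l => nordList S B (l.map e)) (l ++ L')) L =
          contract (fun b => modeContr S B (e a) (e b)) (fun l => nordList S B (l.map e)) L *
            nordList S B (L'.map e) := by
        rw [← LinearMap.mulRight_apply (R := ℂ), ← contract_linear]
        refine contract_congr (fun _ _ => rfl) fun l hl hl' => ?_
        exact (ih _ (by omega) (fun b hb c hc => h1 b (by simp [hl.subset hb]) c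
          (by simp [hl.subset hc])) (fun b hb => h12 b (by simp [hl.subset hb])) rfl).symm
      rw [e3, LinearMap.mulLeft_apply]
      abel

theorem nord_eq_zero_of_trunc {D : ℚ} {x : X} (hx : Trunc S D x) {r : ℕ} (n : Fin r → ℤ)
    (h : Fin r → 𝔥) (hD : D < ∑ i, max (S.deg (n i)) 0) : nord S B n h x = 0 := by
  have e : ((List.finRange r).map fun i => max (S.deg (n i)) 0).sum =
      (((List.finRange r).filter fun i => 0 < S.deg (n i)).map fun i => S.deg (n i)).sum := by
    induction List.finRange r with
    | nil => simp
    | cons a L ih =>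
      by_cases ha : 0 < S.deg (n a)
      · simp [ha, ih, ha.le]
      · simp [ha, ih, not_lt.1 ha]
  rw [← List.sum_ofFn, List.ofFn_eq_map, e] at hD
  have h0 := (hx.nordZero n h (fun i j => B (h i) (h j))
    ((List.finRange r).filter fun i => S.deg (n i) = 0) (by simp))
    (((List.finRange r).filter fun i => 0 < S.deg (n i)).map fun i => (n i, h i)) (by simp)
    (by simpa [List.map_map, Function.comp_def] using hD)
  simp only [List.map_map, Function.comp_def] at h0
  simp only [nord, LinearMap.smul_apply, Module.End.mul_apply]
  rw [h0]
  simp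

theorem exists_trunc (S : ModeSystem 𝔥 X) (x : X) : ∃ D : ℚ, 0 ≤ D ∧ Trunc S D x := by
  obtain ⟨D, hD⟩ := S.truncated x
  exact ⟨max D 0, le_max_right _ _, fun L h1 h2 => hD L h1 (lt_of_le_of_lt (le_max_left _ _) h2)⟩

/-! ### The anticommutation relations of the modes of `V` and of `W`. -/

theorem modesV_deg (n : ℤ) : (modesV B).deg n = n + 1 / 2 := rfl

theorem modesV_deg_pos {n : ℤ} : 0 < (modesV B).deg n ↔ 0 ≤ n := by
  rw [modesV_deg]
  constructor
  · intro h
    have : (0 : ℚ) < ((2 * n + 1 : ℤ) : ℚ) := by push_cast; linarith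
    have : 0 < 2 * n + 1 := by exact_mod_cast this
    omega
  · intro h
    have : (0 : ℚ) ≤ n := by exact_mod_cast h
    linarith

theorem modesV_deg_ne (n : ℤ) : (modesV B).deg n ≠ 0 := by
  rw [modesV_deg]
  intro h
  have : ((2 * n + 1 : ℤ) : ℚ) = 0 := by push_cast; linarith
  have : 2 * n + 1 = 0 := by exact_mod_cast this
  omega

theorem modesV_deg_neg {n : ℤ} : (modesV B).deg n < 0 ↔ n < 0 := by
  rw [← not_le, ← not_le, not_iff_not, le_iff_lt_or_eq, modesV_deg_pos]
  exact or_iff_left (modesV_deg_ne n).symm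

theorem modesV_fermionic (B : LinearMap.BilinForm ℂ 𝔥) : (modesV B).Fermionic B where
  pos_neg m n a b hm hn := by
    rw [modesV_deg_pos] at hm
    rw [modesV_deg_neg] at hn
    obtain ⟨m, rfl⟩ := Int.eq_ofNat_of_zero_le hm
    obtain ⟨k, rfl⟩ := Int.eq_negSucc_of_lt_zero hn
    refine (annih_create B m k a b).trans ?_
    congr 2
    rw [modesV_deg, modesV_deg, eq_iff_iff, Int.negSucc_eq]
    push_cast
    constructor
    · rintro rfl; ring
    · intro h
      have : (m : ℚ) = k := by linarith
      exact_mod_cast this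
  neg_zero n z a b _ hz := absurd hz (modesV_deg_ne z)

/-- Degrees in `V` are never zero, so in normal order every mode that is not a creation operator is
positive, stands to the right and kills the vacuum. -/
theorem nordList_modesV_one (L : List (ℤ × 𝔥)) : nordList (modesV B) B L 1 =
    if ∀ c ∈ L, c.1 < 0 then modeProd (modesV B) L 1 else 0 := by
  have h1 : ∀ L : List (ℤ × 𝔥), nordNonneg (modesV B) B L 1 = if L = [] then 1 else 0 := by
    intro L
    induction L with
    | nil => simp [nordNonneg, prodIf, modeProd, nordZeroList]
    | cons c L ih =>
      rcases lt_trichotomy ((modesV B).deg c.1) 0 with hc | hc | hc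
      · simp [nordNonneg_cons_neg hc]
      · exact absurd hc (modesV_deg_ne _)
      · rw [nordNonneg_cons_pos hc, Module.End.mul_apply, ih]
        obtain ⟨m, hm⟩ := Int.eq_ofNat_of_zero_le (modesV_deg_pos.1 hc)
        split_ifs with h h'
        · simp at h'
        · rw [hm]; exact annih_one B m c.2
        · simp_all
        · simp
  -- If only the empty second half contributes, the sole surviving splitting is the trivial one,
  -- with sign `1`.
  have h2 : ∀ (H : List (ℤ × 𝔥) → List (ℤ × 𝔥) → FockV 𝔥) (L : List (ℤ × 𝔥)),
      (∀ s c, c ≠ [] → H s c = 0) → unshuffle ℂ H L = H L [] := by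
    intro H L
    induction L generalizing H with
    | nil => intro _; rfl
    | cons a L ih =>
      intro hH
      rw [unshuffle_cons, ih _ fun s c hc => hH _ c hc]
      have : (fun s c => (-1 : ℂ) ^ s.length • H s (a :: c)) = fun _ _ => 0 := by
        funext s c
        rw [hH s _ (by simp), smul_zero]
      rw [this, unshuffle_zero, add_zero]
  rw [← nordSplit_eq_nordList (modesV_fermionic B), nordSplit]
  have h3 := unshuffle_linear (K := ℂ) (LinearMap.applyₗ (R := ℂ) (1 : FockV 𝔥))
    (fun s c => prodIf (modesV B) (· < 0) (modeProd (modesV B)) s * nordNonneg (modesV B) B c) L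
  simp only [LinearMap.applyₗ_apply_apply] at h3
  rw [← h3, h2]
  · simp only [Module.End.mul_apply, h1, if_true, prodIf, modesV_deg_neg]
    split_ifs <;> rfl
  · intro s c hc
    simp [Module.End.mul_apply, h1, hc]

variable {U : Type v} [AddCommGroup U] [Module ℂ U] [Module (TensorAlgebra ℂ 𝔥) U]

theorem modesW_deg (n : ℤ) : (modesW B U).deg n = n := add_zero _

theorem modesW_fermionic (B : LinearMap.BilinForm ℂ 𝔥) (U : Type v) [AddCommGroup U] [Module ℂ U]
    [Module (TensorAlgebra ℂ 𝔥) U] : (modesW B U).Fermionic B where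
  pos_neg m n a b hm hn := by
    rw [modesW_deg] at hm hn
    refine (modeW_pos_neg B U m n a b (by exact_mod_cast hm) (by exact_mod_cast hn)).trans ?_
    congr 2
    rw [modesW_deg, modesW_deg, eq_iff_iff]
    norm_cast
  neg_zero n z a b hn hz := by
    rw [modesW_deg] at hn hz
    obtain rfl : z = 0 := by exact_mod_cast hz
    have hn' : n < 0 := by exact_mod_cast hn
    exact eq_neg_of_add_eq_zero_left (modeW_nonzero_zero B U n a b hn'.ne)

end NormalOrdering

/-! ### Decompositions of words and increasing sequences -/

section Sequences

variable {ι κ K M : Type*} [CommRing K] [AddCommGroup M] [Module K M]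

theorem filter_finRange_eq_ofFn {k r : ℕ} (e : Fin k ↪o Fin r) (p : Fin r → Bool)
    (h : ∀ i, p i = true ↔ i ∈ Set.range e) : (List.finRange r).filter p = List.ofFn e := by
  have hp : ((List.finRange r).filter p).Perm (List.ofFn e) := by
    rw [List.perm_ext_iff_of_nodup ((List.nodup_finRange r).filter _)
      (List.nodup_ofFn.2 e.injective)]
    intro i
    rw [List.mem_filter, List.mem_ofFn, h]
    simp
  refine hp.eq_of_pairwise' (r := (· ≤ ·)) ?_ ?_
  · exact ((List.pairwise_lt_finRange r).filter _).imp fun h => h.le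
  · exact List.pairwise_ofFn.2 fun i j hij => (e.strictMono hij).le

theorem range_complSeq {k r : ℕ} (p : Fin k ↪o Fin r) :
    Set.range (complSeq p) = (Set.range p)ᶜ := by
  rw [complSeq, Finset.range_orderEmbOfFin]
  simp

/-- The shuffle that moves positions `p₁ < ⋯ < pₖ`, counted from `1`, to the front has `∑ (pᵢ - i)`
inversions. This has the parity of `∑ pᵢ + k(k+1)/2`. -/
theorem unshuffle_finRange (r : ℕ) (H : List (Fin r) → List (Fin r) → M) :
    unshuffle K H (List.finRange r) = ∑ p : Fin r → Bool,
      (-1 : K) ^ ((∑ i, if p i then (i : ℕ) + 1 else 0) +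
        (∑ i, if p i then 1 else 0) * ((∑ i, if p i then 1 else 0) + 1) / 2) •
      H ((List.finRange r).filter p) ((List.finRange r).filter fun i => !p i) := by
  induction r with
  | zero => simp
  | succ r ih =>
    rw [List.finRange_succ, unshuffle_cons, unshuffle_comap, unshuffle_comap, ih, ih,
      ← (Fin.consEquiv fun _ => Bool).sum_comp, Fintype.sum_prod_type, Fintype.sum_bool]
    have hlen : ∀ p : Fin r → Bool, ((List.finRange r).filter p).length =
        ∑ i, if p i then 1 else 0 := by
      intro p
      rw [← List.countP_eq_length_filter, ← Finset.card_filter]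
      rw [List.countP_eq_length_filter, ← List.toFinset_card_of_nodup
        ((List.nodup_finRange r).filter _)]
      congr 1
      ext i
      simp
    have hw : ∀ (b : Bool) (p : Fin r → Bool), (∑ i : Fin (r + 1),
        if (Fin.consEquiv fun _ => Bool) (b, p) i then (i : ℕ) + 1 else 0) =
        (if b then 1 else 0) + ((∑ i, if p i then (i : ℕ) + 1 else 0) +
          ∑ i, if p i then 1 else 0) := by
      intro b p
      rw [Fin.sum_univ_succ, ← Finset.sum_add_distrib]
      congr 1
      refine Finset.sum_congr rfl fun i _ => ?_
      simp only [Fin.consEquiv_apply, Fin.cons_succ, Fin.val_succ]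
      split_ifs <;> rfl
    have hc : ∀ (b : Bool) (p : Fin r → Bool), (∑ i : Fin (r + 1),
        if (Fin.consEquiv fun _ => Bool) (b, p) i then 1 else 0) =
        (if b then 1 else 0) + ∑ i, if p i then 1 else 0 := by
      intro b p
      rw [Fin.sum_univ_succ]
      simp
    congr 1
    · refine Finset.sum_congr rfl fun p _ => ?_
      rw [hw, hc]
      simp only [List.filter_cons, Fin.consEquiv_apply, Fin.cons_zero, if_true, Bool.not_true,
        List.filter_map, Function.comp_def, Fin.cons_succ]
      congr 1
      generalize (∑ i, if p i then 1 else 0) = c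
      generalize (∑ i, if p i then (i : ℕ) + 1 else 0) = w
      have : (1 + c) * (1 + c + 1) / 2 = (c + 1) + c * (c + 1) / 2 := by
        rw [show (1 + c) * (1 + c + 1) = (c + 1) * 2 + c * (c + 1) by ring,
          Nat.add_comm, Nat.add_mul_div_right _ _ (by norm_num)]
        ring
      rw [this, show 1 + (w + c) + ((c + 1) + c * (c + 1) / 2) =
        (w + c * (c + 1) / 2) + 2 * (c + 1) by ring, pow_add _ _ (2 * (c + 1)), pow_mul]
      simp
    · refine Finset.sum_congr rfl fun p _ => ?_
      rw [hw, hc]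
      simp only [List.filter_cons, Fin.consEquiv_apply, Fin.cons_zero, if_false, Bool.not_false,
        List.filter_map, Function.comp_def, Fin.cons_succ, Bool.false_eq_true, if_true, zero_add,
        List.length_map, hlen, smul_smul, ← pow_add]
      congr 2
      ring

theorem unshuffle_ofFn {r : ℕ} (H : List ι → List ι → M) (f : Fin r → ι) :
    unshuffle K H (List.ofFn f) = ∑ k ∈ Finset.range (r + 1), ∑ p : Fin k ↪o Fin r,
      (-1 : K) ^ (seqSum p + k * (k + 1) / 2) •
        H (List.ofFn fun i => f (p i)) (List.ofFn fun i => f (complSeq p i)) := by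
  classical
  rw [List.ofFn_eq_map, unshuffle_comap, unshuffle_finRange, Finset.sum_sigma']
  symm
  refine Finset.sum_nbij (fun x i => decide (i ∈ Set.range x.2)) (fun _ _ => Finset.mem_univ _)
    ?_ ?_ ?_
  · rintro ⟨k, e⟩ - ⟨l, e'⟩ - h
    have hr : Set.range e = Set.range e' := by
      ext i
      have := congrFun h i
      simpa only [decide_eq_decide] using this
    have hkl : k = l := by
      have h1 := congrArg Set.ncard hr
      rw [← Set.image_univ, ← Set.image_univ, Set.ncard_image_of_injective _ e.injective,
        Set.ncard_image_of_injective _ e'.injective] at h1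
      simpa [Set.ncard_univ] using h1
    subst hkl
    have := (StrictMono.range_inj e.strictMono e'.strictMono).1 hr
    rw [DFunLike.coe_injective this]
  · intro p _
    refine ⟨⟨(Finset.univ.filter fun i => p i = true).card,
      Finset.orderEmbOfFin _ rfl⟩, ?_, ?_⟩
    · simp only [Finset.coe_sigma, Set.mem_sigma_iff, Finset.coe_range, Set.mem_Iio,
        Finset.coe_univ, Set.mem_univ, and_true]
      exact Nat.lt_succ_of_le ((Finset.card_le_univ _).trans (by simp))
    · funext i
      have := Finset.range_orderEmbOfFin (Finset.univ.filter fun i => p i = true) rfl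
      simp only [this]
      simp
  · rintro ⟨k, e⟩ -
    have h1 : (∑ i : Fin r, if (decide (i ∈ Set.range e)) = true then 1 else 0) = k := by
      rw [← Finset.card_filter]
      have : (Finset.univ.filter fun i : Fin r => decide (i ∈ Set.range e) = true) =
        Finset.univ.map e.toEmbedding := by ext i; simp
      rw [this]; simp
    have h2 : (∑ i : Fin r, if (decide (i ∈ Set.range e)) = true then (i : ℕ) + 1 else 0) =
        seqSum e := by
      rw [← Finset.sum_filter]
      have : (Finset.univ.filter fun i : Fin r => decide (i ∈ Set.range e) = true) =
        Finset.univ.map e.toEmbedding := by ext i; simp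
      rw [this, Finset.sum_map]
      rfl
    simp only [h1, h2]
    rw [filter_finRange_eq_ofFn e _ (by simp), filter_finRange_eq_ofFn (complSeq e) _
      (by intro i; rw [range_complSeq]; simp)]
    simp only [List.map_ofFn, Function.comp_def]

theorem orderEmb_isEmpty {k r : ℕ} (h : r < k) : IsEmpty (Fin k ↪o Fin r) :=
  ⟨fun e => by
    have := Fintype.card_le_of_injective e e.injective
    simp at this
    omega⟩

/-- For `2k` contracted letters the shuffle sign has exponent `∑ pᵢ + k(2k+1)`, which reduces to `∑
pᵢ + k`. The factor `(-1)^k` will later cancel against the minus sign of each contraction of `exp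
Δ`. -/
theorem wick_ofFn {r : ℕ} (β : ι → ι → K) (F : List ι → M) (f : Fin r → ι) :
    wick β F (List.ofFn f) = ∑ k ∈ Finset.range (r + 1), ∑ p : Fin (2 * k) ↪o Fin r,
      ((-1 : K) ^ (seqSum p + k) * totalContr β (List.ofFn fun i => f (p i))) •
        F (List.ofFn fun i => f (complSeq p i)) := by
  rw [wick_eq_unshuffle, unshuffle_ofFn]
  -- Subwords of odd length have no total contraction, and there are no increasing sequences longer
  -- than `r`. So the range can be enlarged freely before it is reindexed by half the length.
  set g : ℕ → M := fun k => ∑ p : Fin k ↪o Fin r, (-1 : K) ^ (seqSum p + k * (k + 1) / 2) •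
    totalContr β (List.ofFn fun i => f (p i)) • F (List.ofFn fun i => f (complSeq p i)) with hg
  have hodd : ∀ k, g (2 * k + 1) = 0 := fun k => by
    rw [hg]
    refine Finset.sum_eq_zero fun p _ => ?_
    rw [totalContr_odd β (by simp), zero_smul, smul_zero]
  have hbig : ∀ k, r < k → g k = 0 := fun k hk => by
    have := orderEmb_isEmpty hk
    rw [hg]
    exact Fintype.sum_empty _
  have h1 : ∀ N, ∑ k ∈ Finset.range (2 * N), g k = ∑ k ∈ Finset.range N, g (2 * k) := by
    intro N
    induction N with
    | zero => rfl
    | succ N ih =>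
      rw [show 2 * (N + 1) = 2 * N + 1 + 1 by ring, Finset.sum_range_succ, Finset.sum_range_succ,
        ih, hodd, add_zero, Finset.sum_range_succ]
  have h2 : ∑ k ∈ Finset.range (r + 1), g k = ∑ k ∈ Finset.range (2 * (r + 1)), g k := by
    refine Finset.sum_subset (fun k hk => ?_) fun k _ hk => hbig k ?_
    · simp only [Finset.mem_range] at hk ⊢; omega
    · simpa using hk
  rw [h2, h1]
  refine Finset.sum_congr rfl fun k _ => Finset.sum_congr rfl fun p _ => ?_
  rw [smul_smul]
  congr 2
  have : 2 * k * (2 * k + 1) / 2 = 2 * (k * k) + k := by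
    rw [show 2 * k * (2 * k + 1) = 2 * (2 * (k * k) + k) by ring]
    exact Nat.mul_div_cancel_left _ (by norm_num)
  rw [this, pow_add, pow_add, pow_mul, pow_add]
  simp

/-- Mixed contractions select `ρ` letters from each alphabet. Selections of unequal sizes cannot be
matched completely and drop out. -/
theorem wick_cross_ofFn {r s : ℕ} (g : ι → κ → K) (F : List (ι ⊕ κ) → M) (a : Fin r → ι)
    (b : Fin s → κ) :
    wick (crossContr g) F ((List.ofFn a).map .inl ++ (List.ofFn b).map .inr) =
      ∑ ρ ∈ Finset.range (min r s + 1), ∑ i : Fin ρ ↪o Fin r, ∑ j : Fin ρ ↪o Fin s,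
        ((-1 : K) ^ (seqSum i + seqSum j + r * ρ + ρ * (ρ + 1) / 2) *
          (Matrix.of fun α β => g (a (i α)) (b (j β))).det) •
        F ((List.ofFn fun α => a (complSeq i α)).map .inl ++
          (List.ofFn fun β => b (complSeq j β)).map .inr) := by
  rw [wick_eq_unshuffle, unshuffle_append, unshuffle_comap, unshuffle_ofFn]
  simp only [unshuffle_comap]
  simp only [unshuffle_ofFn]
  have h0 : ∀ {k l : ℕ} (i : Fin k → ι) (j : Fin l → κ), k ≠ l →
      totalContr (crossContr g) ((List.ofFn i).map .inl ++ (List.ofFn j).map .inr) = 0 :=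
    fun i j hkl => totalContr_cross_eq_zero g (by simpa using hkl)
  have h1 : Finset.range (min r s + 1) ⊆ Finset.range (r + 1) := by
    intro x hx
    simp only [Finset.mem_range] at hx ⊢; omega
  rw [← Finset.sum_subset h1]
  · refine Finset.sum_congr rfl fun ρ hρ => Finset.sum_congr rfl fun i _ => ?_
    rw [Finset.sum_eq_single ρ]
    · rw [Finset.smul_sum]
      refine Finset.sum_congr rfl fun j _ => ?_
      rw [totalContr_cross]
      simp only [smul_smul, List.length_map, List.length_ofFn, ← mul_assoc, ← pow_add]
      congr 3
      simp only [Finset.mem_range] at hρ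
      obtain ⟨d, rfl⟩ : ∃ d, r = ρ + d := ⟨r - ρ, by omega⟩
      have h2 : ρ * (ρ + 1) / 2 = ρ + ρ * (ρ - 1) / 2 := by
        cases ρ with
        | zero => rfl
        | succ n =>
          rw [show (n + 1) * (n + 1 + 1) = (n + 1) * n + (n + 1) * 2 by ring,
            Nat.add_mul_div_right _ _ (by norm_num), Nat.add_sub_cancel]
          ring
      rw [Nat.add_sub_cancel_left, h2]
      -- Four signs are combined: the two selections contribute `ρ(ρ+1)/2` each, moving the `r - ρ`
      -- surviving letters past the `ρ` selected ones of the second alphabet gives `(r-ρ)ρ`, and the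
      -- determinant gives `ρ(ρ-1)/2`. Modulo `2` the sum is `rρ + ρ(ρ+1)/2`.
      have h3 : ρ * ρ = ρ + 2 * (ρ * (ρ - 1) / 2) := by
        cases ρ with
        | zero => rfl
        | succ n =>
          rw [Nat.add_sub_cancel, Nat.mul_div_cancel' (by
            rw [mul_comm]; exact (Nat.even_mul_succ_self n).two_dvd)]
          ring
      generalize ρ * (ρ - 1) / 2 = c at *
      rw [add_mul, h3]
      ring
    · intro l _ hl
      refine Finset.sum_eq_zero fun j _ => ?_
      rw [h0 _ _ hl.symm]
      simp
    · intro h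
      simp only [Finset.mem_range] at h hρ
      omega
  · intro k hk hk'
    refine Finset.sum_eq_zero fun i _ => ?_
    rw [Finset.sum_eq_zero, smul_zero]
    intro l hl
    refine Finset.sum_eq_zero fun j _ => ?_
    rw [h0 _ _ ?_]
    · simp
    · simp only [Finset.mem_range] at hk hk' hl
      omega

end Sequences

/-! ### Expansions as Hahn series -/

/-- Series in two variables. An exponent records the power of the small variable and the total
power. -/
abbrev Ser : Type := HahnSeries (ℚ × ℚ) ℂ

/-- The exponent of `x^p y^q`: the power of the small variable and the total power. -/
def expo (R : Expansion) (p q : ℚ) : ℚ × ℚ :=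
  match R with
  | .xy => (q, p + q)
  | .yx => (p, p + q)

theorem expo_add (R : Expansion) (p q p' q' : ℚ) :
    expo R (p + p') (q + q') = expo R p q + expo R p' q' := by
  cases R <;> ext <;> simp [expo] <;> ring

theorem expo_neg (R : Expansion) (p q : ℚ) : expo R (-p) (-q) = -expo R p q := by
  cases R <;> ext <;> simp [expo] <;> ring

theorem expo_sub (R : Expansion) (p q p' q' : ℚ) :
    expo R (p - p') (q - q') = expo R p q - expo R p' q' := by
  simp only [sub_eq_add_neg, expo_add, expo_neg]

@[simp] theorem expo_zero (R : Expansion) : expo R 0 0 = 0 := by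
  cases R <;> ext <;> simp [expo]

@[simp] theorem expo_snd (R : Expansion) (p q : ℚ) : (expo R p q).2 = p + q := by
  cases R <;> rfl

theorem expo_bijective (R : Expansion) : Function.Bijective fun c : ℚ × ℚ => expo R c.1 c.2 := by
  constructor
  · rintro ⟨p, q⟩ ⟨p', q'⟩ h
    cases R <;> simp only [expo, Prod.mk.injEq] at h <;> ext <;> simp <;> linarith [h.1, h.2]
  · rintro ⟨a, b⟩
    cases R
    · exact ⟨(b - a, a), by simp [expo]⟩
    · exact ⟨(a, b - a), by simp [expo]⟩

theorem expo_inj {R : Expansion} {p q p' q' : ℚ} :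
    expo R p q = expo R p' q' ↔ p = p' ∧ q = q' := by
  have := (expo_bijective R).1.eq_iff (a := (p, q)) (b := (p', q'))
  simpa using this

/-- The equivalence between pairs of powers of `x`, `y` and exponents. -/
def expoEquiv (R : Expansion) : ℚ × ℚ ≃ ℚ × ℚ := Equiv.ofBijective _ (expo_bijective R)

@[simp] theorem expoEquiv_apply (R : Expansion) (c : ℚ × ℚ) :
    expoEquiv R c = expo R c.1 c.2 := rfl

theorem ser_ext (R : Expansion) {f g : Ser}
    (h : ∀ p q, f.coeff (expo R p q) = g.coeff (expo R p q)) : f = g := by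
  ext γ
  obtain ⟨⟨p, q⟩, rfl⟩ := (expo_bijective R).2 γ
  exact h p q

/-- The binomial coefficient with a rational lower index, zero unless this is a natural number. -/
def binomQ (α t : ℚ) : ℂ := ∑ᶠ i : ℕ, if t = i then binom α i else 0

@[simp] theorem binomQ_natCast (α : ℚ) (i : ℕ) : binomQ α i = binom α i := by
  rw [binomQ, finsum_eq_single _ i]
  · simp
  · intro j hj
    rw [if_neg]
    exact_mod_cast hj.symm

theorem binomQ_eq_zero {α t : ℚ} (h : ∀ i : ℕ, t ≠ i) : binomQ α t = 0 := by
  simp [binomQ, h]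

@[simp] theorem binom_zero (α : ℚ) : binom α 0 = 1 := by simp [binom]

theorem binom_succ (α : ℚ) (k : ℕ) : ((k : ℂ) + 1) * binom α (k + 1) = (α - k) * binom α k := by
  have h := Ring.descPochhammer_eq_factorial_smul_choose α (k + 1)
  have h' := Ring.descPochhammer_eq_factorial_smul_choose α k
  rw [descPochhammer_succ_right, Polynomial.smeval_mul, h'] at h
  simp only [Polynomial.smeval_sub, Polynomial.smeval_X, pow_one, Polynomial.smeval_natCast,
    pow_zero, nsmul_eq_mul, mul_one, Nat.factorial_succ, Nat.cast_mul] at h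
  have h0 : (k.factorial : ℚ) ≠ 0 := by positivity
  have h1 : ((k + 1 : ℕ) : ℚ) * Ring.choose α (k + 1) = (α - k) * Ring.choose α k := by
    apply mul_left_cancel₀ h0
    linear_combination -h
  have h2 := congrArg (fun q : ℚ => (q : ℂ)) h1
  simp only [binom]
  push_cast at h2
  exact h2

theorem binom_pred (α : ℚ) (k : ℕ) : (α - k) * binom α k = α * binom (α - 1) k := by
  induction k with
  | zero => simp
  | succ k ih =>
    have h1 := binom_succ α k
    have h2 := binom_succ (α - 1) k
    have h0 : ((k : ℂ) + 1) ≠ 0 := by exact_mod_cast Nat.succ_ne_zero k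
    apply mul_left_cancel₀ h0
    push_cast at h1 h2 ih ⊢
    linear_combination (α - (k + 1)) * h1 + (α - (k + 1)) * ih - α * h2

theorem binomQ_succ (α t : ℚ) : ((t : ℂ) + 1) * binomQ α (t + 1) = (α - t) * binomQ α t := by
  by_cases h : ∃ i : ℕ, t = i
  · obtain ⟨i, rfl⟩ := h
    have := binomQ_natCast α (i + 1)
    push_cast at this ⊢
    rw [this, binomQ_natCast, binom_succ]
  · push Not at h
    rw [binomQ_eq_zero h, mul_zero]
    by_cases h1 : t = -1
    · subst h1; simp
    · rw [binomQ_eq_zero, mul_zero]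
      intro i hi
      cases i with
      | zero => exact h1 (by push_cast at hi; linarith)
      | succ i => exact h i (by push_cast at hi; linarith)

theorem binomQ_pred (α t : ℚ) : ((α : ℂ) - t) * binomQ α t = α * binomQ (α - 1) t := by
  by_cases h : ∃ i : ℕ, t = i
  · obtain ⟨i, rfl⟩ := h
    rw [binomQ_natCast, binomQ_natCast, ← binom_pred]
    push_cast
    rfl
  · push Not at h
    rw [binomQ_eq_zero h, binomQ_eq_zero h, mul_zero, mul_zero]

/-- `(1 + z)^α` as a series in the ratio `z` of the small variable and the large one. -/
def oneAddPow (α : ℚ) : Ser :=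
  HahnSeries.embDomainRingHom (((AddMonoidHom.inl ℚ ℚ).comp (Nat.castAddMonoidHom ℚ)))
    (fun a b h => by simpa using h) (fun a b => by simp)
    (HahnSeries.toPowerSeries.symm (PowerSeries.binomialSeries ℂ α))

theorem oneAddPow_coeff (α t v : ℚ) :
    (oneAddPow α).coeff (t, v) = if v = 0 then binomQ α t else 0 := by
  change (HahnSeries.embDomain ⟨⟨fun i : ℕ => ((i : ℚ), (0 : ℚ)), _⟩, _⟩ _).coeff _ = _
  by_cases h : ∃ i : ℕ, (t, v) = ((i : ℚ), (0 : ℚ))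
  · obtain ⟨i, hi⟩ := h
    simp only [Prod.mk.injEq] at hi
    obtain ⟨rfl, rfl⟩ := hi
    rw [if_pos rfl, binomQ_natCast]
    refine (HahnSeries.embDomain_coeff (a := i)).trans ?_
    simp [binom, Rat.smul_def]
  · refine (HahnSeries.embDomain_of_notMem_range ?_).trans ?_
    · rintro ⟨i, hi⟩
      exact h ⟨i, hi.symm⟩
    · split_ifs with hv
      · subst hv
        rw [binomQ_eq_zero]
        intro i hi
        exact h ⟨i, by rw [hi]⟩
      · rfl

theorem oneAddPow_add (α β : ℚ) : oneAddPow (α + β) = oneAddPow α * oneAddPow β := by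
  rw [oneAddPow, PowerSeries.binomialSeries_add, map_mul, map_mul]
  rfl

@[simp] theorem oneAddPow_zero : oneAddPow 0 = 1 := by
  simp [oneAddPow, PowerSeries.binomialSeries_zero]

/-- The expansion of `(x + y)^α y^β x^γ`. -/
def monoSer (R : Expansion) (α β γ : ℚ) : Ser :=
  HahnSeries.single (expo R γ β + (0, α)) 1 * oneAddPow α

/-- This is the exponent law of the binomial series. It makes both expansions ring homomorphisms on
algebraic functions. -/
theorem monoSer_mul (R : Expansion) (α β γ α' β' γ' : ℚ) :
    monoSer R α β γ * monoSer R α' β' γ' = monoSer R (α + α') (β + β') (γ + γ') := by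
  simp only [monoSer, oneAddPow_add]
  rw [mul_mul_mul_comm, HahnSeries.single_mul_single, mul_one, expo_add]
  have : expo R γ β + (0, α) + (expo R γ' β' + (0, α')) =
      expo R γ β + expo R γ' β' + (0, α + α') := by
    rw [add_add_add_comm]; simp
  rw [this]

@[simp] theorem monoSer_zero (R : Expansion) : monoSer R 0 0 0 = 1 := by
  simp only [monoSer, expo_zero, oneAddPow_zero, mul_one, zero_add]
  rfl

theorem monoSer_coeff (R : Expansion) (α β γ p q : ℚ) :
    (monoSer R α β γ).coeff (expo R p q) =
      if p + q = α + β + γ then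
        binomQ α (match R with | .xy => q - β | .yx => p - γ) else 0 := by
  rw [monoSer, HahnSeries.coeff_single_mul, one_mul]
  cases R
  · have : expo .xy p q - (expo .xy γ β + (0, α)) = (q - β, p + q - (α + β + γ)) := by
      ext <;> simp [expo]; ring
    rw [this, oneAddPow_coeff]
    simp [sub_eq_zero]
  · have : expo .yx p q - (expo .yx γ β + (0, α)) = (p - γ, p + q - (α + β + γ)) := by
      ext <;> simp [expo]; ring
    rw [this, oneAddPow_coeff]
    simp [sub_eq_zero]

theorem iotaMono_eq_coeff (R : Expansion) (α β : ℚ) (γ : ℤ) (p q : ℚ) :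
    iotaMono R α β γ p q = (monoSer R α β γ).coeff (expo R p q) := by
  rw [monoSer_coeff]
  cases R
  · simp only [iotaMono, binomQ]
    split_ifs with h
    · refine finsum_congr fun i => if_congr ⟨fun h' => ?_, fun h' => ⟨?_, ?_⟩⟩ rfl rfl <;>
        linarith
    · refine (finsum_congr fun i => if_neg fun h' => h ?_).trans finsum_zero
      linarith
  · simp only [iotaMono, binomQ]
    split_ifs with h
    · refine finsum_congr fun i => if_congr ⟨fun h' => ?_, fun h' => ⟨?_, ?_⟩⟩ rfl rfl <;>
        linarith
    · refine (finsum_congr fun i => if_neg fun h' => h ?_).trans finsum_zero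
      linarith

/-- The expansion of algebraic functions as a homomorphism. -/
def iotaHom (R : Expansion) : AlgFun →ₐ[ℂ] Ser :=
  AddMonoidAlgebra.lift ℂ Ser (ℚ × ℚ × ℤ)
    { toFun := fun t => monoSer R t.toAdd.1 t.toAdd.2.1 t.toAdd.2.2
      map_one' := by simp
      map_mul' := fun a b => by simp [monoSer_mul] }

theorem iotaHom_mono (R : Expansion) (α β : ℚ) (γ : ℤ) (c : ℂ) :
    iotaHom R (.mono α β γ c) = c • monoSer R α β γ := by
  rw [iotaHom, AlgFun.mono, AddMonoidAlgebra.lift_single]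
  rfl

theorem iotaHom_coeff (R : Expansion) (A : AlgFun) (p q : ℚ) :
    (iotaHom R A).coeff (expo R p q) = iota R A p q := by
  induction A using AddMonoidAlgebra.induction_linear with
  | zero => simp [iota]
  | add f g hf hg =>
    rw [map_add, HahnSeries.coeff_add, hf, hg, iota, iota, iota, AddMonoidAlgebra.coeff_add,
      Finsupp.sum_add_index'] <;> simp [add_mul]
  | single t c =>
    have := iotaHom_mono R t.1 t.2.1 t.2.2 c
    rw [AlgFun.mono] at this
    rw [this, HahnSeries.coeff_smul, ← iotaMono_eq_coeff, iota, AddMonoidAlgebra.coeff_single,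
      Finsupp.sum_single_index] <;> simp

open Filter

/-! ### Coefficientwise limits -/

/-- Coefficientwise eventual equality, the supports being contained in one partially well-ordered
set. -/
def Tends (f : ℕ → Ser) (g : Ser) : Prop :=
  (∃ s : Set (ℚ × ℚ), s.IsPWO ∧ ∀ N, (f N).support ⊆ s) ∧
    ∀ γ, ∀ᶠ N in atTop, (f N).coeff γ = g.coeff γ

theorem Tends.const (g : Ser) : Tends (fun _ => g) g :=
  ⟨⟨_, g.isPWO_support, fun _ => le_rfl⟩, fun _ => Eventually.of_forall fun _ => rfl⟩

theorem Tends.unique {f : ℕ → Ser} {g g' : Ser} (h : Tends f g) (h' : Tends f g') : g = g' := by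
  ext γ
  obtain ⟨N, hN⟩ := ((h.2 γ).and (h'.2 γ)).exists
  exact hN.1.symm.trans hN.2

theorem Tends.congr {f f' : ℕ → Ser} {g : Ser} (h : Tends f g) (hf : ∀ N, f' N = f N) :
    Tends f' g := by
  rwa [show f' = f from funext hf]

theorem Tends.add {f f' : ℕ → Ser} {g g' : Ser} (h : Tends f g) (h' : Tends f' g') :
    Tends (fun N => f N + f' N) (g + g') := by
  obtain ⟨⟨s, hs, hf⟩, hc⟩ := h
  obtain ⟨⟨s', hs', hf'⟩, hc'⟩ := h'
  refine ⟨⟨s ∪ s', hs.union hs', fun N => (HahnSeries.support_add_subset _ _).trans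
    (Set.union_subset_union (hf N) (hf' N))⟩, fun γ => ?_⟩
  filter_upwards [hc γ, hc' γ] with N h1 h2
  simp [h1, h2]

-- The common supports make each coefficient of `f N * f' N` a sum over a finite set of pairs of
-- exponents that does not depend on `N`. Finitely many coefficients become constant simultaneously.
open scoped Pointwise in
theorem Tends.mul {f f' : ℕ → Ser} {g g' : Ser} (h : Tends f g) (h' : Tends f' g') :
    Tends (fun N => f N * f' N) (g * g') := by
  obtain ⟨⟨s, hs, hf⟩, hc⟩ := h
  obtain ⟨⟨s', hs', hf'⟩, hc'⟩ := h'
  have hg : g.support ⊆ s := fun γ hγ => by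
    obtain ⟨N, hN⟩ := (hc γ).exists
    exact hf N (by rw [HahnSeries.mem_support, hN]; exact hγ)
  have hg' : g'.support ⊆ s' := fun γ hγ => by
    obtain ⟨N, hN⟩ := (hc' γ).exists
    exact hf' N (by rw [HahnSeries.mem_support, hN]; exact hγ)
  have key : ∀ (a b : Ser) (_ : a.support ⊆ s) (_ : b.support ⊆ s') (γ : ℚ × ℚ),
      (a * b).coeff γ = ∑ ij ∈ Finset.antidiagonal hs hs' γ, a.coeff ij.1 * b.coeff ij.2 := by
    intro a b ha hb γ
    rw [HahnSeries.coeff_mul_left' hs ha]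
    refine Finset.sum_subset_zero_on_sdiff ?_ ?_ fun _ _ => rfl
    · intro ij hij
      rw [Finset.mem_antidiagonal] at hij ⊢
      exact ⟨hij.1, hb hij.2.1, hij.2.2⟩
    · intro ij hij
      rw [Finset.mem_sdiff, Finset.mem_antidiagonal, Finset.mem_antidiagonal] at hij
      have : ij.2 ∉ b.support := fun h => hij.2 ⟨hij.1.1, h, hij.1.2.2⟩
      rw [HahnSeries.mem_support, not_not] at this
      rw [this, mul_zero]
  refine ⟨⟨s + s', hs.add hs', fun N => HahnSeries.support_mul_subset.trans
    (Set.add_subset_add (hf N) (hf' N))⟩, fun γ => ?_⟩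
  have : ∀ᶠ N in atTop, ∀ ij ∈ Finset.antidiagonal hs hs' γ,
      (f N).coeff ij.1 = g.coeff ij.1 ∧ (f' N).coeff ij.2 = g'.coeff ij.2 :=
    (Finset.eventually_all _).2 fun ij _ => (hc ij.1).and (hc' ij.2)
  filter_upwards [this] with N hN
  rw [key _ _ (hf N) (hf' N), key _ _ hg hg']
  exact Finset.sum_congr rfl fun ij hij => by rw [(hN ij hij).1, (hN ij hij).2]

theorem Tends.smul {f : ℕ → Ser} {g : Ser} (h : Tends f g) (c : ℂ) :
    Tends (fun N => c • f N) (c • g) := by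
  have := (Tends.const (HahnSeries.C c)).mul h
  simpa only [HahnSeries.C_mul_eq_smul] using this

theorem Tends.neg {f : ℕ → Ser} {g : Ser} (h : Tends f g) : Tends (fun N => -f N) (-g) := by
  have e : ∀ x : Ser, (-1 : ℂ) • x = -x := fun x => by ext; simp
  simpa only [e] using h.smul (-1)

theorem Tends.sub {f f' : ℕ → Ser} {g g' : Ser} (h : Tends f g) (h' : Tends f' g') :
    Tends (fun N => f N - f' N) (g - g') := by
  simpa only [sub_eq_add_neg] using h.add h'.neg

theorem Tends.prod {σ : Type*} (T : Finset σ) {f : σ → ℕ → Ser} {g : σ → Ser}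
    (h : ∀ t ∈ T, Tends (f t) (g t)) : Tends (fun N => ∏ t ∈ T, f t N) (∏ t ∈ T, g t) := by
  classical
  induction T using Finset.induction_on with
  | empty => simpa using Tends.const 1
  | insert a T ha ih =>
    simp only [Finset.prod_insert ha]
    exact (h a (by simp)).mul (ih fun t ht => h t (by simp [ht]))

theorem tends_contract {ι : Type*} {β : ℕ → ι → Ser} {β' : ι → Ser} {F : ℕ → List ι → Ser}
    {F' : List ι → Ser} {L : List ι} (hβ : ∀ a ∈ L, Tends (fun N => β N a) (β' a))
    (hF : ∀ l, Tends (fun N => F N l) (F' l)) :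
    Tends (fun N => contract (β N) (F N) L) (contract β' F' L) := by
  induction L generalizing F F' with
  | nil => exact Tends.const 0
  | cons a L ih =>
    simp only [contract_cons, smul_eq_mul]
    exact ((hβ a (by simp)).mul (hF L)).sub
      (ih (fun b hb => hβ b (by simp [hb])) fun l => hF (a :: l))

open Classical in
theorem tends_wick {ι : Type*} {β : ℕ → ι → ι → Ser} {β' : ι → ι → Ser} {F : ℕ → List ι → Ser}
    {F' : List ι → Ser} {L : List ι}
    (hβ : L.Pairwise fun a b => Tends (fun N => β N a b) (β' a b))
    (hF : ∀ l, l.Sublist L → Tends (fun N => F N l) (F' l)) :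
    Tends (fun N => wick (β N) (F N) L) (wick β' F' L) := by
  induction L generalizing F F' with
  | nil => exact hF [] (List.Sublist.refl _)
  | cons a L ih =>
    rw [List.pairwise_cons] at hβ
    simp only [wick_cons]
    refine ih hβ.2 fun l hl => (hF _ (hl.cons_cons a)).add ?_
    -- Convergence is known on subwords only. Setting the functionals to zero elsewhere does not
    -- affect the contraction and makes convergence hold for all words.
    have h1 : ∀ N, contract (β N a) (F N) l =
        contract (β N a) (fun l' => if l'.Sublist L then F N l' else 0) l := fun N =>
      contract_congr (fun _ _ => rfl) fun l' hl' _ => by rw [if_pos (hl'.trans hl)]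
    have h2 : contract (β' a) F' l =
        contract (β' a) (fun l' => if l'.Sublist L then F' l' else 0) l :=
      contract_congr (fun _ _ => rfl) fun l' hl' _ => by rw [if_pos (hl'.trans hl)]
    simp only [h1, h2]
    refine tends_contract (fun b hb => hβ.1 b (hl.subset hb)) fun l' => ?_
    by_cases h : l'.Sublist L
    · simpa only [if_pos h] using hF l' (h.cons a)
    · simpa only [if_neg h] using Tends.const 0

/-- The series with the given coefficients, if their support is partially well-ordered. -/
def serOf (f : ℚ × ℚ → ℂ) : Ser :=
  open Classical in if h : (Function.support f).IsPWO then ⟨f, h⟩ else 0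

theorem serOf_coeff {f : ℚ × ℚ → ℂ} {s : Set (ℚ × ℚ)} (hs : s.IsPWO)
    (h : Function.support f ⊆ s) (γ : ℚ × ℚ) : (serOf f).coeff γ = f γ := by
  rw [serOf, dif_pos (hs.mono h)]

/-- Sums over growing finite sets of families that converge termwise. -/
theorem Tends.sum_exhaust {I : Type*} {Λ : ℕ → Finset I} (hΛ : ∀ i, ∀ᶠ N in atTop, i ∈ Λ N)
    {f : ℕ → I → Ser} {g : I → Ser} (hf : ∀ i γ, ∀ᶠ N in atTop, (f N i).coeff γ = (g i).coeff γ)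
    {s : Set (ℚ × ℚ)} (hs : s.IsPWO) (hfs : ∀ N i, (f N i).support ⊆ s)
    (hfin : ∀ γ, ∃ T : Finset I, ∀ N, ∀ i ∉ T, (f N i).coeff γ = 0) :
    Tends (fun N => ∑ i ∈ Λ N, f N i) (serOf fun γ => ∑ᶠ i, (g i).coeff γ) := by
  classical
  have hgs : ∀ i, (g i).support ⊆ s := fun i γ hγ => by
    obtain ⟨N, hN⟩ := (hf i γ).exists
    exact hfs N i (by rw [HahnSeries.mem_support, hN]; exact hγ)
  refine ⟨⟨s, hs, fun N γ hγ => ?_⟩, fun γ => ?_⟩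
  · by_contra h
    apply hγ
    rw [HahnSeries.coeff_sum]
    refine Finset.sum_eq_zero fun i _ => ?_
    by_contra h'
    exact h (hfs N i h')
  · rw [serOf_coeff hs]
    · obtain ⟨T, hT⟩ := hfin γ
      have hT' : ∀ i ∉ T, (g i).coeff γ = 0 := fun i hi => by
        obtain ⟨N, hN⟩ := (hf i γ).exists
        rw [← hN, hT N i hi]
      have h1 : ∀ᶠ N in atTop, ∀ i ∈ T, i ∈ Λ N ∧ (f N i).coeff γ = (g i).coeff γ :=
        (Finset.eventually_all _).2 fun i _ => (hΛ i).and (hf i γ)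
      filter_upwards [h1] with N hN
      rw [HahnSeries.coeff_sum, finsum_eq_sum_of_support_subset _ (s := T)]
      · rw [← Finset.sum_subset (fun i hi => (hN i hi).1) fun i _ hi => hT N i hi]
        exact Finset.sum_congr rfl fun i hi => (hN i hi).2
      · intro i hi
        by_contra h
        exact hi (hT' i h)
    · intro γ' hγ'
      by_contra h
      apply hγ'
      refine (finsum_congr fun i => ?_).trans finsum_zero
      by_contra h'
      exact h (hgs i h')

/-- The group of half integers. -/
def halfInts : AddSubgroup ℚ := AddSubgroup.zmultiples (1 / 2)

theorem half_mem : (1 / 2 : ℚ) ∈ halfInts := AddSubgroup.mem_zmultiples _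

theorem intCast_mem_halfInts (i : ℤ) : (i : ℚ) ∈ halfInts :=
  AddSubgroup.mem_zmultiples_iff.2 ⟨2 * i, by simp [zsmul_eq_mul]; ring⟩

theorem natCast_mem_halfInts (i : ℕ) : (i : ℚ) ∈ halfInts := intCast_mem_halfInts i

/-- The half-integral exponents bounded below by `-c`. -/
def halfBox (c : ℚ) : Set (ℚ × ℚ) :=
  {γ | (-c ≤ γ.1 ∧ γ.1 ∈ halfInts) ∧ -c ≤ γ.2 ∧ γ.2 ∈ halfInts}

/-- Half-integers bounded below form a well-ordered set, and products of two such sets are partially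
well-ordered. Half-integrality is essential, because intervals of rational exponents would not do.
-/
theorem halfBox_isPWO (c : ℚ) : (halfBox c).IsPWO := by
  have h1 : {a : ℚ | -c ≤ a ∧ a ∈ halfInts}.IsPWO := by
    have h : (Set.Ici ⌊-c * 2⌋).IsPWO := bddBelow_Ici.isWF.isPWO
    refine (h.image_of_monotone (f := fun i : ℤ => (i : ℚ) * (1 / 2)) fun i j hij => ?_).mono ?_
    · have : (i : ℚ) ≤ j := by exact_mod_cast hij
      linarith
    · rintro a ⟨ha, hi⟩
      obtain ⟨i, rfl⟩ := AddSubgroup.mem_zmultiples_iff.1 hi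
      rw [zsmul_eq_mul] at ha ⊢
      refine ⟨i, ?_, rfl⟩
      have : ((⌊-c * 2⌋ : ℤ) : ℚ) ≤ i := (Int.floor_le _).trans (by linarith)
      exact_mod_cast this
  exact h1.prod h1

open Filter

/-! ### Derivatives -/

/-- The coefficients of `∂f/∂x`. -/
def derX (f : ℚ → ℚ → ℂ) (p q : ℚ) : ℂ := (p + 1) * f (p + 1) q

/-- The coefficients of `∂f/∂y - ∂f/∂x`, the derivative by `y` at constant `x + y`. -/
def derYX (f : ℚ → ℚ → ℂ) (p q : ℚ) : ℂ := (q + 1) * f p (q + 1) - (p + 1) * f (p + 1) q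

/-- The coefficient of `x^p y^q` in the expansion of `(x + y)^α y^β x^γ`. -/
def monoCoeff (R : Expansion) (α β γ p q : ℚ) : ℂ := (monoSer R α β γ).coeff (expo R p q)

/-- The Leibniz rule for `(x+y)^α y^β x^γ`, read off from the recursions of binomial coefficients.
-/
theorem derX_monoCoeff (R : Expansion) (α β γ p q : ℚ) :
    derX (monoCoeff R α β γ) p q =
      α * monoCoeff R (α - 1) β γ p q + γ * monoCoeff R α β (γ - 1) p q := by
  simp only [derX, monoCoeff, monoSer_coeff]
  by_cases h : p + q = α + β + γ - 1
  · rw [if_pos (by linarith), if_pos (by linarith), if_pos (by linarith)]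
    cases R
    · have h1 := binomQ_pred α (q - β)
      have h2 : (p : ℂ) = α + β + γ - 1 - q := by
        have : p = α + β + γ - 1 - q := by linarith
        exact_mod_cast congrArg (Rat.cast : ℚ → ℂ) this
      simp only
      rw [← h1, h2]
      push_cast
      ring
    · have h1 := binomQ_pred α (p - γ)
      have h2 := binomQ_succ α (p - γ)
      simp only
      rw [← h1, ← h2, show p - (γ - 1) = p - γ + 1 by ring, show p + 1 - γ = p - γ + 1 by ring]
      push_cast
      ring
  · rw [if_neg fun h' => h (by linarith), if_neg fun h' => h (by linarith),
      if_neg fun h' => h (by linarith)]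
    ring

/-- `∂/∂y - ∂/∂x` kills every power of `x + y`. -/
theorem derYX_monoCoeff (R : Expansion) (α β γ p q : ℚ) :
    derYX (monoCoeff R α β γ) p q =
      β * monoCoeff R α (β - 1) γ p q - γ * monoCoeff R α β (γ - 1) p q := by
  simp only [derYX, monoCoeff, monoSer_coeff]
  by_cases h : p + q = α + β + γ - 1
  · rw [if_pos (by linarith), if_pos (by linarith), if_pos (by linarith), if_pos (by linarith)]
    have h2 : (p : ℂ) = α + β + γ - 1 - q := by
      have : p = α + β + γ - 1 - q := by linarith
      exact_mod_cast congrArg (Rat.cast : ℚ → ℂ) this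
    cases R
    · have h1 := binomQ_succ α (q - β)
      simp only
      rw [show q - (β - 1) = q - β + 1 by ring, show q + 1 - β = q - β + 1 by ring]
      push_cast at h1
      linear_combination h1 - binomQ α (q - β) * h2
    · have h1 := binomQ_succ α (p - γ)
      simp only
      rw [show p - (γ - 1) = p - γ + 1 by ring, show p + 1 - γ = p - γ + 1 by ring]
      push_cast at h1
      linear_combination -h1 + binomQ α (p - γ) * h2
  · rw [if_neg fun h' => h (by linarith), if_neg fun h' => h (by linarith),
      if_neg fun h' => h (by linarith), if_neg fun h' => h (by linarith)]
    ring

theorem iota_mono (R : Expansion) (α β : ℚ) (γ : ℤ) (c : ℂ) (p q : ℚ) :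
    iota R (.mono α β γ c) p q = c * monoCoeff R α β γ p q := by
  rw [← iotaHom_coeff, iotaHom_mono, HahnSeries.coeff_smul]
  rfl

theorem iota_add (R : Expansion) (A A' : AlgFun) (p q : ℚ) :
    iota R (A + A') p q = iota R A p q + iota R A' p q := by
  simp only [← iotaHom_coeff, map_add, HahnSeries.coeff_add]

theorem iota_neg (R : Expansion) (A : AlgFun) (p q : ℚ) : iota R (-A) p q = -iota R A p q := by
  simp only [← iotaHom_coeff, map_neg, HahnSeries.coeff_neg]

theorem iota_smul (R : Expansion) (c : ℂ) (A : AlgFun) (p q : ℚ) :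
    iota R (c • A) p q = c * iota R A p q := by
  simp only [← iotaHom_coeff, map_smul, HahnSeries.coeff_smul, smul_eq_mul]

theorem algFun_mono_add (α β : ℚ) (γ : ℤ) (c c' : ℂ) :
    AlgFun.mono α β γ (c + c') = .mono α β γ c + .mono α β γ c' := by
  simp [AlgFun.mono, AddMonoidAlgebra.single_add]

theorem algFun_mono_zero (α β : ℚ) (γ : ℤ) : AlgFun.mono α β γ 0 = 0 := by
  simp [AlgFun.mono]

theorem d1_add (A A' : AlgFun) : (A + A').d1 = A.d1 + A'.d1 := by
  rw [AlgFun.d1, AlgFun.d1, AlgFun.d1, AddMonoidAlgebra.coeff_add, Finsupp.sum_add_index']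
  · intro t; simp [algFun_mono_zero]
  · intro t c c'; rw [add_mul, add_mul, algFun_mono_add, algFun_mono_add]; abel

theorem d2_add (A A' : AlgFun) : (A + A').d2 = A.d2 + A'.d2 := by
  rw [AlgFun.d2, AlgFun.d2, AlgFun.d2, AddMonoidAlgebra.coeff_add, Finsupp.sum_add_index']
  · intro t; simp [algFun_mono_zero]
  · intro t c c'; rw [add_mul, add_mul, algFun_mono_add, algFun_mono_add]; abel

/-- The substitution `x₁ = x + y` turns `∂/∂x₁` at constant `y` into `∂/∂x`. -/
theorem iota_d1 (R : Expansion) (A : AlgFun) (p q : ℚ) :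
    iota R A.d1 p q = derX (iota R A) p q := by
  induction A using AddMonoidAlgebra.induction_linear with
  | zero => simp [iota, AlgFun.d1, derX]
  | add f g hf hg => rw [d1_add, iota_add, hf, hg, derX, derX, derX, iota_add]; ring
  | single t c =>
    obtain ⟨α, β, γ⟩ := t
    have h1 : derX (iota R (AddMonoidAlgebra.single (α, β, γ) c)) p q =
        c * derX (monoCoeff R α β γ) p q := by
      simp only [derX]
      rw [← AlgFun.mono, iota_mono]
      ring
    have h2 : AlgFun.d1 (AddMonoidAlgebra.single (α, β, γ) c) =
        .mono (α - 1) β γ (c * α) + .mono α β (γ - 1) (c * γ) := by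
      rw [AlgFun.d1, AddMonoidAlgebra.coeff_single, Finsupp.sum_single_index]
      simp [algFun_mono_zero]
    rw [h1, h2, iota_add, iota_mono, iota_mono, derX_monoCoeff]
    push_cast
    ring

/-- The substitution `x₁ = x + y` turns `∂/∂y` at constant `x₁` into `∂/∂y - ∂/∂x`. -/
theorem iota_d2 (R : Expansion) (A : AlgFun) (p q : ℚ) :
    iota R A.d2 p q = derYX (iota R A) p q := by
  induction A using AddMonoidAlgebra.induction_linear with
  | zero => simp [iota, AlgFun.d2, derYX]
  | add f g hf hg =>
    rw [d2_add, iota_add, hf, hg, derYX, derYX, derYX, iota_add, iota_add]; ring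
  | single t c =>
    obtain ⟨α, β, γ⟩ := t
    have h1 : derYX (iota R (AddMonoidAlgebra.single (α, β, γ) c)) p q =
        c * derYX (monoCoeff R α β γ) p q := by
      simp only [derYX]
      rw [← AlgFun.mono, iota_mono, iota_mono]
      ring
    have h2 : AlgFun.d2 (AddMonoidAlgebra.single (α, β, γ) c) =
        .mono α (β - 1) γ (c * β) - .mono α β (γ - 1) (c * γ) := by
      rw [AlgFun.d2, AddMonoidAlgebra.coeff_single, Finsupp.sum_single_index]
      simp [algFun_mono_zero]
    rw [h1, h2, sub_eq_add_neg, iota_add, iota_neg, iota_mono, iota_mono, derYX_monoCoeff]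
    push_cast
    ring

/-- A characterization of the expansions of the functions `g_{mn}` by recursion. -/
theorem eventually_eq_iota_gDer (R : Expansion) (G : ℕ → ℕ → ℕ → ℚ → ℚ → ℂ)
    (h0 : ∀ p q, ∀ᶠ N in atTop, G N 0 0 p q = iota R gFun p q)
    (h1 : ∀ (m n : ℕ) p q, ∀ᶠ N in atTop, ((m : ℂ) + 1) * G N (m + 1) n p q = derX (G N m n) p q)
    (h2 : ∀ (n : ℕ) p q, ∀ᶠ N in atTop, ((n : ℂ) + 1) * G N 0 (n + 1) p q = derYX (G N 0 n) p q)
    (m n : ℕ) (p q : ℚ) : ∀ᶠ N in atTop, G N m n p q = iota R (gDer m n) p q := by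
  -- As in the definition of `gDer`, the derivatives by `y` are taken first. That is why the
  -- recursion in `n` is only required at `m = 0`.
  have hn : ∀ n p q, ∀ᶠ N in atTop,
      (n.factorial : ℂ) * G N 0 n p q = iota R (AlgFun.d2^[n] gFun) p q := by
    intro n
    induction n with
    | zero => simpa using h0
    | succ n ih =>
      intro p q
      filter_upwards [h2 n p q, ih p (q + 1), ih (p + 1) q] with N e1 e2 e3
      rw [Function.iterate_succ_apply', iota_d2, derYX, ← e2, ← e3, Nat.factorial_succ]
      rw [derYX] at e1
      push_cast
      linear_combination (n.factorial : ℂ) * e1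
  have hm : ∀ m p q, ∀ᶠ N in atTop, (m.factorial : ℂ) * n.factorial * G N m n p q =
      iota R (AlgFun.d1^[m] (AlgFun.d2^[n] gFun)) p q := by
    intro m
    induction m with
    | zero => simpa using hn n
    | succ m ih =>
      intro p q
      filter_upwards [h1 m n p q, ih (p + 1) q] with N e1 e2
      rw [Function.iterate_succ_apply', iota_d1, derX, ← e2, Nat.factorial_succ]
      rw [derX] at e1
      push_cast
      linear_combination (m.factorial : ℂ) * n.factorial * e1
  filter_upwards [hm m p q] with N e
  rw [gDer, iota_smul, ← e]
  have : (m.factorial : ℂ) ≠ 0 := by exact_mod_cast m.factorial_ne_zero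
  have : (n.factorial : ℂ) ≠ 0 := by exact_mod_cast n.factorial_ne_zero
  field_simp

theorem binomQ_pascal (α t : ℚ) : binomQ (α + 1) (t + 1) = binomQ α (t + 1) + binomQ α t := by
  by_cases h : ∃ i : ℕ, t = i
  · obtain ⟨i, rfl⟩ := h
    have e : ∀ β : ℚ, binomQ β ((i : ℚ) + 1) = binom β (i + 1) := fun β => by
      rw [← binomQ_natCast]
      push_cast
      rfl
    rw [e, e, binomQ_natCast]
    simp only [binom]
    rw [Ring.choose_succ_succ]
    push_cast
    ring
  · push Not at h
    rw [binomQ_eq_zero h, add_zero]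
    by_cases h1 : t = -1
    · subst h1
      have e : ∀ β : ℚ, binomQ β (-1 + 1) = binom β 0 := fun β => by
        rw [← binomQ_natCast]; norm_num
      rw [e, e, binom_zero, binom_zero]
    · have h2 : ∀ i : ℕ, t + 1 ≠ i := by
        intro i hi
        cases i with
        | zero => exact h1 (by push_cast at hi; linarith)
        | succ i => exact h i (by push_cast at hi; linarith)
      rw [binomQ_eq_zero h2, binomQ_eq_zero h2]

/-- `x = (x + y) - y`. -/
theorem monoSer_succ (R : Expansion) (α β γ : ℚ) :
    monoSer R α β (γ + 1) = monoSer R (α + 1) β γ - monoSer R α (β + 1) γ := by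
  refine ser_ext R fun p q => ?_
  rw [HahnSeries.coeff_sub, monoSer_coeff, monoSer_coeff, monoSer_coeff]
  by_cases h : p + q = α + β + γ + 1
  · rw [if_pos (by linarith), if_pos (by linarith), if_pos (by linarith)]
    cases R
    · have := binomQ_pascal α (q - (β + 1))
      rw [show q - (β + 1) + 1 = q - β by ring] at this
      linear_combination -this
    · have := binomQ_pascal α (p - (γ + 1))
      rw [show p - (γ + 1) + 1 = p - γ by ring] at this
      linear_combination -this
  · rw [if_neg fun h' => h (by linarith), if_neg fun h' => h (by linarith),
      if_neg fun h' => h (by linarith), sub_zero]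

theorem ser_smul_mul (c : ℂ) (f g : Ser) : (c • f) * g = c • (f * g) := by
  rw [← HahnSeries.C_mul_eq_smul, ← HahnSeries.C_mul_eq_smul, mul_assoc]

theorem ser_mul_smul (c : ℂ) (f g : Ser) : f * (c • g) = c • (f * g) := by
  rw [mul_comm, ser_smul_mul, mul_comm]

theorem iotaHom_gFun (R : Expansion) : iotaHom R gFun =
    (1 / 2 : ℂ) • (monoSer R (1 / 2) (-1 / 2) (-1) + monoSer R (-1 / 2) (1 / 2) (-1)) := by
  simp only [gFun, map_mul, map_add, iotaHom_mono, one_smul, mul_add, add_mul, ser_smul_mul,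
    monoSer_mul, smul_add]
  norm_num

theorem monoSer_support {R : Expansion} {α β γ c : ℚ} (hα : α ∈ halfInts) (hβ : β ∈ halfInts)
    (hγ : γ ∈ halfInts) (h1 : -c ≤ (match R with | .xy => β | .yx => γ)) (h2 : -c ≤ α + β + γ) :
    (monoSer R α β γ).support ⊆ halfBox c := by
  intro δ hδ
  obtain ⟨⟨p, q⟩, rfl⟩ := (expo_bijective R).2 δ
  rw [HahnSeries.mem_support] at hδ
  simp only [monoSer_coeff] at hδ
  split_ifs at hδ with h
  · simp only [halfBox, Set.mem_ofPred_eq, expo_snd, h]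
    refine ⟨?_, h2, add_mem (add_mem hα hβ) hγ⟩
    cases R
    · have : ∃ i : ℕ, q - β = i := by
        by_contra h'
        push Not at h'
        exact hδ (binomQ_eq_zero h')
      obtain ⟨i, hi⟩ := this
      obtain rfl : q = β + i := by linarith
      simp only [expo]
      exact ⟨by simp only at h1; have : (0 : ℚ) ≤ i := i.cast_nonneg; linarith,
        add_mem hβ (natCast_mem_halfInts i)⟩
    · have : ∃ i : ℕ, p - γ = i := by
        by_contra h'
        push Not at h'
        exact hδ (binomQ_eq_zero h')
      obtain ⟨i, hi⟩ := this
      obtain rfl : p = γ + i := by linarith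
      simp only [expo]
      exact ⟨by simp only at h1; have : (0 : ℚ) ≤ i := i.cast_nonneg; linarith,
        add_mem hγ (natCast_mem_halfInts i)⟩
  · exact absurd rfl hδ

theorem binom_add_smul (α : ℚ) (m j : ℕ) :
    ((m + j).choose m : ℂ) * binom α (m + j) = binom α m * binom (α - m) j := by
  have h := Ring.choose_smul_choose α (n := m + j) (k := m) (Nat.le_add_right m j)
  rw [nsmul_eq_mul, Nat.add_sub_cancel_left] at h
  simp only [binom]
  exact_mod_cast congrArg (Rat.cast : ℚ → ℂ) h

theorem binom_natCast (k m : ℕ) : binom (k : ℚ) m = (k.choose m : ℂ) := by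
  simp [binom, Ring.choose_natCast]

open Filter

/-! ### The series of contractions -/

theorem support_smul_subset' {s : Set (ℚ × ℚ)} (c : ℂ) {f : Ser} (h : f.support ⊆ s) :
    (c • f).support ⊆ s := fun γ hγ => h fun h' => hγ (by rw [HahnSeries.coeff_smul, h', smul_zero])

theorem support_sum_subset {σ : Type*} {T : Finset σ} {f : σ → Ser} {s : Set (ℚ × ℚ)}
    (h : ∀ t ∈ T, (f t).support ⊆ s) : (∑ t ∈ T, f t).support ⊆ s := by
  intro γ hγ
  by_contra h'
  apply hγ
  rw [HahnSeries.coeff_sum]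
  refine Finset.sum_eq_zero fun t ht => ?_
  by_contra h''
  exact h' (h t ht h'')

theorem tends_of_coeff (R : Expansion) {c : ℚ} {f : ℕ → Ser} {g : Ser}
    (hf : ∀ N, (f N).support ⊆ halfBox c)
    (h : ∀ p q, ∀ᶠ N in atTop, (f N).coeff (expo R p q) = g.coeff (expo R p q)) : Tends f g := by
  refine ⟨⟨_, halfBox_isPWO c, hf⟩, fun γ => ?_⟩
  obtain ⟨⟨p, q⟩, rfl⟩ := (expo_bijective R).2 γ
  exact h p q

theorem derX_sum {σ : Type*} (T : Finset σ) (c : σ → ℂ) (f : σ → ℚ → ℚ → ℂ) (p q : ℚ) :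
    derX (fun p q => ∑ t ∈ T, c t * f t p q) p q = ∑ t ∈ T, c t * derX (f t) p q := by
  simp only [derX, Finset.mul_sum]
  exact Finset.sum_congr rfl fun t _ => by ring

theorem derYX_sum {σ : Type*} (T : Finset σ) (c : σ → ℂ) (f : σ → ℚ → ℚ → ℂ) (p q : ℚ) :
    derYX (fun p q => ∑ t ∈ T, c t * f t p q) p q = ∑ t ∈ T, c t * derYX (f t) p q := by
  simp only [derYX, Finset.mul_sum, ← Finset.sum_sub_distrib]
  exact Finset.sum_congr rfl fun t _ => by ring

theorem monoCoeff_eq_zero_xy {α β γ p q : ℚ} (h : q < β) : monoCoeff .xy α β γ p q = 0 := by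
  rw [monoCoeff, monoSer_coeff]
  split_ifs with h'
  · refine binomQ_eq_zero fun i hi => ?_
    have : (0 : ℚ) ≤ i := i.cast_nonneg
    linarith
  · rfl

theorem monoCoeff_eq_zero_yx {α β γ p q : ℚ} (h : p < γ) : monoCoeff .yx α β γ p q = 0 := by
  rw [monoCoeff, monoSer_coeff]
  split_ifs with h'
  · refine binomQ_eq_zero fun i hi => ?_
    have : (0 : ℚ) ≤ i := i.cast_nonneg
    linarith
  · rfl

theorem monoCoeff_zero (R : Expansion) (β γ p q : ℚ) :
    monoCoeff R 0 β γ p q = if p = γ ∧ q = β then 1 else 0 := by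
  have : monoSer R 0 β γ = HahnSeries.single (expo R γ β) 1 := by
    rw [monoSer, oneAddPow_zero, mul_one, show ((0 : ℚ), (0 : ℚ)) = 0 from rfl, add_zero]
  rw [monoCoeff, this, HahnSeries.coeff_single]
  simp only [expo_inj]

/-- The contraction of modes of degree `k` and `k'`, up to the value of the bilinear form. -/
def modePair (k k' : ℤ) : ℂ := if k + k' = 0 then if 0 < k then 1 else if k = 0 then 1 / 2 else 0
  else 0

/-- Only pairs of opposite degree `d`, `-d` with `d ≥ 0` contract, and the zero modes count one
half. -/
theorem sum_modePair {E : Type*} [AddCommGroup E] [Module ℂ E] (N : ℕ) (f : ℤ → ℤ → E) :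
    ∑ k ∈ Finset.Icc (-(N : ℤ)) N, ∑ k' ∈ Finset.Icc (-(N : ℤ)) N, modePair k k' • f k k' =
      ∑ d ∈ Finset.range (N + 1), (if d = 0 then (1 / 2 : ℂ) else 1) • f d (-d) := by
  have h1 : ∀ k ∈ Finset.Icc (-(N : ℤ)) N, ∑ k' ∈ Finset.Icc (-(N : ℤ)) N,
      modePair k k' • f k k' = modePair k (-k) • f k (-k) := by
    intro k hk
    rw [Finset.mem_Icc] at hk
    refine Finset.sum_eq_single (-k) (fun k' _ hk' => ?_) fun h => ?_
    · rw [modePair, if_neg (by omega), zero_smul]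
    · exact absurd (Finset.mem_Icc.2 (by omega)) h
  rw [Finset.sum_congr rfl h1]
  symm
  refine Finset.sum_of_injOn (fun d : ℕ => (d : ℤ)) (fun a _ b _ h => by simpa using h)
    (fun d hd => ?_) (fun k hk hk' => ?_) fun d _ => ?_
  · simp at hd ⊢
    omega
  · have : k < 0 := by
      by_contra h
      refine hk' ⟨k.toNat, ?_, by simp; omega⟩
      simp at hk ⊢
      omega
    rw [modePair, if_pos (by omega), if_neg (by omega), if_neg (by omega), zero_smul]
  · rw [modePair, if_pos (add_neg_cancel _)]
    by_cases h : d = 0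
    · simp [h]
    · rw [if_neg h, if_pos (by omega)]

theorem sum_Icc_int {E : Type*} [AddCommGroup E] (N : ℕ) (f : ℤ → E) :
    ∑ k ∈ Finset.Icc (-(N : ℤ)) N, f k =
      ∑ k ∈ Finset.range (N + 1), f k + ∑ k ∈ Finset.range N, f (-k - 1) := by
  induction N with
  | zero => simp
  | succ N ih =>
    have h : Finset.Icc (-((N + 1 : ℕ) : ℤ)) (N + 1 : ℕ) =
        insert ((N : ℤ) + 1) (insert (-(N : ℤ) - 1) (Finset.Icc (-(N : ℤ)) N)) := by
      ext k
      simp only [Finset.mem_Icc, Finset.mem_insert]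
      push_cast
      omega
    rw [h, Finset.sum_insert, Finset.sum_insert, ih,
      Finset.sum_range_succ _ (N + 1), Finset.sum_range_succ (fun k : ℕ => f (-(k : ℤ) - 1)) N]
    · push_cast; abel
    · simp
    · simp only [Finset.mem_insert, Finset.mem_Icc, not_or]; omega

/-- The contraction of fields of `W` is the expansion of the derivative of `g`. -/
theorem tends_gDer_xy (m n : ℕ) : Tends (fun N => ∑ d ∈ Finset.range (N + 1),
    (if d = 0 then (1 / 2 : ℂ) else 1) •
      ((binom (-d - 1 / 2) m * binom (d - 1 / 2) n) •
        monoSer .xy (-d - 1 / 2 - m) (d - 1 / 2 - n) 0)) (iotaHom .xy (gDer m n)) := by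
  refine tends_of_coeff .xy (c := 1 + m + n) (fun N => support_sum_subset fun d _ =>
    support_smul_subset' _ (support_smul_subset' _ (monoSer_support ?_ ?_ (zero_mem _) ?_ ?_))) ?_
  · exact sub_mem (sub_mem (neg_mem (natCast_mem_halfInts d)) half_mem) (natCast_mem_halfInts m)
  · exact sub_mem (sub_mem (natCast_mem_halfInts d) half_mem) (natCast_mem_halfInts n)
  · have h1 : (0 : ℚ) ≤ d := d.cast_nonneg
    have h2 : (0 : ℚ) ≤ m := m.cast_nonneg
    simp only
    linarith
  · linarith
  let G : ℕ → ℕ → ℕ → ℚ → ℚ → ℂ := fun N m n p q => ∑ d ∈ Finset.range (N + 1),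
    ((if d = 0 then (1 / 2 : ℂ) else 1) * (binom (-d - 1 / 2) m * binom (d - 1 / 2) n)) *
      monoCoeff .xy (-d - 1 / 2 - m) (d - 1 / 2 - n) 0 p q
  have hG : ∀ m n p q, ∀ᶠ N in atTop, G N m n p q = iota .xy (gDer m n) p q := by
    refine eventually_eq_iota_gDer .xy G ?_ ?_ ?_
    · intro p q
      -- By `x = (x+y) - y` the summand `(x+y)^(-d-1/2) y^(d-1/2)` is the difference of consecutive
      -- terms of `T d = (x+y)^(1/2-d) y^(d-1/2) x⁻¹`. The weight `1/2` at `d = 0` leaves `(T 0 + T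
      -- 1)/2`, which is `g`.
      let T : ℕ → Ser := fun d => monoSer .xy (1 / 2 - d) (d - 1 / 2) (-1)
      have hT : ∀ d : ℕ, monoSer .xy (-d - 1 / 2) (d - 1 / 2) 0 = T d - T (d + 1) := by
        intro d
        have := monoSer_succ .xy (-d - 1 / 2) (d - 1 / 2) (-1)
        simp only [T]
        push_cast
        rw [show (-1 + 1 : ℚ) = 0 by ring] at this
        rw [this]
        congr 2 <;> ring
      have hsum : ∀ N : ℕ, ∑ d ∈ Finset.range (N + 1), (if d = 0 then (1 / 2 : ℂ) else 1) •
          (monoSer .xy (-d - 1 / 2) (d - 1 / 2) 0) =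
            (1 / 2 : ℂ) • (T 0 + T 1) - T (N + 1) := by
        intro N
        induction N with
        | zero =>
          have := hT 0
          rw [Finset.sum_range_one, if_pos rfl, this]
          ext γ
          simp only [HahnSeries.coeff_smul, HahnSeries.coeff_sub, HahnSeries.coeff_add,
            smul_eq_mul]
          ring
        | succ N ih =>
          rw [Finset.sum_range_succ, ih, if_neg (by omega), one_smul, hT]
          abel
      have hg : iotaHom .xy gFun = (1 / 2 : ℂ) • (T 0 + T 1) := by
        rw [iotaHom_gFun]
        simp only [T]
        norm_num
      -- The remainder `T (N + 1)` starts with the power `N + 1/2` of `y`, so it does not reach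
      -- `y^q`.
      obtain ⟨N₀, hN₀⟩ := exists_nat_gt q
      filter_upwards [eventually_ge_atTop N₀] with N hN
      have h1 := congrArg (fun f : Ser => f.coeff (expo .xy p q)) (hsum N)
      simp only [HahnSeries.coeff_sum, HahnSeries.coeff_sub, ← hg, HahnSeries.coeff_smul,
        smul_eq_mul] at h1
      rw [← iotaHom_coeff]
      have h2 : (T (N + 1)).coeff (expo .xy p q) = 0 := by
        refine monoCoeff_eq_zero_xy ?_
        have : (N₀ : ℚ) ≤ N := by exact_mod_cast hN
        push_cast
        linarith
      rw [h2, sub_zero] at h1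
      rw [← h1]
      simp [G, monoCoeff]
    · intro m n p q
      refine Eventually.of_forall fun N => ?_
      simp only [G]
      rw [derX_sum, Finset.mul_sum]
      refine Finset.sum_congr rfl fun d _ => ?_
      rw [derX_monoCoeff]
      have := binom_succ (-d - 1 / 2) m
      push_cast at this ⊢
      rw [show (-d - 1 / 2 - (m + 1) : ℚ) = -d - 1 / 2 - m - 1 by ring]
      linear_combination (if d = 0 then (1 / 2 : ℂ) else 1) * binom (d - 1 / 2) n *
        monoCoeff .xy (-d - 1 / 2 - m - 1) (d - 1 / 2 - n) 0 p q * this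
    · intro n p q
      refine Eventually.of_forall fun N => ?_
      simp only [G]
      rw [derYX_sum, Finset.mul_sum]
      refine Finset.sum_congr rfl fun d _ => ?_
      rw [derYX_monoCoeff]
      have := binom_succ (d - 1 / 2) n
      push_cast at this ⊢
      rw [show (d - 1 / 2 - (n + 1) : ℚ) = d - 1 / 2 - n - 1 by ring]
      linear_combination (if d = 0 then (1 / 2 : ℂ) else 1) * binom (-d - 1 / 2) 0 *
        monoCoeff .xy (-d - 1 / 2 - 0) (d - 1 / 2 - n - 1) 0 p q * this
  intro p q
  filter_upwards [hG m n p q] with N hN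
  rw [iotaHom_coeff, ← hN]
  simp only [G, HahnSeries.coeff_sum, HahnSeries.coeff_smul, smul_eq_mul, monoCoeff, mul_assoc]

/-- Euler's identity in coefficients: the generating function `∑ C_{kn} u^k v^n` is homogeneous of
degree `-1` in `1 + u` and `1 + v`. All that is used about `C` in the derivative steps and in the
Taylor sums below is this recursion. -/
theorem cNum_recursion (k n : ℕ) : ((n : ℂ) + 1) * cNum k (n + 1) + (k + 1) * cNum (k + 1) n +
    (k + n + 1) * cNum k n = 0 := by
  have h1 := binom_succ (-1 / 2) k
  have h2 := binom_succ (-1 / 2) n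
  simp only [cNum]
  push_cast at h1 h2 ⊢
  have h3 : ((k : ℂ) + n + 1) ≠ 0 := by exact_mod_cast Nat.succ_ne_zero (k + n)
  have h4 : ((k : ℂ) + n + 1 + 1) ≠ 0 := by exact_mod_cast Nat.succ_ne_zero (k + n + 1)
  have e1 : ((n : ℂ) + 1) * (1 / 2 * ((k - (n + 1)) / (k + (n + 1) + 1)) * binom (-1 / 2) k *
      binom (-1 / 2) (n + 1)) = 1 / 2 * ((k - (n + 1)) / (k + n + 1 + 1)) * binom (-1 / 2) k *
      ((-1 / 2 - n) * binom (-1 / 2) n) := by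
    rw [← h2, ← add_assoc (k : ℂ)]; ring
  have e2 : ((k : ℂ) + 1) * (1 / 2 * ((k + 1 - n) / (k + 1 + n + 1)) * binom (-1 / 2) (k + 1) *
      binom (-1 / 2) n) = 1 / 2 * ((k + 1 - n) / (k + n + 1 + 1)) *
      ((-1 / 2 - k) * binom (-1 / 2) k) * binom (-1 / 2) n := by
    rw [← h1, add_right_comm (k : ℂ) 1 n]; ring
  rw [e1, e2]
  field_simp
  ring

open Filter

/-- The contraction of a field of `V` with a creation operator that is contained in the iterate of
vertex operators is the other expansion of the derivative of `g`. -/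
theorem tends_gDer_yx (m n : ℕ) : Tends (fun N =>
    binom (-n - 1) m • monoSer .yx 0 0 (-n - 1 - m) - ∑ k ∈ Finset.range N,
      (binom k m * cNum k n) • monoSer .yx 0 (-k - n - 1) (k - m)) (iotaHom .yx (gDer m n)) := by
  refine tends_of_coeff .yx (c := 1 + m + n) (fun N => ?_) ?_
  · have h1 : (0 : ℚ) ≤ n := n.cast_nonneg
    rw [sub_eq_add_neg]
    refine (HahnSeries.support_add_subset _ _).trans (Set.union_subset
      (support_smul_subset' _ (monoSer_support (zero_mem _) (zero_mem _) ?_ ?_ ?_)) ?_)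
    · exact sub_mem (sub_mem (neg_mem (natCast_mem_halfInts n))
        (by exact_mod_cast natCast_mem_halfInts 1)) (natCast_mem_halfInts m)
    · simp only; linarith
    · linarith
    · rw [HahnSeries.support_neg]
      refine support_sum_subset fun k _ => support_smul_subset' _
        (monoSer_support (zero_mem _) ?_ ?_ ?_ ?_)
      · exact sub_mem (sub_mem (neg_mem (natCast_mem_halfInts k)) (natCast_mem_halfInts n))
          (by exact_mod_cast natCast_mem_halfInts 1)
      · exact sub_mem (natCast_mem_halfInts k) (natCast_mem_halfInts m)
      · have h2 : (0 : ℚ) ≤ k := k.cast_nonneg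
        simp only; linarith
      · linarith
  let G : ℕ → ℕ → ℕ → ℚ → ℚ → ℂ := fun N m n p q =>
    binom (-n - 1) m * monoCoeff .yx 0 0 (-n - 1 - m) p q - ∑ k ∈ Finset.range N,
      (binom k m * cNum k n) * monoCoeff .yx 0 (-k - n - 1) (k - m) p q
  have hG : ∀ m n p q, ∀ᶠ N in atTop, G N m n p q = iota .yx (gDer m n) p q := by
    refine eventually_eq_iota_gDer .yx G ?_ ?_ ?_
    · intro p q
      obtain ⟨N₀, hN₀⟩ := exists_nat_gt p
      filter_upwards [eventually_ge_atTop N₀] with N hN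
      have hN' : p < N := hN₀.trans_le (by exact_mod_cast hN)
      rw [← iotaHom_coeff, iotaHom_gFun]
      -- The coefficient of `x^p y^(-1-p)` in `g` is half the sum of `binom(1/2, p+1)` and
      -- `binom(-1/2, p+1)`. Pascal's rule expresses it through binomial coefficients of `-1/2`
      -- alone, as they occur in `C_{p0}`.
      have hb : ∀ t : ℚ, binomQ (1 / 2) (t + 1) =
          binomQ (-1 / 2) (t + 1) + binomQ (-1 / 2) t := fun t => by
        rw [← binomQ_pascal]; norm_num
      simp only [G, HahnSeries.coeff_smul, HahnSeries.coeff_add, monoSer_coeff, smul_eq_mul,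
        monoCoeff_zero, binom_zero, Nat.cast_zero, sub_zero, neg_zero, zero_sub, one_mul]
      by_cases hpq : p + q = -1
      · have e1 : p + q = 1 / 2 + -1 / 2 + -1 := by linarith
        have e2 : p + q = -1 / 2 + 1 / 2 + -1 := by linarith
        rw [if_pos e1, if_pos e2, sub_neg_eq_add, hb]
        -- For a natural number `p` the coefficient comes from the term `k = p` of the sum with `C`,
        -- for `p = -1` from the polar term. All other coefficients vanish.
        by_cases hp : ∃ k : ℕ, p = k
        · obtain ⟨k, rfl⟩ := hp
          rw [if_neg (by
            rintro ⟨h, -⟩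
            have : (0 : ℚ) ≤ k := k.cast_nonneg
            linarith), Finset.sum_eq_single k]
          · rw [if_pos ⟨rfl, by linarith⟩]
            have e := binomQ_natCast (-1 / 2) (k + 1)
            push_cast at e
            rw [e, binomQ_natCast]
            have h1 := binom_succ (-1 / 2) k
            have h0 : ((k : ℂ) + 1) ≠ 0 := by exact_mod_cast Nat.succ_ne_zero k
            simp only [cNum, binom_zero, Nat.cast_zero]
            generalize binom (-1 / 2) k = b at h1 ⊢
            generalize binom (-1 / 2) (k + 1) = b' at h1 ⊢
            have h2 : b' = (-1 / 2 - k) * b / (k + 1) := by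
              field_simp
              push_cast at h1
              linear_combination 2 * h1
            rw [h2]
            field_simp
            ring
          · intro k' _ hk'
            rw [if_neg, mul_zero]
            rintro ⟨h, -⟩
            exact hk' (by exact_mod_cast h.symm)
          · intro h
            exfalso
            apply h
            rw [Finset.mem_range]
            exact_mod_cast hN'
        · push Not at hp
          rw [Finset.sum_eq_zero fun k _ => by rw [if_neg fun h => hp k h.1, mul_zero],
            binomQ_eq_zero hp]
          by_cases hp1 : p = -1
          · have e := binomQ_natCast (-1 / 2) 0
            rw [if_pos ⟨hp1, by linarith⟩, hp1]
            push_cast at e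
            rw [show (-1 + 1 : ℚ) = 0 by ring, e, binom_zero]
            norm_num
          · rw [if_neg fun h => hp1 h.1, binomQ_eq_zero]
            · norm_num
            · intro i hi
              cases i with
              | zero => exact hp1 (by push_cast at hi; linarith)
              | succ i => exact hp i (by push_cast at hi; linarith)
      · have e1 : ¬(p + q = 1 / 2 + -1 / 2 + -1) := fun h => hpq (by linarith)
        have e2 : ¬(p + q = -1 / 2 + 1 / 2 + -1) := fun h => hpq (by linarith)
        have e3 : ¬(p = -1 ∧ q = 0) := fun h => hpq (by linarith [h.1, h.2])
        rw [if_neg e1, if_neg e2, if_neg e3, Finset.sum_eq_zero]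
        · norm_num
        · intro k _
          rw [if_neg fun h => hpq (by linarith [h.1, h.2]), mul_zero]
    · intro m n p q
      refine Eventually.of_forall fun N => ?_
      have e : derX (G N m n) p q = binom (-n - 1) m * derX (monoCoeff .yx 0 0 (-n - 1 - m)) p q -
          ∑ k ∈ Finset.range N, (binom k m * cNum k n) *
            derX (monoCoeff .yx 0 (-k - n - 1) (k - m)) p q := by
        rw [← derX_sum]
        simp only [derX, G]
        ring
      rw [e]
      simp only [G]
      rw [mul_sub, Finset.mul_sum]
      congr 1
      · rw [derX_monoCoeff]
        have := binom_succ (-n - 1) m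
        push_cast at this ⊢
        rw [show (-n - 1 - (m + 1) : ℚ) = -n - 1 - m - 1 by ring]
        linear_combination monoCoeff .yx 0 0 (-n - 1 - m - 1) p q * this
      · refine Finset.sum_congr rfl fun k _ => ?_
        rw [derX_monoCoeff]
        have := binom_succ k m
        push_cast at this ⊢
        rw [show (k - (m + 1) : ℚ) = k - m - 1 by ring]
        linear_combination cNum k n * monoCoeff .yx 0 (-k - n - 1) (k - m - 1) p q * this
    · intro n p q
      obtain ⟨N₀, hN₀⟩ := exists_nat_gt (p + 1)
      filter_upwards [eventually_ge_atTop N₀] with N hN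
      have hN' : p + 1 < N := hN₀.trans_le (by exact_mod_cast hN)
      have e : derYX (G N 0 n) p q = derYX (monoCoeff .yx 0 0 (-n - 1)) p q -
          ∑ k ∈ Finset.range N, cNum k n * derYX (monoCoeff .yx 0 (-k - n - 1) k) p q := by
        rw [← derYX_sum]
        simp only [derYX, G, binom_zero, Nat.cast_zero, sub_zero, one_mul]
        ring
      rw [e]
      simp only [G, derYX_monoCoeff, binom_zero, Nat.cast_zero, sub_zero, one_mul]
      -- The part in which `x^k` is differentiated is shifted by one in `k`, so that it matches the
      -- other part and `cNum_recursion` applies term by term.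
      have h1 : ∑ k ∈ Finset.range N, cNum k n * (((-k - n - 1 : ℚ) : ℂ) *
            monoCoeff .yx 0 (-k - n - 1 - 1) k p q - ((k : ℚ) : ℂ) *
            monoCoeff .yx 0 (-k - n - 1) (k - 1) p q) =
          ∑ k ∈ Finset.range N, (-((k + n + 1) * cNum k n) - (k + 1) * cNum (k + 1) n) *
            monoCoeff .yx 0 (-k - n - 1 - 1) k p q := by
        simp only [mul_sub, sub_mul, Finset.sum_sub_distrib]
        congr 1
        · refine Finset.sum_congr rfl fun k _ => ?_
          push_cast
          ring
        -- The shift costs two boundary terms. The one at `k = 0` has the factor `k`; the one at `k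
        -- = N` starts with `x^(N-1)` and does not reach `x^p`, since `p + 1 < N`.
        · have h2 := Finset.sum_range_succ (fun k : ℕ => cNum k n * (((k : ℚ) : ℂ) *
            monoCoeff .yx 0 (-k - n - 1) (k - 1) p q)) N
          have h3 := Finset.sum_range_succ' (fun k : ℕ => cNum k n * (((k : ℚ) : ℂ) *
            monoCoeff .yx 0 (-k - n - 1) (k - 1) p q)) N
          rw [monoCoeff_eq_zero_yx (by linarith), mul_zero, mul_zero, add_zero] at h2
          rw [← h2, h3]
          simp only [Nat.cast_zero, Rat.cast_zero, zero_mul, mul_zero, add_zero]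
          refine Finset.sum_congr rfl fun k _ => ?_
          push_cast
          rw [show (-(k + 1) - n - 1 : ℚ) = -k - n - 1 - 1 by ring,
            show (k + 1 - 1 : ℚ) = k by ring]
          ring
      rw [h1, mul_sub, Finset.mul_sum]
      congr 1
      · push_cast
        rw [show (-(n + 1) - 1 : ℚ) = -n - 1 - 1 by ring]
        ring
      · refine Finset.sum_congr rfl fun k _ => ?_
        have := cNum_recursion k n
        push_cast
        rw [show (-k - (n + 1) - 1 : ℚ) = -k - n - 1 - 1 by ring]
        linear_combination monoCoeff .yx 0 (-k - n - 1 - 1) k p q * this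
  intro p q
  filter_upwards [hG m n p q] with N hN
  rw [iotaHom_coeff, ← hN]
  simp only [G, HahnSeries.coeff_sub, HahnSeries.coeff_sum, HahnSeries.coeff_smul, smul_eq_mul,
    monoCoeff]

/-- The sum of the images of an uncontracted field of `V` under the vertex operator of `W`. -/
theorem tends_field_yx (m : ℕ) (e : ℚ) (he : e ∈ halfInts) : Tends (fun N =>
    ∑ k ∈ Finset.range N, (binom k m * binom e k) • monoSer .yx 0 (e - k) (k - m))
    (binom e m • monoSer .yx (e - m) 0 0) := by
  refine tends_of_coeff .yx (c := |e| + m) (fun N => ?_) ?_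
  · have h2 : (0 : ℚ) ≤ |e| := abs_nonneg e
    refine support_sum_subset fun k _ => support_smul_subset' _
        (monoSer_support (zero_mem _) ?_ ?_ ?_ ?_)
    · exact sub_mem he (natCast_mem_halfInts k)
    · exact sub_mem (natCast_mem_halfInts k) (natCast_mem_halfInts m)
    · have h1 : (0 : ℚ) ≤ k := k.cast_nonneg
      simp only
      linarith
    · have := neg_abs_le e
      linarith
  · intro p q
    obtain ⟨N₀, hN₀⟩ := exists_nat_gt (p + m)
    filter_upwards [eventually_ge_atTop N₀] with N hN
    have hN' : p + m < N := hN₀.trans_le (by exact_mod_cast hN)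
    simp only [HahnSeries.coeff_sum, HahnSeries.coeff_smul, smul_eq_mul]
    have h1 : ∀ β γ, (monoSer .yx 0 β γ).coeff (expo .yx p q) =
        if p = γ ∧ q = β then 1 else 0 := fun β γ => monoCoeff_zero .yx β γ p q
    simp only [h1, monoSer_coeff, add_zero, sub_zero]
    by_cases hpq : p + q = e - m
    · rw [if_pos hpq]
      by_cases hp : ∃ j : ℕ, p = j
      · obtain ⟨j, rfl⟩ := hp
        -- The coefficient of `x^j` arises from `k = m + j` only. The identity needed is `binom(m+j,
        -- m) binom(e, m+j) = binom(e, m) binom(e-m, j)`.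
        rw [Finset.sum_eq_single (m + j)]
        · rw [if_pos ⟨by push_cast; ring, by push_cast; linarith⟩, binomQ_natCast, mul_one,
            binom_natCast, binom_add_smul]
        · intro k _ hk
          rw [if_neg, mul_zero]
          rintro ⟨h, -⟩
          apply hk
          have : (k : ℚ) = m + j := by linarith
          exact_mod_cast this
        · intro h
          exfalso
          apply h
          rw [Finset.mem_range]
          have : (m : ℚ) + j < N := by linarith
          exact_mod_cast this
      · push Not at hp
        rw [binomQ_eq_zero hp, mul_zero]
        refine Finset.sum_eq_zero fun k _ => ?_
        split_ifs with h
        · by_cases hk : m ≤ k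
          · exfalso
            refine hp (k - m) ?_
            rw [h.1]
            push_cast [hk]
            rfl
          · rw [binom_natCast, Nat.choose_eq_zero_of_lt (by omega)]
            simp
        · rw [mul_zero]
    · rw [if_neg hpq, mul_zero]
      refine Finset.sum_eq_zero fun k _ => ?_
      rw [if_neg fun h => hpq (by linarith), mul_zero]

/-- On the antidiagonal `k + l = K + 1` the factor on the left is the sum of `k - m` and `l - m'`.
Each of these lowers a binomial coefficient by `binom_pred`, and after the index shifts
`cNum_recursion` collects the two sums. -/
theorem sum_antidiagonal_cNum (m m' K : ℕ) : (((K : ℚ) - m - m' : ℚ) + 1 : ℂ) *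
    (∑ kl ∈ Finset.HasAntidiagonal.antidiagonal (K + 1), binom kl.1 m * binom kl.2 m' * cNum kl.1 kl.2) =
      -(K + 1) * ∑ kl ∈ Finset.HasAntidiagonal.antidiagonal K, binom kl.1 m * binom kl.2 m' * cNum kl.1 kl.2 := by
  have h1 : ∀ kl ∈ Finset.HasAntidiagonal.antidiagonal (K + 1), (((K : ℚ) - m - m' : ℚ) + 1 : ℂ) *
      (binom kl.1 m * binom kl.2 m' * cNum kl.1 kl.2) =
      kl.1 * binom (kl.1 - 1) m * binom kl.2 m' * cNum kl.1 kl.2 +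
        kl.2 * binom kl.1 m * binom (kl.2 - 1) m' * cNum kl.1 kl.2 := by
    intro kl hkl
    have e : (kl.1 : ℂ) + kl.2 = K + 1 := by exact_mod_cast Finset.HasAntidiagonal.mem_antidiagonal.1 hkl
    have h1 := binom_pred kl.1 m
    have h2 := binom_pred kl.2 m'
    push_cast at h1 h2 ⊢
    linear_combination (binom kl.2 m' * cNum kl.1 kl.2) * h1 + (binom kl.1 m * cNum kl.1 kl.2) * h2
      - binom kl.1 m * binom kl.2 m' * cNum kl.1 kl.2 * e
  rw [Finset.mul_sum, Finset.sum_congr rfl h1, Finset.sum_add_distrib,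
    Finset.Nat.sum_antidiagonal_succ, Finset.Nat.sum_antidiagonal_succ']
  simp only [Nat.cast_zero, zero_mul, zero_add]
  rw [← Finset.sum_add_distrib, Finset.mul_sum]
  refine Finset.sum_congr rfl fun kl hkl => ?_
  have e : (kl.1 : ℂ) + kl.2 = K := by exact_mod_cast Finset.HasAntidiagonal.mem_antidiagonal.1 hkl
  have := cNum_recursion kl.1 kl.2
  push_cast
  rw [add_sub_cancel_right, add_sub_cancel_right, ← e]
  linear_combination binom kl.1 m * binom kl.2 m' * this

theorem sum_antidiagonal_cNum_eq (m m' j : ℕ) :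
    ∑ kl ∈ Finset.HasAntidiagonal.antidiagonal (m + m' + j), binom kl.1 m * binom kl.2 m' * cNum kl.1 kl.2 =
      cNum m m' * binom (-m - m' - 1) j := by
  induction j with
  | zero =>
    -- On the lowest antidiagonal every pair other than `(m, m')` has `k < m` or `l < m'`, and a
    -- binomial coefficient vanishes.
    rw [Finset.sum_eq_single (m, m')]
    · simp [binom_natCast]
    · rintro ⟨k, l⟩ hkl hne
      rw [Finset.HasAntidiagonal.mem_antidiagonal] at hkl
      simp only [binom_natCast]
      by_cases hk : k < m
      · rw [Nat.choose_eq_zero_of_lt hk]; simp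
      · have hl : l < m' := by
          by_contra hl
          refine hne ?_
          simp only at hkl
          ext <;> simp <;> omega
        rw [Nat.choose_eq_zero_of_lt hl]; simp
    · intro h
      exact absurd (Finset.HasAntidiagonal.mem_antidiagonal.2 (by simp)) h
  | succ j ih =>
    have h := sum_antidiagonal_cNum m m' (m + m' + j)
    rw [ih] at h
    have h0 : ((j : ℂ) + 1) ≠ 0 := by exact_mod_cast Nat.succ_ne_zero j
    apply mul_left_cancel₀ h0
    have h1 := binom_succ (-m - m' - 1) j
    rw [← add_assoc]
    push_cast at h h1 ⊢
    linear_combination h - cNum m m' * h1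

theorem sum_antidiagonal_cNum_eq_zero {m m' K : ℕ} (h : K < m + m') :
    ∑ kl ∈ Finset.HasAntidiagonal.antidiagonal K, binom kl.1 m * binom kl.2 m' * cNum kl.1 kl.2 = 0 := by
  refine Finset.sum_eq_zero fun kl hkl => ?_
  rw [Finset.HasAntidiagonal.mem_antidiagonal] at hkl
  simp only [binom_natCast]
  by_cases hk : kl.1 < m
  · rw [Nat.choose_eq_zero_of_lt hk]; simp
  · rw [Nat.choose_eq_zero_of_lt (show kl.2 < m' by omega)]; simp

/-- The contraction of two fields of `V` by `exp Δ`. -/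
theorem tends_cNum_yx (m m' : ℕ) : Tends (fun N => ∑ k ∈ Finset.range N, ∑ l ∈ Finset.range N,
    (binom k m * binom l m' * cNum k l) • monoSer .yx 0 (-k - l - 1) ((k - m) + (l - m')))
    (cNum m m' • monoSer .yx (-m - m' - 1) 0 0) := by
  refine tends_of_coeff .yx (c := m + m' + 1) (fun N => ?_) ?_
  · refine support_sum_subset fun k _ => support_sum_subset fun l _ => support_smul_subset' _
        (monoSer_support (zero_mem _) ?_ ?_ ?_ ?_)
    · exact sub_mem (sub_mem (neg_mem (natCast_mem_halfInts k)) (natCast_mem_halfInts l))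
          (by exact_mod_cast natCast_mem_halfInts 1)
    · exact add_mem (sub_mem (natCast_mem_halfInts k) (natCast_mem_halfInts m))
        (sub_mem (natCast_mem_halfInts l) (natCast_mem_halfInts m'))
    · have h1 : (0 : ℚ) ≤ k := k.cast_nonneg
      have h2 : (0 : ℚ) ≤ l := l.cast_nonneg
      simp only
      linarith
    · linarith
  · intro p q
    obtain ⟨N₀, hN₀⟩ := exists_nat_gt (p + m + m')
    filter_upwards [eventually_ge_atTop N₀] with N hN
    have hN' : p + m + m' < N := hN₀.trans_le (by exact_mod_cast hN)
    simp only [HahnSeries.coeff_sum, HahnSeries.coeff_smul, smul_eq_mul]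
    have h1 : ∀ β γ, (monoSer .yx 0 β γ).coeff (expo .yx p q) =
        if p = γ ∧ q = β then 1 else 0 := fun β γ => monoCoeff_zero .yx β γ p q
    simp only [h1, monoSer_coeff, add_zero, sub_zero]
    by_cases hpq : p + q = -m - m' - 1
    · rw [if_pos hpq]
      by_cases hp : ∃ K : ℕ, p + m + m' = K
      · obtain ⟨K, hK⟩ := hp
        have hKN : K < N := by rw [hK] at hN'; exact_mod_cast hN'
        -- The power `x^p` selects the antidiagonal `k + l = K`. It lies completely inside the
        -- square of side `N`, because `K < N`.
        have h2 : ∑ k ∈ Finset.range N, ∑ l ∈ Finset.range N, binom k m * binom l m' * cNum k l *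
            (if p = k - m + (l - m') ∧ q = -k - l - 1 then 1 else 0) =
            ∑ kl ∈ Finset.HasAntidiagonal.antidiagonal K, binom kl.1 m * binom kl.2 m' * cNum kl.1 kl.2 := by
          rw [← Finset.sum_product']
          symm
          refine Finset.sum_subset_zero_on_sdiff (fun kl hkl => ?_) (fun kl hkl => ?_)
            fun kl hkl => ?_
          · rw [Finset.HasAntidiagonal.mem_antidiagonal] at hkl
            rw [Finset.mem_product, Finset.mem_range, Finset.mem_range]
            omega
          · rw [Finset.mem_sdiff, Finset.HasAntidiagonal.mem_antidiagonal] at hkl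
            rw [if_neg, mul_zero]
            rintro ⟨h, -⟩
            apply hkl.2
            have : (kl.1 : ℚ) + kl.2 = K := by linarith
            exact_mod_cast this
          · have : (kl.1 : ℚ) + kl.2 = K := by exact_mod_cast Finset.HasAntidiagonal.mem_antidiagonal.1 hkl
            rw [if_pos ⟨by linarith, by linarith⟩, mul_one]
        rw [h2]
        by_cases hKm : m + m' ≤ K
        · obtain ⟨j, rfl⟩ := Nat.exists_eq_add_of_le hKm
          obtain rfl : p = j := by push_cast at hK; linarith
          rw [sum_antidiagonal_cNum_eq, binomQ_natCast]
        · rw [sum_antidiagonal_cNum_eq_zero (by omega), binomQ_eq_zero, mul_zero]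
          intro i hi
          apply hKm
          have : (K : ℚ) = m + m' + i := by linarith
          have : K = m + m' + i := by exact_mod_cast this
          omega
      · push Not at hp
        rw [binomQ_eq_zero, mul_zero]
        · refine Finset.sum_eq_zero fun k _ => Finset.sum_eq_zero fun l _ => ?_
          rw [if_neg, mul_zero]
          rintro ⟨h, -⟩
          exact hp (k + l) (by push_cast; linarith)
        · intro i hi
          exact hp (i + m + m') (by push_cast; linarith)
    · rw [if_neg hpq, mul_zero]
      refine Finset.sum_eq_zero fun k _ => Finset.sum_eq_zero fun l _ => ?_
      rw [if_neg fun h => hpq (by linarith), mul_zero]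

/-! ### The operator `exp Δ` on words -/

section ExpDelta

variable {𝔥 : Type u} [AddCommGroup 𝔥] [Module ℂ 𝔥] (B : LinearMap.BilinForm ℂ 𝔥)

theorem annih_create_apply (m k : ℕ) (a b : 𝔥) (v : FockV 𝔥) :
    annih B m a (create k b v) = (if m = k then B a b else 0) • v - create k b (annih B m a v) := by
  have := congrArg (fun f : Module.End ℂ (FockV 𝔥) => f v) (annih_create B m k a b)
  simp only [LinearMap.add_apply, Module.End.mul_apply, LinearMap.smul_apply,
    Module.End.one_apply] at this
  rw [← this, add_sub_cancel_right]

theorem fockV_induction {P : FockV 𝔥 → Prop} (h1 : P 1) (hadd : ∀ x y, P x → P y → P (x + y))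
    (hsmul : ∀ (c : ℂ) x, P x → P (c • x)) (hcreate : ∀ k b x, P x → P (create k b x))
    (x : FockV 𝔥) : P x := by
  have h0 : P 0 := by simpa using hsmul 0 1 h1
  induction x using tensor_left_induction with
  | h1 => exact h1
  | hadd x y hx hy => exact hadd x y hx hy
  | hsmul c x hx => exact hsmul c x hx
  | hmul a x hx =>
    induction a using DirectSum.induction_on with
    | zero => simpa using h0
    | add v w hv hw => rw [map_add, add_mul]; exact hadd _ _ hv hw
    | of k b => exact hcreate k b x hx

/-- No relation between positive modes of `V` is imposed. It follows from their action: both sides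
kill the vacuum and behave in the same way under left multiplication by a creation operator. -/
theorem annih_annih (m n : ℕ) (a b : 𝔥) (v : FockV 𝔥) :
    annih B m a (annih B n b v) = -annih B n b (annih B m a v) := by
  induction v using fockV_induction with
  | h1 => simp [annih_one]
  | hadd x y hx hy => simp only [map_add, hx, hy, neg_add]
  | hsmul c x hx => simp only [map_smul, hx, smul_neg]
  | hcreate k h x hx =>
    simp only [annih_create_apply, map_sub, map_smul, hx, map_neg]
    abel

variable {M : ℕ} (e e' : Fin M → 𝔥)

theorem cNum_antisymm (m n : ℕ) : cNum m n = -cNum n m := by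
  simp only [cNum]
  have h1 : ((m : ℂ) + n + 1) ≠ 0 := by exact_mod_cast Nat.succ_ne_zero (m + n)
  have h2 : ((n : ℂ) + m + 1) ≠ 0 := by exact_mod_cast Nat.succ_ne_zero (n + m)
  field_simp
  ring

/-- The commutator of `Δ(x)` and `h(-k-1/2)`, as a series in `x⁻¹`. -/
def deltaComm (k : ℕ) (h : 𝔥) : PowerSeries (Module.End ℂ (FockV 𝔥)) :=
  PowerSeries.mk fun d => if k < d then cNum (d - k - 1) k • annih B (d - k - 1) h else 0

/-- The commutator arises by contracting `h` with `ē_i` or with `e_i`. The second kind has the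
opposite sign, which the antisymmetry of `C` undoes. The two kinds add up to the expansion of `h` in
the dual bases, so the commutator is an annihilation operator of `h` itself. -/
theorem coeff_deltaSeries_create
    (hcomp : ∀ h, ∑ i, (B (e' i) h • e i + B (e i) h • e' i) = h) (k d : ℕ) (h : 𝔥) :
    PowerSeries.coeff d (deltaSeries B e e') * create k h =
      create k h * PowerSeries.coeff d (deltaSeries B e e') +
        PowerSeries.coeff d (deltaComm B k h) := by
  rw [deltaSeries, deltaComm, PowerSeries.coeff_mk, PowerSeries.coeff_mk]
  cases d with
  | zero => simp
  | succ d =>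
    simp only [Finset.sum_mul, Finset.mul_sum]
    have h1 : ∀ (mn : ℕ × ℕ) (i : Fin M),
        (cNum mn.1 mn.2 • (modeV B mn.1 (e i) * modeV B mn.2 (e' i))) * create k h =
          create k h * (cNum mn.1 mn.2 • (modeV B mn.1 (e i) * modeV B mn.2 (e' i))) +
          ((if mn.2 = k then (cNum mn.1 mn.2 * B (e' i) h) • annih B mn.1 (e i) else 0) -
            (if mn.1 = k then (cNum mn.1 mn.2 * B (e i) h) • annih B mn.2 (e' i) else 0)) := by
      intro mn i
      refine LinearMap.ext fun v => ?_
      change cNum mn.1 mn.2 • annih B mn.1 (e i) (annih B mn.2 (e' i) (create k h v)) =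
        create k h (cNum mn.1 mn.2 • annih B mn.1 (e i) (annih B mn.2 (e' i) v)) + _
      rw [annih_create_apply, map_sub, annih_create_apply, map_smul, map_smul, LinearMap.sub_apply]
      split_ifs
      · simp only [LinearMap.smul_apply, smul_sub, smul_smul]; abel
      · simp only [LinearMap.smul_apply, smul_sub, smul_smul, zero_smul, LinearMap.zero_apply]
        simp
        abel
      · simp only [LinearMap.smul_apply, smul_sub, smul_smul, zero_smul, LinearMap.zero_apply]
        simp
        abel
      · simp
    simp only [h1, Finset.sum_add_distrib]
    congr 1
    simp only [Finset.sum_sub_distrib]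
    have h2 : ∀ f : ℕ × ℕ → Module.End ℂ (FockV 𝔥),
        ∑ mn ∈ Finset.HasAntidiagonal.antidiagonal d, (if mn.2 = k then f mn else 0) =
          if k < d + 1 then f (d + 1 - k - 1, k) else 0 := by
      intro f
      split_ifs with hk
      · rw [Finset.sum_eq_single (d + 1 - k - 1, k)]
        · simp
        · rintro ⟨m, n⟩ hmn hne
          rw [Finset.HasAntidiagonal.mem_antidiagonal] at hmn
          refine if_neg fun h => hne ?_
          simp only at hmn h
          ext <;> simp <;> omega
        · intro h
          exact absurd (Finset.HasAntidiagonal.mem_antidiagonal.2 (by simp; omega)) h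
      · refine Finset.sum_eq_zero fun mn hmn => if_neg fun h => ?_
        rw [Finset.HasAntidiagonal.mem_antidiagonal] at hmn
        omega
    have h3 : ∀ f : ℕ × ℕ → Module.End ℂ (FockV 𝔥),
        ∑ mn ∈ Finset.HasAntidiagonal.antidiagonal d, (if mn.1 = k then f mn else 0) =
          if k < d + 1 then f (k, d + 1 - k - 1) else 0 := by
      intro f
      have := h2 fun mn => f mn.swap
      rw [← Finset.Nat.sum_antidiagonal_swap] at this
      simpa using this
    have h4 : ∀ (p : Prop) [Decidable p] (f : Fin M → Module.End ℂ (FockV 𝔥)),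
        ∑ i, (if p then f i else 0) = if p then ∑ i, f i else 0 := by
      intro p _ f
      split_ifs <;> simp
    simp only [h4]
    rw [h2 fun mn => ∑ i, (cNum mn.1 mn.2 * B (e' i) h) • annih B mn.1 (e i),
      h3 fun mn => ∑ i, (cNum mn.1 mn.2 * B (e i) h) • annih B mn.2 (e' i)]
    split_ifs
    · simp only
      rw [cNum_antisymm k]
      conv_rhs => rw [← hcomp h]
      have h5 : ∀ (c : ℂ) (f : Module.End ℂ (FockV 𝔥)), (-c) • f = -(c • f) :=
        fun c f => neg_smul c f
      simp only [neg_mul, h5, Finset.sum_neg_distrib, sub_neg_eq_add, map_sum, map_add,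
        map_smul, Finset.smul_sum, smul_add, smul_smul, Finset.sum_add_distrib]
    · simp

theorem deltaSeries_mul_C
    (hcomp : ∀ h, ∑ i, (B (e' i) h • e i + B (e i) h • e' i) = h) (k : ℕ) (h : 𝔥) :
    deltaSeries B e e' * PowerSeries.C (create k h) =
      PowerSeries.C (create k h) * deltaSeries B e e' + deltaComm B k h := by
  ext1 d
  rw [PowerSeries.coeff_mul_C, map_add, PowerSeries.coeff_C_mul,
    coeff_deltaSeries_create B e e' hcomp]

/-- `Δ(x)` is quadratic in annihilation operators, and these anticommute. -/
theorem deltaSeries_comm (k : ℕ) (h : 𝔥) : Commute (deltaSeries B e e') (deltaComm B k h) := by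
  have h1 : ∀ d d', Commute (PowerSeries.coeff d (deltaSeries B e e'))
      (PowerSeries.coeff d' (deltaComm B k h)) := by
    intro d d'
    rw [deltaSeries, deltaComm, PowerSeries.coeff_mk, PowerSeries.coeff_mk]
    split_ifs
    · refine Commute.smul_right ?_ _
      cases d with
      | zero => exact Commute.zero_left _
      | succ d =>
        refine Commute.sum_left _ _ _ fun mn _ => Commute.sum_left _ _ _ fun i _ =>
          Commute.smul_left ?_ _
        refine LinearMap.ext fun v => ?_
        change annih B mn.1 (e i) (annih B mn.2 (e' i) (annih B _ h v)) =
          annih B _ h (annih B mn.1 (e i) (annih B mn.2 (e' i) v))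
        rw [annih_annih B mn.2, map_neg, annih_annih B mn.1, neg_neg]
    · exact Commute.zero_right _
  refine PowerSeries.ext fun d => ?_
  rw [PowerSeries.coeff_mul, PowerSeries.coeff_mul, ← Finset.Nat.sum_antidiagonal_swap]
  exact Finset.sum_congr rfl fun mn _ => h1 _ _

/-- The commutator of `Δ(x)` with a creation operator commutes with `Δ(x)`, so the bracket acts on
powers like a derivative. The factor `j + 1` turns `1/(j+1)!` into `1/j!` in the exponential. -/
theorem deltaSeries_pow_mul_C
    (hcomp : ∀ h, ∑ i, (B (e' i) h • e i + B (e i) h • e' i) = h) (k : ℕ) (h : 𝔥) (j : ℕ) :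
    deltaSeries B e e' ^ (j + 1) * PowerSeries.C (create k h) =
      PowerSeries.C (create k h) * deltaSeries B e e' ^ (j + 1) +
        ((j + 1 : ℕ) : ℂ) • (deltaComm B k h * deltaSeries B e e' ^ j) := by
  induction j with
  | zero => simpa using deltaSeries_mul_C B e e' hcomp k h
  | succ j ih =>
    rw [pow_succ' _ (j + 1), mul_assoc, ih, mul_add, ← mul_assoc, deltaSeries_mul_C B e e' hcomp,
      add_mul, mul_assoc, ← pow_succ', add_assoc]
    congr 1
    rw [mul_smul_comm, ← mul_assoc, (deltaSeries_comm B e e' k h).eq, mul_assoc, ← pow_succ']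
    rw [Nat.cast_succ (j + 1), add_smul _ (1 : ℂ), one_smul, add_comm]

theorem coeff_deltaSeries_pow {d j : ℕ} (h : d < j) :
    PowerSeries.coeff d (deltaSeries B e e' ^ j) = 0 := by
  induction j generalizing d with
  | zero => omega
  | succ j ih =>
    rw [pow_succ, PowerSeries.coeff_mul]
    refine Finset.sum_eq_zero fun mn hmn => ?_
    rw [Finset.HasAntidiagonal.mem_antidiagonal] at hmn
    by_cases h0 : mn.2 = 0
    · have : PowerSeries.coeff mn.2 (deltaSeries B e e') = 0 := by
        rw [h0, deltaSeries, PowerSeries.coeff_mk]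
      rw [this, mul_zero]
    · rw [ih (by omega), zero_mul]

theorem expDelta_eq {d n : ℕ} (h : d < n) : expDelta B e e' d =
    ∑ j ∈ Finset.range n, ((j.factorial : ℂ))⁻¹ • PowerSeries.coeff d (deltaSeries B e e' ^ j) := by
  rw [expDelta]
  refine Finset.sum_subset (Finset.range_mono h) fun j _ hj => ?_
  rw [Finset.mem_range, not_lt] at hj
  rw [coeff_deltaSeries_pow B e e' (by omega), smul_zero]

/-- `exp(Δ(x)) h(-k-1/2) = (h(-k-1/2) + [Δ(x), h(-k-1/2)]) exp(Δ(x))`. -/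
theorem expDelta_create
    (hcomp : ∀ h, ∑ i, (B (e' i) h • e i + B (e i) h • e' i) = h) (k d : ℕ) (h : 𝔥)
    (v : FockV 𝔥) : expDelta B e e' d (create k h v) = create k h (expDelta B e e' d v) +
      ∑ mn ∈ Finset.HasAntidiagonal.antidiagonal d,
        PowerSeries.coeff mn.1 (deltaComm B k h) (expDelta B e e' mn.2 v) := by
  have h1 : expDelta B e e' d * create k h = create k h * expDelta B e e' d +
      ∑ mn ∈ Finset.HasAntidiagonal.antidiagonal d,
        PowerSeries.coeff mn.1 (deltaComm B k h) * expDelta B e e' mn.2 := by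
    have h2 : ∀ mn ∈ Finset.HasAntidiagonal.antidiagonal d,
        PowerSeries.coeff mn.1 (deltaComm B k h) * expDelta B e e' mn.2 =
          ∑ j ∈ Finset.range (d + 1), ((j.factorial : ℂ))⁻¹ •
            (PowerSeries.coeff mn.1 (deltaComm B k h) *
              PowerSeries.coeff mn.2 (deltaSeries B e e' ^ j)) := by
      intro mn hmn
      rw [Finset.HasAntidiagonal.mem_antidiagonal] at hmn
      rw [expDelta_eq B e e' (show mn.2 < d + 1 by omega), Finset.mul_sum]
      simp only [mul_smul_comm]
    rw [Finset.sum_congr rfl h2, Finset.sum_comm, expDelta_eq B e e' (show d < d + 2 by omega),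
      Finset.sum_mul, Finset.mul_sum, Finset.sum_range_succ', Finset.sum_range_succ' _ (d + 1),
      add_right_comm, ← Finset.sum_add_distrib]
    congr 1
    · refine Finset.sum_congr rfl fun j _ => ?_
      have := congrArg (PowerSeries.coeff d) (deltaSeries_pow_mul_C B e e' hcomp k h j)
      rw [PowerSeries.coeff_mul_C, map_add, PowerSeries.coeff_C_mul, PowerSeries.coeff_smul,
        PowerSeries.coeff_mul] at this
      rw [smul_mul_assoc, this, smul_add, mul_smul_comm, smul_smul, Finset.smul_sum]
      congr 1
      refine Finset.sum_congr rfl fun mn _ => ?_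
      congr 1
      have h3 : ((j + 1 : ℕ) : ℂ) ≠ 0 := by exact_mod_cast Nat.succ_ne_zero j
      rw [Nat.factorial_succ, Nat.cast_mul, mul_inv, mul_right_comm, inv_mul_cancel₀ h3, one_mul]
    · simp only [pow_zero, smul_mul_assoc, mul_smul_comm]
      rw [PowerSeries.coeff_one]
      split_ifs <;> simp
  have := congrArg (fun f : Module.End ℂ (FockV 𝔥) => f v) h1
  simpa only [Module.End.mul_apply, LinearMap.add_apply, LinearMap.sum_apply] using this

end ExpDelta

/-! ### Universal Wick sums for polynomial contractions. -/

section WickFree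

variable {ι : Type*}

/-- The universal sum over partial contractions, for polynomial contractions. -/
def wickFree (β : ι → ι → Polynomial ℂ) (L : List ι) : List ι →₀ Polynomial ℂ :=
  wick β (fun l => Finsupp.single l 1) L

/-- All Wick sums whose contractions are images of one family of polynomials are specialisations of
a single finite sum. In this way `exp Δ` can be applied with different variables substituted for
`x⁻¹`. -/
theorem wick_eq_sum_wickFree {K N : Type*} [CommRing K] [AddCommGroup N] [Module K N]
    (ψ : Polynomial ℂ →+* K) (β : ι → ι → Polynomial ℂ) (F : List ι → N) (L : List ι) :
    wick (fun a b => ψ (β a b)) F L = (wickFree β L).sum fun l p => ψ p • F l := by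
  let T : (List ι →₀ Polynomial ℂ) →+ N := Finsupp.liftAddHom fun l =>
    { toFun := fun p => ψ p • F l, map_zero' := by simp, map_add' := by simp [add_smul] }
  have hT : ∀ l p, T (Finsupp.single l p) = ψ p • F l := fun l p => by simp [T]
  have h := wick_map T β (fun a b => ψ (β a b)) (fun a b x => by
    induction x using Finsupp.induction_linear with
    | zero => simp
    | add x y hx hy => rw [smul_add, map_add, hx, hy, map_add, smul_add]
    | single l p => rw [Finsupp.smul_single, hT, hT, smul_eq_mul, map_mul, mul_smul])
    (fun l => Finsupp.single l 1) L
  simp only [hT, map_one, one_smul] at h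
  rw [h]
  simp [T, wickFree]

end WickFree

/-! ### The operator `exp Δ` as a sum over contractions. -/

section Words

variable {𝔥 : Type u} [AddCommGroup 𝔥] [Module ℂ 𝔥] (B : LinearMap.BilinForm ℂ 𝔥)

/-- The element `h₁(-k₁-1/2) ⋯ hᵣ(-kᵣ-1/2) 𝟏` of `V` for a list of pairs `(kᵢ, hᵢ)`. -/
def wordL (L : List (ℕ × 𝔥)) : FockV 𝔥 := (L.map fun c => create c.1 c.2).prod 1

@[simp] theorem wordL_nil : wordL ([] : List (ℕ × 𝔥)) = 1 := by simp [wordL]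

@[simp] theorem wordL_cons (c : ℕ × 𝔥) (L : List (ℕ × 𝔥)) :
    wordL (c :: L) = create c.1 c.2 (wordL L) := by simp [wordL]

theorem modeV_neg (k : ℕ) : modeV B (-(k : ℤ) - 1) = create k := by
  rw [show -(k : ℤ) - 1 = Int.negSucc k by rw [Int.negSucc_eq]; ring]
  rfl

theorem word_eq_wordL {r : ℕ} (a : Fin r → 𝔥) (m : Fin r → ℕ) :
    word B a m = wordL (List.ofFn fun i => (m i, a i)) := by
  simp only [word, wordL, modeV_neg, List.map_ofFn, Function.comp_def]

theorem annih_wordL (m : ℕ) (h : 𝔥) (L : List (ℕ × 𝔥)) : annih B m h (wordL L) =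
    contract (fun c : ℕ × 𝔥 => if m = c.1 then B h c.2 else 0) wordL L := by
  induction L with
  | nil => simp [annih_one]
  | cons c L ih =>
    rw [wordL_cons, annih_create_apply, ih, contract_cons]
    simp only [wordL_cons, contract_linear]

/-- The contractions of `exp Δ`, the variable being `x⁻¹`. -/
def deltaPair (c d : ℕ × 𝔥) : Polynomial ℂ :=
  Polynomial.monomial (c.1 + d.1 + 1) (-cNum c.1 d.1 * B c.2 d.2)

variable {M : ℕ} (e e' : Fin M → 𝔥)

theorem expDelta_one (d : ℕ) : expDelta B e e' d 1 = if d = 0 then 1 else 0 := by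
  have h1 : ∀ (j d : ℕ), PowerSeries.coeff d (deltaSeries B e e' ^ (j + 1)) 1 = 0 := by
    intro j
    induction j with
    | zero =>
      intro d
      rw [zero_add, pow_one, deltaSeries, PowerSeries.coeff_mk]
      cases d with
      | zero => simp
      | succ d =>
        simp only [LinearMap.sum_apply, LinearMap.smul_apply]
        refine Finset.sum_eq_zero fun mn _ => Finset.sum_eq_zero fun i _ => ?_
        change cNum mn.1 mn.2 • annih B mn.1 (e i) (annih B mn.2 (e' i) 1) = 0
        rw [annih_one, map_zero, smul_zero]
    | succ j ih =>
      intro d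
      rw [pow_succ', PowerSeries.coeff_mul, LinearMap.sum_apply]
      refine Finset.sum_eq_zero fun mn _ => ?_
      rw [Module.End.mul_apply, ih, map_zero]
  rw [expDelta, LinearMap.sum_apply, Finset.sum_range_succ']
  simp only [LinearMap.smul_apply, h1, smul_zero, Finset.sum_const_zero, zero_add, pow_zero,
    PowerSeries.coeff_one]
  split_ifs <;> simp

/-- The commutation rule `expDelta_create` is the recursion `wick_cons'`: the first letter either
survives or is replaced by an annihilation operator, which contracts it with a later letter.
Applying `ψ` makes the coefficients scalars, so that the identity lives over the commutative ring of
power series in `x⁻¹`. -/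
theorem mk_expDelta_wordL
    (hcomp : ∀ h, ∑ i, (B (e' i) h • e i + B (e i) h • e' i) = h) (L : List (ℕ × 𝔥))
    (ψ : FockV 𝔥 →ₗ[ℂ] ℂ) : PowerSeries.mk (fun d => ψ (expDelta B e e' d (wordL L))) =
      wick (fun a b => (Polynomial.coeToPowerSeries.ringHom (deltaPair B a b) : PowerSeries ℂ))
        (fun l => PowerSeries.C (ψ (wordL l))) L := by
  induction L generalizing ψ with
  | nil =>
    ext d
    simp only [wordL_nil, PowerSeries.coeff_mk, expDelta_one, wick_nil, PowerSeries.coeff_C]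
    split_ifs <;> simp
  | cons a L ih =>
    obtain ⟨k, h⟩ := a
    rw [wick_cons', ← wick_contract]
    have e1 := ih (ψ ∘ₗ create k h)
    simp only [LinearMap.comp_apply] at e1
    simp only [wordL_cons]
    rw [← e1]
    ext d
    rw [map_add, PowerSeries.coeff_mk, PowerSeries.coeff_mk, expDelta_create B e e' hcomp, map_add]
    congr 1
    -- The bound `n` exceeds every mode that can meet a letter of `L` and every mode that
    -- contributes to the coefficient of `x^(-d)`. A sum over `m < n` therefore misses nothing.
    obtain ⟨n, hn⟩ : ∃ n, d < n ∧ ∀ c ∈ L, c.1 < n := by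
      refine ⟨d + 1 + (L.map Prod.fst).sum, by omega, fun c hc => ?_⟩
      have := List.single_le_sum (by simp) c.1 (List.mem_map.2 ⟨c, hc, rfl⟩ : c.1 ∈ L.map Prod.fst)
      omega
    -- The contraction of the first letter is written as a combination of annihilation operators.
    -- They can be absorbed into the functional `ψ`, to which the induction hypothesis applies
    -- again.
    have e2 : ∀ l : List (ℕ × 𝔥), l.Sublist L →
        contract (fun c => (Polynomial.coeToPowerSeries.ringHom (deltaPair B (k, h) c) :
          PowerSeries ℂ)) (fun l => PowerSeries.C (ψ (wordL l))) l =
        ∑ m ∈ Finset.range n, (PowerSeries.X ^ (m + k + 1) * PowerSeries.C (cNum m k)) •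
          PowerSeries.C ((ψ ∘ₗ annih B m h) (wordL l)) := by
      intro l hl
      let T : FockV 𝔥 →+ PowerSeries ℂ :=
        (PowerSeries.C (R := ℂ)).toAddMonoidHom.comp ψ.toAddMonoidHom
      have e3 : ∀ m, PowerSeries.C ((ψ ∘ₗ annih B m h) (wordL l)) =
          contract (fun c : ℕ × 𝔥 => PowerSeries.C (if m = c.1 then B h c.2 else 0))
            (fun l => PowerSeries.C (ψ (wordL l))) l := by
        intro m
        rw [LinearMap.comp_apply, annih_wordL]
        exact (contract_map T (fun c : ℕ × 𝔥 => if m = c.1 then B h c.2 else 0)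
          (fun c : ℕ × 𝔥 => PowerSeries.C (if m = c.1 then B h c.2 else 0))
          (fun c v => by split_ifs <;> simp [T]) wordL l).symm
      simp only [e3, ← contract_smul_left]
      rw [← contract_sum_left]
      refine contract_congr (fun c hc => ?_) fun _ _ _ => rfl
      rw [Finset.sum_eq_single c.1]
      · rw [if_pos rfl, deltaPair, ← cNum_antisymm]
        simp only [Polynomial.coeToPowerSeries.ringHom_apply, Polynomial.coe_monomial]
        rw [mul_assoc, ← map_mul, add_comm k, PowerSeries.X_pow_mul,
          PowerSeries.monomial_eq_mk]
        ext i
        rw [PowerSeries.coeff_mk, PowerSeries.coeff_C_mul, PowerSeries.coeff_X_pow]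
        split_ifs <;> simp
      · intro m _ hm
        rw [if_neg hm, map_zero, mul_zero]
      · intro h'
        exact absurd (Finset.mem_range.2 (hn.2 c (hl.subset hc))) h'
    rw [wick_congr (γ := fun a b => (Polynomial.coeToPowerSeries.ringHom (deltaPair B a b) :
      PowerSeries ℂ)) (List.pairwise_of_forall fun _ _ => rfl) e2, wick_sum]
    simp only [wick_smul, ← ih]
    rw [map_sum, map_sum, Finset.Nat.sum_antidiagonal_eq_sum_range_succ_mk]
    have e4 : ∀ m, PowerSeries.coeff d ((PowerSeries.X ^ (m + k + 1) * PowerSeries.C (cNum m k)) •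
        PowerSeries.mk fun d => (ψ ∘ₗ annih B m h) (expDelta B e e' d (wordL L))) =
        if m + k + 1 ≤ d then cNum m k * ψ (annih B m h (expDelta B e e' (d - (m + k + 1))
          (wordL L))) else 0 := by
      intro m
      rw [smul_eq_mul, mul_assoc, PowerSeries.coeff_X_pow_mul']
      simp only [PowerSeries.coeff_C_mul, PowerSeries.coeff_mk, LinearMap.comp_apply]
    have e5 : ∀ i, ψ (PowerSeries.coeff i (deltaComm B k h) (expDelta B e e' (d - i) (wordL L))) =
        if k < i then cNum (i - k - 1) k *
          ψ (annih B (i - k - 1) h (expDelta B e e' (d - i) (wordL L))) else 0 := by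
      intro i
      rw [deltaComm, PowerSeries.coeff_mk]
      split_ifs <;> simp
    simp only [e4, e5, ← Finset.sum_filter]
    refine Finset.sum_nbij' (fun i => i - k - 1) (fun m => m + k + 1) ?_ ?_ ?_ ?_ ?_
    · intro i hi
      simp only [Finset.mem_filter, Finset.mem_range] at hi ⊢
      omega
    · intro i hi
      simp only [Finset.mem_filter, Finset.mem_range] at hi ⊢
      omega
    · intro i hi
      simp only [Finset.mem_filter, Finset.mem_range] at hi ⊢
      omega
    · intro i hi
      simp only [Finset.mem_filter, Finset.mem_range] at hi ⊢
      omega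
    · intro i hi
      simp only [Finset.mem_filter, Finset.mem_range] at hi
      rw [show i - k - 1 + k + 1 = i by omega]

/-- The action of `exp Δ` on a word is given by contractions. -/
theorem expDelta_wordL (hcomp : ∀ h, ∑ i, (B (e' i) h • e i + B (e i) h • e' i) = h)
    (L : List (ℕ × 𝔥)) (d : ℕ) : expDelta B e e' d (wordL L) =
      (wickFree (deltaPair B) L).sum fun l p => p.coeff d • wordL l := by
  rw [← sub_eq_zero, ← Module.forall_dual_apply_eq_zero_iff ℂ]
  intro ψ
  rw [map_sub, sub_eq_zero]
  have h := congrArg (PowerSeries.coeff d) (mk_expDelta_wordL B e e' hcomp L ψ)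
  rw [PowerSeries.coeff_mk, wick_eq_sum_wickFree] at h
  rw [h, Finsupp.sum, Finsupp.sum, map_sum, map_sum]
  refine Finset.sum_congr rfl fun l _ => ?_
  rw [smul_eq_mul, PowerSeries.coeff_mul_C, map_smul, smul_eq_mul]
  simp

end Words

open Filter

/-! ### Normally ordered products as series -/

/-- Half-integral powers of the small variable that are at least `l`, and the total power `t`. -/
def lineSet (l t : ℚ) : Set (ℚ × ℚ) := {γ | γ.1 ∈ halfInts ∧ l ≤ γ.1 ∧ γ.2 = t}

theorem mem_lineSet {l t : ℚ} {γ : ℚ × ℚ} :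
    γ ∈ lineSet l t ↔ γ.1 ∈ halfInts ∧ l ≤ γ.1 ∧ γ.2 = t := Iff.rfl

open scoped Pointwise in
theorem support_prod_lineSet {σ : Type*} (T : Finset σ) (f : σ → Ser) (l t : σ → ℚ)
    (h : ∀ i ∈ T, (f i).support ⊆ lineSet (l i) (t i)) :
    (∏ i ∈ T, f i).support ⊆ lineSet (∑ i ∈ T, l i) (∑ i ∈ T, t i) := by
  classical
  induction T using Finset.induction_on with
  | empty =>
    intro γ hγ
    rw [Finset.prod_empty, HahnSeries.support_one] at hγ
    obtain rfl : γ = 0 := hγ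
    simp [mem_lineSet, zero_mem]
  | insert a T ha ih =>
    rw [Finset.prod_insert ha, Finset.sum_insert ha, Finset.sum_insert ha]
    refine HahnSeries.support_mul_subset.trans ?_
    rintro _ ⟨x, hx, y, hy, rfl⟩
    have h1 := h a (by simp) hx
    have h2 := ih (fun i hi => h i (by simp [hi])) hy
    rw [mem_lineSet] at h1 h2 ⊢
    exact ⟨add_mem h1.1 h2.1, add_le_add h1.2.1 h2.2.1, by
      rw [← h1.2.2, ← h2.2.2]; rfl⟩

theorem monoSer_support_lineSet {R : Expansion} {α β γ l : ℚ} (hβ : β ∈ halfInts)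
    (hγ : γ ∈ halfInts) (h1 : l ≤ (match R with | .xy => β | .yx => γ)) :
    (monoSer R α β γ).support ⊆ lineSet l (α + β + γ) := by
  intro δ hδ
  obtain ⟨⟨p, q⟩, rfl⟩ := (expo_bijective R).2 δ
  rw [HahnSeries.mem_support] at hδ
  simp only [monoSer_coeff] at hδ
  split_ifs at hδ with h
  · rw [mem_lineSet]
    simp only [expo_snd, h, and_true]
    cases R
    · have : ∃ i : ℕ, q - β = i := by
        by_contra h'
        push Not at h'
        exact hδ (binomQ_eq_zero h')
      obtain ⟨i, hi⟩ := this
      obtain rfl : q = β + i := by linarith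
      simp only [expo]
      exact ⟨add_mem hβ (natCast_mem_halfInts i),
        by simp only at h1; have : (0 : ℚ) ≤ i := i.cast_nonneg; linarith⟩
    · have : ∃ i : ℕ, p - γ = i := by
        by_contra h'
        push Not at h'
        exact hδ (binomQ_eq_zero h')
      obtain ⟨i, hi⟩ := this
      obtain rfl : p = γ + i := by linarith
      simp only [expo]
      exact ⟨add_mem hγ (natCast_mem_halfInts i),
        by simp only at h1; have : (0 : ℚ) ≤ i := i.cast_nonneg; linarith⟩
  · exact absurd rfl hδ

theorem prod_smul_monoSer (R : Expansion) {σ : Type*} (T : Finset σ) (c : σ → ℂ)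
    (α β γ : σ → ℚ) : ∏ i ∈ T, c i • monoSer R (α i) (β i) (γ i) =
      (∏ i ∈ T, c i) • monoSer R (∑ i ∈ T, α i) (∑ i ∈ T, β i) (∑ i ∈ T, γ i) := by
  classical
  induction T using Finset.induction_on with
  | empty => simp
  | insert a T ha ih =>
    simp only [Finset.prod_insert ha, Finset.sum_insert ha, ih, ser_smul_mul, ser_mul_smul,
      monoSer_mul, smul_smul, mul_comm]

theorem eventually_mem_piFinset_Icc {r : ℕ} (κ : Fin r → ℤ) :
    ∀ᶠ N : ℕ in atTop, κ ∈ Fintype.piFinset fun _ => Finset.Icc (-(N : ℤ)) N := by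
  have : ∀ᶠ N : ℕ in atTop, ∀ i, κ i ∈ Finset.Icc (-(N : ℤ)) N := by
    rw [eventually_all]
    intro i
    filter_upwards [eventually_ge_atTop (κ i).natAbs] with N hN
    rw [Finset.mem_Icc]
    omega
  filter_upwards [this] with N hN
  rwa [Fintype.mem_piFinset]

section NordSer

variable {𝔥 : Type u} [AddCommGroup 𝔥] [Module ℂ 𝔥] (B : LinearMap.BilinForm ℂ 𝔥)
  {U : Type v} [AddCommGroup U] [Module ℂ U] [Module (TensorAlgebra ℂ 𝔥) U]
  (φ : SpaceW B U →ₗ[ℂ] ℂ) (w : SpaceW B U) (R : Expansion)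

/-- Letters `inl (m, h)`, `inr (n, h)` stand for `h^(m)(x + y)`, `h^(n)(y)`. -/
abbrev Letter (𝔥 : Type u) : Type u := (ℕ × 𝔥) ⊕ (ℕ × 𝔥)

/-- The order of the derivative and the vector. -/
def Letter.data (c : Letter 𝔥) : ℕ × 𝔥 := Sum.elim id id c

/-- The factor that accompanies the mode `h(n)` of `W` in a field. -/
def fieldWt (c : Letter 𝔥) (n : ℤ) : Ser :=
  match c with
  | .inl a => binom (-n - 1 / 2) a.1 • monoSer R (-n - 1 / 2 - a.1) 0 0
  | .inr b => binom (-n - 1 / 2) b.1 • monoSer R 0 (-n - 1 / 2 - b.1) 0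

theorem half_sub_mem (n : ℤ) (m : ℕ) : (-n - 1 / 2 - m : ℚ) ∈ halfInts :=
  sub_mem (sub_mem (neg_mem (intCast_mem_halfInts n)) half_mem) (natCast_mem_halfInts m)

-- One bound is chosen for both expansions and for both kinds of letters. The positive part of `n`
-- enters because the power of the small variable can be lowered by positive modes only, and these
-- are limited on a given vector.
omit [AddCommGroup 𝔥] [Module ℂ 𝔥] in
theorem fieldWt_support (c : Letter 𝔥) (n : ℤ) : (fieldWt R c n).support ⊆
    lineSet (-(max (n : ℚ) 0) - 1 / 2 - c.data.1) (-n - 1 / 2 - c.data.1) := by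
  have h1 : (n : ℚ) ≤ max (n : ℚ) 0 := le_max_left _ _
  have h2 : (0 : ℚ) ≤ max (n : ℚ) 0 := le_max_right _ _
  cases c with
  | inl a =>
    have h0 : (0 : ℚ) ≤ a.1 := a.1.cast_nonneg
    have := monoSer_support_lineSet (R := R) (α := -n - 1 / 2 - a.1) (β := 0) (γ := 0)
      (l := -(max (n : ℚ) 0) - 1 / 2 - a.1) (zero_mem _) (zero_mem _) (by cases R <;> simp only <;>
        linarith)
    rw [add_zero, add_zero] at this
    exact support_smul_subset' _ this
  | inr a =>
    have h0 : (0 : ℚ) ≤ a.1 := a.1.cast_nonneg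
    have := monoSer_support_lineSet (R := R) (α := 0) (β := -n - 1 / 2 - a.1) (γ := 0)
      (l := -(max (n : ℚ) 0) - 1 / 2 - a.1) (half_sub_mem n a.1) (zero_mem _)
      (by cases R <;> simp only <;> linarith)
    rw [add_zero, zero_add] at this
    exact support_smul_subset' _ this

/-- The matrix coefficient of a normally ordered product of modes of `W`. -/
def nordFun (ℓ : List (Letter 𝔥 × ℤ)) : ℂ :=
  φ (nordList (modesW B U) B (ℓ.map fun c => (c.2, c.1.data.2)) w)

theorem nordFun_ofFn {r : ℕ} (c : Fin r → Letter 𝔥) (κ : Fin r → ℤ) :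
    nordFun B φ w (List.ofFn fun i => (c i, κ i)) =
      φ (nord (modesW B U) B κ (fun i => (c i).data.2) w) := by
  rw [nordFun, nord_eq_nordList (modesW_fermionic B U), List.map_ofFn]
  rfl

/-- A bound for the negative exponents in a product of fields applied to a vector. -/
def nordBound (D : ℚ) (L : List (Letter 𝔥)) : ℚ :=
  D + ∑ i : Fin L.length, (1 / 2 + ((L.get i).data.1 : ℚ))

omit [AddCommGroup 𝔥] [Module ℂ 𝔥] in
theorem sum_half_data_mem (L : List (Letter 𝔥)) :
    (∑ i : Fin L.length, (1 / 2 + ((L.get i).data.1 : ℚ))) ∈ halfInts :=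
  sum_mem fun _ _ => add_mem half_mem (natCast_mem_halfInts _)

variable {B φ w R} in
theorem nordFun_ne_zero {L : List (Letter 𝔥)} {κ : Fin L.length → ℤ}
    (h : nordFun B φ w (List.ofFn fun i => (L.get i, κ i)) ≠ 0) :
    nord (modesW B U) B κ (fun i => (L.get i).data.2) w ≠ 0 := fun h' => by
  rw [nordFun_ofFn, h', map_zero] at h
  exact h rfl

omit [AddCommGroup 𝔥] [Module ℂ 𝔥] in
theorem support_prod_wt (L : List (Letter 𝔥)) (wt : Letter 𝔥 → ℤ → Ser)
    (hsupp : ∀ c ∈ L, ∀ n, (wt c n).support ⊆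
      lineSet (-(max (n : ℚ) 0) - 1 / 2 - c.data.1) (-n - 1 / 2 - c.data.1))
    (κ : Fin L.length → ℤ) : (∏ i, wt (L.get i) (κ i)).support ⊆
      lineSet (-(∑ i, max (κ i : ℚ) 0) - ∑ i : Fin L.length, (1 / 2 + ((L.get i).data.1 : ℚ)))
        (-(∑ i, (κ i : ℚ)) - ∑ i : Fin L.length, (1 / 2 + ((L.get i).data.1 : ℚ))) := by
  have := support_prod_lineSet Finset.univ _ _ _
    fun i _ => hsupp _ (List.get_mem L i) (κ i)
  refine this.trans (le_of_eq ?_)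
  congr 1
  · rw [← Finset.sum_neg_distrib, ← Finset.sum_sub_distrib]
    exact Finset.sum_congr rfl fun i _ => by ring
  · rw [← Finset.sum_neg_distrib, ← Finset.sum_sub_distrib]
    exact Finset.sum_congr rfl fun i _ => by ring

-- If the operator does not kill `w`, the positive parts of the degrees add up to at most `D`. This
-- bounds all exponents from below, uniformly in the modes.
variable {w} in
theorem support_prod_mul_nordFun {D : ℚ} (hD : Trunc (modesW B U) D w) (L : List (Letter 𝔥))
    (wt : Letter 𝔥 → ℤ → Ser) (hsupp : ∀ c ∈ L, ∀ n, (wt c n).support ⊆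
      lineSet (-(max (n : ℚ) 0) - 1 / 2 - c.data.1) (-n - 1 / 2 - c.data.1))
    (κ : Fin L.length → ℤ) : ((∏ i, wt (L.get i) (κ i)) *
      HahnSeries.C (nordFun B φ w (List.ofFn fun i => (L.get i, κ i)))).support ⊆
      halfBox (nordBound D L) := by
  rw [mul_comm, HahnSeries.C_mul_eq_smul]
  by_cases h0 : nordFun B φ w (List.ofFn fun i => (L.get i, κ i)) = 0
  · intro δ hδ
    rw [h0] at hδ
    exact absurd (by rw [HahnSeries.coeff_smul]; simp) hδ
  · refine support_smul_subset' _ ((support_prod_wt L wt hsupp κ).trans fun γ hγ => ?_)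
    rw [mem_lineSet] at hγ
    have h1 : ∑ i, max (κ i : ℚ) 0 ≤ D := by
      by_contra hlt
      push Not at hlt
      refine nordFun_ne_zero h0 (nord_eq_zero_of_trunc hD κ _ ?_)
      simpa only [modesW_deg] using hlt
    have h2 : ∑ i, (κ i : ℚ) ≤ ∑ i, max (κ i : ℚ) 0 :=
      Finset.sum_le_sum fun i _ => le_max_left _ _
    rw [nordBound]
    refine ⟨⟨by linarith [hγ.2.1], hγ.1⟩, by linarith [hγ.2.2], ?_⟩
    rw [hγ.2.2]
    exact sub_mem (neg_mem (sum_mem fun i _ => intCast_mem_halfInts _)) (sum_half_data_mem L)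

theorem modeSum_nordFun_eq_sum (wt : Letter 𝔥 → ℤ → Ser) (Λ : Finset ℤ) (L : List (Letter 𝔥)) :
    modeSum wt Λ (fun ℓ => (HahnSeries.C (nordFun B φ w ℓ) : Ser)) L =
      ∑ κ ∈ Fintype.piFinset fun _ : Fin L.length => Λ, (∏ i, wt (L.get i) (κ i)) *
          HahnSeries.C (nordFun B φ w (List.ofFn fun i => (L.get i, κ i))) := by
  have := modeSum_ofFn wt Λ (fun ℓ => (HahnSeries.C (nordFun B φ w ℓ) : Ser)) L.get
  rw [List.ofFn_get] at this
  exact this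

/-- The matrix coefficient of a product of series with mode operators as coefficients,
normally ordered and applied to `w`. -/
def nordSerWt (wt : Letter 𝔥 → ℤ → Ser) (L : List (Letter 𝔥)) : Ser :=
  serOf fun γ => ∑ᶠ κ : Fin L.length → ℤ, ((∏ i, wt (L.get i) (κ i)) *
    HahnSeries.C (nordFun B φ w (List.ofFn fun i => (L.get i, κ i)))).coeff γ

/-- The modes that contribute to a given exponent. -/
theorem exists_finset_nordSerWt (L : List (Letter 𝔥)) (γ : ℚ × ℚ) :
    ∃ T : Finset (Fin L.length → ℤ), ∀ wt : Letter 𝔥 → ℤ → Ser,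
      (∀ c ∈ L, ∀ n, (wt c n).support ⊆
        lineSet (-(max (n : ℚ) 0) - 1 / 2 - c.data.1) (-n - 1 / 2 - c.data.1)) →
      ∀ κ ∉ T, ((∏ i, wt (L.get i) (κ i)) *
        HahnSeries.C (nordFun B φ w (List.ofFn fun i => (L.get i, κ i)))).coeff γ = 0 := by
  refine ⟨(nord_finite (modesW B U) B (fun i => (L.get i).data.2) w
    (-γ.2 - ∑ i : Fin L.length, (1 / 2 + ((L.get i).data.1 : ℚ)))).toFinset,
    fun wt hsupp κ hκ => ?_⟩
  rw [mul_comm, HahnSeries.C_mul_eq_smul, HahnSeries.coeff_smul]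
  rw [Set.Finite.mem_toFinset, Set.mem_ofPred_eq, not_and, not_not] at hκ
  by_cases h0 : (∏ i, wt (L.get i) (κ i)).coeff γ = 0
  · rw [h0, smul_zero]
  · have h1 := support_prod_wt L wt hsupp κ h0
    rw [mem_lineSet] at h1
    rw [nordFun_ofFn, hκ (by simp only [modesW_deg]; linarith [h1.2.2]), map_zero, zero_smul]

/-- For each exponent the total degree is fixed, so by `nord_finite` only finitely many tuples of
modes contribute. The set of tuples does not depend on `N`. -/
theorem tends_modeSum_nordFun (L : List (Letter 𝔥)) (wt : ℕ → Letter 𝔥 → ℤ → Ser)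
    (wt' : Letter 𝔥 → ℤ → Ser) (hwt : ∀ c ∈ L, ∀ n, Tends (fun N => wt N c n) (wt' c n))
    (hsupp : ∀ N, ∀ c ∈ L, ∀ n, (wt N c n).support ⊆
      lineSet (-(max (n : ℚ) 0) - 1 / 2 - c.data.1) (-n - 1 / 2 - c.data.1)) :
    Tends (fun N => modeSum (wt N) (Finset.Icc (-(N : ℤ)) N)
      (fun ℓ => HahnSeries.C (nordFun B φ w ℓ)) L) (nordSerWt B φ w wt' L) := by
  obtain ⟨D, -, hD⟩ := exists_trunc (modesW B U) w
  refine Tends.congr (Tends.sum_exhaust (eventually_mem_piFinset_Icc) (fun κ γ => ?_)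
    (halfBox_isPWO (nordBound D L))
    (fun N κ => support_prod_mul_nordFun B φ hD L (wt N) (hsupp N) κ) fun γ => ?_)
    fun N => modeSum_nordFun_eq_sum B φ w (wt N) _ L
  · exact ((Tends.prod _ fun i _ => hwt _ (List.get_mem L i) (κ i)).mul (Tends.const _)).2 γ
  · obtain ⟨T, hT⟩ := exists_finset_nordSerWt B φ w L γ
    exact ⟨T, fun N κ hκ => hT (wt N) (hsupp N) κ hκ⟩

variable {w} in
theorem nordSerWt_coeff {D : ℚ} (hD : Trunc (modesW B U) D w) (L : List (Letter 𝔥))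
    (wt : Letter 𝔥 → ℤ → Ser) (hsupp : ∀ c ∈ L, ∀ n, (wt c n).support ⊆
      lineSet (-(max (n : ℚ) 0) - 1 / 2 - c.data.1) (-n - 1 / 2 - c.data.1)) (γ : ℚ × ℚ) :
    (nordSerWt B φ w wt L).coeff γ = ∑ᶠ κ : Fin L.length → ℤ, ((∏ i, wt (L.get i) (κ i)) *
      HahnSeries.C (nordFun B φ w (List.ofFn fun i => (L.get i, κ i)))).coeff γ := by
  refine serOf_coeff (halfBox_isPWO (nordBound D L)) (fun γ hγ => ?_) γ
  by_contra h
  refine hγ (finsum_eq_zero_of_forall_eq_zero fun κ => ?_)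
  by_contra h'
  exact h (support_prod_mul_nordFun B φ hD L wt hsupp κ h')

variable {w} in
theorem nordSerWt_support {D : ℚ} (hD : Trunc (modesW B U) D w) (L : List (Letter 𝔥))
    (wt : Letter 𝔥 → ℤ → Ser) (hsupp : ∀ c ∈ L, ∀ n, (wt c n).support ⊆
      lineSet (-(max (n : ℚ) 0) - 1 / 2 - c.data.1) (-n - 1 / 2 - c.data.1)) :
    (nordSerWt B φ w wt L).support ⊆ halfBox (nordBound D L) := by
  intro γ hγ
  rw [HahnSeries.mem_support, nordSerWt_coeff B φ hD L wt hsupp] at hγ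
  by_contra h
  refine hγ (finsum_eq_zero_of_forall_eq_zero fun κ => ?_)
  by_contra h'
  exact h (support_prod_mul_nordFun B φ hD L wt hsupp κ h')

/-- Here the sum over modes is already infinite and the weights converge. This is needed for the
iterate, where each field arises as the limit of its Taylor polynomials. -/
theorem tends_nordSerWt (L : List (Letter 𝔥)) (wt : ℕ → Letter 𝔥 → ℤ → Ser)
    (wt' : Letter 𝔥 → ℤ → Ser) (hwt : ∀ c ∈ L, ∀ n, Tends (fun N => wt N c n) (wt' c n))
    (hsupp : ∀ N, ∀ c ∈ L, ∀ n, (wt N c n).support ⊆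
      lineSet (-(max (n : ℚ) 0) - 1 / 2 - c.data.1) (-n - 1 / 2 - c.data.1))
    (hsupp' : ∀ c ∈ L, ∀ n, (wt' c n).support ⊆
      lineSet (-(max (n : ℚ) 0) - 1 / 2 - c.data.1) (-n - 1 / 2 - c.data.1)) :
    Tends (fun N => nordSerWt B φ w (wt N) L) (nordSerWt B φ w wt' L) := by
  obtain ⟨D, -, hD⟩ := exists_trunc (modesW B U) w
  refine ⟨⟨_, halfBox_isPWO (nordBound D L),
    fun N => nordSerWt_support B φ hD L (wt N) (hsupp N)⟩, fun γ => ?_⟩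
  obtain ⟨T, hT⟩ := exists_finset_nordSerWt B φ w L γ
  have : ∀ᶠ N in atTop, ∀ κ ∈ T, ((∏ i, wt N (L.get i) (κ i)) *
        HahnSeries.C (nordFun B φ w (List.ofFn fun i => (L.get i, κ i)))).coeff γ =
      ((∏ i, wt' (L.get i) (κ i)) *
        HahnSeries.C (nordFun B φ w (List.ofFn fun i => (L.get i, κ i)))).coeff γ :=
    (eventually_all_finset T).2 fun κ _ =>
      ((Tends.prod _ fun i _ => hwt _ (List.get_mem L i) (κ i)).mul (Tends.const _)).2 γ
  filter_upwards [this] with N hN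
  rw [nordSerWt_coeff B φ hD L _ (hsupp N), nordSerWt_coeff B φ hD L _ hsupp']
  refine finsum_congr fun κ => ?_
  by_cases hκ : κ ∈ T
  · exact hN κ hκ
  · rw [hT _ (hsupp N) κ hκ, hT _ hsupp' κ hκ]

/-- The matrix coefficient of a normally ordered product of fields, applied to `w`. -/
abbrev nordSer (L : List (Letter 𝔥)) : Ser := nordSerWt B φ w (fieldWt R) L

theorem tends_nordSer (L : List (Letter 𝔥)) :
    Tends (fun N => modeSum (fieldWt R) (Finset.Icc (-(N : ℤ)) N)
      (fun ℓ => HahnSeries.C (nordFun B φ w ℓ)) L) (nordSer B φ w R L) :=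
  tends_modeSum_nordFun B φ w L (fun _ => fieldWt R) _ (fun _ _ _ => Tends.const _)
    fun _ c _ n => fieldWt_support R c n

variable {w} in
theorem nordSer_support {D : ℚ} (hD : Trunc (modesW B U) D w) (L : List (Letter 𝔥)) :
    (nordSer B φ w R L).support ⊆ halfBox (nordBound D L) :=
  nordSerWt_support B φ hD L _ fun c _ n => fieldWt_support R c n

end NordSer

open Filter

/-! ### The right-hand side as a series -/

/-- A sum over exponents of sums over the modes with this exponent is rearranged into one finite sum
over modes. -/
theorem finsum_smul_key {C I X : Type*} [AddCommGroup X] [Module ℂ X] [DecidableEq C]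
    (T : Finset I) (key : I → C) (f : C → ℂ) (v : I → X)
    (hT : ∀ k, f (key k) ≠ 0 → v k ≠ 0 → k ∈ T) :
    ∑ᶠ c, f c • (∑ᶠ k, if key k = c then v k else 0) = ∑ k ∈ T, f (key k) • v k := by
  have e : ∀ c, f c • (∑ᶠ k, if key k = c then v k else 0) =
      ∑ k ∈ T, if key k = c then f c • v k else 0 := by
    intro c
    by_cases hc : f c = 0
    · simp [hc]
    · rw [finsum_eq_sum_of_support_subset (s := T), Finset.smul_sum]
      · exact Finset.sum_congr rfl fun k _ => by split_ifs <;> simp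
      · intro k hk
        rw [Function.mem_support] at hk
        split_ifs at hk with h
        · exact hT k (h ▸ hc) hk
        · exact absurd rfl hk
  simp only [e]
  rw [finsum_sum_comm]
  · refine Finset.sum_congr rfl fun k _ => ?_
    rw [finsum_eq_single _ (key k)]
    · simp
    · intro c hc
      rw [if_neg (Ne.symm hc)]
  · intro k _
    refine (Set.finite_singleton (key k)).subset fun c hc => ?_
    rw [Function.mem_support] at hc
    split_ifs at hc with h
    · exact h.symm
    · exact absurd rfl hc

section Coeff

variable {X : Type v} [AddCommGroup X] [Module ℂ X] {R : Expansion}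

/-- The product of two series, one with coefficients in a module. -/
theorem mulSer_coeff (φ : X →ₗ[ℂ] ℂ) {s : ℚ → ℚ → ℂ} {F : ℚ → ℚ → X} {S Φ : Ser}
    (hS : ∀ p q, S.coeff (expo R p q) = s p q) (hΦ : ∀ p q, Φ.coeff (expo R p q) = φ (F p q))
    {t : Set (ℚ × ℚ)} (ht : t.IsPWO) (hF : ∀ p q, F p q ≠ 0 → expo R p q ∈ t) (p q : ℚ) :
    (S * Φ).coeff (expo R p q) = φ (mulSer s F p q) := by
  classical
  have hΦt : Φ.support ⊆ t := fun γ hγ => by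
    obtain ⟨⟨p, q⟩, rfl⟩ := (expo_bijective R).2 γ
    refine hF p q fun h => ?_
    rw [HahnSeries.mem_support, hΦ, h, map_zero] at hγ
    exact hγ rfl
  rw [HahnSeries.coeff_mul_right' ht hΦt]
  set A := Finset.antidiagonal S.isPWO_support ht (expo R p q) with hA
  have hinj : Set.InjOn (fun ij : (ℚ × ℚ) × (ℚ × ℚ) => (expoEquiv R).symm ij.1) A := by
    rintro ⟨i, j⟩ hi ⟨i', j'⟩ hi' h
    have h1 : i = i' := (expoEquiv R).symm.injective h
    rw [hA, Finset.mem_coe, Finset.mem_antidiagonal] at hi hi'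
    have h2 : i + j = i' + j' := hi.2.2.trans hi'.2.2.symm
    subst h1
    rw [add_right_inj] at h2
    rw [h2]
  rw [mulSer, finsum_eq_sum_of_support_subset (s := A.image fun ij => (expoEquiv R).symm ij.1),
    Finset.sum_image hinj, map_sum]
  · refine Finset.sum_congr rfl fun ij hij => ?_
    rw [hA, Finset.mem_antidiagonal] at hij
    obtain ⟨⟨p', q'⟩, h1⟩ := (expo_bijective R).2 ij.1
    simp only at h1
    have h2 : (expoEquiv R).symm ij.1 = (p', q') := by
      rw [Equiv.symm_apply_eq, expoEquiv_apply, h1]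
    have h3 : ij.2 = expo R (p - p') (q - q') := by
      rw [expo_sub, ← hij.2.2, h1]
      abel
    rw [h2, h3, ← h1, hS, hΦ, map_smul, smul_eq_mul]
  · rintro ⟨p', q'⟩ hc
    rw [Function.mem_support] at hc
    rw [Finset.mem_coe, Finset.mem_image]
    refine ⟨(expo R p' q', expo R (p - p') (q - q')), ?_, ?_⟩
    · rw [hA, Finset.mem_antidiagonal]
      refine ⟨?_, hF _ _ fun h => hc (by rw [h, smul_zero]), ?_⟩
      · rw [HahnSeries.mem_support, hS]
        exact fun h => hc (by rw [h, zero_smul])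
      · rw [← expo_add]
        simp
    · rw [Equiv.symm_apply_eq]
      rfl

end Coeff

section RightSide

variable {𝔥 : Type u} [AddCommGroup 𝔥] [Module ℂ 𝔥] (B : LinearMap.BilinForm ℂ 𝔥)
  {U : Type v} [AddCommGroup U] [Module ℂ U] [Module (TensorAlgebra ℂ 𝔥) U]
  (φ : SpaceW B U →ₗ[ℂ] ℂ) (w : SpaceW B U) (R : Expansion)

/-- The letters of `a₁^(m₁)(x + y) ⋯ aᵣ^(mᵣ)(x + y) b₁^(n₁)(y) ⋯ bₛ^(nₛ)(y)`. -/
def letters {r s : ℕ} (a : Fin r → 𝔥) (m : Fin r → ℕ) (b : Fin s → 𝔥) (n : Fin s → ℕ) :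
    List (Letter 𝔥) :=
  (List.ofFn fun i => (m i, a i)).map .inl ++ (List.ofFn fun j => (n j, b j)).map .inr

omit [AddCommGroup 𝔥] [Module ℂ 𝔥] in
theorem letters_eq_ofFn {r s : ℕ} (a : Fin r → 𝔥) (m : Fin r → ℕ) (b : Fin s → 𝔥)
    (n : Fin s → ℕ) : letters a m b n =
      List.ofFn (Fin.append (fun i => (.inl (m i, a i) : Letter 𝔥)) fun j => .inr (n j, b j)) := by
  rw [letters, List.ofFn_fin_append, List.map_ofFn, List.map_ofFn]
  rfl

omit [AddCommGroup 𝔥] [Module ℂ 𝔥] in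
theorem append_data {r s : ℕ} (a : Fin r → 𝔥) (m : Fin r → ℕ) (b : Fin s → 𝔥) (n : Fin s → ℕ)  :
    (fun i => (Letter.data (Fin.append (fun i => (.inl (m i, a i) : Letter 𝔥))
      (fun j => .inr (n j, b j)) i)).2) = Fin.append a b := by
  funext i
  induction i using Fin.addCases <;> simp [Letter.data]

/-- Summing over modes first, as in `nordSer`, and collecting equal powers of `x₁` and `y` first, as
in `substSer` and `nordTwo`, give the same coefficients, as both are one finite sum over modes. -/
theorem substSer_nordTwo_coeff {r s : ℕ} (a : Fin r → 𝔥) (m : Fin r → ℕ) (b : Fin s → 𝔥)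
    (n : Fin s → ℕ) (p q : ℚ) :
    (nordSer B φ w R (letters a m b n)).coeff (expo R p q) =
      φ (substSer R (nordTwo (modesW B U) B a m b n w) p q) := by
  classical
  set c : Fin (r + s) → Letter 𝔥 :=
    Fin.append (fun i => (.inl (m i, a i) : Letter 𝔥)) fun j => .inr (n j, b j) with hc
  -- The total degree `t` of the modes is determined by `p + q`, since expanding `(x+y)^α` preserves
  -- the total power. So the set `T` contains all modes that matter.
  have hc2 : (fun i => (c i).data.2) = Fin.append a b := append_data a m b n
  set t : ℚ := -(p + q) - (∑ i, (1 / 2 + (m i : ℚ)) + ∑ j, (1 / 2 + (n j : ℚ))) with ht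
  set T := (nord_finite (modesW B U) B (Fin.append a b) w t).toFinset with hT
  have hfexp : ∀ (k : ℤ) (m : ℕ), fexp (modesW B U) m k = -k - 1 / 2 - m := fun k m => by
    rw [fexp, modesW_deg]
  have hsum : ∀ {r : ℕ} (m : Fin r → ℕ) (k : Fin r → ℤ), ∑ i, fexp (modesW B U) (m i) (k i) =
      -∑ i, (k i : ℚ) - ∑ i, (1 / 2 + (m i : ℚ)) := fun m k => by
    rw [← Finset.sum_neg_distrib, ← Finset.sum_sub_distrib]
    exact Finset.sum_congr rfl fun i _ => by rw [hfexp]; ring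
  have hr : substSer R (nordTwo (modesW B U) B a m b n w) p q =
      ∑ k ∈ T.map (Fin.appendEquiv r s).symm.toEmbedding,
        iotaMono R (∑ i, fexp (modesW B U) (m i) (k.1 i)) (∑ j, fexp (modesW B U) (n j) (k.2 j))
          0 p q • ((∏ i, fcoef (modesW B U) (m i) (k.1 i)) *
            ∏ j, fcoef (modesW B U) (n j) (k.2 j)) •
          nord (modesW B U) B (Fin.append k.1 k.2) (Fin.append a b) w := by
    rw [← finsum_smul_key (C := ℚ × ℚ) (T.map (Fin.appendEquiv r s).symm.toEmbedding)
      (fun k : (Fin r → ℤ) × (Fin s → ℤ) => (∑ i, fexp (modesW B U) (m i) (k.1 i),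
        ∑ j, fexp (modesW B U) (n j) (k.2 j))) (fun c => iotaMono R c.1 c.2 0 p q)
      (fun k => ((∏ i, fcoef (modesW B U) (m i) (k.1 i)) *
            ∏ j, fcoef (modesW B U) (n j) (k.2 j)) •
          nord (modesW B U) B (Fin.append k.1 k.2) (Fin.append a b) w)]
    · rw [substSer]
      refine finsum_congr fun c => ?_
      congr 1
      rw [nordTwo]
      refine finsum_congr fun k => ?_
      exact if_congr (by rw [Prod.ext_iff]) rfl rfl
    · rintro ⟨k1, k2⟩ h1 h2
      rw [Finset.mem_map_equiv, hT, Set.Finite.mem_toFinset, Equiv.symm_symm]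
      refine ⟨?_, fun h => h2 (by simp only; rw [show Fin.append k1 k2 =
        (Fin.appendEquiv r s) (k1, k2) from rfl, h, smul_zero])⟩
      simp only [iotaMono_eq_coeff, monoSer_coeff] at h1
      split_ifs at h1 with h
      · simp only [hsum, Int.cast_zero, add_zero] at h
        simp only [modesW_deg, Fin.sum_univ_add]
        change ∑ i, ((Fin.append k1 k2 (Fin.castAdd s i) : ℤ) : ℚ) +
          ∑ i, ((Fin.append k1 k2 (Fin.natAdd r i) : ℤ) : ℚ) = t
        simp only [Fin.append_left, Fin.append_right]
        linarith
      · exact absurd rfl h1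
  have hterm : ∀ κ : Fin (r + s) → ℤ, ((∏ i, fieldWt R (c i) (κ i)) •
      (HahnSeries.C (nordFun B φ w (List.ofFn fun i => (c i, κ i))) : Ser)).coeff (expo R p q) =
      iotaMono R (∑ i, fexp (modesW B U) (m i) (κ (Fin.castAdd s i)))
        (∑ j, fexp (modesW B U) (n j) (κ (Fin.natAdd r j))) 0 p q *
        (((∏ i, fcoef (modesW B U) (m i) (κ (Fin.castAdd s i))) *
          ∏ j, fcoef (modesW B U) (n j) (κ (Fin.natAdd r j))) *
        φ (nord (modesW B U) B κ (Fin.append a b) w)) := by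
    intro κ
    rw [smul_eq_mul, mul_comm, HahnSeries.C_mul_eq_smul, HahnSeries.coeff_smul, nordFun_ofFn, hc2,
      Fin.prod_univ_add]
    have e1 : ∀ i, fieldWt R (c (Fin.castAdd s i)) (κ (Fin.castAdd s i)) =
        fcoef (modesW B U) (m i) (κ (Fin.castAdd s i)) •
          monoSer R (fexp (modesW B U) (m i) (κ (Fin.castAdd s i))) 0 0 := fun i => by
      rw [hc, Fin.append_left, hfexp, fcoef, modesW_deg]
      rfl
    have e2 : ∀ j, fieldWt R (c (Fin.natAdd r j)) (κ (Fin.natAdd r j)) =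
        fcoef (modesW B U) (n j) (κ (Fin.natAdd r j)) •
          monoSer R 0 (fexp (modesW B U) (n j) (κ (Fin.natAdd r j))) 0 := fun j => by
      rw [hc, Fin.append_right, hfexp, fcoef, modesW_deg]
      rfl
    simp only [e1, e2, prod_smul_monoSer, ser_smul_mul, ser_mul_smul, monoSer_mul,
      Finset.sum_const_zero, add_zero, zero_add, HahnSeries.coeff_smul, smul_eq_mul,
      iotaMono_eq_coeff, Int.cast_zero]
    ring
  obtain ⟨N, hN, hTN⟩ := (((tends_nordSer B φ w R (letters a m b n)).2 (expo R p q)).and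
    ((eventually_all_finset T).2 fun κ _ => eventually_mem_piFinset_Icc κ)).exists
  rw [← hN]
  beta_reduce
  rw [letters_eq_ofFn, modeSum_ofFn, HahnSeries.coeff_sum, hr, Finset.sum_map, map_sum]
  symm
  refine (Finset.sum_congr rfl fun κ _ => ?_).trans (Finset.sum_subset (fun κ hκ => hTN κ hκ)
    fun κ _ hκ => ?_)
  · have e : Fin.append (fun i => κ (Fin.castAdd s i)) (fun j => κ (Fin.natAdd r j)) = κ :=
      Fin.append_castAdd_natAdd
    rw [hterm]
    simp only [Equiv.coe_toEmbedding, map_smul, smul_eq_mul]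
    rw [show (Fin.appendEquiv r s).symm κ = (fun i => κ (Fin.castAdd s i),
      fun j => κ (Fin.natAdd r j)) from rfl]
    simp only [e]
  · rw [hterm]
    by_contra hne
    refine hκ ?_
    rw [hT, Set.Finite.mem_toFinset]
    simp only [mul_ne_zero_iff] at hne
    refine ⟨?_, fun h => hne.2.2 (by rw [h, map_zero])⟩
    have h1 := hne.1
    rw [iotaMono_eq_coeff, monoSer_coeff] at h1
    split_ifs at h1 with h
    · simp only [hsum, Int.cast_zero, add_zero] at h
      simp only [modesW_deg, Fin.sum_univ_add]
      linarith
    · exact absurd rfl h1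

variable {w} in
theorem substSer_nordTwo_support {D : ℚ} (hD : Trunc (modesW B U) D w) {r s : ℕ} (a : Fin r → 𝔥)
    (m : Fin r → ℕ) (b : Fin s → 𝔥) (n : Fin s → ℕ) (p q : ℚ)
    (h : substSer R (nordTwo (modesW B U) B a m b n w) p q ≠ 0) :
    expo R p q ∈ halfBox (nordBound D (letters a m b n)) := by
  by_contra h0
  refine h ((Module.forall_dual_apply_eq_zero_iff ℂ _).1 fun φ => ?_)
  rw [← substSer_nordTwo_coeff B φ w R a m b n]
  by_contra h1
  exact h0 (nordSer_support B φ R hD _ h1)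

/-- The contractions of the fields `a^(m)(x + y)` and `b^(n)(y)`. -/
def twistContr (c d : Letter 𝔥) : Ser :=
  match c, d with
  | .inl c, .inl d => (-(B c.2 d.2 * cNum c.1 d.1)) • monoSer R (-c.1 - d.1 - 1) 0 0
  | .inr c, .inr d => (-(B c.2 d.2 * cNum c.1 d.1)) • monoSer R 0 (-c.1 - d.1 - 1) 0
  | .inl c, .inr d => B c.2 d.2 • iotaHom R (gDer c.1 d.1)
  | .inr _, .inl _ => 0

/-- By `wick_wick` the contractions can be carried out in three rounds: within the first alphabet,
within the second, and between the two. This is the nested form of the explicit formula. -/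
theorem wick_sum_letters {ι κ K M : Type*} [CommRing K] [AddCommGroup M] [Module K M]
    (β : ι ⊕ κ → ι ⊕ κ → K) (F : List (ι ⊕ κ) → M)
    (L : List ι) (L' : List κ) :
    wick β F (L.map .inl ++ L'.map .inr) =
      wick (fun c d => β (.inl c) (.inl d)) (fun l => wick (fun c d => β (.inr c) (.inr d))
        (fun l' => wick (crossContr fun c d => β (.inl c) (.inr d)) F
          (l.map .inl ++ l'.map .inr)) L') L := by
  set β₁ : ι ⊕ κ → ι ⊕ κ → K := fun c d => match c, d with
    | .inl c, .inl d => β (.inl c) (.inl d)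
    | _, _ => 0 with hβ₁
  set β₂ : ι ⊕ κ → ι ⊕ κ → K := fun c d => match c, d with
    | .inr c, .inr d => β (.inr c) (.inr d)
    | _, _ => 0 with hβ₂
  set β₃ : ι ⊕ κ → ι ⊕ κ → K := crossContr fun c d => β (.inl c) (.inr d) with hβ₃
  have e : wick β F (L.map .inl ++ L'.map .inr) =
      wick β₁ (wick β₂ (wick β₃ F)) (L.map .inl ++ L'.map .inr) := by
    rw [wick_wick, wick_wick]
    refine wick_congr ?_ fun _ _ => rfl
    rw [List.pairwise_append]
    refine ⟨?_, ?_, ?_⟩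
    · rw [List.pairwise_map]
      refine List.pairwise_of_forall fun c d => ?_
      simp [hβ₁, hβ₂, hβ₃, crossContr]
    · rw [List.pairwise_map]
      refine List.pairwise_of_forall fun c d => ?_
      simp [hβ₁, hβ₂, hβ₃, crossContr]
    · intro c hc d hd
      obtain ⟨c, -, rfl⟩ := List.mem_map.1 hc
      obtain ⟨d, -, rfl⟩ := List.mem_map.1 hd
      simp [hβ₁, hβ₂, hβ₃, crossContr]
  rw [e, wick_append_left, wick_comap]
  · refine wick_congr (List.pairwise_of_forall fun _ _ => rfl) fun l _ => ?_
    rw [wick_append_right, wick_comap]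
    intro c hc d
    obtain ⟨c, -, rfl⟩ := List.mem_map.1 hc
    rfl
  · intro c hc d hd
    obtain ⟨c, -, rfl⟩ := List.mem_map.1 hc
    obtain ⟨d, -, rfl⟩ := List.mem_map.1 hd
    rfl
  · rw [List.pairwise_map]
    exact List.pairwise_of_forall fun _ _ => rfl

theorem totalContr_comap {ι κ K : Type*} [CommRing K] (e : κ → ι) (β : ι → ι → K) (L : List κ) :
    totalContr β (L.map e) = totalContr (fun a b => β (e a) (e b)) L := by
  rw [totalContr, wick_comap, totalContr]
  simp

/-- Total contractions whose pair contractions are monomials. -/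
theorem totalContr_mono {r k : ℕ} (a : Fin r → 𝔥) (m : Fin r → ℕ) (p : Fin (2 * k) ↪o Fin r)
    (β : ℕ × 𝔥 → ℕ × 𝔥 → Ser) (σ : ℚ → Ser) (hσ0 : σ 0 = 1)
    (hσ : ∀ x y, σ (x + y) = σ x * σ y)
    (hβ : ∀ c d, β c d = (-(B c.2 d.2 * cNum c.1 d.1)) • σ (-c.1 - d.1 - 1)) :
    totalContr β (List.ofFn fun i => (m (p i), a (p i))) =
      ((-1) ^ k * tNum B a m p) • σ (-(∑ α, (m (p α) : ℚ)) - k) := by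
  have e1 : (List.ofFn fun i => (m (p i), a (p i))) =
      (List.ofFn p).map fun i => (m i, a i) := by
    rw [List.map_ofFn]
    rfl
  have e2 : ∀ i j, β (m i, a i) (m j, a j) = (-1) * (σ (-(m i) - 1 / 2) * σ (-(m j) - 1 / 2)) *
      HahnSeries.C (B (a i) (a j) * cNum (m i) (m j)) := fun i j => by
    rw [hβ, ← hσ, mul_comm _ (HahnSeries.C _), HahnSeries.C_mul_eq_smul]
    have : (-(m i : ℚ) - 1 / 2 + (-(m j : ℚ) - 1 / 2)) = -(m i : ℚ) - m j - 1 := by ring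
    rw [this, show (-1 : Ser) = HahnSeries.C (-1) by simp, HahnSeries.C_mul_eq_smul, smul_smul,
      mul_neg_one]
  rw [e1, totalContr_comap]
  simp only [e2]
  rw [totalContr_scale (fun i j => HahnSeries.C (B (a i) (a j) * cNum (m i) (m j))) (-1)
    (fun i => σ (-(m i) - 1 / 2)) (k := k) (by simp), totalContr_map (HahnSeries.C : ℂ →+* Ser),
    tNum, contrNum_eq_totalContr]
  have e3 : ∀ L : List (Fin r), (L.map fun i => σ (-(m i) - 1 / 2)).prod =
      σ ((L.map fun i => (-(m i) - 1 / 2 : ℚ)).sum) := by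
    intro L
    induction L with
    | nil => simp [hσ0]
    | cons i L ih => simp only [List.map_cons, List.prod_cons, List.sum_cons, hσ, ih]
  have e4 : ((List.ofFn p).map fun i => (-(m i) - 1 / 2 : ℚ)).sum =
      -(∑ α, (m (p α) : ℚ)) - k := by
    rw [List.map_ofFn, List.sum_ofFn]
    simp only [Function.comp_apply, Finset.sum_sub_distrib, Finset.sum_neg_distrib,
      Finset.sum_const, Finset.card_univ, Fintype.card_fin, nsmul_eq_mul]
    push_cast
    ring
  rw [e3, e4, mul_comm, HahnSeries.C_mul_eq_smul, mul_smul, smul_comm]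
  congr 1
  rcases neg_one_pow_eq_or Ser k with h | h <;> rcases Nat.even_or_odd k with h' | h' <;>
    simp [h'.neg_one_pow]

theorem ser_neg_one_pow_mul (n : ℕ) (f : Ser) : (-1 : Ser) ^ n * f = (-1 : ℂ) ^ n • f := by
  rw [show (-1 : Ser) = HahnSeries.C (-1) by simp, ← map_pow, HahnSeries.C_mul_eq_smul]

theorem iotaHom_scalarFun {r s k l ρ : ℕ} (a : Fin r → 𝔥) (m : Fin r → ℕ) (b : Fin s → 𝔥)
    (n : Fin s → ℕ) (p : Fin (2 * k) ↪o Fin r) (q : Fin (2 * l) ↪o Fin s)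
    (i : Fin ρ ↪o Fin (r - 2 * k)) (j : Fin ρ ↪o Fin (s - 2 * l)) :
    iotaHom R (scalarFun B a m b n p q i j) =
      (((-1) ^ seqSum p * tNum B a m p) • monoSer R (-(∑ α, (m (p α) : ℚ)) - k) 0 0) *
      (((-1) ^ seqSum q * tNum B b n q) • monoSer R 0 (-(∑ α, (n (q α) : ℚ)) - l) 0) *
      ((-1) ^ (seqSum i + seqSum j + (r - 2 * k) * ρ + ρ * (ρ + 1) / 2) *
        (Matrix.of fun α β : Fin ρ => twistContr B R
          (.inl (m (complSeq p (i α)), a (complSeq p (i α))))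
          (.inr (n (complSeq q (j β)), b (complSeq q (j β))))).det) := by
  rw [scalarFun, map_mul, map_mul, iotaHom_mono, iotaHom_mono, map_smul]
  simp only [Int.cast_zero]
  congr 1
  have : (iotaHom R) ((Matrix.of fun α β : Fin ρ =>
      B (a (complSeq p (i α))) (b (complSeq q (j β))) •
        gDer (m (complSeq p (i α))) (n (complSeq q (j β)))).det) =
      (Matrix.of fun α β : Fin ρ => twistContr B R
          (.inl (m (complSeq p (i α)), a (complSeq p (i α))))
          (.inr (n (complSeq q (j β)), b (complSeq q (j β))))).det := by
    rw [AlgHom.map_det]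
    congr 1
    ext α β : 2
    simp [twistContr]
  rw [this]
  generalize (Matrix.of fun α β : Fin ρ => twistContr B R
    (.inl (m (complSeq p (i α)), a (complSeq p (i α))))
    (.inr (n (complSeq q (j β)), b (complSeq q (j β))))).det = x
  exact (ser_neg_one_pow_mul _ x).symm

/-- The multiple sum of the statement is a single Wick sum: the inner contractions yield the numbers
`T`, the mixed ones the determinants. -/
theorem wickSide_coeff {r s : ℕ} (a : Fin r → 𝔥) (m : Fin r → ℕ) (b : Fin s → 𝔥) (n : Fin s → ℕ)
    (p q : ℚ) :
    (wick (twistContr B R) (nordSer B φ w R) (letters a m b n)).coeff (expo R p q) =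
      φ (wickSide B R a m b n w p q) := by
  obtain ⟨D, -, hD⟩ := exists_trunc (modesW B U) w
  rw [letters, wick_sum_letters, wick_ofFn]
  simp only [wickSide, Finset.sum_apply, map_sum, HahnSeries.coeff_sum]
  refine Finset.sum_congr rfl fun k _ => Finset.sum_congr rfl fun p₁ _ => ?_
  rw [wick_ofFn, Finset.smul_sum, HahnSeries.coeff_sum]
  refine Finset.sum_congr rfl fun l _ => ?_
  rw [Finset.smul_sum, HahnSeries.coeff_sum]
  refine Finset.sum_congr rfl fun q₁ _ => ?_
  rw [wick_cross_ofFn]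
  simp only [Finset.smul_sum, HahnSeries.coeff_sum]
  refine Finset.sum_congr rfl fun ρ _ => Finset.sum_congr rfl fun i _ =>
    Finset.sum_congr rfl fun j _ => ?_
  rw [← mulSer_coeff (R := R) φ (iotaHom_coeff R _)
    (fun p q => substSer_nordTwo_coeff B φ w R _ _ _ _ p q) (halfBox_isPWO _)
    (fun p q h => substSer_nordTwo_support B R hD _ _ _ _ p q h), iotaHom_scalarFun]
  congr 1
  rw [totalContr_mono B a m p₁ (fun c d => twistContr B R (.inl c) (.inl d)) (fun α => monoSer R α 0 0) (by simp)
    (fun x y => by simp [monoSer_mul]) (fun _ _ => rfl),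
    totalContr_mono B b n q₁ (fun c d => twistContr B R (.inr c) (.inr d)) (fun α => monoSer R 0 α 0) (by simp)
    (fun x y => by simp [monoSer_mul]) (fun _ _ => rfl)]
  -- The sign `(-1)^k` of the shuffle cancels against the minus signs of the `k` contractions by
  -- `exp Δ`.
  have h1 : ∀ (t k : ℕ) (c : ℂ) (f : Ser),
      (-1 : Ser) ^ (t + k) * (((-1) ^ k * c) • f) = ((-1) ^ t * c) • f := by
    intro t k c f
    rw [ser_neg_one_pow_mul, smul_smul, ← mul_assoc, pow_add, mul_assoc ((-1) ^ t), ← mul_pow]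
    simp
  rw [h1, h1]
  simp only [smul_eq_mul, mul_assoc]
  rfl

end RightSide

open Filter

/-! ### The product formula -/

section Product

variable {𝔥 : Type u} [AddCommGroup 𝔥] [Module ℂ 𝔥] (B : LinearMap.BilinForm ℂ 𝔥)
  {U : Type v} [AddCommGroup U] [Module ℂ U] [Module (TensorAlgebra ℂ 𝔥) U]
  (φ : SpaceW B U →ₗ[ℂ] ℂ) (w : SpaceW B U)

/-- The matrix coefficient of a product of two normally ordered products of modes. -/
def nordMulFun (ℓ ℓ' : List (Letter 𝔥 × ℤ)) : ℂ :=
  φ (nordList (modesW B U) B (ℓ.map fun c => (c.2, c.1.data.2))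
    (nordList (modesW B U) B (ℓ'.map fun c => (c.2, c.1.data.2)) w))

theorem modeContr_modesW (c d : ℤ × 𝔥) :
    modeContr (modesW B U) B c d = modePair c.1 d.1 * B c.2 d.2 := by
  have h1 : ((c.1 : ℚ) + d.1 = 0) ↔ c.1 + d.1 = 0 := by exact_mod_cast Iff.rfl
  have h2 : ((0 : ℚ) < c.1) ↔ 0 < c.1 := by exact_mod_cast Iff.rfl
  have h3 : ((c.1 : ℚ) = 0) ↔ c.1 = 0 := by exact_mod_cast Iff.rfl
  simp only [modeContr, modesW_deg, modePair, h1, h2, h3]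
  split_ifs <;> ring

/-- The product formula for the naive vertex operators. Wick's theorem holds for each choice of
modes, and summation over modes turns the contractions into the partial sums of `tends_gDer_xy`. -/
theorem tends_modeSum_nordMulFun (l l' : List (ℕ × 𝔥)) :
    Tends (fun N => modeSum (fieldWt .xy) (Finset.Icc (-(N : ℤ)) N) (fun ℓ =>
      modeSum (fieldWt .xy) (Finset.Icc (-(N : ℤ)) N) (fun ℓ' =>
        (HahnSeries.C (nordMulFun B φ w ℓ ℓ') : Ser)) (l'.map .inr)) (l.map .inl))
      (wick (crossContr fun c d => twistContr B .xy (.inl c) (.inr d)) (nordSer B φ w .xy)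
        (l.map .inl ++ l'.map .inr)) := by
  set γ : Letter 𝔥 × ℤ → Letter 𝔥 × ℤ → ℂ := fun c d => match c, d with
    | (.inl c, k), (.inr d, k') => modePair k k' * B c.2 d.2
    | _, _ => 0 with hγ
  have e : ∀ N : ℕ, modeSum (fieldWt .xy) (Finset.Icc (-(N : ℤ)) N) (fun ℓ =>
      modeSum (fieldWt .xy) (Finset.Icc (-(N : ℤ)) N) (fun ℓ' =>
        (HahnSeries.C (nordMulFun B φ w ℓ ℓ') : Ser)) (l'.map .inr)) (l.map .inl) =
      wick (fun a b => ∑ n ∈ Finset.Icc (-(N : ℤ)) N, ∑ n' ∈ Finset.Icc (-(N : ℤ)) N,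
        fieldWt .xy a n * (fieldWt .xy b n' * HahnSeries.C (γ (a, n) (b, n'))))
        (modeSum (fieldWt .xy) (Finset.Icc (-(N : ℤ)) N)
          (fun ℓ => HahnSeries.C (nordFun B φ w ℓ))) (l.map .inl ++ l'.map .inr) := by
    intro N
    rw [← modeSum_wick _ _ (fun a b => (HahnSeries.C (γ a b) : Ser)), modeSum_append]
    refine modeSum_congr _ _ fun ℓ hℓ => modeSum_congr _ _ fun ℓ' hℓ' => ?_
    have hl : ∀ c ∈ ℓ, ∃ a, c.1 = Sum.inl a := fun c hc => by
      have : c.1 ∈ l.map Sum.inl := hℓ ▸ List.mem_map_of_mem hc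
      obtain ⟨a, -, h⟩ := List.mem_map.1 this
      exact ⟨a, h.symm⟩
    have hl' : ∀ c ∈ ℓ', ∃ a, c.1 = Sum.inr a := fun c hc => by
      have : c.1 ∈ l'.map Sum.inr := hℓ' ▸ List.mem_map_of_mem hc
      obtain ⟨a, -, h⟩ := List.mem_map.1 this
      exact ⟨a, h.symm⟩
    have h := nordList_mul (S := modesW B U) (B := B)
      (fun c : Letter 𝔥 × ℤ => (c.2, c.1.data.2)) γ (L := ℓ) (L' := ℓ')
      (by
        rintro ⟨c, k⟩ hc ⟨d, k'⟩ hd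
        obtain ⟨a, rfl⟩ := hl _ hc
        obtain ⟨b, rfl⟩ := hl _ hd
        rfl)
      (by
        rintro ⟨c, k⟩ hc ⟨d, k'⟩ hd
        obtain ⟨a, rfl⟩ := hl _ hc
        obtain ⟨b, rfl⟩ := hl' _ hd
        rw [modeContr_modesW]
        rfl)
      (by
        rintro ⟨c, k⟩ hc ⟨d, k'⟩ hd
        obtain ⟨a, rfl⟩ := hl' _ hc
        obtain ⟨b, rfl⟩ := hl' _ hd
        rfl)
    let T : Module.End ℂ (SpaceW B U) →+ Ser :=
      (HahnSeries.C : ℂ →+* Ser).toAddMonoidHom.comp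
        (φ ∘ₗ LinearMap.applyₗ w).toAddMonoidHom
    have hT : ∀ x, T x = HahnSeries.C (φ (x w)) := fun x => rfl
    have := wick_map T γ (fun a b => (HahnSeries.C (γ a b) : Ser)) (fun a b x => by
      rw [hT, hT, LinearMap.smul_apply, map_smul, smul_eq_mul, smul_eq_mul, map_mul])
      (fun l => nordList (modesW B U) B (l.map fun c => (c.2, c.1.data.2))) (ℓ ++ ℓ')
    rw [← h, hT] at this
    exact this.symm
  refine Tends.congr (tends_wick ?_ fun l _ => tends_nordSer B φ w .xy l) e
  have h0 : ∀ (N : ℕ) (a b : Letter 𝔥), (∀ n n', γ (a, n) (b, n') = 0) →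
      ∑ n ∈ Finset.Icc (-(N : ℤ)) N, ∑ n' ∈ Finset.Icc (-(N : ℤ)) N,
        fieldWt .xy a n * (fieldWt .xy b n' * HahnSeries.C (γ (a, n) (b, n'))) = 0 := by
    intro N a b h
    refine Finset.sum_eq_zero fun n _ => Finset.sum_eq_zero fun n' _ => ?_
    rw [h, map_zero, mul_zero, mul_zero]
  refine List.pairwise_of_forall fun a b => ?_
  rcases a with a | a <;> rcases b with b | b
  · exact (Tends.const 0).congr fun N => h0 N _ _ fun _ _ => rfl
  · refine ((tends_gDer_xy a.1 b.1).smul (B a.2 b.2)).congr fun N => ?_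
    have e2 : ∀ n n' : ℤ, fieldWt .xy (.inl a : Letter 𝔥) n *
        (fieldWt .xy (.inr b : Letter 𝔥) n' * HahnSeries.C (γ (.inl a, n) (.inr b, n'))) =
        modePair n n' • (B a.2 b.2 • ((binom (-n - 1 / 2) a.1 * binom (-n' - 1 / 2) b.1) •
          monoSer .xy (-n - 1 / 2 - a.1) (-n' - 1 / 2 - b.1) 0)) := by
      intro n n'
      rw [mul_comm (fieldWt _ _ n') (HahnSeries.C _), HahnSeries.C_mul_eq_smul]
      simp only [fieldWt, hγ, ser_smul_mul, ser_mul_smul, monoSer_mul, smul_smul, add_zero,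
        zero_add]
      congr 1
      ring
    simp only [e2]
    refine (sum_modePair N fun n n' => B a.2 b.2 • ((binom (-n - 1 / 2) a.1 *
      binom (-n' - 1 / 2) b.1) • monoSer .xy (-n - 1 / 2 - a.1) (-n' - 1 / 2 - b.1) 0)).trans ?_
    rw [Finset.smul_sum]
    refine Finset.sum_congr rfl fun d _ => ?_
    rw [smul_comm]
    push_cast
    simp only [neg_neg]
  · exact (Tends.const 0).congr fun N => h0 N _ _ fun _ _ => rfl
  · exact (Tends.const 0).congr fun N => h0 N _ _ fun _ _ => rfl

theorem fexp_modesW (m : ℕ) (k : ℤ) : fexp (modesW B U) m k = -k - 1 / 2 - m := by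
  rw [fexp, modesW_deg]

theorem sum_fexp_modesW {r : ℕ} (m : Fin r → ℕ) (k : Fin r → ℤ) :
    ∑ i, fexp (modesW B U) (m i) (k i) = -∑ i, (k i : ℚ) - ∑ i, (1 / 2 + (m i : ℚ)) := by
  rw [← Finset.sum_neg_distrib, ← Finset.sum_sub_distrib]
  exact Finset.sum_congr rfl fun i _ => by rw [fexp_modesW]; ring

/-- Only finitely many products of two normally ordered products of given total degree are nonzero
on `w` if the degree of the second one is bounded from below. -/
theorem nord_nord_finite {r s : ℕ} (a : Fin r → 𝔥) (b : Fin s → 𝔥) (t t' : ℚ) :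
    {k : (Fin r → ℤ) × (Fin s → ℤ) | ∑ i, (k.1 i : ℚ) + ∑ j, (k.2 j : ℚ) = t ∧
      t' ≤ ∑ j, (k.2 j : ℚ) ∧
      nord (modesW B U) B k.1 a (nord (modesW B U) B k.2 b w) ≠ 0}.Finite := by
  obtain ⟨D, -, hD⟩ := exists_trunc (modesW B U) w
  have h1 : {k' : Fin s → ℤ | t' ≤ ∑ j, (k' j : ℚ) ∧ nord (modesW B U) B k' b w ≠ 0}.Finite := by
    -- The degree of the second product is an integer that is bounded below by `t'` and above by the
    -- truncation degree of `w`.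
    refine ((Set.finite_Icc ⌈t'⌉ ⌊D⌋).biUnion fun z _ =>
      nord_finite (modesW B U) B b w z).subset ?_
    rintro k' ⟨h, h'⟩
    rw [Set.mem_iUnion₂]
    have h3 : ∑ j, max (k' j : ℚ) 0 ≤ D := by
      by_contra hlt
      push Not at hlt
      refine h' (nord_eq_zero_of_trunc hD k' _ ?_)
      simpa only [modesW_deg] using hlt
    have h4 : ∑ j, (k' j : ℚ) ≤ D :=
      (Finset.sum_le_sum fun j _ => le_max_left _ _).trans h3
    refine ⟨∑ j, k' j, ⟨Int.ceil_le.2 (by push_cast; exact h), Int.le_floor.2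
      (by push_cast; exact h4)⟩, ?_, h'⟩
    simp only [modesW_deg]
    push_cast
    rfl
  refine (h1.biUnion fun k' _ => (nord_finite (modesW B U) B a (nord (modesW B U) B k' b w)
    (t - ∑ j, (k' j : ℚ))).image fun k => (k, k')).subset ?_
  rintro ⟨k, k'⟩ ⟨h, h', h''⟩
  rw [Set.mem_iUnion₂]
  refine ⟨k', ⟨h', fun h0 => h'' (by rw [h0, map_zero])⟩, k, ⟨?_, h''⟩, rfl⟩
  simp only [modesW_deg]
  simp only at h
  linarith

theorem vop_vop_eq_finsum {r s : ℕ} (a : Fin r → 𝔥) (m : Fin r → ℕ) (b : Fin s → 𝔥)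
    (n : Fin s → ℕ) (c : ℚ × ℚ) :
    vop (modesW B U) B (word B a m) (vop (modesW B U) B (word B b n) w c.2) c.1 =
      ∑ᶠ k : (Fin r → ℤ) × (Fin s → ℤ),
        if (∑ i, fexp (modesW B U) (m i) (k.1 i), ∑ j, fexp (modesW B U) (n j) (k.2 j)) = c then
          ((∏ i, fcoef (modesW B U) (m i) (k.1 i)) * ∏ j, fcoef (modesW B U) (n j) (k.2 j)) •
            nord (modesW B U) B k.1 a (nord (modesW B U) B k.2 b w) else 0 := by
  classical
  set g : (Fin r → ℤ) × (Fin s → ℤ) → SpaceW B U := fun k =>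
    if (∑ i, fexp (modesW B U) (m i) (k.1 i), ∑ j, fexp (modesW B U) (n j) (k.2 j)) = c then
          ((∏ i, fcoef (modesW B U) (m i) (k.1 i)) * ∏ j, fcoef (modesW B U) (n j) (k.2 j)) •
            nord (modesW B U) B k.1 a (nord (modesW B U) B k.2 b w) else 0 with hg
  have hg0 : ∀ k, g k ≠ 0 → ∑ i, fexp (modesW B U) (m i) (k.1 i) = c.1 ∧
      ∑ j, fexp (modesW B U) (n j) (k.2 j) = c.2 ∧
      nord (modesW B U) B k.1 a (nord (modesW B U) B k.2 b w) ≠ 0 := by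
    intro k hk
    simp only [hg] at hk
    split_ifs at hk with h
    · refine ⟨congrArg Prod.fst h, congrArg Prod.snd h, fun h' => hk (by rw [h', smul_zero])⟩
    · exact absurd rfl hk
  have hgfin : g.support.Finite := by
    refine (nord_nord_finite B w a b (-c.1 - c.2 - (∑ i, (1 / 2 + (m i : ℚ)) +
      ∑ j, (1 / 2 + (n j : ℚ)))) (-c.2 - ∑ j, (1 / 2 + (n j : ℚ)))).subset fun k hk => ?_
    obtain ⟨h1, h2, h3⟩ := hg0 k hk
    rw [sum_fexp_modesW] at h1 h2
    exact ⟨by linarith, by linarith, h3⟩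
  set T := (nord_finite (modesW B U) B b w (-c.2 - ∑ j, (1 / 2 + (n j : ℚ)))).toFinset with hT
  have hT' : ∀ k' : Fin s → ℤ, ∑ j, fexp (modesW B U) (n j) (k' j) = c.2 →
      nord (modesW B U) B k' b w ≠ 0 → k' ∈ T := by
    intro k' h1 h2
    rw [hT, Set.Finite.mem_toFinset]
    rw [sum_fexp_modesW] at h1
    exact ⟨by simp only [modesW_deg]; linarith, h2⟩
  change _ = ∑ᶠ k, g k
  have e1 : vop (modesW B U) B (word B b n) w c.2 = ∑ k' ∈ T,
      if ∑ j, fexp (modesW B U) (n j) (k' j) = c.2 then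
        (∏ j, fcoef (modesW B U) (n j) (k' j)) • nord (modesW B U) B k' b w else 0 := by
    rw [vop_word]
    refine finsum_eq_sum_of_support_subset _ fun k' hk' => ?_
    rw [Function.mem_support] at hk'
    split_ifs at hk' with h
    · exact hT' k' h fun h' => hk' (by rw [h', smul_zero])
    · exact absurd rfl hk'
  have e2 : ∀ k' : Fin s → ℤ, vop (modesW B U) B (word B a m)
      (if ∑ j, fexp (modesW B U) (n j) (k' j) = c.2 then
        (∏ j, fcoef (modesW B U) (n j) (k' j)) • nord (modesW B U) B k' b w else 0) c.1 =
      ∑ᶠ k, g (k, k') := by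
    intro k'
    split_ifs with h
    · rw [vop_word]
      refine finsum_congr fun k => ?_
      simp only [hg]
      refine if_congr ?_ ?_ rfl
      · rw [Prod.ext_iff]
        exact ⟨fun h' => ⟨h', h⟩, fun h' => h'.1⟩
      · rw [map_smul, smul_smul]
    · have : ∀ k, g (k, k') = 0 := fun k => by
        by_contra h'
        exact h (hg0 _ h').2.1
      simp [this]
  rw [e1, map_sum, Finset.sum_apply]
  simp only [e2]
  rw [finsum_curry _ hgfin, ← finsum_sum_comm]
  · refine finsum_congr fun k => (finsum_eq_sum_of_support_subset _ fun k' hk' => ?_).symm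
    obtain ⟨-, h2, h3⟩ := hg0 _ hk'
    exact hT' k' h2 fun h' => h3 (by simp only [h', map_zero])
  · intro k' _
    exact hgfin.preimage (f := fun k => (k, k')) (fun x _ y _ h => congrArg Prod.fst h)

/-- The shifts `d`, `d'` are the powers of `x₁⁻¹` and `y⁻¹` produced by the two operators `exp Δ`.
Finiteness of the support is recorded along with the value, since the combination over all `d`, `d'`
needs it. -/
theorem vop_vop_coeff {r s : ℕ} (a : Fin r → 𝔥) (m : Fin r → ℕ) (b : Fin s → 𝔥) (n : Fin s → ℕ)
    (d d' : ℕ) (p q : ℚ) :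
    (Function.support fun c : ℚ × ℚ => iotaMono .xy (c.1 - d) (c.2 - d') 0 p q •
      vop (modesW B U) B (word B a m) (vop (modesW B U) B (word B b n) w c.2) c.1).Finite ∧
    φ (∑ᶠ c : ℚ × ℚ, iotaMono .xy (c.1 - d) (c.2 - d') 0 p q •
      vop (modesW B U) B (word B a m) (vop (modesW B U) B (word B b n) w c.2) c.1) =
    (monoSer .xy (-d) (-d') 0 * wick (crossContr fun c d => twistContr B .xy (.inl c) (.inr d))
      (nordSer B φ w .xy) (letters a m b n)).coeff (expo .xy p q) := by
  classical
  set key : (Fin r → ℤ) × (Fin s → ℤ) → ℚ × ℚ := fun k =>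
    (∑ i, fexp (modesW B U) (m i) (k.1 i), ∑ j, fexp (modesW B U) (n j) (k.2 j)) with hkey
  set f : ℚ × ℚ → ℂ := fun c => iotaMono .xy (c.1 - d) (c.2 - d') 0 p q with hf
  set v : (Fin r → ℤ) × (Fin s → ℤ) → SpaceW B U := fun k =>
    ((∏ i, fcoef (modesW B U) (m i) (k.1 i)) * ∏ j, fcoef (modesW B U) (n j) (k.2 j)) •
      nord (modesW B U) B k.1 a (nord (modesW B U) B k.2 b w) with hv
  -- Expanding in nonnegative powers of `y` can only raise the power of `y`. This bounds the
  -- exponent of the second factor from above, hence its degree from below, as the finiteness of the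
  -- products requires.
  have hf0 : ∀ c, f c ≠ 0 → c.1 + c.2 = p + q + d + d' ∧ c.2 ≤ q + d' := by
    intro c hc
    simp only [hf, iotaMono_eq_coeff, monoSer_coeff] at hc
    split_ifs at hc with h
    · have : ∃ i : ℕ, q - (c.2 - d') = i := by
        by_contra h'
        push Not at h'
        exact hc (binomQ_eq_zero h')
      obtain ⟨i, hi⟩ := this
      have : (0 : ℚ) ≤ i := i.cast_nonneg
      simp only [Int.cast_zero] at h
      exact ⟨by linarith, by linarith⟩
    · exact absurd rfl hc
  set T := (nord_nord_finite B w a b (-(p + q + d + d') - (∑ i, (1 / 2 + (m i : ℚ)) +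
      ∑ j, (1 / 2 + (n j : ℚ)))) (-(q + d') - ∑ j, (1 / 2 + (n j : ℚ)))).toFinset with hT
  have hTmem : ∀ k, f (key k) ≠ 0 → v k ≠ 0 → k ∈ T := by
    intro k h1 h2
    rw [hT, Set.Finite.mem_toFinset]
    obtain ⟨h3, h4⟩ := hf0 _ h1
    simp only [hkey, sum_fexp_modesW] at h3 h4
    exact ⟨by linarith, by linarith, fun h => h2 (by simp only [hv, h, smul_zero])⟩
  have e1 : ∀ c : ℚ × ℚ, iotaMono .xy (c.1 - d) (c.2 - d') 0 p q •
      vop (modesW B U) B (word B a m) (vop (modesW B U) B (word B b n) w c.2) c.1 =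
      f c • ∑ᶠ k, if key k = c then v k else 0 := fun c => by
    rw [vop_vop_eq_finsum]
  simp only [e1]
  constructor
  · refine (T.image key).finite_toSet.subset fun c hc => ?_
    rw [Function.mem_support] at hc
    have h1 : f c ≠ 0 := fun h => hc (by rw [h, zero_smul])
    have h2 : ∑ᶠ k, (if key k = c then v k else 0) ≠ 0 := fun h => hc (by rw [h, smul_zero])
    obtain ⟨k, hk⟩ : ∃ k, (if key k = c then v k else 0) ≠ 0 := by
      by_contra h
      push Not at h
      exact h2 (finsum_eq_zero_of_forall_eq_zero h)
    split_ifs at hk with h3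
    · rw [Finset.mem_coe, Finset.mem_image]
      exact ⟨k, hTmem k (h3 ▸ h1) hk, h3⟩
    · exact absurd rfl hk
  rw [finsum_smul_key T key f v hTmem]
  -- The truncated mode sums are regrouped as combinations of monomials in `x+y` and `y`. For a
  -- given coefficient the truncation eventually contains all relevant modes.
  have hG : ∀ N : ℕ, monoSer .xy (-d) (-d') 0 * modeSum (fieldWt .xy) (Finset.Icc (-(N : ℤ)) N)
      (fun ℓ => modeSum (fieldWt .xy) (Finset.Icc (-(N : ℤ)) N) (fun ℓ' =>
        (HahnSeries.C (nordMulFun B φ w ℓ ℓ') : Ser)) ((List.ofFn fun j => (n j, b j)).map .inr))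
        ((List.ofFn fun i => (m i, a i)).map .inl) =
      ∑ k ∈ (Fintype.piFinset fun _ => Finset.Icc (-(N : ℤ)) N) ×ˢ
        (Fintype.piFinset fun _ => Finset.Icc (-(N : ℤ)) N), φ (v k) •
          monoSer .xy ((key k).1 - d) ((key k).2 - d') 0 := by
    intro N
    rw [Finset.sum_product, modeSum_comap, modeSum_ofFn, Finset.mul_sum]
    refine Finset.sum_congr rfl fun k _ => ?_
    rw [modeSum_comap, modeSum_ofFn, Finset.smul_sum, Finset.mul_sum]
    refine Finset.sum_congr rfl fun k' _ => ?_
    have e2 : ∀ i, fieldWt .xy (.inl (m i, a i) : Letter 𝔥) (k i) =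
        fcoef (modesW B U) (m i) (k i) • monoSer .xy (fexp (modesW B U) (m i) (k i)) 0 0 := by
      intro i
      rw [fexp_modesW, fcoef, modesW_deg]
      rfl
    have e3 : ∀ j, fieldWt .xy (.inr (n j, b j) : Letter 𝔥) (k' j) =
        fcoef (modesW B U) (n j) (k' j) • monoSer .xy 0 (fexp (modesW B U) (n j) (k' j)) 0 := by
      intro j
      rw [fexp_modesW, fcoef, modesW_deg]
      rfl
    have e4 : nordMulFun B φ w
        ((List.ofFn fun i => ((m i, a i), k i)).map fun c => (.inl c.1, c.2))
        ((List.ofFn fun j => ((n j, b j), k' j)).map fun c => (.inr c.1, c.2)) =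
        φ (nord (modesW B U) B k a (nord (modesW B U) B k' b w)) := by
      rw [nordMulFun, nord_eq_nordList (modesW_fermionic B U),
        nord_eq_nordList (modesW_fermionic B U)]
      simp only [List.map_ofFn]
      rfl
    rw [e4]
    simp only [e2, e3, prod_smul_monoSer, Finset.sum_const_zero, smul_eq_mul]
    rw [mul_comm _ (HahnSeries.C _), HahnSeries.C_mul_eq_smul]
    simp only [ser_smul_mul, ser_mul_smul, monoSer_mul, smul_smul, hv, hkey, map_smul,
      smul_eq_mul]
    congr 1
    · ring
    · congr 1 <;> ring
  have htends := (Tends.const (monoSer .xy (-d) (-d') 0)).mul (tends_modeSum_nordMulFun B φ w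
    (List.ofFn fun i => (m i, a i)) (List.ofFn fun j => (n j, b j)))
  replace htends := Tends.congr htends fun N => (hG N).symm
  have hbox : ∀ k : (Fin r → ℤ) × (Fin s → ℤ), ∀ᶠ N : ℕ in atTop,
      k ∈ (Fintype.piFinset fun _ => Finset.Icc (-(N : ℤ)) N) ×ˢ
        (Fintype.piFinset fun _ => Finset.Icc (-(N : ℤ)) N) := by
    intro k
    filter_upwards [eventually_mem_piFinset_Icc k.1, eventually_mem_piFinset_Icc k.2] with N h h'
    exact Finset.mem_product.2 ⟨h, h'⟩
  obtain ⟨N, hN, hTN⟩ := ((htends.2 (expo .xy p q)).and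
    ((eventually_all_finset T).2 fun k _ => hbox k)).exists
  rw [letters, ← hN]
  beta_reduce
  rw [HahnSeries.coeff_sum, map_sum]
  have e5 : ∀ k, (φ (v k) • monoSer .xy ((key k).1 - d) ((key k).2 - d') 0).coeff (expo .xy p q) =
      φ (f (key k) • v k) := by
    intro k
    rw [HahnSeries.coeff_smul, map_smul φ (f (key k)) (v k), smul_eq_mul, smul_eq_mul, mul_comm]
    simp only [hf, iotaMono_eq_coeff, Int.cast_zero]
  simp only [e5]
  refine Finset.sum_subset (fun k hk => hTN k hk) fun k _ hk => ?_
  by_contra hne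
  refine hk (hTmem k (fun h => hne (by rw [h, zero_smul, map_zero]))
    fun h => hne (by rw [h, smul_zero, map_zero]))

/-- The sum of a finitely supported family, seen through a functional. -/
def FinsumIs {C X : Type*} [AddCommGroup X] [Module ℂ X] (φ : X →ₗ[ℂ] ℂ) (F : C → X) (z : ℂ) :
    Prop := (Function.support F).Finite ∧ φ (∑ᶠ c, F c) = z

theorem FinsumIs.sum {C X I : Type*} [AddCommGroup X] [Module ℂ X] {φ : X →ₗ[ℂ] ℂ}
    {F : I → C → X} {z : I → ℂ} (T : Finset I) (h : ∀ i ∈ T, FinsumIs φ (F i) (z i)) :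
    FinsumIs φ (fun c => ∑ i ∈ T, F i c) (∑ i ∈ T, z i) := by
  constructor
  · refine (T.finite_toSet.biUnion fun i hi => (h i hi).1).subset fun c hc => ?_
    obtain ⟨i, hi, hic⟩ := Finset.exists_ne_zero_of_sum_ne_zero hc
    exact Set.mem_iUnion₂.2 ⟨i, hi, hic⟩
  · rw [finsum_sum_comm _ _ fun i hi => (h i hi).1, map_sum]
    exact Finset.sum_congr rfl fun i hi => (h i hi).2

theorem FinsumIs.smul {C X : Type*} [AddCommGroup X] [Module ℂ X] {φ : X →ₗ[ℂ] ℂ}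
    {F : C → X} {z : ℂ} (h : FinsumIs φ F z) (a : ℂ) :
    FinsumIs φ (fun c => a • F c) (a * z) := by
  refine ⟨h.1.subset fun c hc hc' => hc (by simp only [hc', smul_zero]), ?_⟩
  rw [← smul_finsum' a h.1, map_smul, smul_eq_mul, h.2]

theorem FinsumIs.comp {C X : Type*} [AddCommGroup X] [Module ℂ X] {φ : X →ₗ[ℂ] ℂ}
    {F : C → X} {z : ℂ} (h : FinsumIs φ F z) (e : C ≃ C) : FinsumIs φ (fun c => F (e c)) z :=
  ⟨h.1.preimage e.injective.injOn, by rw [finsum_comp_equiv e, h.2]⟩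

theorem wordL_eq_word (l : List (ℕ × 𝔥)) :
    wordL l = word B (fun i => (l.get i).2) fun i => (l.get i).1 := by
  rw [word_eq_wordL]
  congr 1
  exact (List.ofFn_get l).symm

theorem opYW_wordL {M : ℕ} (e e' : Fin M → 𝔥)
    (hcomp : ∀ h, ∑ i, (B (e' i) h • e i + B (e i) h • e' i) = h) (L : List (ℕ × 𝔥)) (q : ℚ) :
    opYW B e e' (wordL L) w q = (wickFree (deltaPair B) L).sum fun l P =>
      P.sum fun d c => c • vop (modesW B U) B (wordL l) w (q + d) := by
  have e1 : ∀ d, vop (modesW B U) B (expDelta B e e' d (wordL L)) w (q + d) =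
      ∑ l ∈ (wickFree (deltaPair B) L).support, ((wickFree (deltaPair B) L) l).coeff d •
        vop (modesW B U) B (wordL l) w (q + d) := by
    intro d
    rw [expDelta_wordL B e e' hcomp, Finsupp.sum, map_sum, LinearMap.sum_apply, Finset.sum_apply]
    simp only [map_smul, LinearMap.smul_apply, Pi.smul_apply]
  have hsub : ∀ l, (Function.support fun d => ((wickFree (deltaPair B) L) l).coeff d •
        vop (modesW B U) B (wordL l) w (q + d)) ⊆ ((wickFree (deltaPair B) L) l).support := by
    intro l d hd
    rw [Function.mem_support] at hd
    rw [Finset.mem_coe, Polynomial.mem_support_iff]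
    exact fun h => hd (by rw [h, zero_smul])
  rw [opYW, Finsupp.sum]
  simp only [e1]
  rw [finsum_sum_comm _ _ fun l _ => (Finset.finite_toSet _).subset (hsub l)]
  refine Finset.sum_congr rfl fun l _ => ?_
  rw [finsum_eq_sum_of_support_subset _ (hsub l), Polynomial.sum_def]

theorem monoSer_pow (R : Expansion) (α β γ : ℚ) (k : ℕ) :
    monoSer R α β γ ^ k = monoSer R (k * α) (k * β) (k * γ) := by
  induction k with
  | zero => simp
  | succ k ih =>
    rw [pow_succ, ih, monoSer_mul]
    push_cast
    congr 1 <;> ring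

/-- The substitution of a monomial for the variable of a polynomial. -/
def evalMono (R : Expansion) (α β : ℚ) : Polynomial ℂ →+* Ser :=
  Polynomial.eval₂RingHom HahnSeries.C (monoSer R α β 0)

theorem evalMono_apply (R : Expansion) (α β : ℚ) (P : Polynomial ℂ) :
    evalMono R α β P = ∑ d ∈ P.support, P.coeff d • monoSer R (d * α) (d * β) 0 := by
  rw [evalMono, Polynomial.coe_eval₂RingHom, Polynomial.eval₂_eq_sum, Polynomial.sum_def]
  refine Finset.sum_congr rfl fun d _ => ?_
  rw [HahnSeries.C_mul_eq_smul, monoSer_pow, mul_zero]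

theorem evalMono_deltaPair (R : Expansion) (α β : ℚ) (c d : ℕ × 𝔥) :
    evalMono R α β (deltaPair B c d) = (-(B c.2 d.2 * cNum c.1 d.1)) •
      monoSer R ((c.1 + d.1 + 1) * α) ((c.1 + d.1 + 1) * β) 0 := by
  rw [evalMono, Polynomial.coe_eval₂RingHom, deltaPair, Polynomial.eval₂_monomial,
    HahnSeries.C_mul_eq_smul, monoSer_pow, mul_zero]
  push_cast
  congr 1
  ring

theorem wick_eq_sum_mul {ι : Type*} (ψ : Polynomial ℂ →+* Ser) (β : ι → ι → Polynomial ℂ)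
    (F : List ι → Ser) (L : List ι) :
    wick (fun a b => ψ (β a b)) F L = (wickFree β L).sum fun l p => ψ p * F l :=
  wick_eq_sum_wickFree ψ β F L

/-- The contractions inside each of the two groups are those of `exp Δ`, with `(x+y)⁻¹` and `y⁻¹`
substituted for the variable. Only the mixed contractions are kept as a Wick sum. -/
theorem wick_twistContr_eq_sum (R : Expansion) (F : List (Letter 𝔥) → Ser) (L L' : List (ℕ × 𝔥)) :
    wick (twistContr B R) F (L.map .inl ++ L'.map .inr) =
      (wickFree (deltaPair B) L).sum fun l P => evalMono R (-1) 0 P *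
        (wickFree (deltaPair B) L').sum fun l' P' => evalMono R 0 (-1) P' *
          wick (crossContr fun c d => twistContr B R (.inl c) (.inr d)) F
            (l.map .inl ++ l'.map .inr) := by
  rw [wick_sum_letters, ← wick_eq_sum_mul]
  refine wick_congr (List.pairwise_of_forall fun c d => ?_) fun l _ => ?_
  · rw [evalMono_deltaPair, twistContr]
    congr 2 <;> ring
  · rw [← wick_eq_sum_mul]
    refine wick_congr (List.pairwise_of_forall fun c d => ?_) fun l _ => rfl
    rw [evalMono_deltaPair, twistContr]
    congr 2 <;> ring

theorem productSide_coeff {M : ℕ} (e e' : Fin M → 𝔥)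
    (hcomp : ∀ h, ∑ i, (B (e' i) h • e i + B (e i) h • e' i) = h) (L L' : List (ℕ × 𝔥)) (p q : ℚ) :
    φ (productSide B e e' (wordL L) (wordL L') w p q) =
      (wick (twistContr B .xy) (nordSer B φ w .xy) (L.map .inl ++ L'.map .inr)).coeff
        (expo .xy p q) := by
  have key : ∀ (l l' : List (ℕ × 𝔥)) (d d' : ℕ), FinsumIs φ (fun c : ℚ × ℚ =>
      iotaMono .xy c.1 c.2 0 p q • vop (modesW B U) B (wordL l)
        (vop (modesW B U) B (wordL l') w (c.2 + d')) (c.1 + d))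
      ((monoSer .xy (-d) (-d') 0 * wick (crossContr fun c d => twistContr B .xy (.inl c) (.inr d))
      (nordSer B φ w .xy) (l.map .inl ++ l'.map .inr)).coeff (expo .xy p q)) := by
    intro l l' d d'
    have h := vop_vop_coeff B φ w (fun i => (l.get i).2) (fun i => (l.get i).1)
      (fun i => (l'.get i).2) (fun i => (l'.get i).1) d d' p q
    rw [← wordL_eq_word, ← wordL_eq_word, letters] at h
    simp only [Prod.mk.eta] at h
    rw [List.ofFn_get, List.ofFn_get] at h
    -- The exponents are translated by `(d, d')`, since `exp Δ` contributes negative powers that the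
    -- naive operators have to compensate.
    have h' := FinsumIs.comp (φ := φ) h (Equiv.addRight ((d : ℚ), (d' : ℚ)))
    simp only [Equiv.coe_addRight, Prod.fst_add, Prod.snd_add, add_sub_cancel_right] at h'
    exact h'
  rw [wick_twistContr_eq_sum, productSide, substSer]
  simp only [opYW_wordL B _ e e' hcomp, Finsupp.sum, Polynomial.sum_def]
  have h1 := FinsumIs.sum (φ := φ) (wickFree (deltaPair B) L).support fun l _ =>
    FinsumIs.sum (wickFree (deltaPair B) L l).support fun d _ =>
    FinsumIs.sum (wickFree (deltaPair B) L').support fun l' _ =>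
    FinsumIs.sum (wickFree (deltaPair B) L' l').support fun d' _ =>
      ((key l l' d d').smul ((wickFree (deltaPair B) L' l').coeff d')).smul
        ((wickFree (deltaPair B) L l).coeff d)
  refine Eq.trans (congrArg φ (finsum_congr fun c => ?_)) (h1.2.trans ?_)
  · simp only [map_sum, Finset.sum_apply, map_smul, Pi.smul_apply, Finset.smul_sum]
    refine Finset.sum_congr rfl fun l _ => Finset.sum_congr rfl fun d _ =>
      Finset.sum_congr rfl fun l' _ => Finset.sum_congr rfl fun d' _ => ?_
    rw [smul_comm (iotaMono _ _ _ _ _ _), smul_comm (iotaMono _ _ _ _ _ _)]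
  · simp only [evalMono_apply, Finset.sum_mul, Finset.mul_sum, HahnSeries.coeff_sum]
    refine Finset.sum_congr rfl fun l _ => ?_
    rw [Finset.sum_comm]
    refine Finset.sum_congr rfl fun l' _ => ?_
    rw [Finset.sum_comm]
    refine Finset.sum_congr rfl fun d' _ => Finset.sum_congr rfl fun d _ => ?_
    simp only [ser_smul_mul, ser_mul_smul, ← mul_assoc, monoSer_mul, HahnSeries.coeff_smul,
      smul_eq_mul]
    simp only [mul_neg, mul_one, mul_zero, add_zero, zero_add]
    ring

end Product

open Filter

/-! ### The vertex operators on combinations of words -/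

section Linear

variable {𝔥 : Type u} [AddCommGroup 𝔥] [Module ℂ 𝔥] (B : LinearMap.BilinForm ℂ 𝔥)
  {U : Type v} [AddCommGroup U] [Module ℂ U] [Module (TensorAlgebra ℂ 𝔥) U]
  (φ : SpaceW B U →ₗ[ℂ] ℂ) (w : SpaceW B U)

theorem mem_span_wordL (x : FockV 𝔥) : x ∈ Submodule.span ℂ (Set.range (wordL (𝔥 := 𝔥))) := by
  induction x using fockV_induction with
  | h1 => exact Submodule.subset_span ⟨[], wordL_nil⟩
  | hadd x y hx hy => exact add_mem hx hy
  | hsmul c x hx => exact Submodule.smul_mem _ c hx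
  | hcreate k b x hx =>
    induction hx using Submodule.span_induction with
    | mem x hx =>
      obtain ⟨L, rfl⟩ := hx
      exact Submodule.subset_span ⟨(k, b) :: L, wordL_cons _ _⟩
    | zero => rw [map_zero]; exact zero_mem _
    | add x y _ _ hx hy => rw [map_add]; exact add_mem hx hy
    | smul c x _ hx => rw [map_smul]; exact Submodule.smul_mem _ c hx

variable {M : ℕ} {e e' : Fin M → 𝔥}
  (hcomp : ∀ h, ∑ i, (B (e' i) h • e i + B (e i) h • e' i) = h)

-- On a word `exp Δ` is a polynomial in `x⁻¹`, and words span `V`. This finiteness makes `Y_W(u, x)`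
-- additive in `u`.
include hcomp in
theorem expDelta_finite (x : FockV 𝔥) :
    (Function.support fun d => expDelta B e e' d x).Finite := by
  have hx := mem_span_wordL x
  induction hx using Submodule.span_induction with
  | mem x hx =>
    obtain ⟨L, rfl⟩ := hx
    refine ((wickFree (deltaPair B) L).support.finite_toSet.biUnion fun l _ =>
      (wickFree (deltaPair B) L l).support.finite_toSet).subset fun d hd => ?_
    rw [Function.mem_support, expDelta_wordL B e e' hcomp, Finsupp.sum] at hd
    obtain ⟨l, hl, hld⟩ := Finset.exists_ne_zero_of_sum_ne_zero hd
    refine Set.mem_iUnion₂.2 ⟨l, hl, ?_⟩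
    rw [Finset.mem_coe, Polynomial.mem_support_iff]
    exact fun h => hld (by rw [h, zero_smul])
  | zero => simp
  | add x y _ _ hx hy =>
    refine (hx.union hy).subset fun d hd => ?_
    by_contra h
    rw [Set.mem_union, not_or, Function.notMem_support, Function.notMem_support] at h
    exact hd (by simp only [map_add, h.1, h.2, add_zero])
  | smul c x _ hx =>
    refine hx.subset fun d hd h => hd ?_
    simp only at h
    simp only [map_smul, h, smul_zero]

/-- `Y_W(u, x) w` is linear in `u`. -/
def opYWlin (q : ℚ) : FockV 𝔥 →ₗ[ℂ] SpaceW B U where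
  toFun x := opYW B e e' x w q
  map_add' x y := by
    simp only [opYW]
    rw [← finsum_add_distrib]
    · simp only [map_add, LinearMap.add_apply, Pi.add_apply]
    · exact (expDelta_finite B hcomp x).subset fun d hd h => hd (by simp only at h ⊢; simp [h])
    · exact (expDelta_finite B hcomp y).subset fun d hd h => hd (by simp only at h ⊢; simp [h])
  map_smul' c x := by
    simp only [opYW, RingHom.id_apply]
    rw [smul_finsum']
    · simp only [map_smul, LinearMap.smul_apply, Pi.smul_apply]
    · exact (expDelta_finite B hcomp x).subset fun d hd h => hd (by simp only at h ⊢; simp [h])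

theorem opYWlin_apply (q : ℚ) (x : FockV 𝔥) : opYWlin B w hcomp q x = opYW B e e' x w q := rfl

/-- The matrix coefficient of `Y_W(h₁(-k₁-1/2) ⋯ hᵣ(-kᵣ-1/2) 𝟏, y)`. -/
def wordSer (L : List (ℕ × 𝔥)) : Ser :=
  wick (fun c d => twistContr B .yx (.inr c) (.inr d)) (fun l => nordSer B φ w .yx (l.map .inr)) L

theorem binomQ_zero_left (t : ℚ) : binomQ 0 t = if t = 0 then 1 else 0 := by
  by_cases h : ∃ i : ℕ, t = i
  · obtain ⟨i, rfl⟩ := h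
    rw [binomQ_natCast]
    have := binom_natCast 0 i
    rw [Nat.cast_zero] at this
    rw [this]
    cases i <;> simp [Nat.choose]
    norm_cast
  · push Not at h
    rw [binomQ_eq_zero h, if_neg]
    simpa using h 0

theorem monoSer_yx_coeff (β p q : ℚ) : (monoSer .yx 0 β 0).coeff (expo .yx p q) =
    if p = 0 ∧ q = β then 1 else 0 := by
  rw [monoSer_coeff]
  simp only [sub_zero, binomQ_zero_left, zero_add, add_zero]
  by_cases hp : p = 0
  · simp [hp]
  · simp [hp]

theorem vop_word_coeff {s : ℕ} (b : Fin s → 𝔥) (n : Fin s → ℕ) (p q : ℚ) :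
    (nordSer B φ w .yx ((List.ofFn fun j => (n j, b j)).map .inr)).coeff (expo .yx p q) =
      if p = 0 then φ (vop (modesW B U) B (word B b n) w q) else 0 := by
  classical
  set v : (Fin s → ℤ) → SpaceW B U := fun κ =>
    (∏ j, fcoef (modesW B U) (n j) (κ j)) • nord (modesW B U) B κ b w with hv
  have hG : ∀ N : ℕ, modeSum (fieldWt .yx) (Finset.Icc (-(N : ℤ)) N)
      (fun ℓ => (HahnSeries.C (nordFun B φ w ℓ) : Ser)) ((List.ofFn fun j => (n j, b j)).map .inr) =
      ∑ κ ∈ Fintype.piFinset fun _ => Finset.Icc (-(N : ℤ)) N, φ (v κ) •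
        monoSer .yx 0 (∑ j, fexp (modesW B U) (n j) (κ j)) 0 := by
    intro N
    rw [modeSum_comap, modeSum_ofFn]
    refine Finset.sum_congr rfl fun κ _ => ?_
    have e3 : ∀ j, fieldWt .yx (.inr (n j, b j) : Letter 𝔥) (κ j) =
        fcoef (modesW B U) (n j) (κ j) • monoSer .yx 0 (fexp (modesW B U) (n j) (κ j)) 0 := by
      intro j
      rw [fexp_modesW, fcoef, modesW_deg]
      rfl
    have e4 : nordFun B φ w
        ((List.ofFn fun j => ((n j, b j), κ j)).map fun c => (.inr c.1, c.2)) =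
        φ (nord (modesW B U) B κ b w) := by
      rw [nordFun, nord_eq_nordList (modesW_fermionic B U)]
      simp only [List.map_ofFn]
      rfl
    rw [e4]
    simp only [e3, prod_smul_monoSer, Finset.sum_const_zero, smul_eq_mul]
    rw [mul_comm _ (HahnSeries.C _), HahnSeries.C_mul_eq_smul, smul_smul, hv]
    simp only [map_smul, smul_eq_mul, mul_comm]
  have htends := Tends.congr (tends_nordSer B φ w .yx ((List.ofFn fun j => (n j, b j)).map .inr))
    fun N => (hG N).symm
  set T := (nord_finite (modesW B U) B b w (-q - ∑ j, (1 / 2 + (n j : ℚ)))).toFinset with hT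
  have hTmem : ∀ κ, ∑ j, fexp (modesW B U) (n j) (κ j) = q → v κ ≠ 0 → κ ∈ T := by
    intro κ h1 h2
    rw [hT, Set.Finite.mem_toFinset]
    rw [sum_fexp_modesW] at h1
    exact ⟨by simp only [modesW_deg]; linarith, fun h => h2 (by simp only [hv, h, smul_zero])⟩
  obtain ⟨N, hN, hTN⟩ := ((htends.2 (expo .yx p q)).and
    ((eventually_all_finset T).2 fun κ _ => eventually_mem_piFinset_Icc κ)).exists
  rw [← hN]
  beta_reduce
  simp only [HahnSeries.coeff_sum, HahnSeries.coeff_smul, monoSer_yx_coeff]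
  split_ifs with hp
  · rw [vop_word, finsum_eq_sum_of_support_subset (s := T), map_sum]
    · symm
      refine (Finset.sum_congr rfl fun κ _ => ?_).trans (Finset.sum_subset (fun κ hκ => hTN κ hκ)
        fun κ _ hκ => ?_)
      · simp only [hp, true_and, eq_comm (a := q)]
        split_ifs
        · rw [smul_eq_mul, mul_one]
        · rw [map_zero, smul_zero]
      · split_ifs with h
        · have : v κ = 0 := by
            by_contra h'
            exact hκ (hTmem κ h.2.symm h')
          rw [this, map_zero, zero_smul]
        · rw [smul_zero]
    · intro κ hκ
      rw [Function.mem_support] at hκ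
      split_ifs at hκ with h
      · exact hTmem κ h hκ
      · exact absurd rfl hκ
  · simp [hp]

theorem vop_wordL_coeff (l : List (ℕ × 𝔥)) (p q : ℚ) :
    (nordSer B φ w .yx (l.map .inr)).coeff (expo .yx p q) =
      if p = 0 then φ (vop (modesW B U) B (wordL l) w q) else 0 := by
  have h := vop_word_coeff B φ w (fun i => (l.get i).2) (fun i => (l.get i).1) p q
  rw [← wordL_eq_word] at h
  simp only [Prod.mk.eta] at h
  rwa [List.ofFn_get] at h

-- A series in `y` alone is regarded as a series in `x` and `y`, hence the condition `p = 0`.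
include hcomp in
theorem wordSer_coeff (L : List (ℕ × 𝔥)) (p q : ℚ) :
    (wordSer B φ w L).coeff (expo .yx p q) =
      if p = 0 then φ (opYW B e e' (wordL L) w q) else 0 := by
  have e1 : wordSer B φ w L = (wickFree (deltaPair B) L).sum fun l P =>
      evalMono .yx 0 (-1) P * nordSer B φ w .yx (l.map .inr) := by
    rw [wordSer, ← wick_eq_sum_mul]
    refine wick_congr (List.pairwise_of_forall fun c d => ?_) fun l _ => rfl
    rw [evalMono_deltaPair, twistContr]
    congr 2 <;> ring
  have e2 : ∀ (f : Ser) (d : ℕ), (monoSer .yx 0 (-d) 0 * f).coeff (expo .yx p q) =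
      f.coeff (expo .yx p (q + d)) := by
    intro f d
    rw [monoSer, oneAddPow_zero, mul_one, HahnSeries.coeff_single_mul, one_mul]
    congr 1
    ext <;> simp [expo]
    ring
  rw [e1, opYW_wordL B w e e' hcomp]
  simp only [Finsupp.sum, Polynomial.sum_def, evalMono_apply, Finset.sum_mul,
    HahnSeries.coeff_sum, map_sum, ser_smul_mul, mul_zero, HahnSeries.coeff_smul, mul_neg, mul_one,
    e2, vop_wordL_coeff, map_smul]
  split_ifs with hp
  · rfl
  · simp

end Linear

open Filter

/-! ### Contractions restricted to creation operators, and nested sums over modes. -/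

section Restrict

variable {ι μ ν K M : Type*} [CommRing K] [AddCommGroup M] [Module K M]

theorem contract_ite_forall (P : ι → Prop) [DecidablePred P] (f : ι → K) (F : List ι → M) (L : List ι) :
    contract (fun b => if P b then f b else 0) (fun l => if ∀ c ∈ l, P c then F l else 0) L =
      if ∀ c ∈ L, P c then contract f F L else 0 := by
  induction L generalizing F with
  | nil => simp
  | cons b L ih =>
    by_cases hb : P b
    · simp only [contract_cons, List.forall_mem_cons, hb, if_true, true_and, ih]
      split_ifs <;> simp
    · simp only [contract_cons, List.forall_mem_cons, hb, if_false, false_and, zero_smul,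
        contract_zero, sub_zero]

/-- Contractions and functionals that vanish outside of the letters with a given property. -/
theorem wick_ite (P : ι → Prop) [DecidablePred P] (β : ι → ι → K) (F : List ι → M) (L : List ι) :
    wick (fun a b => if P a ∧ P b then β a b else 0) (fun l => if ∀ c ∈ l, P c then F l else 0) L =
      if ∀ c ∈ L, P c then wick β F L else 0 := by
  induction L generalizing F with
  | nil => simp
  | cons a L ih =>
    by_cases ha : P a
    · simp only [wick_cons, List.forall_mem_cons, ha, true_and, contract_ite_forall]
      rw [← ih]
      congr 1
      funext l
      split_ifs <;> simp
    · simp only [wick_cons, List.forall_mem_cons, ha, false_and, if_false, zero_add]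
      have : ∀ l, contract (fun _ : ι => (0 : K)) (fun l => if ∀ c ∈ l, P c then F l else 0) l = 0 :=
        fun l => contract_eq_zero (fun _ _ => rfl) _
      simp only [this, wick_zero]

theorem modeSum_sum {σ : Type*} (wt : ι → μ → K) (Λ : Finset μ) (T : Finset σ) (c : σ → K)
    (G : σ → List (ι × μ) → M) (L : List ι) :
    modeSum wt Λ (fun l => ∑ t ∈ T, c t • G t l) L = ∑ t ∈ T, c t • modeSum wt Λ (G t) L := by
  classical
  induction T using Finset.induction_on with
  | empty => simpa using modeSum_smul wt Λ (0 : K) (fun _ => (0 : M)) L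
  | insert a T ha ih => simp only [Finset.sum_insert ha, modeSum_add, modeSum_smul, ih]

theorem modeSum_zero (wt : ι → μ → K) (Λ : Finset μ) (L : List ι) :
    modeSum wt Λ (fun _ => (0 : M)) L = 0 := by
  simpa using modeSum_smul wt Λ (0 : K) (fun _ => (0 : M)) L

/-- Nested sums over modes. -/
theorem modeSum_modeSum (P : μ → Prop) [DecidablePred P] (wt : ι → μ → K) (wt' : ι × μ → ν → K)
    (Λ : Finset μ) (Λ' : Finset ν) (H : List (ι × ν) → M) (L : List ι) :
    modeSum wt Λ (fun ℓ => if ∀ c ∈ ℓ, P c.2 then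
      modeSum wt' Λ' (fun l => H (l.map fun c => (c.1.1, c.2))) ℓ else 0) L =
    modeSum (fun a n' => ∑ n ∈ Λ, if P n then wt a n * wt' (a, n) n' else 0) Λ' H L := by
  induction L generalizing H with
  | nil => simp [modeSum]
  | cons a L ih =>
    rw [modeSum_cons, modeSum_cons]
    simp only [Finset.sum_smul]
    rw [Finset.sum_comm]
    refine Finset.sum_congr rfl fun n _ => ?_
    by_cases hn : P n
    · simp only [List.forall_mem_cons, hn, true_and, if_true, modeSum_cons, List.map_cons,
        mul_smul, ← Finset.smul_sum]
      congr 1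
      simp only [← ih]
      rw [← modeSum_sum]
      congr 1
      funext ℓ
      split_ifs <;> simp
    · simp only [List.forall_mem_cons, hn, false_and, if_false, modeSum_zero, smul_zero, zero_smul,
        Finset.sum_const_zero]

end Restrict

theorem Tends.sum {σ : Type*} (T : Finset σ) {f : σ → ℕ → Ser} {g : σ → Ser}
    (h : ∀ t ∈ T, Tends (f t) (g t)) : Tends (fun N => ∑ t ∈ T, f t N) (∑ t ∈ T, g t) := by
  classical
  induction T using Finset.induction_on with
  | empty => simpa using Tends.const 0
  | insert a T ha ih =>
    simp only [Finset.sum_insert ha]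
    exact (h a (by simp)).add (ih fun t ht => h t (by simp [ht]))

theorem Tends.shift {f : ℕ → Ser} {g : Ser} (h : Tends f g) (k : ℕ) :
    Tends (fun N => f (N + k)) g := by
  obtain ⟨⟨s, hs, hf⟩, hc⟩ := h
  exact ⟨⟨s, hs, fun N => hf _⟩, fun γ => (tendsto_add_atTop_nat k).eventually (hc γ)⟩

theorem tends_modeSum {ι μ : Type*} (wt : ι → μ → Ser) (Λ : Finset μ)
    {G : ℕ → List (ι × μ) → Ser} {G' : List (ι × μ) → Ser}
    (h : ∀ ℓ, Tends (fun N => G N ℓ) (G' ℓ)) (L : List ι) :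
    Tends (fun N => modeSum wt Λ (G N) L) (modeSum wt Λ G' L) := by
  induction L generalizing G G' with
  | nil => exact h []
  | cons a L ih =>
    simp only [modeSum_cons, smul_eq_mul]
    exact Tends.sum _ fun n _ => (Tends.const _).mul (ih fun ℓ => h _)

/-! ### The iterate as a sum over the modes of `V`. -/

section Iterate

variable {𝔥 : Type u} [AddCommGroup 𝔥] [Module ℂ 𝔥] (B : LinearMap.BilinForm ℂ 𝔥)
  {U : Type v} [AddCommGroup U] [Module ℂ U] [Module (TensorAlgebra ℂ 𝔥) U]
  (φ : SpaceW B U →ₗ[ℂ] ℂ) (w : SpaceW B U)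

/-- The factor that accompanies a mode of `V`: for `inl (m, h)` the modes are those of the field
`h^(m)(x)`, for `inr (n, h)` there is only the mode `h(-n-1/2)`. -/
def creationWt (c : Letter 𝔥) (κ : ℤ) : Ser :=
  match c with
  | .inl a => binom (-κ - 1) a.1 • monoSer .yx 0 0 (-κ - 1 - a.1)
  | .inr b => if κ = -b.1 - 1 then 1 else 0

/-- The contractions of the modes of `V`. -/
def modesVContr (c d : Letter 𝔥 × ℤ) : ℂ :=
  match c, d with
  | (.inl c, k), (.inr d, k') => modeContr (modesV B) B (k, c.2) (k', d.2)
  | _, _ => 0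

/-- The creation operator `h(-k-1/2)` as a letter `(k, h)`. -/
def Letter.creation (c : Letter 𝔥 × ℤ) : ℕ × 𝔥 := ((-c.2 - 1).toNat, c.1.data.2)

/-- A functional of words in the creation operators, extended by zero. -/
def onCreation (F : List (ℕ × 𝔥) → Ser) (ℓ : List (Letter 𝔥 × ℤ)) : Ser :=
  if ∀ c ∈ ℓ, c.2 < 0 then F (ℓ.map Letter.creation) else 0

omit [AddCommGroup 𝔥] [Module ℂ 𝔥] in
theorem onCreation_wick (β : ℕ × 𝔥 → ℕ × 𝔥 → Ser) (F : List (ℕ × 𝔥) → Ser)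
    (ℓ : List (Letter 𝔥 × ℤ)) : onCreation (wick β F) ℓ =
      wick (fun c d => if c.2 < 0 ∧ d.2 < 0 then β (Letter.creation c) (Letter.creation d) else 0)
        (onCreation F) ℓ := by
  unfold onCreation
  rw [wick_ite (fun c : Letter 𝔥 × ℤ => c.2 < 0)
    (fun c d => β (Letter.creation c) (Letter.creation d)) (fun ℓ => F (ℓ.map Letter.creation))]
  simp only [wick_comap]

theorem modeProd_modesV_one {ℓ : List (ℤ × 𝔥)} (h : ∀ c ∈ ℓ, c.1 < 0) :
    modeProd (modesV B) ℓ 1 = wordL (ℓ.map fun c => ((-c.1 - 1).toNat, c.2)) := by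
  induction ℓ with
  | nil => simp [modeProd]
  | cons c ℓ ih =>
    rw [modeProd_cons, Module.End.mul_apply, ih fun d hd => h d (by simp [hd]), List.map_cons,
      wordL_cons]
    have h1 : c.1 < 0 := h c (by simp)
    have h2 : c.1 = -((-c.1 - 1).toNat : ℤ) - 1 := by omega
    change modeV B c.1 c.2 _ = _
    conv_lhs => rw [h2]
    rw [modeV_neg]

variable {M : ℕ} {e e' : Fin M → 𝔥}
  (hcomp : ∀ h, ∑ i, (B (e' i) h • e i + B (e i) h • e' i) = h)

-- Letters `inl` carry a mode of `Y_V(A, x)`, letters `inr` the creation operators of `B`. Wick's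
-- theorem in `V` contracts the former with the latter. On the vacuum only words of creation
-- operators survive, and `wordSer` applies `Y_W` to them.
include hcomp in
theorem wick_modesV_coeff {r s : ℕ} (a : Fin r → 𝔥) (m : Fin r → ℕ) (b : Fin s → 𝔥)
    (n : Fin s → ℕ) (κ : Fin r → ℤ) (p q : ℚ) :
    (wick (fun c d => (HahnSeries.C (modesVContr B c d) : Ser)) (onCreation (wordSer B φ w))
      ((List.ofFn fun i => ((.inl (m i, a i) : Letter 𝔥), κ i)) ++
        List.ofFn fun j => ((.inr (n j, b j) : Letter 𝔥), -(n j : ℤ) - 1))).coeff (expo .yx p q) =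
      if p = 0 then φ (opYW B e e' (nord (modesV B) B κ a (word B b n)) w q) else 0 := by
  let T : FockV 𝔥 →+ ℂ := if p = 0 then (φ ∘ₗ opYWlin B w hcomp q).toAddMonoidHom else 0
  have hT : ∀ x, T x = if p = 0 then φ (opYW B e e' x w q) else 0 := by
    intro x
    by_cases hp : p = 0
    · simp only [T, if_pos hp]
      rfl
    · simp only [T, if_neg hp]
      rfl
  let ev : Letter 𝔥 × ℤ → ℤ × 𝔥 := fun c => (c.2, c.1.data.2)
  have h1 : nord (modesV B) B κ a (word B b n) =
      wick (modesVContr B) (fun l => nordList (modesV B) B (l.map ev) 1)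
        ((List.ofFn fun i => ((.inl (m i, a i) : Letter 𝔥), κ i)) ++
        List.ofFn fun j => ((.inr (n j, b j) : Letter 𝔥), -(n j : ℤ) - 1)) := by
    -- A product of creation operators is its own normal ordering, so `B` can serve as the second
    -- factor.
    have h2 := nordList_mul (S := modesV B) (B := B) ev (modesVContr B)
      (L := List.ofFn fun i => ((.inl (m i, a i) : Letter 𝔥), κ i))
      (L' := List.ofFn fun j => ((.inr (n j, b j) : Letter 𝔥), -(n j : ℤ) - 1))
      (by
        intro c hc d hd
        obtain ⟨i, rfl⟩ := (List.mem_ofFn' _ _).1 hc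
        obtain ⟨j, rfl⟩ := (List.mem_ofFn' _ _).1 hd
        rfl)
      (by
        intro c hc d hd
        obtain ⟨i, rfl⟩ := (List.mem_ofFn' _ _).1 hc
        obtain ⟨j, rfl⟩ := (List.mem_ofFn' _ _).1 hd
        rfl)
      (by
        intro c hc d hd
        obtain ⟨i, rfl⟩ := (List.mem_ofFn' _ _).1 hc
        obtain ⟨j, rfl⟩ := (List.mem_ofFn' _ _).1 hd
        rfl)
    have h3 := congrArg (fun f : Module.End ℂ (FockV 𝔥) => f 1) h2
    simp only [Module.End.mul_apply] at h3
    have h4 : wick (modesVContr B) (fun l => nordList (modesV B) B (l.map ev) 1)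
        ((List.ofFn fun i => ((.inl (m i, a i) : Letter 𝔥), κ i)) ++
        List.ofFn fun j => ((.inr (n j, b j) : Letter 𝔥), -(n j : ℤ) - 1)) = _ :=
      wick_linear (LinearMap.applyₗ (1 : FockV 𝔥)) (modesVContr B)
        (fun l => nordList (modesV B) B (l.map ev)) _
    rw [h4]
    refine Eq.trans ?_ h3
    rw [nord_eq_nordList (modesV_fermionic B), List.map_ofFn, List.map_ofFn,
      nordList_modesV_one, if_pos]
    · simp only [word, modeProd, List.map_ofFn]
      rfl
    · intro c hc
      obtain ⟨j, rfl⟩ := (List.mem_ofFn' _ _).1 hc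
      simp only [Function.comp_apply, ev]
      omega
  rw [← hT, h1, ← wick_map T (modesVContr B) (modesVContr B) fun a b x => by
    rw [hT, hT]
    split_ifs
    · rw [← opYWlin_apply B w hcomp, ← opYWlin_apply B w hcomp, map_smul, map_smul]
    · simp]
  have h5 : ∀ l : List (Letter 𝔥 × ℤ), T (nordList (modesV B) B (l.map ev) 1) =
      (onCreation (wordSer B φ w) l).coeff (expo .yx p q) := by
    intro l
    rw [nordList_modesV_one, onCreation]
    have h6 : (∀ c ∈ l.map ev, c.1 < 0) ↔ ∀ c ∈ l, c.2 < 0 := by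
      rw [List.forall_mem_map]
    by_cases h7 : ∀ c ∈ l, c.2 < 0
    · rw [if_pos (h6.2 h7), if_pos h7, modeProd_modesV_one B (h6.2 h7),
        wordSer_coeff B φ w hcomp, hT, List.map_map]
      rfl
    · rw [if_neg fun h => h7 (h6.1 h), if_neg h7, map_zero, HahnSeries.coeff_zero]
  simp only [h5]
  let C : Ser →+ ℂ :=
    { toFun := fun f => f.coeff (expo .yx p q), map_zero' := rfl, map_add' := fun _ _ => rfl }
  exact (wick_map C (fun c d => (HahnSeries.C (modesVContr B c d) : Ser)) (modesVContr B)
    (fun a b x => by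
      simp only [smul_eq_mul, HahnSeries.C_mul_eq_smul]
      rfl) (onCreation (wordSer B φ w)) _).symm

theorem fexp_modesV (m : ℕ) (k : ℤ) : fexp (modesV B) m k = -k - 1 - m := by
  rw [fexp, modesV_deg]
  ring

/-- The matrix coefficients of the iterate as sums over modes of `V`. -/
def iterSum (L : List (Letter 𝔥)) (N : ℕ) : Ser :=
  modeSum creationWt (Finset.Icc (-(N : ℤ)) N)
    (wick (fun c d => (HahnSeries.C (modesVContr B c d) : Ser)) (onCreation (wordSer B φ w))) L

omit [AddCommGroup 𝔥] [Module ℂ 𝔥] in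
theorem modeSum_creationWt_inr (N : ℕ) (L : List (ℕ × 𝔥)) (hN : ∀ c ∈ L, c.1 < N)
    (G : List (Letter 𝔥 × ℤ) → Ser) :
    modeSum creationWt (Finset.Icc (-(N : ℤ)) N) G (L.map .inr) =
      G (L.map fun c => (.inr c, -(c.1 : ℤ) - 1)) := by
  induction L generalizing G with
  | nil => rfl
  | cons c L ih =>
    rw [List.map_cons, modeSum_cons, Finset.sum_eq_single (-(c.1 : ℤ) - 1)]
    · rw [ih fun d hd => hN d (by simp [hd])]
      simp [creationWt]
    · intro κ _ hκ
      simp [creationWt, hκ]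
    · intro h
      have := hN c (by simp)
      exact absurd (Finset.mem_Icc.2 (by omega)) h

-- For a fixed power of `x` only finitely many modes of `Y_V(A, x)` act nontrivially on `B`, so a
-- large truncation gives the exact coefficient.
include hcomp in
theorem iterateSide_coeff_eventually {r s : ℕ} (a : Fin r → 𝔥) (m : Fin r → ℕ) (b : Fin s → 𝔥)
    (n : Fin s → ℕ) (p q : ℚ) : ∀ᶠ N : ℕ in atTop,
    (iterSum B φ w (letters a m b n) N).coeff (expo .yx p q) =
      φ (iterateSide B e e' (word B a m) (word B b n) w p q) := by
  classical
  set T := (nord_finite (modesV B) B a (word B b n) (-p - r / 2 - ∑ i, (m i : ℚ))).toFinset with hT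
  have hTmem : ∀ κ : Fin r → ℤ, ∑ i, fexp (modesV B) (m i) (κ i) = p →
      nord (modesV B) B κ a (word B b n) ≠ 0 → κ ∈ T := by
    intro κ h1 h2
    rw [hT, Set.Finite.mem_toFinset]
    refine ⟨?_, h2⟩
    simp only [fexp, Finset.sum_sub_distrib, Finset.sum_neg_distrib, Finset.sum_const,
      Finset.card_univ, Fintype.card_fin, nsmul_eq_mul] at h1
    linarith
  have hR : φ (iterateSide B e e' (word B a m) (word B b n) w p q) =
      ∑ κ ∈ T, if ∑ i, fexp (modesV B) (m i) (κ i) = p then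
        (∏ i, fcoef (modesV B) (m i) (κ i)) *
          φ (opYW B e e' (nord (modesV B) B κ a (word B b n)) w q) else 0 := by
    rw [iterateSide, opYV, vop_word, finsum_eq_sum_of_support_subset (s := T),
      ← opYWlin_apply B w hcomp, map_sum, map_sum]
    · refine Finset.sum_congr rfl fun κ _ => ?_
      split_ifs
      · rw [map_smul, map_smul, smul_eq_mul]
        rfl
      · rw [map_zero, map_zero]
    · intro κ hκ
      rw [Function.mem_support] at hκ
      split_ifs at hκ with h
      · exact hTmem κ h fun h' => hκ (by rw [h', smul_zero])
      · exact absurd rfl hκ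
  -- The interval of modes has to contain the index `-n_j - 1` of every creation operator of `B`.
  obtain ⟨N₀, hN₀⟩ : ∃ N₀ : ℕ, ∀ j, n j < N₀ :=
    ⟨∑ j, n j + 1, fun j => Nat.lt_succ_of_le
      (Finset.single_le_sum (f := n) (fun _ _ => Nat.zero_le _) (Finset.mem_univ j))⟩
  filter_upwards [(eventually_all_finset T).2 fun κ _ => eventually_mem_piFinset_Icc κ,
    eventually_ge_atTop N₀] with N hTN hN
  have hlt : ∀ c ∈ List.ofFn fun j => (n j, b j), c.1 < N := by
    intro c hc
    obtain ⟨j, rfl⟩ := (List.mem_ofFn' _ _).1 hc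
    exact (hN₀ j).trans_le hN
  rw [iterSum, letters, modeSum_append]
  simp only [modeSum_creationWt_inr N _ hlt]
  rw [modeSum_comap, modeSum_ofFn, HahnSeries.coeff_sum, hR]
  have hterm : ∀ κ : Fin r → ℤ, ((∏ i, creationWt (.inl (m i, a i) : Letter 𝔥) (κ i)) •
      wick (fun c d => (HahnSeries.C (modesVContr B c d) : Ser)) (onCreation (wordSer B φ w))
        ((List.ofFn fun i => ((m i, a i), κ i)).map (fun c => (.inl c.1, c.2)) ++
          (List.ofFn fun j => (n j, b j)).map fun c => (.inr c, -(c.1 : ℤ) - 1))).coeff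
            (expo .yx p q) =
      if ∑ i, fexp (modesV B) (m i) (κ i) = p then
        (∏ i, fcoef (modesV B) (m i) (κ i)) *
          φ (opYW B e e' (nord (modesV B) B κ a (word B b n)) w q) else 0 := by
    intro κ
    have e1 : ∀ i, creationWt (.inl (m i, a i) : Letter 𝔥) (κ i) =
        fcoef (modesV B) (m i) (κ i) • monoSer .yx 0 0 (fexp (modesV B) (m i) (κ i)) := by
      intro i
      rw [fexp_modesV, fcoef, modesV_deg]
      simp only [creationWt]
      congr 2
      ring
    have e2 : ∀ (f : Ser) (α : ℚ), (monoSer .yx 0 0 α * f).coeff (expo .yx p q) =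
        f.coeff (expo .yx (p - α) q) := by
      intro f α
      rw [monoSer, oneAddPow_zero, mul_one, HahnSeries.coeff_single_mul, one_mul]
      congr 1
      ext <;> simp [expo]
      ring
    simp only [e1, prod_smul_monoSer, Finset.sum_const_zero, smul_eq_mul, ser_smul_mul,
      HahnSeries.coeff_smul, e2]
    simp only [List.map_ofFn]
    have := wick_modesV_coeff B φ w hcomp a m b n κ
      (p - ∑ i, fexp (modesV B) (m i) (κ i)) q
    rw [show (((fun c : (ℕ × 𝔥) × ℤ => ((.inl c.1, c.2) : Letter 𝔥 × ℤ)) ∘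
      fun i => ((m i, a i), κ i))) = fun i => ((.inl (m i, a i) : Letter 𝔥), κ i) from rfl,
      show ((fun c : ℕ × 𝔥 => ((.inr c, -(c.1 : ℤ) - 1) : Letter 𝔥 × ℤ)) ∘
      fun j => (n j, b j)) = fun j => ((.inr (n j, b j) : Letter 𝔥), -(n j : ℤ) - 1) from rfl,
      this]
    simp only [sub_eq_zero, eq_comm (a := p)]
    split_ifs
    · rfl
    · rw [mul_zero]
  simp only [hterm]
  symm
  refine Finset.sum_subset (fun κ hκ => hTN κ hκ) fun κ _ hκ => ?_
  split_ifs with h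
  · have : nord (modesV B) B κ a (word B b n) = 0 := by
      by_contra h'
      exact hκ (hTmem κ h h')
    rw [this, ← opYWlin_apply B w hcomp, map_zero, map_zero, mul_zero]
  · rfl

end Iterate

open Filter

theorem sum_Icc_neg {E : Type*} [AddCommGroup E] (N : ℕ) (f : ℤ → E) :
    ∑ k ∈ Finset.Icc (-(N : ℤ)) N, (if k < 0 then f k else 0) =
      ∑ k ∈ Finset.range N, f (-k - 1) := by
  rw [sum_Icc_int, Finset.sum_eq_zero, zero_add]
  · exact Finset.sum_congr rfl fun k _ => if_pos (by omega)
  · exact fun k _ => if_neg (by omega)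

/-! ### The limit of the truncated iterate. -/

section IterateLimit

variable {𝔥 : Type u} [AddCommGroup 𝔥] [Module ℂ 𝔥] (B : LinearMap.BilinForm ℂ 𝔥)
  {U : Type v} [AddCommGroup U] [Module ℂ U] [Module (TensorAlgebra ℂ 𝔥) U]
  (φ : SpaceW B U →ₗ[ℂ] ℂ) (w : SpaceW B U)

omit [AddCommGroup 𝔥] [Module ℂ 𝔥] in
theorem creationWt_inl (a : ℕ × 𝔥) (k : ℕ) :
    creationWt (.inl a : Letter 𝔥) (-k - 1) = binom k a.1 • monoSer .yx 0 0 (k - a.1) := by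
  simp only [creationWt]
  push_cast
  congr 2 <;> ring

omit [AddCommGroup 𝔥] [Module ℂ 𝔥] in
theorem creation_neg (c : Letter 𝔥) (k : ℕ) : Letter.creation (c, -k - 1) = (k, c.data.2) := by
  simp only [Letter.creation]
  congr 1
  omega

omit [AddCommGroup 𝔥] [Module ℂ 𝔥] in
theorem sum_creationWt_inr {N : ℕ} {b : ℕ × 𝔥} (hN : b.1 < N) (f : ℤ → Ser) :
    ∑ n ∈ Finset.Icc (-(N : ℤ)) N, creationWt (.inr b : Letter 𝔥) n * f n = f (-b.1 - 1) := by
  rw [Finset.sum_eq_single (-(b.1 : ℤ) - 1)]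
  · simp [creationWt]
  · intro κ _ hκ
    simp [creationWt, hκ]
  · intro h
    exact absurd (Finset.mem_Icc.2 (by omega)) h

/-- The contractions of two letters that arise from the modes of `V` and from `Δ(x)`. -/
def iterContr (N : ℕ) (c d : Letter 𝔥) : Ser :=
  ∑ n ∈ Finset.Icc (-(N : ℤ)) N, ∑ n' ∈ Finset.Icc (-(N : ℤ)) N,
    creationWt c n * (creationWt d n' * (HahnSeries.C (modesVContr B (c, n) (d, n')) +
      if n < 0 ∧ n' < 0 then twistContr B .yx (.inr (Letter.creation (c, n)))
        (.inr (Letter.creation (d, n'))) else 0))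

/-- The field of a letter, expanded in the modes of `V`. -/
def creationFieldWt (N : ℕ) (c : Letter 𝔥) (κ : ℤ) : Ser :=
  ∑ k ∈ Finset.Icc (-(N : ℤ)) N,
    if k < 0 then creationWt c k * fieldWt .yx (.inr (Letter.creation (c, k))) κ else 0

/-- The contractions in `V` and those of `exp Δ` are two Wick sums over the same words. They merge
by `wick_wick`, and summation over modes gives one contraction per pair of letters. -/
theorem iterSum_eq_wick (L : List (Letter 𝔥)) (N : ℕ) :
    iterSum B φ w L N = wick (iterContr B N) (modeSum creationWt (Finset.Icc (-(N : ℤ)) N)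
      (onCreation fun l => nordSer B φ w .yx (l.map .inr))) L := by
  have h : onCreation (wordSer B φ w) = wick (fun c d : Letter 𝔥 × ℤ => if c.2 < 0 ∧ d.2 < 0 then
      twistContr B .yx (.inr (Letter.creation c)) (.inr (Letter.creation d)) else 0)
      (onCreation fun l => nordSer B φ w .yx (l.map .inr)) :=
    funext fun ℓ => onCreation_wick _ _ ℓ
  have h' : wick (fun c d : Letter 𝔥 × ℤ => (HahnSeries.C (modesVContr B c d) : Ser))
      (onCreation (wordSer B φ w)) = wick (fun c d : Letter 𝔥 × ℤ =>
        HahnSeries.C (modesVContr B c d) + if c.2 < 0 ∧ d.2 < 0 then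
      twistContr B .yx (.inr (Letter.creation c)) (.inr (Letter.creation d)) else 0)
      (onCreation fun l => nordSer B φ w .yx (l.map .inr)) := by
    funext ℓ
    rw [h, wick_wick]
  rw [iterSum, h', modeSum_wick]
  rfl

omit [AddCommGroup 𝔥] [Module ℂ 𝔥] in
theorem creationFieldWt_inl (N : ℕ) (a : ℕ × 𝔥) (κ : ℤ) :
    creationFieldWt N (.inl a) κ = ∑ k ∈ Finset.range N, (binom k a.1 * binom (-κ - 1 / 2) k) •
      monoSer .yx 0 (-κ - 1 / 2 - k) (k - a.1) := by
  rw [creationFieldWt, sum_Icc_neg]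
  refine Finset.sum_congr rfl fun k _ => ?_
  rw [creationWt_inl, creation_neg]
  simp only [fieldWt, ser_smul_mul, ser_mul_smul, monoSer_mul, smul_smul, add_zero, zero_add,
    mul_comm]

omit [AddCommGroup 𝔥] [Module ℂ 𝔥] in
theorem creationFieldWt_inr {N : ℕ} {b : ℕ × 𝔥} (hN : b.1 < N) (κ : ℤ) :
    creationFieldWt N (.inr b) κ = fieldWt .yx (.inr b) κ := by
  have : ∀ k : ℤ, (if k < 0 then creationWt (.inr b : Letter 𝔥) k *
      fieldWt .yx (.inr (Letter.creation (.inr b, k))) κ else 0) =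
      creationWt (.inr b : Letter 𝔥) k *
        if k < 0 then fieldWt .yx (.inr (Letter.creation (.inr b, k))) κ else 0 := by
    intro k
    split_ifs <;> simp
  simp only [creationFieldWt, this]
  rw [sum_creationWt_inr hN, if_pos (by omega), creation_neg]
  rfl

omit [AddCommGroup 𝔥] [Module ℂ 𝔥] in
theorem creationFieldWt_support {N : ℕ} {c : Letter 𝔥} (hN : c.data.1 < N) (κ : ℤ) :
    (creationFieldWt N c κ).support ⊆
      lineSet (-(max (κ : ℚ) 0) - 1 / 2 - c.data.1) (-κ - 1 / 2 - c.data.1) := by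
  cases c with
  | inl a =>
    rw [creationFieldWt_inl]
    refine support_sum_subset fun k _ => support_smul_subset' _ ?_
    have h2 : (0 : ℚ) ≤ max (κ : ℚ) 0 := le_max_right _ _
    have h3 : (0 : ℚ) ≤ k := k.cast_nonneg
    have := monoSer_support_lineSet (R := .yx) (α := 0) (β := -κ - 1 / 2 - k) (γ := k - a.1)
      (l := -(max (κ : ℚ) 0) - 1 / 2 - a.1) (half_sub_mem κ k)
      (sub_mem (natCast_mem_halfInts k) (natCast_mem_halfInts a.1)) (by simp only; linarith)
    rwa [show (0 : ℚ) + (-κ - 1 / 2 - k) + (k - a.1) = -κ - 1 / 2 - a.1 by ring] at this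
  | inr b =>
    rw [creationFieldWt_inr (b := b) hN]
    exact fieldWt_support .yx (.inr b) κ

omit [AddCommGroup 𝔥] [Module ℂ 𝔥] in
theorem tends_creationFieldWt {N₀ : ℕ} {c : Letter 𝔥} (hN : c.data.1 < N₀) (κ : ℤ) :
    Tends (fun N => creationFieldWt (N + N₀) c κ) (fieldWt .yx c κ) := by
  cases c with
  | inl a =>
    have h := (tends_field_yx a.1 (-κ - 1 / 2)
      (sub_mem (neg_mem (intCast_mem_halfInts κ)) half_mem)).shift N₀
    exact h.congr fun N => creationFieldWt_inl (N + N₀) a κ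
  | inr b =>
    exact (Tends.const _).congr fun N => creationFieldWt_inr (Nat.lt_add_left N hN) κ

/-- The finite sum over the modes of `V` is interchanged with the infinite sum over the modes of
`W`. Both sides are limits of the same doubly truncated sums, and limits are unique. -/
theorem modeSum_onCreation (N : ℕ) (L : List (Letter 𝔥)) (hN : ∀ c ∈ L, c.data.1 < N) :
    modeSum creationWt (Finset.Icc (-(N : ℤ)) N)
      (onCreation fun l => nordSer B φ w .yx (l.map .inr)) L =
      nordSerWt B φ w (creationFieldWt N) L := by
  refine Tends.unique (tends_modeSum creationWt _ (G := fun N' => onCreation fun l =>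
    modeSum (fieldWt .yx) (Finset.Icc (-(N' : ℤ)) N')
      (fun ℓ => (HahnSeries.C (nordFun B φ w ℓ) : Ser)) (l.map .inr)) (fun ℓ => ?_) L)
    ((tends_modeSum_nordFun B φ w L (fun _ => creationFieldWt N) (creationFieldWt N)
      (fun _ _ _ => Tends.const _) fun _ c hc κ => creationFieldWt_support (hN c hc) κ).congr
      fun N' => ?_)
  · unfold onCreation
    split_ifs
    · exact tends_nordSer B φ w .yx _
    · exact Tends.const 0
  · refine Eq.trans ?_ (modeSum_modeSum (fun k : ℤ => k < 0) creationWt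
      (fun c => fieldWt .yx (.inr (Letter.creation c))) (Finset.Icc (-(N : ℤ)) N)
      (Finset.Icc (-(N' : ℤ)) N') (fun ℓ => (HahnSeries.C (nordFun B φ w ℓ) : Ser)) L)
    refine modeSum_congr _ _ fun ℓ _ => ?_
    simp only [onCreation, List.map_map, modeSum_comap]
    congr 2
    funext l
    simp only [nordFun, List.map_map]
    rfl

/-- Two letters of `A` stand in one normally ordered product, so they have no contraction in `V`.
Only `exp Δ` contributes, and its Taylor sum is `tends_cNum_yx`. -/
theorem tends_iterContr_inl_inl (a a' : ℕ × 𝔥) :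
    Tends (fun N => iterContr B N (.inl a) (.inl a')) (twistContr B .yx (.inl a) (.inl a')) := by
  have h := (tends_cNum_yx a.1 a'.1).smul (-B a.2 a'.2)
  rw [smul_smul, neg_mul] at h
  refine h.congr fun N => ?_
  have e1 : ∀ k k' : ℤ, creationWt (.inl a : Letter 𝔥) k * (creationWt (.inl a' : Letter 𝔥) k' *
      (HahnSeries.C (modesVContr B (.inl a, k) (.inl a', k')) +
      if k < 0 ∧ k' < 0 then twistContr B .yx (.inr (Letter.creation (.inl a, k)))
        (.inr (Letter.creation (.inl a', k'))) else 0)) =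
      if k < 0 then (if k' < 0 then creationWt (.inl a : Letter 𝔥) k *
        (creationWt (.inl a' : Letter 𝔥) k' * twistContr B .yx
          (.inr (Letter.creation (.inl a, k))) (.inr (Letter.creation (.inl a', k')))) else 0)
      else 0 := by
    intro k k'
    simp only [modesVContr, map_zero, zero_add, ite_and]
    split_ifs <;> simp
  have e2 : ∀ k : ℤ, ∑ k' ∈ Finset.Icc (-(N : ℤ)) N, (if k < 0 then (if k' < 0 then
        creationWt (.inl a : Letter 𝔥) k *
        (creationWt (.inl a' : Letter 𝔥) k' * twistContr B .yx
          (.inr (Letter.creation (.inl a, k))) (.inr (Letter.creation (.inl a', k')))) else 0)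
      else 0) = if k < 0 then ∑ k' ∈ Finset.range N, creationWt (.inl a : Letter 𝔥) k *
        (creationWt (.inl a' : Letter 𝔥) (-k' - 1) * twistContr B .yx
          (.inr (Letter.creation (.inl a, k))) (.inr (Letter.creation (.inl a', -k' - 1))))
        else 0 := by
    intro k
    split_ifs
    · exact sum_Icc_neg N _
    · exact Finset.sum_const_zero
  simp only [iterContr, e1, e2]
  rw [sum_Icc_neg, Finset.smul_sum]
  refine Finset.sum_congr rfl fun k _ => ?_
  rw [Finset.smul_sum]
  refine Finset.sum_congr rfl fun k' _ => ?_
  rw [creationWt_inl, creationWt_inl, creation_neg, creation_neg]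
  simp only [twistContr, ser_smul_mul, ser_mul_smul, monoSer_mul, smul_smul, add_zero, zero_add]
  congr 1
  simp only [Letter.data, Sum.elim_inl, id_eq]
  ring

/-- The first term is the contraction in `V`, where only the mode of degree opposite to that of `b`
contributes. The sum is the contribution of `exp Δ`. Together they are the partial sums of
`tends_gDer_yx`. -/
theorem iterContr_inl_inr {N : ℕ} (a b : ℕ × 𝔥) (hN : b.1 < N) :
    iterContr B N (.inl a) (.inr b) = B a.2 b.2 • (binom (-b.1 - 1) a.1 •
      monoSer .yx 0 0 (-b.1 - 1 - a.1) - ∑ k ∈ Finset.range N,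
        (binom k a.1 * cNum k b.1) • monoSer .yx 0 (-k - b.1 - 1) (k - a.1)) := by
  have e2 : ∀ k : ℤ, modesVContr B (.inl a, k) (.inr b, -b.1 - 1) =
      if k = b.1 then B a.2 b.2 else 0 := by
    intro k
    have h1 : (k : ℚ) + 1 / 2 + ((-(b.1 : ℤ) - 1 : ℤ) + 1 / 2) = 0 ↔ k = b.1 := by
      push_cast
      constructor
      · intro h
        have : (k : ℚ) = (b.1 : ℤ) := by push_cast; linarith
        exact_mod_cast this
      · rintro rfl
        push_cast
        ring
    have h2 : (0 : ℚ) ≤ b.1 := b.1.cast_nonneg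
    simp only [modesVContr, modeContr, modesV_deg, h1]
    by_cases h : k = b.1
    · rw [if_pos h, if_pos h]
      refine if_pos ?_
      rw [h]
      push_cast
      linarith
    · rw [if_neg h, if_neg h]
  have e3 : (-(b.1 : ℤ) - 1) < 0 := by omega
  simp only [iterContr, ← Finset.mul_sum, sum_creationWt_inr hN]
  simp only [e2, e3, and_true, mul_add, Finset.sum_add_distrib]
  rw [smul_sub, Finset.smul_sum]
  refine (congrArg₂ (· + ·) ?_ ?_).trans (sub_eq_add_neg _ _).symm
  · rw [Finset.sum_eq_single (b.1 : ℤ), if_pos rfl, mul_comm, HahnSeries.C_mul_eq_smul]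
    · simp only [creationWt, Int.cast_natCast]
    · intro k _ hk
      rw [if_neg hk, map_zero, mul_zero]
    · intro h
      exact absurd (Finset.mem_Icc.2 (by omega)) h
  · have e4 : ∀ k : ℤ, (creationWt (.inl a : Letter 𝔥) k * if k < 0 then twistContr B .yx
        (.inr (Letter.creation (.inl a, k))) (.inr (Letter.creation (.inr b, -b.1 - 1))) else 0) =
        if k < 0 then creationWt (.inl a : Letter 𝔥) k * twistContr B .yx
        (.inr (Letter.creation (.inl a, k))) (.inr (Letter.creation (.inr b, -b.1 - 1))) else 0 := by
      intro k
      split_ifs <;> simp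
    simp only [e4]
    rw [sum_Icc_neg, ← Finset.sum_neg_distrib]
    refine Finset.sum_congr rfl fun k _ => ?_
    rw [creationWt_inl, creation_neg, creation_neg]
    simp only [twistContr, ser_smul_mul, ser_mul_smul, monoSer_mul, smul_smul, add_zero, zero_add,
      Letter.data, Sum.elim_inl, Sum.elim_inr, id_eq]
    ext γ
    simp only [HahnSeries.coeff_smul, HahnSeries.coeff_neg, smul_eq_mul]
    ring

theorem iterContr_inr_inr {N : ℕ} (b b' : ℕ × 𝔥) (hN : b.1 < N) (hN' : b'.1 < N) :
    iterContr B N (.inr b) (.inr b') = twistContr B .yx (.inr b) (.inr b') := by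
  simp only [iterContr, ← Finset.mul_sum, sum_creationWt_inr hN, sum_creationWt_inr hN']
  rw [if_pos ⟨by omega, by omega⟩, creation_neg, creation_neg]
  simp only [modesVContr, map_zero, zero_add]
  rfl

/-- The index is shifted by `N₀` so that every truncation contains the creation operators of all
letters. -/
theorem tends_iterSum (l l' : List (ℕ × 𝔥)) {N₀ : ℕ} (hl : ∀ c ∈ l, c.1 < N₀)
    (hl' : ∀ c ∈ l', c.1 < N₀) :
    Tends (fun N => iterSum B φ w (l.map .inl ++ l'.map .inr) (N + N₀))
      (wick (twistContr B .yx) (nordSer B φ w .yx) (l.map .inl ++ l'.map .inr)) := by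
  have hL : ∀ c ∈ l.map (.inl : ℕ × 𝔥 → Letter 𝔥) ++ l'.map .inr,
      (Letter.data c).1 < N₀ := by
    intro c hc
    rcases List.mem_append.1 hc with hc | hc
    · obtain ⟨a, ha, rfl⟩ := List.mem_map.1 hc
      exact hl a ha
    · obtain ⟨a, ha, rfl⟩ := List.mem_map.1 hc
      exact hl' a ha
  refine Tends.congr (tends_wick ?_ fun L hsub => ?_) fun N => iterSum_eq_wick B φ w _ _
  · rw [List.pairwise_append, List.pairwise_map, List.pairwise_map]
    refine ⟨List.pairwise_of_forall fun a a' => (tends_iterContr_inl_inl B a a').shift N₀,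
      List.Pairwise.imp_of_mem (fun {b b'} hb hb' _ => ?_)
        (List.pairwise_of_forall (R := fun _ _ => True) fun _ _ => trivial), ?_⟩
    · exact (Tends.const _).congr fun N => iterContr_inr_inr B b b'
        (Nat.lt_add_left N (hl' b hb)) (Nat.lt_add_left N (hl' b' hb'))
    · intro c hc d hd
      obtain ⟨a, ha, rfl⟩ := List.mem_map.1 hc
      obtain ⟨b, hb, rfl⟩ := List.mem_map.1 hd
      have h := ((tends_gDer_yx a.1 b.1).smul (B a.2 b.2)).shift N₀
      exact h.congr fun N => iterContr_inl_inr B a b (Nat.lt_add_left N (hl' b hb))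
  · have hL' : ∀ c ∈ L, c.data.1 < N₀ := fun c hc => hL c (hsub.subset hc)
    refine Tends.congr (tends_nordSerWt B φ w L (fun N => creationFieldWt (N + N₀)) (fieldWt .yx)
      (fun c hc κ => tends_creationFieldWt (hL' c hc) κ)
      (fun N c hc κ => creationFieldWt_support (Nat.lt_add_left N (hL' c hc)) κ)
      fun c _ κ => fieldWt_support .yx c κ) fun N => ?_
    exact modeSum_onCreation B φ w _ L fun c hc => Nat.lt_add_left N (hL' c hc)

variable {M : ℕ} {e e' : Fin M → 𝔥}
  (hcomp : ∀ h, ∑ i, (B (e' i) h • e i + B (e i) h • e' i) = h)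

include hcomp in
theorem iterateSide_coeff {r s : ℕ} (a : Fin r → 𝔥) (m : Fin r → ℕ) (b : Fin s → 𝔥)
    (n : Fin s → ℕ) (p q : ℚ) : φ (iterateSide B e e' (word B a m) (word B b n) w p q) =
    (wick (twistContr B .yx) (nordSer B φ w .yx) (letters a m b n)).coeff (expo .yx p q) := by
  have h0 : ∀ {t : ℕ} (f : Fin t → ℕ) (g : Fin t → 𝔥), ∀ c ∈ List.ofFn fun i => (f i, g i),
      c.1 < ∑ i, f i + 1 := by
    intro t f g c hc
    obtain ⟨i, rfl⟩ := (List.mem_ofFn' _ _).1 hc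
    exact Nat.lt_succ_of_le
      (Finset.single_le_sum (f := f) (fun _ _ => Nat.zero_le _) (Finset.mem_univ i))
  have h1 := tends_iterSum B φ w (List.ofFn fun i => (m i, a i)) (List.ofFn fun j => (n j, b j))
    (N₀ := ∑ i, m i + ∑ j, n j + 1) (fun c hc => (h0 m a c hc).trans_le (by omega))
    (fun c hc => (h0 n b c hc).trans_le (by omega))
  obtain ⟨N, hN, hN'⟩ := ((h1.2 (expo .yx p q)).and
    ((tendsto_add_atTop_nat (∑ i, m i + ∑ j, n j + 1)).eventually
      (iterateSide_coeff_eventually B φ w hcomp a m b n p q))).exists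
  exact hN'.symm.trans hN

end IterateLimit

open Filter

/-! ### Comparison of the two expansions -/

/-- Two series have the same coefficients, if the first one is read in the expansion `xy` and the
second one in the expansion `yx`. -/
def SameCoeff (S S' : Ser) : Prop := ∀ p q, S.coeff (expo .xy p q) = S'.coeff (expo .yx p q)

/-- The symmetry of binomial coefficients with natural upper index is the reason why the two
expansions of `(x+y)^n` coincide. -/
theorem binomQ_symm (n : ℕ) (t : ℚ) : binomQ n (n - t) = binomQ n t := by
  have key : ∀ i : ℕ, binomQ n (n - i) = binomQ n i := by
    intro i
    by_cases hi : i ≤ n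
    · rw [← Nat.cast_sub hi, binomQ_natCast, binomQ_natCast, binom_natCast, binom_natCast,
        Nat.choose_symm hi]
    · push Not at hi
      rw [binomQ_natCast, binom_natCast, Nat.choose_eq_zero_of_lt hi, binomQ_eq_zero, Nat.cast_zero]
      intro j hj
      have h1 : (n : ℚ) < i := by exact_mod_cast hi
      have h2 : (0 : ℚ) ≤ j := j.cast_nonneg
      linarith
  by_cases h : ∃ i : ℕ, t = i
  · obtain ⟨i, rfl⟩ := h
    exact key i
  · by_cases h' : ∃ i : ℕ, n - t = i
    · obtain ⟨i, hi⟩ := h'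
      have := key i
      rw [hi, ← this, ← hi, sub_sub_cancel]
    · push Not at h h'
      rw [binomQ_eq_zero h, binomQ_eq_zero h']

theorem sameCoeff_monoSer (n : ℕ) (β γ : ℚ) :
    SameCoeff (monoSer .xy n β γ) (monoSer .yx n β γ) := by
  intro p q
  rw [monoSer_coeff, monoSer_coeff]
  split_ifs with h
  · simp only
    rw [← binomQ_symm]
    congr 1
    linarith
  · rfl

theorem SameCoeff.add {S S' T T' : Ser} (h : SameCoeff S S') (h' : SameCoeff T T') :
    SameCoeff (S + T) (S' + T') := fun p q => by
  rw [HahnSeries.coeff_add, HahnSeries.coeff_add, h, h']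

theorem SameCoeff.smul {S S' : Ser} (h : SameCoeff S S') (c : ℂ) : SameCoeff (c • S) (c • S') :=
  fun p q => by rw [HahnSeries.coeff_smul, HahnSeries.coeff_smul, h]

theorem SameCoeff.sum {σ : Type*} (T : Finset σ) {f f' : σ → Ser}
    (h : ∀ t ∈ T, SameCoeff (f t) (f' t)) : SameCoeff (∑ t ∈ T, f t) (∑ t ∈ T, f' t) :=
  fun p q => by
    rw [HahnSeries.coeff_sum, HahnSeries.coeff_sum]
    exact Finset.sum_congr rfl fun t ht => h t ht p q

theorem SameCoeff.of_tends {f f' : ℕ → Ser} {S S' : Ser} (hf : Tends f S) (hf' : Tends f' S')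
    (h : ∀ N, SameCoeff (f N) (f' N)) : SameCoeff S S' := fun p q => by
  obtain ⟨N, h1, h2⟩ := ((hf.2 (expo .xy p q)).and (hf'.2 (expo .yx p q))).exists
  rw [← h1, ← h2, h N]

theorem monoSer_zero_mul_coeff (R : Expansion) (β γ p q : ℚ) (f : Ser) :
    (monoSer R 0 β γ * f).coeff (expo R p q) = f.coeff (expo R (p - γ) (q - β)) := by
  rw [monoSer, oneAddPow_zero, mul_one, HahnSeries.coeff_single_mul, one_mul]
  congr 1
  rw [expo_sub]
  ext <;> simp

theorem SameCoeff.monoSer_zero_mul {S S' : Ser} (h : SameCoeff S S') (β γ : ℚ) :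
    SameCoeff (monoSer .xy 0 β γ * S) (monoSer .yx 0 β γ * S') := fun p q => by
  rw [monoSer_zero_mul_coeff, monoSer_zero_mul_coeff, h]

/-- The two series have the same coefficients after multiplication by `(x + y)^(a + n)`, for all
natural numbers `n`. -/
def SameAfter (a : ℚ) (S S' : Ser) : Prop :=
  ∀ n : ℕ, SameCoeff (monoSer .xy (a + n) 0 0 * S) (monoSer .yx (a + n) 0 0 * S')

namespace SameAfter

variable {a : ℚ} {S S' T T' : Ser}

theorem add (h : SameAfter a S S') (h' : SameAfter a T T') : SameAfter a (S + T) (S' + T') :=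
  fun n => by
    rw [mul_add, mul_add]
    exact (h n).add (h' n)

theorem smul (h : SameAfter a S S') (c : ℂ) : SameAfter a (c • S) (c • S') := fun n => by
  rw [ser_mul_smul, ser_mul_smul]
  exact (h n).smul c

theorem zero : SameAfter a 0 0 := fun n p q => by
  rw [mul_zero, mul_zero, HahnSeries.coeff_zero, HahnSeries.coeff_zero]

theorem sub (h : SameAfter a S S') (h' : SameAfter a T T') : SameAfter a (S - T) (S' - T') := by
  have e : ∀ x y : Ser, x - y = x + (-1 : ℂ) • y := fun x y => by ext; simp [sub_eq_add_neg]
  rw [e, e]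
  exact h.add (h'.smul _)

theorem mono (h : SameAfter a S S') (k : ℕ) : SameAfter (a + k) S S' := fun n => by
  have := h (k + n)
  rwa [Nat.cast_add, ← add_assoc] at this

theorem of_tends {f f' : ℕ → Ser} (hf : Tends f S) (hf' : Tends f' S')
    (h : ∀ N, SameAfter a (f N) (f' N)) : SameAfter a S S' := fun n =>
  SameCoeff.of_tends ((Tends.const _).mul hf) ((Tends.const _).mul hf') fun N => h N n

/-- Powers of `x` and `y` are expanded in the same way on both sides. Only the power of `x + y`
changes the exponent that has to be cleared. -/
theorem monoSer_mul (h : SameAfter a S S') (α β γ : ℚ) :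
    SameAfter (a - α) (monoSer .xy α β γ * S) (monoSer .yx α β γ * S') := fun n => by
  have e : ∀ (R : Expansion) (f : Ser), monoSer R (a - α + n) 0 0 * (monoSer R α β γ * f) =
      monoSer R 0 β γ * (monoSer R (a + n) 0 0 * f) := by
    intro R f
    rw [← mul_assoc, ← mul_assoc, TwistedFermion.monoSer_mul, TwistedFermion.monoSer_mul]
    congr 2 <;> ring
  rw [e, e]
  exact (h n).monoSer_zero_mul β γ

theorem sum {σ : Type*} (A : Finset σ) {f f' : σ → Ser}
    (h : ∀ t ∈ A, SameAfter a (f t) (f' t)) : SameAfter a (∑ t ∈ A, f t) (∑ t ∈ A, f' t) :=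
  fun n => by
    rw [Finset.mul_sum, Finset.mul_sum]
    exact SameCoeff.sum _ fun t ht => h t ht n

theorem of_monoSer {α : ℚ} (k : ℕ) (h : a + α = k) (β γ : ℚ) :
    SameAfter a (monoSer .xy α β γ) (monoSer .yx α β γ) := fun n => by
  rw [TwistedFermion.monoSer_mul, TwistedFermion.monoSer_mul,
    show a + n + α = ((k + n : ℕ) : ℚ) by push_cast; linarith]
  exact sameCoeff_monoSer _ _ _

end SameAfter

/-! ### Denominators in Wick sums. -/

section SameAfterWick

variable {ι : Type*}

/-- Each letter has a cost `wt`. The functional pays for the surviving letters and the contraction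
for the removed one, so every term costs the same as the whole word; `c` is the cost of the other
partner of the contraction. -/
theorem SameAfter.contract {f f' : ι → Ser} {F F' : List ι → Ser} {wt : ι → ℚ} {c : ℚ}
    (hf : ∀ b a S S', SameAfter a S S' → SameAfter (a + (c + wt b)) (f b * S) (f' b * S'))
    (L : List ι) (a : ℚ) (hF : ∀ l, SameAfter (a + (l.map wt).sum) (F l) (F' l)) :
    SameAfter (a + c + (L.map wt).sum) (contract f F L) (contract f' F' L) := by
  induction L generalizing a F F' with
  | nil => exact SameAfter.zero
  | cons b L ih =>
    rw [contract_cons, contract_cons, smul_eq_mul, smul_eq_mul, List.map_cons, List.sum_cons]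
    refine SameAfter.sub ?_ ?_
    · have := hf b _ _ _ (hF L)
      rwa [show a + (L.map wt).sum + (c + wt b) = a + c + (wt b + (L.map wt).sum) by ring] at this
    · have := ih (a + wt b) (F := fun l => F (b :: l)) (F' := fun l => F' (b :: l)) fun l => by
        have := hF (b :: l)
        rwa [List.map_cons, List.sum_cons, ← add_assoc] at this
      rwa [show a + wt b + c + (L.map wt).sum = a + c + (wt b + (L.map wt).sum) by ring] at this

theorem SameAfter.wick {β β' : ι → ι → Ser} {F F' : List ι → Ser} {wt : ι → ℚ}
    (hβ : ∀ b c a S S', SameAfter a S S' →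
      SameAfter (a + (wt b + wt c)) (β b c * S) (β' b c * S'))
    (L : List ι) (a : ℚ) (hF : ∀ l, SameAfter (a + (l.map wt).sum) (F l) (F' l)) :
    SameAfter (a + (L.map wt).sum) (wick β F L) (wick β' F' L) := by
  induction L generalizing a F F' with
  | nil => exact hF []
  | cons b L ih =>
    rw [wick_cons, wick_cons, List.map_cons, List.sum_cons, ← add_assoc]
    refine ih (a + wt b) fun l => SameAfter.add ?_ (SameAfter.contract (hβ b) l a hF)
    have := hF (b :: l)
    rwa [List.map_cons, List.sum_cons, ← add_assoc] at this

end SameAfterWick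

/-- Combinations of `x₁^α y^β (x₁ - y)^γ` with `α ∈ -1/2 - k + ℕ`. -/
def halfPowers (k : ℕ) : AddSubmonoid AlgFun :=
  AddSubmonoid.closure {A | ∃ (i : ℕ) (β : ℚ) (γ : ℤ) (c : ℂ), A = .mono (i - 1 / 2 - k) β γ c}

theorem mono_mem_halfPowers {k : ℕ} {α : ℚ} (i : ℕ) (h : α = i - 1 / 2 - k) (β : ℚ) (γ : ℤ)
    (c : ℂ) : AlgFun.mono α β γ c ∈ halfPowers k :=
  AddSubmonoid.subset_closure ⟨i, β, γ, c, by rw [h]⟩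

theorem d1_mono (α β : ℚ) (γ : ℤ) (c : ℂ) : (AlgFun.mono α β γ c).d1 =
    .mono (α - 1) β γ (c * α) + .mono α β (γ - 1) (c * γ) := by
  rw [AlgFun.mono, AlgFun.d1, AddMonoidAlgebra.coeff_single, Finsupp.sum_single_index]
  simp [algFun_mono_zero]

theorem d2_mono (α β : ℚ) (γ : ℤ) (c : ℂ) : (AlgFun.mono α β γ c).d2 =
    .mono α (β - 1) γ (c * β) - .mono α β (γ - 1) (c * γ) := by
  rw [AlgFun.mono, AlgFun.d2, AddMonoidAlgebra.coeff_single, Finsupp.sum_single_index]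
  simp [algFun_mono_zero]

theorem d1_mem_halfPowers {k : ℕ} {A : AlgFun} (h : A ∈ halfPowers k) :
    A.d1 ∈ halfPowers (k + 1) := by
  induction h using AddSubmonoid.closure_induction with
  | mem A hA =>
    obtain ⟨i, β, γ, c, rfl⟩ := hA
    rw [d1_mono]
    exact add_mem (mono_mem_halfPowers i (by push_cast; ring) _ _ _)
      (mono_mem_halfPowers (i + 1) (by push_cast; ring) _ _ _)
  | zero => simp [AlgFun.d1]
  | add A A' _ _ hA hA' =>
    rw [d1_add]
    exact add_mem hA hA'

/-- Differentiation by `y` leaves the powers of `x₁` alone; only derivatives by `x₁` increase the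
denominator. Therefore `g_{mn}` costs `m + 1/2`, whatever `n` is. -/
theorem d2_mem_halfPowers {k : ℕ} {A : AlgFun} (h : A ∈ halfPowers k) : A.d2 ∈ halfPowers k := by
  induction h using AddSubmonoid.closure_induction with
  | mem A hA =>
    obtain ⟨i, β, γ, c, rfl⟩ := hA
    have e : ∀ (α β : ℚ) (γ : ℤ) (c : ℂ), -AlgFun.mono α β γ c = .mono α β γ (-c) := by
      intro α β γ c
      simp [AlgFun.mono]
    rw [d2_mono, sub_eq_add_neg, e]
    exact add_mem (mono_mem_halfPowers i rfl _ _ _) (mono_mem_halfPowers i rfl _ _ _)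
  | zero => simp [AlgFun.d2]
  | add A A' _ _ hA hA' =>
    rw [d2_add]
    exact add_mem hA hA'

theorem gFun_mem_halfPowers : gFun ∈ halfPowers 0 := by
  have e : ∀ (α β : ℚ) (γ : ℤ) (c : ℂ) (α' β' : ℚ) (γ' : ℤ) (c' : ℂ),
      AlgFun.mono α β γ c * .mono α' β' γ' c' = .mono (α + α') (β + β') (γ + γ') (c * c') := by
    intro α β γ c α' β' γ' c'
    simp [AlgFun.mono, AddMonoidAlgebra.single_mul_single]
  rw [gFun, mul_add, add_mul, e, e, e, e]
  exact add_mem (mono_mem_halfPowers 1 (by norm_num) _ _ _)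
    (mono_mem_halfPowers 0 (by norm_num) _ _ _)

theorem d1_d2_gFun_mem_halfPowers (m n : ℕ) : AlgFun.d1^[m] (AlgFun.d2^[n] gFun) ∈ halfPowers m := by
  induction m with
  | zero =>
    induction n with
    | zero => exact gFun_mem_halfPowers
    | succ n ih =>
      rw [Function.iterate_zero, id_eq] at ih ⊢
      rw [Function.iterate_succ_apply']
      exact d2_mem_halfPowers ih
  | succ m ih =>
    rw [Function.iterate_succ_apply']
    exact d1_mem_halfPowers ih

theorem SameAfter.iotaHom_mul {k : ℕ} {A : AlgFun} (hA : A ∈ halfPowers k) {a : ℚ} {S S' : Ser}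
    (h : SameAfter a S S') :
    SameAfter (a + (k + 1 / 2)) (iotaHom .xy A * S) (iotaHom .yx A * S') := by
  induction hA using AddSubmonoid.closure_induction with
  | mem A hA =>
    obtain ⟨i, β, γ, c, rfl⟩ := hA
    rw [iotaHom_mono, iotaHom_mono, ser_smul_mul, ser_smul_mul]
    have := ((h.monoSer_mul (i - 1 / 2 - k) β γ).mono i).smul c
    rwa [show a - (i - 1 / 2 - k) + i = a + (k + 1 / 2) by ring] at this
  | zero =>
    rw [map_zero, map_zero, zero_mul, zero_mul]
    exact SameAfter.zero
  | add A A' _ _ hA hA' =>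
    rw [map_add, map_add, add_mul, add_mul]
    exact hA.add hA'

section Compare

variable {𝔥 : Type u} [AddCommGroup 𝔥] [Module ℂ 𝔥] (B : LinearMap.BilinForm ℂ 𝔥)
  {U : Type v} [AddCommGroup U] [Module ℂ U] [Module (TensorAlgebra ℂ 𝔥) U]
  (φ : SpaceW B U →ₗ[ℂ] ℂ) (w : SpaceW B U)

/-- The exponent of `x + y` that removes the denominators that a letter contributes. -/
def Letter.pole : Letter 𝔥 → ℚ := Sum.elim (fun a => a.1 + 1 / 2) fun _ => 0

/-- A pair in `A` has the denominator `(x+y)^(m+m'+1)`, which is the sum of the costs of its two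
letters. A mixed pair costs `m + 1/2`, and the letters of `B` are free. -/
theorem sameAfter_twistContr (c d : Letter 𝔥) {a : ℚ} {S S' : Ser} (h : SameAfter a S S') :
    SameAfter (a + (Letter.pole c + Letter.pole d)) (twistContr B .xy c d * S)
      (twistContr B .yx c d * S') := by
  rcases c with c | c <;> rcases d with d | d
  · simp only [twistContr, ser_smul_mul, Letter.pole, Sum.elim_inl]
    have := (h.monoSer_mul (-c.1 - d.1 - 1) 0 0).smul (-(B c.2 d.2 * cNum c.1 d.1))
    rwa [show a - (-c.1 - d.1 - 1) = a + (c.1 + 1 / 2 + (d.1 + 1 / 2) : ℚ) by ring] at this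
  · simp only [twistContr, ser_smul_mul, Letter.pole, Sum.elim_inl, Sum.elim_inr, add_zero, gDer,
      map_smul]
    exact ((h.iotaHom_mul (d1_d2_gFun_mem_halfPowers c.1 d.1)).smul _).smul _
  · simp only [twistContr, zero_mul]
    exact SameAfter.zero
  · simp only [twistContr, ser_smul_mul, Letter.pole, Sum.elim_inr, add_zero]
    have := (h.monoSer_mul 0 (-c.1 - d.1 - 1) 0).smul (-(B c.2 d.2 * cNum c.1 d.1))
    rwa [sub_zero] at this

-- In each term the power of `x + y` becomes a nonnegative integer after the multiplication, and
-- then both expansions agree.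
variable {w} in
theorem sameAfter_nordSer {D : ℕ} (hD : Trunc (modesW B U) D w) (L : List (Letter 𝔥)) :
    SameAfter (D + (L.map Letter.pole).sum) (nordSer B φ w .xy L) (nordSer B φ w .yx L) := by
  refine SameAfter.of_tends (tends_nordSer B φ w .xy L) (tends_nordSer B φ w .yx L) fun N => ?_
  rw [modeSum_nordFun_eq_sum, modeSum_nordFun_eq_sum]
  refine SameAfter.sum _ fun κ _ => ?_
  by_cases h0 : nordFun B φ w (List.ofFn fun i => (L.get i, κ i)) = 0
  · rw [h0, map_zero, mul_zero, mul_zero]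
    exact SameAfter.zero
  have hκ : ∑ i, max (κ i : ℚ) 0 ≤ D := by
    by_contra hlt
    push Not at hlt
    refine nordFun_ne_zero h0 (nord_eq_zero_of_trunc hD κ _ ?_)
    simpa only [modesW_deg] using hlt
  have hκ' : ∑ i, max (κ i) 0 ≤ (D : ℤ) := by
    have : ((∑ i, max (κ i) 0 : ℤ) : ℚ) ≤ (D : ℤ) := by push_cast; exact hκ
    exact_mod_cast this
  let ex : Letter 𝔥 → ℤ → ℚ × ℚ := fun c k => match c with
    | .inl a => (-k - 1 / 2 - a.1, 0)
    | .inr b => (0, -k - 1 / 2 - b.1)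
  let co : Letter 𝔥 → ℤ → ℂ := fun c k => binom (-k - 1 / 2) c.data.1
  have e : ∀ (R : Expansion) (c : Letter 𝔥) (k : ℤ), fieldWt R c k =
      co c k • monoSer R (ex c k).1 (ex c k).2 0 := by
    intro R c k
    cases c <;> rfl
  simp only [e, prod_smul_monoSer, mul_comm _ (HahnSeries.C _), HahnSeries.C_mul_eq_smul,
    Finset.sum_const_zero]
  refine (SameAfter.smul ?_ _).smul _
  -- The costs of the letters at `x+y` cancel the summands `-1/2 - m` of the exponent. What remains
  -- is `D` minus the degrees of these modes. It is an integer, and it is nonnegative because the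
  -- positive parts of all degrees add up to at most `D`.
  obtain ⟨k, hk⟩ : ∃ k : ℤ, (D : ℚ) + (L.map Letter.pole).sum + ∑ i, (ex (L.get i) (κ i)).1 = k ∧
      0 ≤ k := by
    refine ⟨D - ∑ i, if (L.get i).isLeft then κ i else 0, ?_, ?_⟩
    · have h1 : (L.map Letter.pole).sum = ∑ i : Fin L.length, Letter.pole (L.get i) :=
        (congrArg (fun l => (l.map Letter.pole).sum) (List.ofFn_get L)).symm.trans (by
          rw [List.map_ofFn, List.sum_ofFn]
          rfl)
      rw [h1, add_assoc, ← Finset.sum_add_distrib]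
      push_cast
      rw [sub_eq_add_neg, ← Finset.sum_neg_distrib]
      congr 1
      refine Finset.sum_congr rfl fun i _ => ?_
      cases h : L.get i with
      | inl a => simp [ex, Letter.pole]; ring
      | inr a => simp [ex, Letter.pole]
    · have : ∑ i, (if (L.get i).isLeft then κ i else 0) ≤ ∑ i, max (κ i) 0 :=
        Finset.sum_le_sum fun i _ => by
          split_ifs
          · exact le_max_left _ _
          · exact le_max_right _ _
      omega
  obtain ⟨n, rfl⟩ := Int.eq_ofNat_of_zero_le hk.2
  exact SameAfter.of_monoSer n (by rw [hk.1]; rfl) _ _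

variable {w} in
theorem sameAfter_wick {D : ℕ} (hD : Trunc (modesW B U) D w) (L : List (Letter 𝔥)) :
    SameAfter (D + (L.map Letter.pole).sum)
      (wick (twistContr B .xy) (nordSer B φ w .xy) L)
      (wick (twistContr B .yx) (nordSer B φ w .yx) L) :=
  SameAfter.wick (fun _ _ _ _ _ h => sameAfter_twistContr B _ _ h) L D
    fun l => sameAfter_nordSer B φ hD l

/-- The generating vector `u` is killed by positive modes. A mode of degree `-d` raises the
truncation degree by at most `d`, and zero modes do not raise it. -/
theorem trunc_modesW (t : ℕ) (h : Fin t → 𝔥) (d : Fin t → ℕ) (u : U) :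
    Trunc (modesW B U) (∑ i, d i : ℕ)
      ((List.ofFn fun i => modeW B U (-(d i : ℤ)) (h i)).prod (ofU B u)) := by
  change TruncAt (modeW B U) 0 _ _
  induction t with
  | zero =>
    have := TruncAt.vacuum (mode := modeW B U) (shift := 0) (x := ofU B u) fun p a hp =>
      modeW_ofU B U p a u (by simpa using hp)
    simpa using this
  | succ t ih =>
    rw [List.ofFn_succ, List.prod_cons, Module.End.mul_apply, Fin.sum_univ_succ]
    have := TruncAt.move (modeW B U (-(d 0 : ℤ)) (h 0)) (k := (d 0 : ℚ)) (Nat.cast_nonneg _)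
      (fun p a hp => ?_) (ih (fun i => h i.succ) fun i => d i.succ)
    · refine this.mono (le_of_eq ?_)
      push_cast
      ring
    · have hp' : 0 < p := by simpa using hp
      by_cases h0 : d 0 = 0
      · refine ⟨0, fun h => absurd rfl h, ?_⟩
        rw [zero_smul, h0]
        exact modeW_nonzero_zero B U p a _ hp'.ne'
      · refine ⟨_, fun hne => ?_, modeW_pos_neg B U p _ a _ hp' (by omega)⟩
        have : p + -(d 0 : ℤ) = 0 := by
          by_contra hne'
          simp [hne'] at hne
        have h2 : p = d 0 := by omega
        rw [h2]
        simp

/-- The supports of the series of a family are contained in one partially well-ordered set. -/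
def SupportBdd {σ : Type*} (f : σ → Ser) : Prop :=
  ∃ t : Set (ℚ × ℚ), t.IsPWO ∧ ∀ x, (f x).support ⊆ t

theorem SupportBdd.add {σ : Type*} {f g : σ → Ser} (hf : SupportBdd f) (hg : SupportBdd g) :
    SupportBdd fun x => f x + g x := by
  obtain ⟨s, hs, hf⟩ := hf
  obtain ⟨t, ht, hg⟩ := hg
  exact ⟨s ∪ t, hs.union ht, fun x => (HahnSeries.support_add_subset _ _).trans
    (Set.union_subset_union (hf x) (hg x))⟩

theorem SupportBdd.neg {σ : Type*} {f : σ → Ser} (hf : SupportBdd f) :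
    SupportBdd fun x => -f x := by
  obtain ⟨s, hs, hf⟩ := hf
  exact ⟨s, hs, fun x => by rw [HahnSeries.support_neg]; exact hf x⟩

open scoped Pointwise in
theorem SupportBdd.const_mul {σ : Type*} {f : σ → Ser} (hf : SupportBdd f) (g : Ser) :
    SupportBdd fun x => g * f x := by
  obtain ⟨s, hs, hf⟩ := hf
  exact ⟨g.support + s, g.isPWO_support.add hs, fun x => HahnSeries.support_mul_subset.trans
    (Set.add_subset_add_left (hf x))⟩

theorem SupportBdd.contract {σ ι : Type*} {f : ι → Ser} {F : σ → List ι → Ser} (L : List ι)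
    (hF : ∀ l, SupportBdd fun x => F x l) : SupportBdd fun x => contract f (F x) L := by
  induction L generalizing F with
  | nil => exact ⟨∅, Set.isPWO_empty, fun x γ hγ => absurd rfl hγ⟩
  | cons b L ih =>
    simp only [contract_cons, smul_eq_mul, sub_eq_add_neg]
    exact ((hF L).const_mul _).add (ih fun l => hF _).neg

theorem SupportBdd.wick {σ ι : Type*} {β : ι → ι → Ser} {F : σ → List ι → Ser} (L : List ι)
    (hF : ∀ l, SupportBdd fun x => F x l) : SupportBdd fun x => wick β (F x) L := by
  induction L generalizing F with
  | nil => exact hF []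
  | cons b L ih =>
    simp only [wick_cons]
    exact ih fun l => (hF _).add (SupportBdd.contract l hF)

/-- The bound on the supports depends on `w` but not on the functional. Hence the vector-valued
series itself has partially well-ordered support, and products with it are finite sums. -/
theorem supportBdd_wick_nordSer (R : Expansion) (L : List (Letter 𝔥)) :
    SupportBdd fun φ : SpaceW B U →ₗ[ℂ] ℂ => wick (twistContr B R) (nordSer B φ w R) L := by
  obtain ⟨D, -, hD⟩ := exists_trunc (modesW B U) w
  exact SupportBdd.wick L fun l => ⟨_, halfBox_isPWO (nordBound D l),
    fun φ => nordSer_support B φ R hD l⟩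

/-- Vectors are determined by their images under linear functionals. -/
theorem eq_of_forall_functional {X : Type*} [AddCommGroup X] [Module ℂ X] {x y : X}
    (h : ∀ φ : X →ₗ[ℂ] ℂ, φ x = φ y) : x = y := by
  rw [← sub_eq_zero, ← Module.forall_dual_apply_eq_zero_iff ℂ]
  intro φ
  rw [map_sub, h, sub_self]

/-- The factor `y^β` is split off because it merely shifts exponents in both expansions, whereas
`(x+y)^α` is the factor to be compared. -/
theorem monoSer_mul_wick_coeff (R : Expansion) (α β : ℚ) {L : List (Letter 𝔥)}
    {F : ℚ → ℚ → SpaceW B U} (hF : ∀ (φ : SpaceW B U →ₗ[ℂ] ℂ) p q,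
      φ (F p q) = (wick (twistContr B R) (nordSer B φ w R) L).coeff (expo R p q)) (p q : ℚ) :
    φ (mulSer (iotaMono R α β 0) F p q) =
      (monoSer R 0 β 0 * (monoSer R α 0 0 * wick (twistContr B R) (nordSer B φ w R) L)).coeff
        (expo R p q) := by
  obtain ⟨t, ht, hφ⟩ := supportBdd_wick_nordSer B w R L
  have := mulSer_coeff φ (R := R) (s := iotaMono R α β 0) (F := F) (S := monoSer R α β 0)
    (Φ := wick (twistContr B R) (nordSer B φ w R) L)
    (fun p q => by rw [iotaMono_eq_coeff, Int.cast_zero]) (fun p q => (hF φ p q).symm) ht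
    (fun p q hpq => by
      by_contra h
      refine hpq (eq_of_forall_functional fun ψ => ?_)
      rw [map_zero, hF ψ]
      by_contra h'
      exact h (hφ ψ h')) p q
  rw [← this, ← mul_assoc, monoSer_mul, zero_add, add_zero, add_zero]

variable {M : ℕ} {e e' : Fin M → 𝔥}
  (hcomp : ∀ h, ∑ i, (B (e' i) h • e i + B (e i) h • e' i) = h)

include hcomp in
theorem iterateSide_eq_wickSide {r s : ℕ} (a : Fin r → 𝔥) (m : Fin r → ℕ) (b : Fin s → 𝔥)
    (n : Fin s → ℕ) :
    iterateSide B e e' (word B a m) (word B b n) w = wickSide B .yx a m b n w := by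
  funext p q
  refine eq_of_forall_functional fun φ => ?_
  rw [iterateSide_coeff B φ w hcomp, wickSide_coeff]

include hcomp in
theorem productSide_word_coeff {r s : ℕ} (a : Fin r → 𝔥) (m : Fin r → ℕ) (b : Fin s → 𝔥)
    (n : Fin s → ℕ) (p q : ℚ) :
    φ (productSide B e e' (word B a m) (word B b n) w p q) =
      (wick (twistContr B .xy) (nordSer B φ w .xy) (letters a m b n)).coeff (expo .xy p q) := by
  rw [word_eq_wordL, word_eq_wordL, productSide_coeff B φ w e e' hcomp]
  rfl

include hcomp in
theorem productSide_eq_wickSide {r s : ℕ} (a : Fin r → 𝔥) (m : Fin r → ℕ) (b : Fin s → 𝔥)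
    (n : Fin s → ℕ) :
    productSide B e e' (word B a m) (word B b n) w = wickSide B .xy a m b n w := by
  funext p q
  refine eq_of_forall_functional fun φ => ?_
  rw [productSide_word_coeff B φ w hcomp, wickSide_coeff]

omit [AddCommGroup 𝔥] [Module ℂ 𝔥] in
theorem sum_pole_letters {r s : ℕ} (a : Fin r → 𝔥) (m : Fin r → ℕ) (b : Fin s → 𝔥)
    (n : Fin s → ℕ) :
    ((letters a m b n).map Letter.pole).sum = ∑ i, (m i : ℚ) + r / 2 := by
  simp [letters, List.map_ofFn, List.sum_ofFn, Letter.pole, Function.comp_def,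
    Finset.sum_add_distrib, div_eq_mul_inv]

-- The exponent `α` is the total cost of the letters plus the truncation degree of `w`, up to a
-- surplus `k`.
variable {w} in
include hcomp in
theorem mulSer_productSide_eq_mulSer_iterateSide {D : ℕ} (hD : Trunc (modesW B U) D w) {r s : ℕ}
    (a : Fin r → 𝔥) (m : Fin r → ℕ) (b : Fin s → 𝔥) (n : Fin s → ℕ) {α : ℚ} (k : ℕ)
    (hα : α = D + (∑ i, (m i : ℚ) + r / 2) + k) (β : ℚ) :
    mulSer (iotaMono .xy α β 0) (productSide B e e' (word B a m) (word B b n) w) =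
      mulSer (iotaMono .yx α β 0) (iterateSide B e e' (word B a m) (word B b n) w) := by
  funext p q
  refine eq_of_forall_functional fun φ => ?_
  rw [monoSer_mul_wick_coeff B φ w .xy α β
      (fun φ => productSide_word_coeff B φ w hcomp a m b n),
    monoSer_mul_wick_coeff B φ w .yx α β (fun φ => iterateSide_coeff B φ w hcomp a m b n)]
  have := sameAfter_wick B φ hD (letters a m b n) k
  rw [sum_pole_letters, ← hα] at this
  exact this.monoSer_zero_mul β 0 p q

end Compare

/-- The expansion of a vector in dual bases of two complementary isotropic subspaces. -/
theorem sum_dual_bases {𝔥 : Type*} [AddCommGroup 𝔥] [Module ℂ 𝔥] {B : LinearMap.BilinForm ℂ 𝔥}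
    (hsymm : B.IsSymm) {𝔭 𝔮 : Submodule ℂ 𝔥} (hpq : IsCompl 𝔭 𝔮)
    (h𝔭 : ∀ x ∈ 𝔭, ∀ y ∈ 𝔭, B x y = 0) (h𝔮 : ∀ x ∈ 𝔮, ∀ y ∈ 𝔮, B x y = 0)
    {M : ℕ} (e : Module.Basis (Fin M) ℂ 𝔭) (e' : Module.Basis (Fin M) ℂ 𝔮)
    (hdual : ∀ i j, B (e i) (e' j) = if i = j then 1 else 0) (h : 𝔥) :
    ∑ i, (B (e' i : 𝔥) h • (e i : 𝔥) + B (e i : 𝔥) h • (e' i : 𝔥)) = h := by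
  obtain ⟨x, hx, y, hy, rfl⟩ := Submodule.mem_sup.1 (hpq.sup_eq_top ▸ Submodule.mem_top (x := h))
  have hx' : ∑ i, e.repr ⟨x, hx⟩ i • (e i : 𝔥) = x := by
    simpa only [map_sum, map_smul, Submodule.subtype_apply] using
      congrArg 𝔭.subtype (e.sum_repr ⟨x, hx⟩)
  have hy' : ∑ i, e'.repr ⟨y, hy⟩ i • (e' i : 𝔥) = y := by
    simpa only [map_sum, map_smul, Submodule.subtype_apply] using
      congrArg 𝔮.subtype (e'.sum_repr ⟨y, hy⟩)
  have e1 : ∀ i, B (e' i : 𝔥) (x + y) = e.repr ⟨x, hx⟩ i := by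
    intro i
    rw [map_add, h𝔮 _ (e' i).2 _ hy, add_zero, ← hsymm.eq]
    conv_lhs => rw [← hx']
    simp [hdual]
  have e2 : ∀ i, B (e i : 𝔥) (x + y) = e'.repr ⟨y, hy⟩ i := by
    intro i
    rw [map_add, h𝔭 _ (e i).2 _ hx, zero_add]
    conv_lhs => rw [← hy']
    simp [hdual]
  simp only [e1, e2, Finset.sum_add_distrib]
  rw [hx', hy']

end TwistedFermion

open TwistedFermion in
theorem mainTheorem4 {𝔥 : Type*} [AddCommGroup 𝔥] [Module ℂ 𝔥]
    (B : LinearMap.BilinForm ℂ 𝔥) (hsymm : B.IsSymm) (hnondeg : B.Nondegenerate)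
    (𝔭 𝔮 : Submodule ℂ 𝔥) (hpq : IsCompl 𝔭 𝔮)
    (h𝔭 : ∀ x ∈ 𝔭, ∀ y ∈ 𝔭, B x y = 0) (h𝔮 : ∀ x ∈ 𝔮, ∀ y ∈ 𝔮, B x y = 0)
    {M : ℕ} (e : Module.Basis (Fin M) ℂ 𝔭) (e' : Module.Basis (Fin M) ℂ 𝔮)
    (hdual : ∀ i j, B (e i) (e' j) = if i = j then 1 else 0)
    {U : Type*} [AddCommGroup U] [Module ℂ U] [Module (TensorAlgebra ℂ 𝔥) U]
    [IsScalarTower ℂ (TensorAlgebra ℂ 𝔥) U]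
    {r s : ℕ} (a : Fin r → 𝔥) (m : Fin r → ℕ) (b : Fin s → 𝔥) (n : Fin s → ℕ) :
    -- the iterate formula
    (∀ w : SpaceW B U,
      iterateSide B (fun i => (e i : 𝔥)) (fun i => (e' i : 𝔥)) (word B a m) (word B b n) w =
        wickSide B .yx a m b n w) ∧
    -- the product formula: the same expression with the other expansion
    (∀ w : SpaceW B U,
      productSide B (fun i => (e i : 𝔥)) (fun i => (e' i : 𝔥)) (word B a m) (word B b n) w =
        wickSide B .xy a m b n w) ∧
    -- the difference of the two expansions disappears after multiplication by a power of `x + y`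
    (∀ (t : ℕ) (h : Fin t → 𝔥) (d : Fin t → ℕ) (u : U) (P : ℕ),
      (∑ i, (m i : ℚ)) + r / 2 + ∑ i, (d i : ℚ) < P →
      let w : SpaceW B U := (List.ofFn fun i => modeW B U (-(d i : ℤ)) (h i)).prod (ofU B u)
      let α : ℚ := P + ((r % 2 : ℕ) : ℚ) / 2
      let β : ℚ := ((s % 2 : ℕ) : ℚ) / 2
      mulSer (iotaMono .xy α β 0)
        (productSide B (fun i => (e i : 𝔥)) (fun i => (e' i : 𝔥)) (word B a m) (word B b n) w) =
      mulSer (iotaMono .yx α β 0)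
        (iterateSide B (fun i => (e i : 𝔥)) (fun i => (e' i : 𝔥)) (word B a m) (word B b n) w)) := by
  have hcomp := sum_dual_bases hsymm hpq h𝔭 h𝔮 e e' hdual
  refine ⟨fun w => iterateSide_eq_wickSide B w hcomp a m b n,
    fun w => productSide_eq_wickSide B w hcomp a m b n, fun t h d u P hP => ?_⟩
  -- Here `r / 2` is the integer quotient. The half that it loses for odd `r` is the summand `|A|/2`
  -- of the exponent.
  have h1 : ∑ i, m i + r / 2 + ∑ i, d i ≤ P := by
    have h2 : ((r / 2 : ℕ) : ℚ) ≤ r / 2 := Nat.cast_div_le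
    have h3 : ((∑ i, m i + r / 2 + ∑ i, d i : ℕ) : ℚ) ≤ P := by
      rw [Nat.cast_add, Nat.cast_add, Nat.cast_sum, Nat.cast_sum]
      linarith
    exact_mod_cast h3
  -- The surplus is `P` minus the integral part of the cost. With `r = 2 (r / 2) + r % 2` the
  -- exponents match.
  refine mulSer_productSide_eq_mulSer_iterateSide B hcomp (trunc_modesW B t h d u) a m b n
    (P - (∑ i, m i + r / 2 + ∑ i, d i)) ?_ _
  have h4 : (r : ℚ) = 2 * (r / 2 : ℕ) + (r % 2 : ℕ) := by exact_mod_cast (Nat.div_add_mod r 2).symm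
  rw [Nat.cast_sub h1]
  push_cast
  rw [h4]
  ring
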